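/- **Conventions.** A *symmetric categorical group* is a (small) symmetric monoidal groupoid $(\mathbb S,+,0)$ such that for every object $x$ the functor $x+(-)$ is an equivalence of categories. Symmetric categorical groups, symmetric (strong) monoidal functors, and monoidal natural transformations ("tracks") form a 2-category $\mathfrak{SCG}r$; each groupoid of morphisms $\mathbf{Hom}(A,B)$ is again a symmetric categorical group under pointwise addition. A *2-ring* $R$ is a symmetric categorical group with a biadditive multiplication (that is, a morphism $y\mapsto(x\mapsto xy)$ of symmetric categorical groups $R\to\mathbf{Hom}(R,R)$), an object $1$, and isomorphisms $(xy)z\cong x(yz)$, $1x\cong x$, $x1\cong x$ which are natural and compatible with addition in each variable and satisfy the pentagon and triangle axioms. A *right 2-module* over $R$ is a symmetric categorical group $M$ with a biadditive action $M\times R\to M$ and isomorphisms $(mr)s\cong m(rs)$, $m1\cong m$ which are natural and compatible with addition in each variable and satisfy the pentagon and triangle axioms. A morphism of 2-modules is a morphism $F$ of symmetric categorical groups with isomorphisms $F(mr)\cong F(m)r$, natural and compatible with addition in each variable and compatible with the associativity and unit isomorphisms; tracks of 2-modules are tracks compatible with these isomorphisms. The morphisms between two 2-modules form a symmetric categorical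 group under pointwise addition. Let $\mathfrak T$ be $\mathfrak{SCG}r$ or the 2-category of right 2-modules over a 2-ring. * A morphism $f:A\to B$ is *cofaithful* if for all $X$ the functor $\mathbf{Hom}(B,X)\to\mathbf{Hom}(A,X)$, $h\mapsto hf$, is faithful. * $P$ is *projective* if for every cofaithful $S_1\to S_2$ the map $\pi_0\mathbf{Hom}(P,S_1)\to\pi_0\mathbf{Hom}(P,S_2)$ on sets of connected components is surjective. $\mathfrak T$ *has enough projectives* if every object $A$ admits a cofaithful morphism $P\to A$ with $P$ projective. * Morphisms $\mu_i:A_i\to A$ ($i$ in a set $I$) form a *coproduct* if for all $X$ the functor $\mathbf{Hom}(A,X)\to\prod_i\mathbf{Hom}(A_i,X)$ is an equivalence. * $S$ is *small* if $\mathbf{Hom}(S,-):\mathfrak T\to\mathfrak{SCG}r$ preserves coproducts. * The *relative cokernel* of $A\xrightarrow{f}B\xrightarrow{g}D$ with a track $\alpha:gf\Rightarrow0$ is a universal pair $(q:D\to Q,\ \zeta:qg\Rightarrow0)$ for which the two tracks $qgf\Rightarrow0$ obtained from $\alpha$ and from $\zeta$ agree: for every $X$, composition with $(q,\zeta)$ is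 fully faithful and essentially surjective from $\mathbf{Hom}(Q,X)$ to the groupoid of such pairs $(h:D\to X,\ \eta:hg\Rightarrow0)$. * $G$ is a *generator* if every object is equivalent to the relative cokernel of some such diagram in which $A,B,D$ are coproducts of copies of $G$. Let $\Phi$ be the symmetric categorical group whose objects are the integers, with no morphisms between different integers, with $\mathrm{Aut}(n)$ cyclic of order two generated by $\varepsilon_n$, with addition induced by addition of integers (and of elements of $\mathbb Z/2$ on morphisms), with identity associativity and unit constraints, and with commutativity constraint $n+m\to m+n$ equal to $nm\,\varepsilon_{n+m}$. **Theorem.** (i) $\Phi$ is small, projective, and a generator in $\mathfrak{SCG}r$. The 2-category $\mathfrak{SCG}r$ has enough projectives. Every projective object of $\mathfrak{SCG}r$ is equivalent to a coproduct of copies of $\Phi$. (ii) For every 2-ring $R$, the right 2-module $R$ is small, projective, and a generator in the 2-category of right 2-modules over $R$, and this 2-category has enough projectives. -/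

import Mathlib

open CategoryTheory MonoidalCategory

universe u

noncomputable section

/-- A symmetric categorical group (Picard category): a small symmetric monoidal groupoid in which
adding any fixed object is an equivalence of categories. The addition is written `⊗`, the neutral
object `𝟙_`. -/
structure SCGr : Type (u + 1) where
  carrier : Type u
  [category : Category.{u} carrier]
  [monoidal : MonoidalCategory carrier]
  [symmetric : SymmetricCategory carrier]
  [isGroupoid : IsGroupoid carrier]
  isEquivalence_tensorLeft : ∀ x : carrier, (tensorLeft x).IsEquivalence

namespace SCGr

instance : CoeSort SCGr.{u} (Type u) := ⟨SCGr.carrier⟩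

attribute [instance] category monoidal symmetric isGroupoid isEquivalence_tensorLeft

/-- Morphisms of symmetric categorical groups: symmetric (strong) monoidal functors. -/
structure Hom (A B : SCGr.{u}) : Type u where
  functor : A ⥤ B
  [braided : functor.Braided]

attribute [instance] Hom.braided

/-- Tracks: monoidal natural transformations (they are automatically invertible). -/
@[ext]
structure Track {A B : SCGr.{u}} (F G : Hom A B) : Type u where
  nat : F.functor ⟶ G.functor
  [isMonoidal : NatTrans.IsMonoidal nat]

attribute [instance] Track.isMonoidal

instance : CategoryStruct.{u} SCGr.{u} where
  Hom := Hom
  id A := { functor := 𝟭 A }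
  comp F G := { functor := F.functor ⋙ G.functor }

instance homCategory (A B : SCGr.{u}) : Category.{u} (A ⟶ B) where
  Hom F G := Track F G
  id F := { nat := 𝟙 F.functor }
  comp s t := { nat := s.nat ≫ t.nat }

section

variable {A B C : SCGr.{u}}

@[simp] lemma id_functor : (𝟙 A : A ⟶ A).functor = 𝟭 A := rfl
@[simp] lemma comp_functor (F : A ⟶ B) (G : B ⟶ C) :
    (F ≫ G).functor = F.functor ⋙ G.functor := rfl
@[simp] lemma id_nat (F : A ⟶ B) : Track.nat (𝟙 F) = 𝟙 F.functor := rfl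
@[simp] lemma comp_nat {F G H : A ⟶ B} (s : F ⟶ G) (t : G ⟶ H) :
    (s ≫ t).nat = s.nat ≫ t.nat := rfl

lemma track_ext {F G : A ⟶ B} {s t : F ⟶ G} (h : ∀ x, s.nat.app x = t.nat.app x) : s = t :=
  Track.ext (NatTrans.ext (funext h))

/-- A track from a monoidal isomorphism of functors. -/
@[simps]
def isoMk {F G : A ⟶ B} (e : F.functor ≅ G.functor) (he : NatTrans.IsMonoidal e.hom) : F ≅ G where
  hom := { nat := e.hom }
  inv := { nat := e.inv }
  hom_inv_id := track_ext fun x => by simp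
  inv_hom_id := track_ext fun x => by simp

instance : IsGroupoid (A ⟶ B) where
  all_isIso {F G} s :=
    (isoMk (F := F) (G := G) (@asIso _ _ _ _ s.nat (NatIso.isIso_of_isIso_app _))
      s.isMonoidal).isIso_hom

end

instance : Bicategory.{u, u} SCGr.{u} where
  homCategory := homCategory
  whiskerLeft F G H s := Track.mk (F := F ≫ G) (G := F ≫ H) (Functor.whiskerLeft F.functor s.nat)
    (isMonoidal := inferInstanceAs (NatTrans.IsMonoidal (Functor.whiskerLeft F.functor s.nat)))
  whiskerRight {_ _ _ F G} s H := Track.mk (F := F ≫ H) (G := G ≫ H)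
    (Functor.whiskerRight s.nat H.functor)
    (isMonoidal := inferInstanceAs (NatTrans.IsMonoidal (Functor.whiskerRight s.nat H.functor)))
  associator F G H := isoMk (F := (F ≫ G) ≫ H) (G := F ≫ G ≫ H)
    (Functor.associator F.functor G.functor H.functor)
    (inferInstanceAs (NatTrans.IsMonoidal
      (Functor.associator F.functor G.functor H.functor).hom))
  leftUnitor {A _} F := isoMk (F := 𝟙 A ≫ F) (G := F) F.functor.leftUnitor
    (inferInstanceAs (NatTrans.IsMonoidal F.functor.leftUnitor.hom))
  rightUnitor {_ B} F := isoMk (F := F ≫ 𝟙 B) (G := F) F.functor.rightUnitor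
    (inferInstanceAs (NatTrans.IsMonoidal F.functor.rightUnitor.hom))
  whiskerLeft_id _ _ := track_ext fun _ => by simp
  whiskerLeft_comp _ _ _ _ _ _ := track_ext fun _ => by simp
  id_whiskerLeft _ := track_ext fun _ => by simp
  comp_whiskerLeft _ _ _ _ _ := track_ext fun _ => by simp
  id_whiskerRight _ _ := track_ext fun _ => by simp
  comp_whiskerRight _ _ _ := track_ext fun _ => by simp
  whiskerRight_id _ := track_ext fun _ => by simp
  whiskerRight_comp _ _ _ := track_ext fun _ => by simp
  whisker_assoc _ _ _ _ _ := track_ext fun _ => by simp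
  whisker_exchange _ _ := track_ext fun _ => by simp
  pentagon _ _ _ _ := track_ext fun _ => by simp
  triangle _ _ := track_ext fun _ => by simp

end SCGr

section SymmetricLemmas

variable {𝒞 : Type*} [Category 𝒞] [MonoidalCategory 𝒞]

lemma sum_unit_assoc {X Y Z : 𝒞} (f : 𝟙_ 𝒞 ⟶ X) (g : 𝟙_ 𝒞 ⟶ Y) (h : 𝟙_ 𝒞 ⟶ Z) :
    ((λ_ (𝟙_ 𝒞)).inv ≫ ((λ_ (𝟙_ 𝒞)).inv ≫ (f ⊗ₘ g) ⊗ₘ h)) ≫ (α_ X Y Z).hom =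
      (λ_ (𝟙_ 𝒞)).inv ≫ (f ⊗ₘ (λ_ (𝟙_ 𝒞)).inv ≫ (g ⊗ₘ h)) := by
  have e : ((λ_ (𝟙_ 𝒞)).inv ⊗ₘ 𝟙 (𝟙_ 𝒞)) ≫ (α_ _ _ _).hom = 𝟙 _ ⊗ₘ (λ_ (𝟙_ 𝒞)).inv := by
    simp; monoidal
  have h := congr((λ_ (𝟙_ 𝒞)).inv ≫ $e ≫ (f ⊗ₘ g ⊗ₘ h))
  rw [Category.assoc, ← associator_naturality] at h
  simpa only [Category.assoc, ← tensorHom_comp_tensorHom_assoc,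
    tensorHom_comp_tensorHom, Category.id_comp, Category.comp_id,
    tensorHom_comp_tensorHom_assoc] using h

lemma sum_unit_left {X : 𝒞} (f : 𝟙_ 𝒞 ⟶ X) :
    ((λ_ (𝟙_ 𝒞)).inv ≫ (𝟙 (𝟙_ 𝒞) ⊗ₘ f)) ≫ (λ_ X).hom = f := by
  simp

lemma sum_unit_right {X : 𝒞} (f : 𝟙_ 𝒞 ⟶ X) :
    ((λ_ (𝟙_ 𝒞)).inv ≫ (f ⊗ₘ 𝟙 (𝟙_ 𝒞))) ≫ (ρ_ X).hom = f := by
  simp [unitors_inv_equal]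

variable [SymmetricCategory 𝒞]

lemma sum_unit_braiding {X Y : 𝒞} (f : 𝟙_ 𝒞 ⟶ X) (g : 𝟙_ 𝒞 ⟶ Y) :
    ((λ_ (𝟙_ 𝒞)).inv ≫ (f ⊗ₘ g)) ≫ (β_ X Y).hom = (λ_ (𝟙_ 𝒞)).inv ≫ (g ⊗ₘ f) := by
  simp [← unitors_equal]

lemma tensorμ_braiding (X₁ X₂ Y₁ Y₂ : 𝒞) :
    tensorμ X₁ X₂ Y₁ Y₂ ≫ ((β_ X₁ Y₁).hom ⊗ₘ (β_ X₂ Y₂).hom) =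
      (β_ (X₁ ⊗ X₂) (Y₁ ⊗ Y₂)).hom ≫ tensorμ Y₁ Y₂ X₁ X₂ := by
  simp [tensorμ, SymmetricCategory.braiding_swap_eq_inv_braiding Y₁ X₂,
    SymmetricCategory.braiding_swap_eq_inv_braiding Y₂ X₁, MonoidalCategory.tensorHom_def]

lemma braiding_tensorμ (X₁ X₂ Y₁ Y₂ : 𝒞) :
    tensorμ X₁ X₂ Y₁ Y₂ ≫ (β_ (X₁ ⊗ Y₁) (X₂ ⊗ Y₂)).hom =
      ((β_ X₁ X₂).hom ⊗ₘ (β_ Y₁ Y₂).hom) ≫ tensorμ X₂ X₁ Y₂ Y₁ := by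
  simp [tensorμ, SymmetricCategory.braiding_swap_eq_inv_braiding X₂ Y₁,
    MonoidalCategory.tensorHom_def]

lemma tensorμ_tensorμ (X₁ X₂ Y₁ Y₂ : 𝒞) :
    tensorμ X₁ X₂ Y₁ Y₂ ≫ tensorμ X₁ Y₁ X₂ Y₂ = 𝟙 _ := by
  simp [tensorμ, SymmetricCategory.braiding_swap_eq_inv_braiding X₂ Y₁]

lemma sum_braiding {X₁ X₂ Y₁ Y₂ Z₁ Z₂ : 𝒞} (f : X₁ ⊗ X₂ ⟶ Z₁) (g : Y₁ ⊗ Y₂ ⟶ Z₂) :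
    (tensorμ X₁ Y₁ X₂ Y₂ ≫ (f ⊗ₘ g)) ≫ (β_ Z₁ Z₂).hom =
      ((β_ X₁ Y₁).hom ⊗ₘ (β_ X₂ Y₂).hom) ≫ tensorμ Y₁ X₁ Y₂ X₂ ≫ (g ⊗ₘ f) := by
  have h := congr($(braiding_tensorμ X₁ Y₁ X₂ Y₂) ≫ (g ⊗ₘ f))
  rw [Category.assoc, ← BraidedCategory.braiding_naturality] at h
  simpa only [Category.assoc] using h

lemma sum_assoc {X₁ X₂ X₃ Y₁ Y₂ Y₃ Z₁ Z₂ Z₃ : 𝒞}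
    (f : X₁ ⊗ Y₁ ⟶ Z₁) (g : X₂ ⊗ Y₂ ⟶ Z₂) (h : X₃ ⊗ Y₃ ⟶ Z₃) :
    (tensorμ (X₁ ⊗ X₂) X₃ (Y₁ ⊗ Y₂) Y₃ ≫ (tensorμ X₁ X₂ Y₁ Y₂ ≫ (f ⊗ₘ g) ⊗ₘ h)) ≫
        (α_ Z₁ Z₂ Z₃).hom =
      ((α_ X₁ X₂ X₃).hom ⊗ₘ (α_ Y₁ Y₂ Y₃).hom) ≫
        tensorμ X₁ (X₂ ⊗ X₃) Y₁ (Y₂ ⊗ Y₃) ≫ (f ⊗ₘ tensorμ X₂ X₃ Y₂ Y₃ ≫ (g ⊗ₘ h)) := by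
  have e := congr($(associator_monoidal X₁ X₂ X₃ Y₁ Y₂ Y₃) ≫ (f ⊗ₘ g ⊗ₘ h))
  simp only [Category.assoc, ← associator_naturality, ← tensorHom_id, ← id_tensorHom] at e
  simpa only [Category.assoc, Category.id_comp, Category.comp_id,
    tensorHom_comp_tensorHom, tensorHom_comp_tensorHom_assoc] using e

lemma sum_left {X Y Z : 𝒞} (f : X ⊗ Y ⟶ Z) :
    (tensorμ (𝟙_ 𝒞) X (𝟙_ 𝒞) Y ≫ ((λ_ (𝟙_ 𝒞)).hom ⊗ₘ f)) ≫ (λ_ Z).hom =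
      ((λ_ X).hom ⊗ₘ (λ_ Y).hom) ≫ f := by
  rw [leftUnitor_monoidal]
  simp [MonoidalCategory.tensorHom_def]

lemma sum_right {X Y Z : 𝒞} (f : X ⊗ Y ⟶ Z) :
    (tensorμ X (𝟙_ 𝒞) Y (𝟙_ 𝒞) ≫ (f ⊗ₘ (λ_ (𝟙_ 𝒞)).hom)) ≫ (ρ_ Z).hom =
      ((ρ_ X).hom ⊗ₘ (ρ_ Y).hom) ≫ f := by
  rw [rightUnitor_monoidal]
  simp [MonoidalCategory.tensorHom_def']

lemma sum_tensorHom {X₁ X₂ Y₁ Y₂ X₁' X₂' Y₁' Y₂' Z₁ Z₂ Z₁' Z₂' : 𝒞}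
    {f : X₁ ⊗ X₂ ⟶ Z₁} {g : Y₁ ⊗ Y₂ ⟶ Z₂} {f' : X₁' ⊗ X₂' ⟶ Z₁'} {g' : Y₁' ⊗ Y₂' ⟶ Z₂'}
    {s₁ : X₁ ⟶ X₁'} {s₂ : X₂ ⟶ X₂'} {t₁ : Y₁ ⟶ Y₁'} {t₂ : Y₂ ⟶ Y₂'} {s : Z₁ ⟶ Z₁'} {t : Z₂ ⟶ Z₂'}
    (hs : f ≫ s = (s₁ ⊗ₘ s₂) ≫ f') (ht : g ≫ t = (t₁ ⊗ₘ t₂) ≫ g') :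
    (tensorμ X₁ Y₁ X₂ Y₂ ≫ (f ⊗ₘ g)) ≫ (s ⊗ₘ t) =
      ((s₁ ⊗ₘ t₁) ⊗ₘ (s₂ ⊗ₘ t₂)) ≫ tensorμ X₁' Y₁' X₂' Y₂' ≫ (f' ⊗ₘ g') := by
  rw [Category.assoc, tensorHom_comp_tensorHom, hs, ht, ← tensorHom_comp_tensorHom,
    tensorμ_natural_assoc]

lemma sum_sym {X₁ X₂ Y₁ Y₂ Z₁ Z₂ Z₁' Z₂' : 𝒞}
    {f : X₁ ⊗ X₂ ⟶ Z₁} {g : Y₁ ⊗ Y₂ ⟶ Z₂} {f' : X₂ ⊗ X₁ ⟶ Z₁'} {g' : Y₂ ⊗ Y₁ ⟶ Z₂'}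
    {s : Z₁ ⟶ Z₁'} {t : Z₂ ⟶ Z₂'}
    (hs : f ≫ s = (β_ X₁ X₂).hom ≫ f') (ht : g ≫ t = (β_ Y₁ Y₂).hom ≫ g') :
    (tensorμ X₁ Y₁ X₂ Y₂ ≫ (f ⊗ₘ g)) ≫ (s ⊗ₘ t) =
      (β_ (X₁ ⊗ Y₁) (X₂ ⊗ Y₂)).hom ≫ tensorμ X₂ Y₂ X₁ Y₁ ≫ (f' ⊗ₘ g') := by
  rw [Category.assoc, tensorHom_comp_tensorHom, hs, ht, ← tensorHom_comp_tensorHom,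
    ← Category.assoc, tensorμ_braiding, Category.assoc]

end SymmetricLemmas

namespace SCGr

open Functor.LaxMonoidal Functor.Monoidal

section

variable {A B C D : SCGr.{u}}

@[simp] lemma whiskerLeft_app (F : A ⟶ B) {G H : B ⟶ C} (s : G ⟶ H) (x : A) :
    (Bicategory.whiskerLeft F s).nat.app x = s.nat.app (F.functor.obj x) := rfl
@[simp] lemma whiskerRight_app {F G : A ⟶ B} (s : F ⟶ G) (H : B ⟶ C) (x : A) :
    (Bicategory.whiskerRight s H).nat.app x = H.functor.map (s.nat.app x) := rfl
@[simp] lemma associator_hom_app (F : A ⟶ B) (G : B ⟶ C) (H : C ⟶ D) (x : A) :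
    (Bicategory.associator F G H).hom.nat.app x = 𝟙 _ := rfl
@[simp] lemma associator_inv_app (F : A ⟶ B) (G : B ⟶ C) (H : C ⟶ D) (x : A) :
    (Bicategory.associator F G H).inv.nat.app x = 𝟙 _ := rfl
@[simp] lemma leftUnitor_hom_app (F : A ⟶ B) (x : A) :
    (Bicategory.leftUnitor F).hom.nat.app x = 𝟙 _ := rfl
@[simp] lemma leftUnitor_inv_app (F : A ⟶ B) (x : A) :
    (Bicategory.leftUnitor F).inv.nat.app x = 𝟙 _ := rfl
@[simp] lemma rightUnitor_hom_app (F : A ⟶ B) (x : A) :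
    (Bicategory.rightUnitor F).hom.nat.app x = 𝟙 _ := rfl
@[simp] lemma rightUnitor_inv_app (F : A ⟶ B) (x : A) :
    (Bicategory.rightUnitor F).inv.nat.app x = 𝟙 _ := rfl

lemma prod_ε (F G : A ⟶ B) : ε (Functor.prod' F.functor G.functor ⋙ tensor B) =
    (λ_ (𝟙_ B)).inv ≫ (ε F.functor ⊗ₘ ε G.functor) := by
  simp

lemma prod_μ (F G : A ⟶ B) (x y : A) :
    μ (Functor.prod' F.functor G.functor ⋙ tensor B) x y =
      tensorμ _ _ _ _ ≫ (μ F.functor x y ⊗ₘ μ G.functor x y) := by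
  simp

/-- The underlying functor of the pointwise sum. -/
@[simps]
def addFunctor (F G : A ⟶ B) : A ⥤ B where
  obj x := F.functor.obj x ⊗ G.functor.obj x
  map f := F.functor.map f ⊗ₘ G.functor.map f

instance addFunctorMonoidal (F G : A ⟶ B) : (addFunctor F G).Monoidal :=
  Functor.CoreMonoidal.toMonoidal
    { εIso := (λ_ (𝟙_ B)).symm ≪≫ tensorIso (εIso F.functor) (εIso G.functor)
      μIso := fun x y =>
        ⟨tensorμ _ _ _ _, tensorδ _ _ _ _, tensorμ_tensorδ _ _ _ _, tensorδ_tensorμ _ _ _ _⟩ ≪≫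
          tensorIso (μIso F.functor x y) (μIso G.functor x y)
      μIso_hom_natural_left := fun f x => by
        have h := μ_natural_left (Functor.prod' F.functor G.functor ⋙ tensor B) f x
        rw [prod_μ, prod_μ] at h
        exact h
      μIso_hom_natural_right := fun x f => by
        have h := μ_natural_right (Functor.prod' F.functor G.functor ⋙ tensor B) x f
        rw [prod_μ, prod_μ] at h
        exact h
      associativity := fun x y z => by
        have h := associativity (Functor.prod' F.functor G.functor ⋙ tensor B) x y z
        rw [prod_μ, prod_μ, prod_μ, prod_μ] at h
        exact h
      left_unitality := fun x => by
        have h := left_unitality (Functor.prod' F.functor G.functor ⋙ tensor B) x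
        rw [prod_μ, prod_ε] at h
        exact h
      right_unitality := fun x => by
        have h := right_unitality (Functor.prod' F.functor G.functor ⋙ tensor B) x
        rw [prod_μ, prod_ε] at h
        exact h }

/-- The pointwise sum `(F + G)(x) = F x + G x` of two morphisms, with the structure constraint
`(F x + G x) + (F y + G y) ≅ (F x + F y) + (G x + G y) ≅ F (x + y) + G (x + y)`. -/
def add (F G : A ⟶ B) : A ⟶ B where
  functor := addFunctor F G
  braided :=
    { addFunctorMonoidal F G with
      braided := fun x y =>
        sum_sym (f := μ F.functor x y) (g := μ G.functor x y) (f' := μ F.functor y x)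
          (g' := μ G.functor y x) (Functor.LaxBraided.braided x y)
          (Functor.LaxBraided.braided x y) }

/-- The zero morphism: the constant functor at the neutral object. -/
def zero (A B : SCGr.{u}) : A ⟶ B where
  functor := (Functor.const A).obj (𝟙_ B)
  braided :=
    { Functor.CoreMonoidal.toMonoidal
        { εIso := Iso.refl _
          μIso := fun _ _ => λ_ (𝟙_ B)
          associativity := fun _ _ _ => by simp; monoidal
          left_unitality := fun _ => by simp
          right_unitality := fun _ => by simp [← unitors_equal] } with
      braided := fun _ _ => by
        change (λ_ (𝟙_ B)).hom ≫ 𝟙 _ = (β_ (𝟙_ B) (𝟙_ B)).hom ≫ (λ_ (𝟙_ B)).hom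
        simp [← unitors_equal] }

/-- A track from a family of morphisms. -/
@[simps]
def mkTrack {F G : A ⟶ B} (t : ∀ x, F.functor.obj x ⟶ G.functor.obj x)
    (nat : ∀ {x y : A} (f : x ⟶ y), F.functor.map f ≫ t y = t x ≫ G.functor.map f)
    (unit : ε F.functor ≫ t (𝟙_ A) = ε G.functor)
    (tensor : ∀ x y, μ F.functor x y ≫ t (x ⊗ y) = (t x ⊗ₘ t y) ≫ μ G.functor x y) : F ⟶ G where
  nat := { app := t, naturality := fun _ _ f => nat f }
  isMonoidal := ⟨unit, tensor⟩

/-- An invertible track from a family of isomorphisms. -/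
@[simps]
def mkIso {F G : A ⟶ B} (t : ∀ x, F.functor.obj x ≅ G.functor.obj x)
    (nat : ∀ {x y : A} (f : x ⟶ y), F.functor.map f ≫ (t y).hom = (t x).hom ≫ G.functor.map f)
    (unit : ε F.functor ≫ (t (𝟙_ A)).hom = ε G.functor)
    (tensor : ∀ x y, μ F.functor x y ≫ (t (x ⊗ y)).hom =
      ((t x).hom ⊗ₘ (t y).hom) ≫ μ G.functor x y) : F ≅ G where
  hom := mkTrack (fun x => (t x).hom) nat unit tensor
  inv := mkTrack (fun x => (t x).inv)
    (fun {x y} f => by rw [← cancel_epi (t x).hom, ← reassoc_of% (nat f)]; simp)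
    (by rw [← unit]; simp)
    (fun x y => by
      rw [← cancel_epi ((t x).hom ⊗ₘ (t y).hom), ← reassoc_of% (tensor x y)]; simp)
  hom_inv_id := track_ext fun x => by simp
  inv_hom_id := track_ext fun x => by simp

/-- The pointwise sum of tracks. -/
def addTrack {F F' G G' : A ⟶ B} (s : F ⟶ F') (t : G ⟶ G') : add F G ⟶ add F' G' :=
  mkTrack (fun x => s.nat.app x ⊗ₘ t.nat.app x)
    (fun f => by
      change (F.functor.map f ⊗ₘ G.functor.map f) ≫ _ = _ ≫ (F'.functor.map f ⊗ₘ G'.functor.map f)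
      simp)
    (by
      change ((λ_ (𝟙_ B)).inv ≫ (ε F.functor ⊗ₘ ε G.functor)) ≫ _ =
        (λ_ (𝟙_ B)).inv ≫ (ε F'.functor ⊗ₘ ε G'.functor)
      simp)
    (fun x y => sum_tensorHom (s.isMonoidal.tensor x y) (t.isMonoidal.tensor x y))

instance homMonoidalStruct (A B : SCGr.{u}) : MonoidalCategoryStruct (A ⟶ B) where
  tensorObj := add
  tensorUnit := zero A B
  tensorHom := addTrack
  whiskerLeft F _ _ t := addTrack (𝟙 F) t
  whiskerRight s G := addTrack s (𝟙 G)
  associator F G H := mkIso (fun x => α_ (F.functor.obj x) (G.functor.obj x) (H.functor.obj x))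
    (fun f => associator_naturality _ _ _)
    (sum_unit_assoc _ _ _)
    (fun x y => sum_assoc _ _ _)
  leftUnitor F := mkIso (fun x => λ_ (F.functor.obj x))
    (fun f => by
      change (𝟙 (𝟙_ B) ⊗ₘ F.functor.map f) ≫ _ = _
      rw [id_tensorHom, leftUnitor_naturality]; rfl)
    (sum_unit_left _)
    (fun x y => sum_left _)
  rightUnitor F := mkIso (fun x => ρ_ (F.functor.obj x))
    (fun f => by
      change (F.functor.map f ⊗ₘ 𝟙 (𝟙_ B)) ≫ _ = _
      rw [tensorHom_id, rightUnitor_naturality]; rfl)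
    (sum_unit_right _)
    (fun x y => sum_right _)

@[simp] lemma tensorObj_functor_obj (F G : A ⟶ B) (x : A) :
    (F ⊗ G).functor.obj x = F.functor.obj x ⊗ G.functor.obj x := rfl
@[simp] lemma tensorObj_functor_map (F G : A ⟶ B) {x y : A} (f : x ⟶ y) :
    (F ⊗ G).functor.map f = F.functor.map f ⊗ₘ G.functor.map f := rfl
lemma tensorObj_ε (F G : A ⟶ B) :
    ε (F ⊗ G).functor = (λ_ (𝟙_ B)).inv ≫ (ε F.functor ⊗ₘ ε G.functor) := rfl
lemma tensorObj_μ (F G : A ⟶ B) (x y : A) :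
    μ (F ⊗ G).functor x y = tensorμ _ _ _ _ ≫ (μ F.functor x y ⊗ₘ μ G.functor x y) := rfl
@[simp] lemma tensorUnit_functor_obj (x : A) : (𝟙_ (A ⟶ B)).functor.obj x = 𝟙_ B := rfl
@[simp] lemma tensorUnit_functor_map {x y : A} (f : x ⟶ y) :
    (𝟙_ (A ⟶ B)).functor.map f = 𝟙 _ := rfl
lemma tensorUnit_ε : ε (𝟙_ (A ⟶ B)).functor = 𝟙 _ := rfl
lemma tensorUnit_μ (x y : A) : μ (𝟙_ (A ⟶ B)).functor x y = (λ_ (𝟙_ B)).hom := rfl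
@[simp] lemma tensorHom_app {F F' G G' : A ⟶ B} (s : F ⟶ F') (t : G ⟶ G') (x : A) :
    (s ⊗ₘ t).nat.app x = s.nat.app x ⊗ₘ t.nat.app x := rfl
@[simp] lemma whiskerLeft_nat_app (F : A ⟶ B) {G G' : A ⟶ B} (t : G ⟶ G') (x : A) :
    (F ◁ t).nat.app x = F.functor.obj x ◁ t.nat.app x :=
  id_tensorHom (C := B) (F.functor.obj x) (t.nat.app x)
@[simp] lemma whiskerRight_nat_app {F F' : A ⟶ B} (s : F ⟶ F') (G : A ⟶ B) (x : A) :
    (s ▷ G).nat.app x = s.nat.app x ▷ G.functor.obj x :=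
  tensorHom_id (C := B) (s.nat.app x) (G.functor.obj x)
@[simp] lemma associator_hom_nat_app (F G H : A ⟶ B) (x : A) :
    (α_ F G H).hom.nat.app x = (α_ (F.functor.obj x) (G.functor.obj x) (H.functor.obj x)).hom := rfl
@[simp] lemma associator_inv_nat_app (F G H : A ⟶ B) (x : A) :
    (α_ F G H).inv.nat.app x = (α_ (F.functor.obj x) (G.functor.obj x) (H.functor.obj x)).inv := rfl
@[simp] lemma leftUnitor_hom_nat_app (F : A ⟶ B) (x : A) :
    (λ_ F).hom.nat.app x = (λ_ (F.functor.obj x)).hom := rfl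
@[simp] lemma leftUnitor_inv_nat_app (F : A ⟶ B) (x : A) :
    (λ_ F).inv.nat.app x = (λ_ (F.functor.obj x)).inv := rfl
@[simp] lemma rightUnitor_hom_nat_app (F : A ⟶ B) (x : A) :
    (ρ_ F).hom.nat.app x = (ρ_ (F.functor.obj x)).hom := rfl
@[simp] lemma rightUnitor_inv_nat_app (F : A ⟶ B) (x : A) :
    (ρ_ F).inv.nat.app x = (ρ_ (F.functor.obj x)).inv := rfl

/-- The pointwise monoidal structure on the groupoid of morphisms `A ⟶ B`. -/
instance homMonoidal (A B : SCGr.{u}) : MonoidalCategory (A ⟶ B) :=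
  MonoidalCategory.ofTensorHom
    (id_tensorHom_id := fun _ _ => track_ext fun _ => id_tensorHom_id (C := B) _ _)
    (tensorHom_comp_tensorHom := fun _ _ _ _ => track_ext fun _ =>
      tensorHom_comp_tensorHom (C := B) _ _ _ _)
    (associator_naturality := fun _ _ _ => track_ext fun _ => associator_naturality (C := B) _ _ _)
    (leftUnitor_naturality := fun s => track_ext fun x =>
      (congr($(id_tensorHom (𝟙_ B) (s.nat.app x)) ≫ (λ_ _).hom)).trans
        (leftUnitor_naturality (C := B) (s.nat.app x)))
    (rightUnitor_naturality := fun s => track_ext fun x =>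
      (congr($(tensorHom_id (s.nat.app x) (𝟙_ B)) ≫ (ρ_ _).hom)).trans
        (rightUnitor_naturality (C := B) (s.nat.app x)))
    (pentagon := fun _ _ _ _ => track_ext fun _ => by simp)
    (triangle := fun F G => track_ext fun x => by
      simp [-Functor.LaxMonoidal.left_unitality, -Functor.LaxMonoidal.right_unitality])

instance homBraided (A B : SCGr.{u}) : BraidedCategory (A ⟶ B) where
  braiding F G := mkIso (fun x => β_ (F.functor.obj x) (G.functor.obj x))
    (fun f => BraidedCategory.braiding_naturality _ _)
    (sum_unit_braiding _ _)
    (fun x y => sum_braiding _ _)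
  braiding_naturality_right F {G H} t := track_ext fun x => by
    change (F ◁ t).nat.app x ≫ (β_ (F.functor.obj x) (H.functor.obj x)).hom =
      (β_ (F.functor.obj x) (G.functor.obj x)).hom ≫ (t ▷ F).nat.app x
    simp
  braiding_naturality_left {F G} t H := track_ext fun x => by
    change (t ▷ H).nat.app x ≫ (β_ (G.functor.obj x) (H.functor.obj x)).hom =
      (β_ (F.functor.obj x) (H.functor.obj x)).hom ≫ (H ◁ t).nat.app x
    simp
  hexagon_forward F G H := track_ext fun x => by
    refine (BraidedCategory.hexagon_forward (C := B) _ _ _).trans ?_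
    simp only [← tensorHom_id, ← id_tensorHom]
    rfl
  hexagon_reverse F G H := track_ext fun x => by
    refine (BraidedCategory.hexagon_reverse (C := B) _ _ _).trans ?_
    simp only [← tensorHom_id, ← id_tensorHom]
    rfl

@[simp] lemma braiding_hom_nat_app (F G : A ⟶ B) (x : A) :
    (β_ F G).hom.nat.app x = (β_ (F.functor.obj x) (G.functor.obj x)).hom := rfl

instance homSymmetric (A B : SCGr.{u}) : SymmetricCategory (A ⟶ B) where
  symmetry _ _ := track_ext fun _ => by simp

end
end SCGr

section Pairings

variable {𝒞 : Type*} [Category 𝒞] [MonoidalCategory 𝒞]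

/-- Morphisms `f : x ⟶ x'` and `g : y ⟶ y'` are compatible with pairings `p : x ⊗ y ⟶ 𝟙_` and
`p' : x' ⊗ y' ⟶ 𝟙_`. -/
def Compat {x y x' y' : 𝒞} (p : x ⊗ y ⟶ 𝟙_ 𝒞) (p' : x' ⊗ y' ⟶ 𝟙_ 𝒞) (f : x ⟶ x') (g : y ⟶ y') :
    Prop :=
  (f ⊗ₘ g) ≫ p' = p

lemma Compat.comp {x y x' y' x'' y'' : 𝒞} {p : x ⊗ y ⟶ 𝟙_ 𝒞} {p' : x' ⊗ y' ⟶ 𝟙_ 𝒞}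
    {p'' : x'' ⊗ y'' ⟶ 𝟙_ 𝒞} {f : x ⟶ x'} {g : y ⟶ y'} {f' : x' ⟶ x''} {g' : y' ⟶ y''}
    (h : Compat p p' f g) (h' : Compat p' p'' f' g') : Compat p p'' (f ≫ f') (g ≫ g') := by
  unfold Compat at *
  rw [← tensorHom_comp_tensorHom, Category.assoc, h', h]

lemma Compat.inv {x y x' y' : 𝒞} {p : x ⊗ y ⟶ 𝟙_ 𝒞} {p' : x' ⊗ y' ⟶ 𝟙_ 𝒞}
    {f : x ≅ x'} {g : y ≅ y'} (h : Compat p p' f.hom g.hom) : Compat p' p f.inv g.inv := by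
  unfold Compat at *
  rw [← h, tensorHom_comp_tensorHom_assoc]; simp

lemma Compat.id {x y : 𝒞} (p : x ⊗ y ⟶ 𝟙_ 𝒞) : Compat p p (𝟙 x) (𝟙 y) := by
  simp [Compat]

/-- In a braided category, adding an object which has an opposite is an equivalence. -/
lemma isEquivalence_tensorLeft_of_iso [BraidedCategory 𝒞] {x y : 𝒞} (e : x ⊗ y ≅ 𝟙_ 𝒞) :
    (tensorLeft x).IsEquivalence :=
  (CategoryTheory.Equivalence.mk (tensorLeft x) (tensorLeft y)
    ((leftUnitorNatIso 𝒞).symm ≪≫ (curriedTensor 𝒞).mapIso ((β_ y x) ≪≫ e).symm ≪≫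
      tensorLeftTensor y x)
    ((tensorLeftTensor x y).symm ≪≫ (curriedTensor 𝒞).mapIso e ≪≫
      leftUnitorNatIso 𝒞)).isEquivalence_functor

section

variable [SymmetricCategory 𝒞]

/-- The sum of two pairings. -/
def addPairing {x₁ y₁ x₂ y₂ : 𝒞} (p : x₁ ⊗ y₁ ⟶ 𝟙_ 𝒞) (q : x₂ ⊗ y₂ ⟶ 𝟙_ 𝒞) :
    (x₁ ⊗ x₂) ⊗ (y₁ ⊗ y₂) ⟶ 𝟙_ 𝒞 :=
  (tensorμ x₁ x₂ y₁ y₂ ≫ (p ⊗ₘ q)) ≫ (λ_ (𝟙_ 𝒞)).hom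

lemma Compat.add {x₁ y₁ x₂ y₂ x₁' y₁' x₂' y₂' : 𝒞} {p : x₁ ⊗ y₁ ⟶ 𝟙_ 𝒞} {q : x₂ ⊗ y₂ ⟶ 𝟙_ 𝒞}
    {p' : x₁' ⊗ y₁' ⟶ 𝟙_ 𝒞} {q' : x₂' ⊗ y₂' ⟶ 𝟙_ 𝒞} {f : x₁ ⟶ x₁'} {g : y₁ ⟶ y₁'}
    {f' : x₂ ⟶ x₂'} {g' : y₂ ⟶ y₂'} (h : Compat p p' f g) (h' : Compat q q' f' g') :
    Compat (addPairing p q) (addPairing p' q') (f ⊗ₘ f') (g ⊗ₘ g') := by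
  unfold Compat at *
  rw [addPairing, addPairing, ← h, ← h', ← tensorHom_comp_tensorHom]
  simp only [Category.assoc]
  rw [tensorμ_natural_assoc]

lemma compat_assoc {x₁ y₁ x₂ y₂ x₃ y₃ : 𝒞} (p : x₁ ⊗ y₁ ⟶ 𝟙_ 𝒞) (q : x₂ ⊗ y₂ ⟶ 𝟙_ 𝒞)
    (r : x₃ ⊗ y₃ ⟶ 𝟙_ 𝒞) :
    Compat (addPairing (addPairing p q) r) (addPairing p (addPairing q r))
      (α_ x₁ x₂ x₃).hom (α_ y₁ y₂ y₃).hom := by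
  have h := congr($(sum_assoc p q r) ≫ 𝟙_ 𝒞 ◁ (λ_ (𝟙_ 𝒞)).hom ≫ (λ_ (𝟙_ 𝒞)).hom)
  have e : (α_ (𝟙_ 𝒞) (𝟙_ 𝒞) (𝟙_ 𝒞)).hom ≫ 𝟙_ 𝒞 ◁ (λ_ (𝟙_ 𝒞)).hom ≫ (λ_ (𝟙_ 𝒞)).hom =
    (λ_ (𝟙_ 𝒞)).hom ▷ 𝟙_ 𝒞 ≫ (λ_ (𝟙_ 𝒞)).hom := by monoidal
  simp only [Category.assoc, e] at h
  simp only [← tensorHom_id, ← id_tensorHom, tensorHom_comp_tensorHom_assoc, Category.comp_id,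
    Category.assoc] at h
  simp only [Compat, addPairing, Category.assoc]
  exact h.symm

lemma compat_leftUnitor {x y : 𝒞} (p : x ⊗ y ⟶ 𝟙_ 𝒞) :
    Compat (addPairing (λ_ (𝟙_ 𝒞)).hom p) p (λ_ x).hom (λ_ y).hom :=
  (sum_left p).symm

lemma compat_rightUnitor {x y : 𝒞} (p : x ⊗ y ⟶ 𝟙_ 𝒞) :
    Compat (addPairing p (λ_ (𝟙_ 𝒞)).hom) p (ρ_ x).hom (ρ_ y).hom := by
  have h := sum_right p
  rw [← unitors_equal] at h
  exact h.symm

lemma compat_braiding {x₁ y₁ x₂ y₂ : 𝒞} (p : x₁ ⊗ y₁ ⟶ 𝟙_ 𝒞) (q : x₂ ⊗ y₂ ⟶ 𝟙_ 𝒞) :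
    Compat (addPairing p q) (addPairing q p) (β_ x₁ x₂).hom (β_ y₁ y₂).hom := by
  have h := congr($(sum_braiding p q) ≫ (λ_ (𝟙_ 𝒞)).hom)
  rw [Category.assoc, braiding_leftUnitor, ← unitors_equal] at h
  rw [Compat, addPairing, addPairing, h, Category.assoc, Category.assoc, Category.assoc]

end

section

variable {𝒟 : Type*} [Category 𝒟] [MonoidalCategory 𝒟]

open Functor.LaxMonoidal Functor.OplaxMonoidal

/-- The image of a pairing under a monoidal functor. -/
def mapPairing (F : 𝒞 ⥤ 𝒟) [F.Monoidal] {x y : 𝒞} (p : x ⊗ y ⟶ 𝟙_ 𝒞) :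
    F.obj x ⊗ F.obj y ⟶ 𝟙_ 𝒟 :=
  μ F x y ≫ F.map p ≫ η F

lemma Compat.map (F : 𝒞 ⥤ 𝒟) [F.Monoidal] {x y x' y' : 𝒞} {p : x ⊗ y ⟶ 𝟙_ 𝒞}
    {p' : x' ⊗ y' ⟶ 𝟙_ 𝒞} {f : x ⟶ x'} {g : y ⟶ y'} (h : Compat p p' f g) :
    Compat (mapPairing F p) (mapPairing F p') (F.map f) (F.map g) := by
  unfold Compat at *
  rw [mapPairing, mapPairing, ← h, μ_natural_assoc, F.map_comp, Category.assoc]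

lemma compat_nat {F G : 𝒞 ⥤ 𝒟} [F.Monoidal] [G.Monoidal] (t : F ⟶ G) [t.IsMonoidal] {x y : 𝒞}
    (p : x ⊗ y ⟶ 𝟙_ 𝒞) : Compat (mapPairing F p) (mapPairing G p) (t.app x) (t.app y) := by
  have h : t.app (𝟙_ 𝒞) ≫ η G = η F := by
    rw [← cancel_epi (ε F), ← Category.assoc, NatTrans.IsMonoidal.unit]; simp
  rw [Compat, mapPairing, mapPairing, ← NatTrans.IsMonoidal.tensor_assoc, ← h, t.naturality_assoc]

lemma μ_unit (F : 𝒞 ⥤ 𝒟) [F.Monoidal] :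
    μ F (𝟙_ 𝒞) (𝟙_ 𝒞) ≫ F.map (λ_ (𝟙_ 𝒞)).hom ≫ η F = (η F ⊗ₘ η F) ≫ (λ_ (𝟙_ 𝒟)).hom := by
  rw [MonoidalCategory.tensorHom_def, Category.assoc, leftUnitor_naturality, Functor.LaxMonoidal.left_unitality,
    Category.assoc, Category.assoc, Functor.Monoidal.whiskerRight_η_ε_assoc]

lemma compat_μ [SymmetricCategory 𝒞] [SymmetricCategory 𝒟] (F : 𝒞 ⥤ 𝒟) [F.Braided]
    {x₁ y₁ x₂ y₂ : 𝒞} (p : x₁ ⊗ y₁ ⟶ 𝟙_ 𝒞) (q : x₂ ⊗ y₂ ⟶ 𝟙_ 𝒞) :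
    Compat (addPairing (mapPairing F p) (mapPairing F q)) (mapPairing F (addPairing p q))
      (μ F x₁ x₂) (μ F y₁ y₂) := by
  have h := congr($(tensorμ_comp_μ_tensorHom_μ_comp_μ F x₁ x₂ y₁ y₂) ≫ F.map (p ⊗ₘ q) ≫
    F.map (λ_ (𝟙_ 𝒞)).hom ≫ η F)
  simp only [Category.assoc, ← μ_natural_assoc, μ_unit] at h
  simp only [Compat, addPairing, mapPairing, Functor.map_comp, Category.assoc,
    ← tensorHom_comp_tensorHom]
  exact h.symm

lemma compat_ε (F : 𝒞 ⥤ 𝒟) [F.Monoidal] :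
    Compat (λ_ (𝟙_ 𝒟)).hom (mapPairing F (λ_ (𝟙_ 𝒞)).hom) (ε F) (ε F) := by
  rw [Compat, mapPairing, μ_unit, tensorHom_comp_tensorHom_assoc]
  simp

end

variable [IsGroupoid 𝒞] [∀ x : 𝒞, (tensorLeft x).IsEquivalence]

lemma Compat.unique {x y x' y' : 𝒞} {p : x ⊗ y ⟶ 𝟙_ 𝒞} {p' : x' ⊗ y' ⟶ 𝟙_ 𝒞}
    {f f' : x ⟶ x'} {g g' : y ⟶ y'} (h : Compat p p' f g) (h' : Compat p p' f' g') (hf : f = f') :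
    g = g' := by
  subst hf
  apply (tensorLeft x').map_injective
  have e : f ▷ y ≫ x' ◁ g = f ▷ y ≫ x' ◁ g' := by
    rw [← MonoidalCategory.tensorHom_def, ← MonoidalCategory.tensorHom_def, ← cancel_mono p']
    exact h.trans h'.symm
  exact (cancel_epi _).1 e

/-- The morphism `y ⟶ y'` determined by `f : x ⟶ x'`. -/
def dualMap {x y x' y' : 𝒞} (p : x ⊗ y ⟶ 𝟙_ 𝒞) (p' : x' ⊗ y' ⟶ 𝟙_ 𝒞) (f : x ⟶ x') : y ⟶ y' :=
  (tensorLeft x').preimage (inv f ▷ y ≫ p ≫ inv p')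

lemma dualMap_compat {x y x' y' : 𝒞} (p : x ⊗ y ⟶ 𝟙_ 𝒞) (p' : x' ⊗ y' ⟶ 𝟙_ 𝒞) (f : x ⟶ x') :
    Compat p p' f (dualMap p p' f) := by
  have h : x' ◁ dualMap p p' f = inv f ▷ y ≫ p ≫ inv p' := (tensorLeft x').map_preimage _
  unfold Compat
  rw [MonoidalCategory.tensorHom_def, h]
  simp [← comp_whiskerRight_assoc]

/-- An object opposite to `x`. -/
def negObj (x : 𝒞) : 𝒞 := (tensorLeft x).objPreimage (𝟙_ 𝒞)

/-- The sum of an object and its opposite is zero. -/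
def negObjIso (x : 𝒞) : x ⊗ negObj x ≅ 𝟙_ 𝒞 := (tensorLeft x).objObjPreimageIso (𝟙_ 𝒞)

/-- The pairing of an object and its opposite. -/
abbrev negPairing (x : 𝒞) : x ⊗ negObj x ⟶ 𝟙_ 𝒞 := (negObjIso x).hom

end Pairings

namespace SCGr

open Functor.LaxMonoidal Functor.OplaxMonoidal

section

variable {A B C D : SCGr.{u}}

/-- The opposite, as an endomorphism of a symmetric categorical group. -/
def neg (A : SCGr.{u}) : A ⟶ A :=
  let F : A ⥤ A :=
    { obj := negObj
      map := fun f => dualMap (negPairing _) (negPairing _) f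
      map_id := fun x => (dualMap_compat _ _ _).unique (Compat.id _) rfl
      map_comp := fun f g =>
        (dualMap_compat _ _ _).unique ((dualMap_compat _ _ f).comp (dualMap_compat _ _ g)) rfl }
  let m (x y : A) : negObj x ⊗ negObj y ⟶ negObj (x ⊗ y) :=
    dualMap (addPairing (negPairing x) (negPairing y)) (negPairing (x ⊗ y)) (𝟙 _)
  have hm (x y : A) : Compat (addPairing (negPairing x) (negPairing y)) (negPairing (x ⊗ y))
    (𝟙 _) (m x y) := dualMap_compat _ _ _
  let e : 𝟙_ A ⟶ negObj (𝟙_ A) := dualMap (λ_ (𝟙_ A)).hom (negPairing (𝟙_ A)) (𝟙 _)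
  have he : Compat (λ_ (𝟙_ A)).hom (negPairing (𝟙_ A)) (𝟙 _) e := dualMap_compat _ _ _
  { functor := F
    braided :=
      { Functor.CoreMonoidal.toMonoidal (F := F)
          { εIso := asIso e
            μIso := fun x y => asIso (m x y)
            μIso_hom_natural_left := fun {x y} f z => by
              have h₁ := ((dualMap_compat (negPairing x) (negPairing y) f).add
                (Compat.id (negPairing z))).comp (hm y z)
              have h₂ := (hm x z).comp (dualMap_compat (negPairing _) (negPairing _) (f ▷ z))
              simpa using h₁.unique h₂ (by simp)
            μIso_hom_natural_right := fun {x y} z f => by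
              have h₁ := ((Compat.id (negPairing z)).add
                (dualMap_compat (negPairing x) (negPairing y) f)).comp (hm z y)
              have h₂ := (hm z x).comp (dualMap_compat (negPairing _) (negPairing _) (z ◁ f))
              simpa using h₁.unique h₂ (by simp)
            associativity := fun x y z => by
              have h₁ := (((hm x y).add (Compat.id (negPairing z))).comp (hm (x ⊗ y) z)).comp
                (dualMap_compat (negPairing _) (negPairing _) (α_ x y z).hom)
              have h₂ := ((compat_assoc (negPairing x) (negPairing y) (negPairing z)).comp
                ((Compat.id (negPairing x)).add (hm y z))).comp (hm x (y ⊗ z))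
              simpa using h₁.unique h₂ (by simp)
            left_unitality := fun x => by
              have h₁ := compat_leftUnitor (negPairing x)
              have h₂ := ((he.add (Compat.id (negPairing x))).comp (hm (𝟙_ A) x)).comp
                (dualMap_compat (negPairing _) (negPairing _) (λ_ x).hom)
              simpa using h₁.unique h₂ (by simp)
            right_unitality := fun x => by
              have h₁ := compat_rightUnitor (negPairing x)
              have h₂ := (((Compat.id (negPairing x)).add he).comp (hm x (𝟙_ A))).comp
                (dualMap_compat (negPairing _) (negPairing _) (ρ_ x).hom)
              simpa using h₁.unique h₂ (by simp) } with
        braided := fun x y => by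
          have h₁ := (hm x y).comp
            (dualMap_compat (negPairing _) (negPairing _) (β_ x y).hom)
          have h₂ := (compat_braiding (negPairing x) (negPairing y)).comp (hm y x)
          exact h₁.unique h₂ (by simp) } }

lemma neg_compat_map {x y : A} (f : x ⟶ y) :
    Compat (negPairing x) (negPairing y) f ((neg A).functor.map f) :=
  dualMap_compat _ _ _

lemma neg_compat_μ (x y : A) :
    Compat (addPairing (negPairing x) (negPairing y)) (negPairing (x ⊗ y)) (𝟙 _)
      (μ (neg A).functor x y) :=
  dualMap_compat _ _ _

lemma neg_compat_ε :
    Compat (λ_ (𝟙_ A)).hom (negPairing (𝟙_ A)) (𝟙 _) (ε (neg A).functor) :=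
  dualMap_compat _ _ _

/-- The canonical track `F + (-F) ≅ 0`. -/
def addNegIso (F : A ⟶ B) : F ⊗ (F ≫ neg B) ≅ 𝟙_ (A ⟶ B) :=
  mkIso (fun x => negObjIso (F.functor.obj x))
    (fun f => (neg_compat_map (F.functor.map f)).trans (Category.comp_id _).symm)
    (by
      have h := neg_compat_ε.comp (neg_compat_map (ε F.functor))
      rw [Compat, Category.id_comp] at h
      exact ((Category.assoc _ _ _).trans congr((λ_ (𝟙_ B)).inv ≫ $h)).trans
        (λ_ (𝟙_ B)).inv_hom_id)
    (fun x y => by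
      have h := (neg_compat_μ (F.functor.obj x) (F.functor.obj y)).comp
        (neg_compat_map (μ F.functor x y))
      rw [Compat, Category.id_comp] at h
      refine ((Category.assoc _ _ _).trans congr(tensorμ _ _ _ _ ≫ $h)).trans ?_
      change tensorμ _ _ _ _ ≫ (tensorμ _ _ _ _ ≫ (_ ⊗ₘ _)) ≫ (λ_ (𝟙_ B)).hom =
        (_ ⊗ₘ _) ≫ (λ_ (𝟙_ B)).hom
      rw [← Category.assoc, ← Category.assoc, tensorμ_tensorμ, Category.id_comp])

instance (A B : SCGr.{u}) (F : A ⟶ B) : (tensorLeft F).IsEquivalence :=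
  isEquivalence_tensorLeft_of_iso (addNegIso F)

/-- The symmetric categorical group of morphisms from `A` to `B`, with pointwise addition. -/
abbrev hom (A B : SCGr.{u}) : SCGr.{u} where
  carrier := A ⟶ B
  isEquivalence_tensorLeft := inferInstance

/-- Every morphism commutes with opposites. -/
def negComm (F : A ⟶ B) (x : A) :
    (neg B).functor.obj (F.functor.obj x) ⟶ F.functor.obj ((neg A).functor.obj x) :=
  dualMap (negPairing (F.functor.obj x)) (mapPairing F.functor (negPairing x)) (𝟙 _)

lemma negComm_compat (F : A ⟶ B) (x : A) :
    Compat (negPairing (F.functor.obj x)) (mapPairing F.functor (negPairing x)) (𝟙 _)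
      (negComm F x) :=
  dualMap_compat _ _ _

def negCommIso (F : A ⟶ B) : F ≫ neg B ≅ neg A ≫ F :=
  mkIso (fun x => asIso (negComm F x))
    (fun {x y} f => by
      have h₁ := (neg_compat_map (F.functor.map f)).comp (negComm_compat F y)
      have h₂ := (negComm_compat F x).comp ((neg_compat_map f).map F.functor)
      exact h₁.unique h₂ (by simp))
    (by
      have h₁ := (neg_compat_ε.comp (neg_compat_map (ε F.functor))).comp (negComm_compat F _)
      have h₂ := (compat_ε F.functor).comp (neg_compat_ε.map F.functor)
      exact h₁.unique h₂ (by simp))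
    (fun x y => by
      have h₁ := ((neg_compat_μ _ _).comp (neg_compat_map (μ F.functor x y))).comp
        (negComm_compat F _)
      have h₂ := (((negComm_compat F x).add (negComm_compat F y)).comp
        (compat_μ F.functor _ _)).comp ((neg_compat_μ x y).map F.functor)
      exact (h₁.unique h₂ (by simp)).trans (Category.assoc _ _ _))

end

end SCGr

/-- Biadditive functors `M × R → N`, that is, morphisms from `R` to the symmetric categorical group
of morphisms `M ⟶ N`. The value at `(m, r)` is written `β.op m r`. -/
abbrev Biadd (M R N : SCGr.{u}) : Type u := R ⟶ SCGr.hom M N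

namespace Biadd

open Functor.LaxMonoidal

variable {M R N : SCGr.{u}} (β : Biadd M R N)

/-- The morphism `m ↦ m · r`. -/
def at' (r : R) : M ⟶ N := β.functor.obj r

/-- The track `(m ↦ m · r) ⟶ (m ↦ m · s)` induced by a morphism `r ⟶ s`. -/
def atMap {r s : R} (g : r ⟶ s) : β.at' r ⟶ β.at' s := β.functor.map g

/-- The track with components `m · r + m · s ⟶ m · (r + s)`. -/
def atAdd (r s : R) : β.at' r ⊗ β.at' s ⟶ β.at' (r ⊗ s) :=
  @μ _ _ _ _ _ _ β.functor (SCGr.Hom.braided β).toLaxMonoidal r s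

/-- The value `m · r`. -/
def op (m : M) (r : R) : N := (β.at' r).functor.obj m

/-- Functoriality in the left variable. -/
def mapLeft {m n : M} (f : m ⟶ n) (r : R) : β.op m r ⟶ β.op n r := (β.at' r).functor.map f

/-- Functoriality in the right variable. -/
def mapRight (m : M) {r s : R} (g : r ⟶ s) : β.op m r ⟶ β.op m s := (β.atMap g).nat.app m

/-- The distributivity constraint `m · r + n · r ≅ (m + n) · r`. -/
def addLeft (m n : M) (r : R) : β.op m r ⊗ β.op n r ⟶ β.op (m ⊗ n) r := μ (β.at' r).functor m n

/-- The distributivity constraint `m · r + m · s ≅ m · (r + s)`. -/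
def addRight (m : M) (r s : R) : β.op m r ⊗ β.op m s ⟶ β.op m (r ⊗ s) := (β.atAdd r s).nat.app m

end Biadd

/-- A 2-ring (categorical ring, Ann-category): a symmetric categorical group with a biadditive
multiplication, a unit object, and coherent associativity and unit constraints which are natural and
additive in each variable. -/
structure TwoRing : Type (u + 1) where
  toSCGr : SCGr.{u}
  mul : Biadd toSCGr toSCGr toSCGr
  one : toSCGr
  assoc (x y z : toSCGr) : mul.op (mul.op x y) z ≅ mul.op x (mul.op y z)
  unitLeft (x : toSCGr) : mul.op one x ≅ x
  unitRight (x : toSCGr) : mul.op x one ≅ x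
  assoc_nat_left {x x' : toSCGr} (f : x ⟶ x') (y z : toSCGr) :
    mul.mapLeft (mul.mapLeft f y) z ≫ (assoc x' y z).hom =
      (assoc x y z).hom ≫ mul.mapLeft f (mul.op y z)
  assoc_nat_mid (x : toSCGr) {y y' : toSCGr} (f : y ⟶ y') (z : toSCGr) :
    mul.mapLeft (mul.mapRight x f) z ≫ (assoc x y' z).hom =
      (assoc x y z).hom ≫ mul.mapRight x (mul.mapLeft f z)
  assoc_nat_right (x y : toSCGr) {z z' : toSCGr} (f : z ⟶ z') :
    mul.mapRight (mul.op x y) f ≫ (assoc x y z').hom =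
      (assoc x y z).hom ≫ mul.mapRight x (mul.mapRight y f)
  unitLeft_nat {x x' : toSCGr} (f : x ⟶ x') :
    mul.mapRight one f ≫ (unitLeft x').hom = (unitLeft x).hom ≫ f
  unitRight_nat {x x' : toSCGr} (f : x ⟶ x') :
    mul.mapLeft f one ≫ (unitRight x').hom = (unitRight x).hom ≫ f
  assoc_add_left (x x' y z : toSCGr) :
    mul.addLeft (mul.op x y) (mul.op x' y) z ≫ mul.mapLeft (mul.addLeft x x' y) z ≫
        (assoc (x ⊗ x') y z).hom =
      ((assoc x y z).hom ⊗ₘ (assoc x' y z).hom) ≫ mul.addLeft x x' (mul.op y z)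
  assoc_add_mid (x y y' z : toSCGr) :
    mul.addLeft (mul.op x y) (mul.op x y') z ≫ mul.mapLeft (mul.addRight x y y') z ≫
        (assoc x (y ⊗ y') z).hom =
      ((assoc x y z).hom ⊗ₘ (assoc x y' z).hom) ≫ mul.addRight x (mul.op y z) (mul.op y' z) ≫
        mul.mapRight x (mul.addLeft y y' z)
  assoc_add_right (x y z z' : toSCGr) :
    mul.addRight (mul.op x y) z z' ≫ (assoc x y (z ⊗ z')).hom =
      ((assoc x y z).hom ⊗ₘ (assoc x y z').hom) ≫ mul.addRight x (mul.op y z) (mul.op y z') ≫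
        mul.mapRight x (mul.addRight y z z')
  unitLeft_add (x x' : toSCGr) :
    mul.addRight one x x' ≫ (unitLeft (x ⊗ x')).hom = (unitLeft x).hom ⊗ₘ (unitLeft x').hom
  unitRight_add (x x' : toSCGr) :
    mul.addLeft x x' one ≫ (unitRight (x ⊗ x')).hom = (unitRight x).hom ⊗ₘ (unitRight x').hom
  pentagon (x y z w : toSCGr) :
    mul.mapLeft (assoc x y z).hom w ≫ (assoc x (mul.op y z) w).hom ≫
        mul.mapRight x (assoc y z w).hom =
      (assoc (mul.op x y) z w).hom ≫ (assoc x y (mul.op z w)).hom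
  triangle (x y : toSCGr) :
    (assoc x one y).hom ≫ mul.mapRight x (unitLeft y).hom = mul.mapLeft (unitRight x).hom y

/-- A right 2-module over a 2-ring `R`: a symmetric categorical group `M` with a biadditive action
`M × R → M` and coherent associativity and unit constraints which are natural and additive in each
variable. -/
structure TwoMod (R : TwoRing.{u}) : Type (u + 1) where
  toSCGr : SCGr.{u}
  act : Biadd toSCGr R.toSCGr toSCGr
  assoc (m : toSCGr) (r s : R.toSCGr) : act.op (act.op m r) s ≅ act.op m (R.mul.op r s)
  unit (m : toSCGr) : act.op m R.one ≅ m
  assoc_nat_left {m m' : toSCGr} (f : m ⟶ m') (r s : R.toSCGr) :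
    act.mapLeft (act.mapLeft f r) s ≫ (assoc m' r s).hom =
      (assoc m r s).hom ≫ act.mapLeft f (R.mul.op r s)
  assoc_nat_mid (m : toSCGr) {r r' : R.toSCGr} (f : r ⟶ r') (s : R.toSCGr) :
    act.mapLeft (act.mapRight m f) s ≫ (assoc m r' s).hom =
      (assoc m r s).hom ≫ act.mapRight m (R.mul.mapLeft f s)
  assoc_nat_right (m : toSCGr) (r : R.toSCGr) {s s' : R.toSCGr} (f : s ⟶ s') :
    act.mapRight (act.op m r) f ≫ (assoc m r s').hom =
      (assoc m r s).hom ≫ act.mapRight m (R.mul.mapRight r f)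
  unit_nat {m m' : toSCGr} (f : m ⟶ m') :
    act.mapLeft f R.one ≫ (unit m').hom = (unit m).hom ≫ f
  assoc_add_left (m m' : toSCGr) (r s : R.toSCGr) :
    act.addLeft (act.op m r) (act.op m' r) s ≫ act.mapLeft (act.addLeft m m' r) s ≫
        (assoc (m ⊗ m') r s).hom =
      ((assoc m r s).hom ⊗ₘ (assoc m' r s).hom) ≫ act.addLeft m m' (R.mul.op r s)
  assoc_add_mid (m : toSCGr) (r r' s : R.toSCGr) :
    act.addLeft (act.op m r) (act.op m r') s ≫ act.mapLeft (act.addRight m r r') s ≫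
        (assoc m (r ⊗ r') s).hom =
      ((assoc m r s).hom ⊗ₘ (assoc m r' s).hom) ≫
        act.addRight m (R.mul.op r s) (R.mul.op r' s) ≫ act.mapRight m (R.mul.addLeft r r' s)
  assoc_add_right (m : toSCGr) (r s s' : R.toSCGr) :
    act.addRight (act.op m r) s s' ≫ (assoc m r (s ⊗ s')).hom =
      ((assoc m r s).hom ⊗ₘ (assoc m r s').hom) ≫
        act.addRight m (R.mul.op r s) (R.mul.op r s') ≫ act.mapRight m (R.mul.addRight r s s')
  unit_add (m m' : toSCGr) :
    act.addLeft m m' R.one ≫ (unit (m ⊗ m')).hom = (unit m).hom ⊗ₘ (unit m').hom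
  pentagon (m : toSCGr) (r s t : R.toSCGr) :
    act.mapLeft (assoc m r s).hom t ≫ (assoc m (R.mul.op r s) t).hom ≫
        act.mapRight m (R.assoc r s t).hom =
      (assoc (act.op m r) s t).hom ≫ (assoc m r (R.mul.op s t)).hom
  triangle (m : toSCGr) (r : R.toSCGr) :
    (assoc m R.one r).hom ≫ act.mapRight m (R.unitLeft r).hom = act.mapLeft (unit m).hom r

namespace TwoMod

open Functor.LaxMonoidal

variable {R : TwoRing.{u}}

/-- The 2-ring `R` as a right 2-module over itself. -/
def regular (R : TwoRing.{u}) : TwoMod R where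
  toSCGr := R.toSCGr
  act := R.mul
  assoc := R.assoc
  unit := R.unitRight
  assoc_nat_left := R.assoc_nat_left
  assoc_nat_mid := R.assoc_nat_mid
  assoc_nat_right := R.assoc_nat_right
  unit_nat := R.unitRight_nat
  assoc_add_left := R.assoc_add_left
  assoc_add_mid := R.assoc_add_mid
  assoc_add_right := R.assoc_add_right
  unit_add := R.unitRight_add
  pentagon := R.pentagon
  triangle := R.triangle

/-- Morphisms of right 2-modules: morphisms `F` of symmetric categorical groups with constraints
`F (m · r) ≅ F m · r` (automatically invertible), natural and additive in both variables and
compatible with the associativity and unit constraints. -/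
@[ext]
structure Hom (M N : TwoMod R) : Type u where
  toHom : M.toSCGr ⟶ N.toSCGr
  lin (m : M.toSCGr) (r : R.toSCGr) :
    toHom.functor.obj (M.act.op m r) ⟶ N.act.op (toHom.functor.obj m) r
  lin_nat_left {m m' : M.toSCGr} (f : m ⟶ m') (r : R.toSCGr) :
    toHom.functor.map (M.act.mapLeft f r) ≫ lin m' r =
      lin m r ≫ N.act.mapLeft (toHom.functor.map f) r
  lin_nat_right (m : M.toSCGr) {r r' : R.toSCGr} (f : r ⟶ r') :
    toHom.functor.map (M.act.mapRight m f) ≫ lin m r' =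
      lin m r ≫ N.act.mapRight (toHom.functor.obj m) f
  lin_add_left (m m' : M.toSCGr) (r : R.toSCGr) :
    μ toHom.functor (M.act.op m r) (M.act.op m' r) ≫ toHom.functor.map (M.act.addLeft m m' r) ≫
        lin (m ⊗ m') r =
      (lin m r ⊗ₘ lin m' r) ≫ N.act.addLeft (toHom.functor.obj m) (toHom.functor.obj m') r ≫
        N.act.mapLeft (μ toHom.functor m m') r
  lin_add_right (m : M.toSCGr) (r r' : R.toSCGr) :
    μ toHom.functor (M.act.op m r) (M.act.op m r') ≫ toHom.functor.map (M.act.addRight m r r') ≫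
        lin m (r ⊗ r') =
      (lin m r ⊗ₘ lin m r') ≫ N.act.addRight (toHom.functor.obj m) r r'
  lin_assoc (m : M.toSCGr) (r s : R.toSCGr) :
    lin (M.act.op m r) s ≫ N.act.mapLeft (lin m r) s ≫ (N.assoc (toHom.functor.obj m) r s).hom =
      toHom.functor.map (M.assoc m r s).hom ≫ lin m (R.mul.op r s)
  lin_unit (m : M.toSCGr) :
    lin m R.one ≫ (N.unit (toHom.functor.obj m)).hom = toHom.functor.map (M.unit m).hom

/-- Tracks between morphisms of right 2-modules: tracks of the underlying morphisms of symmetric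
categorical groups which are compatible with the action. -/
@[ext]
structure Track {M N : TwoMod R} (F G : Hom M N) : Type u where
  track : F.toHom ⟶ G.toHom
  lin (m : M.toSCGr) (r : R.toSCGr) :
    F.lin m r ≫ N.act.mapLeft (track.nat.app m) r = track.nat.app (M.act.op m r) ≫ G.lin m r

end TwoMod

namespace Biadd

open Functor.LaxMonoidal

variable {M R N : SCGr.{u}} (β : Biadd M R N)

lemma mapLeft_id (m : M) (r : R) : β.mapLeft (𝟙 m) r = 𝟙 _ := (β.at' r).functor.map_id m

lemma mapLeft_comp {m n k : M} (f : m ⟶ n) (g : n ⟶ k) (r : R) :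
    β.mapLeft (f ≫ g) r = β.mapLeft f r ≫ β.mapLeft g r := (β.at' r).functor.map_comp f g

lemma mapLeft_mapRight {m n : M} (f : m ⟶ n) {r s : R} (g : r ⟶ s) :
    β.mapLeft f r ≫ β.mapRight n g = β.mapRight m g ≫ β.mapLeft f s :=
  (β.atMap g).nat.naturality f

lemma addLeft_nat {m m' n n' : M} (f : m ⟶ m') (g : n ⟶ n') (r : R) :
    (β.mapLeft f r ⊗ₘ β.mapLeft g r) ≫ β.addLeft m' n' r =
      β.addLeft m n r ≫ β.mapLeft (f ⊗ₘ g) r :=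
  μ_natural (β.at' r).functor f g

lemma addRight_nat_left {m n : M} (f : m ⟶ n) (r s : R) :
    (β.mapLeft f r ⊗ₘ β.mapLeft f s) ≫ β.addRight n r s =
      β.addRight m r s ≫ β.mapLeft f (r ⊗ s) :=
  (β.atAdd r s).nat.naturality f

lemma addLeft_mapRight (m n : M) {r s : R} (g : r ⟶ s) :
    β.addLeft m n r ≫ β.mapRight (m ⊗ n) g =
      (β.mapRight m g ⊗ₘ β.mapRight n g) ≫ β.addLeft m n s :=
  (β.atMap g).isMonoidal.tensor m n

lemma addLeft_addRight (m n : M) (r s : R) :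
    (tensorμ _ _ _ _ ≫ (β.addLeft m n r ⊗ₘ β.addLeft m n s)) ≫ β.addRight (m ⊗ n) r s =
      (β.addRight m r s ⊗ₘ β.addRight n r s) ≫ β.addLeft m n (r ⊗ s) :=
  (β.atAdd r s).isMonoidal.tensor m n

lemma addLeft_addLeft (m n k l : M) (r : R) :
    (β.addLeft m n r ⊗ₘ β.addLeft k l r) ≫ β.addLeft (m ⊗ n) (k ⊗ l) r ≫
        β.mapLeft (tensorμ m n k l) r =
      tensorμ _ _ _ _ ≫ (β.addLeft m k r ⊗ₘ β.addLeft n l r) ≫ β.addLeft (m ⊗ k) (n ⊗ l) r :=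
  (tensorμ_comp_μ_tensorHom_μ_comp_μ (β.at' r).functor m n k l).symm

end Biadd

namespace TwoMod

open Functor.LaxMonoidal

variable {R : TwoRing.{u}}

/-- The composition of morphisms of right 2-modules. -/
@[simps]
def Hom.comp {M N K : TwoMod R} (F : Hom M N) (G : Hom N K) : Hom M K where
  toHom := F.toHom ≫ G.toHom
  lin m r := G.toHom.functor.map (F.lin m r) ≫ G.lin (F.toHom.functor.obj m) r
  lin_nat_left f r := by
    have h := congr(G.toHom.functor.map $(F.lin_nat_left f r) ≫ G.lin _ r)
    rw [Functor.map_comp, Functor.map_comp, Category.assoc, Category.assoc, G.lin_nat_left] at h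
    exact h.trans (Category.assoc _ _ _).symm
  lin_nat_right m r r' f := by
    have h := congr(G.toHom.functor.map $(F.lin_nat_right m f) ≫ G.lin _ r')
    rw [Functor.map_comp, Functor.map_comp, Category.assoc, Category.assoc, G.lin_nat_right] at h
    exact h.trans (Category.assoc _ _ _).symm
  lin_add_left m m' r := by
    have h := congr(μ G.toHom.functor _ _ ≫ G.toHom.functor.map $(F.lin_add_left m m' r) ≫
      G.lin _ r)
    simp only [Functor.map_comp, Category.assoc, G.lin_nat_left, ← μ_natural_assoc] at h
    have h' := congr((G.toHom.functor.map (F.lin m r) ⊗ₘ G.toHom.functor.map (F.lin m' r)) ≫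
      $(G.lin_add_left (F.toHom.functor.obj m) (F.toHom.functor.obj m') r) ≫
      K.act.mapLeft (G.toHom.functor.map (μ F.toHom.functor m m')) r)
    simp only [Category.assoc] at h'
    rw [h'] at h
    change (μ G.toHom.functor _ _ ≫ G.toHom.functor.map (μ F.toHom.functor _ _)) ≫
      G.toHom.functor.map (F.toHom.functor.map _) ≫ _ ≫ _ = (_ ≫ _ ⊗ₘ _ ≫ _) ≫ _ ≫
      K.act.mapLeft (μ G.toHom.functor _ _ ≫ G.toHom.functor.map (μ F.toHom.functor _ _)) r
    rw [Biadd.mapLeft_comp, ← tensorHom_comp_tensorHom, Category.assoc, Category.assoc]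
    exact h
  lin_add_right m r r' := by
    have h := congr(μ G.toHom.functor _ _ ≫ G.toHom.functor.map $(F.lin_add_right m r r') ≫
      G.lin _ (r ⊗ r'))
    simp only [Functor.map_comp, Category.assoc, ← μ_natural_assoc] at h
    rw [G.lin_add_right] at h
    change (μ G.toHom.functor _ _ ≫ G.toHom.functor.map (μ F.toHom.functor _ _)) ≫
      G.toHom.functor.map (F.toHom.functor.map _) ≫ _ ≫ _ = (_ ≫ _ ⊗ₘ _ ≫ _) ≫ _
    rw [← tensorHom_comp_tensorHom, Category.assoc, Category.assoc]
    exact h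
  lin_assoc m r s := by
    have h := congr(G.toHom.functor.map $(F.lin_assoc m r s) ≫ G.lin _ (R.mul.op r s))
    simp only [Functor.map_comp, Category.assoc] at h
    rw [← G.lin_assoc, reassoc_of% G.lin_nat_left] at h
    rw [Biadd.mapLeft_comp, Category.assoc, Category.assoc]
    exact h
  lin_unit m := by
    have h := congr(G.toHom.functor.map $(F.lin_unit m))
    rw [Functor.map_comp, ← G.lin_unit] at h
    exact (Category.assoc _ _ _).trans h

instance : CategoryStruct.{u} (TwoMod R) where
  Hom := Hom
  id M :=
    { toHom := 𝟙 M.toSCGr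
      lin _ _ := 𝟙 _
      lin_nat_left f r := (Category.comp_id _).trans (Category.id_comp _).symm
      lin_nat_right _ _ _ f := (Category.comp_id _).trans (Category.id_comp _).symm
      lin_add_left m m' r := by
        change 𝟙 _ ≫ M.act.addLeft m m' r ≫ 𝟙 _ =
          (𝟙 _ ⊗ₘ 𝟙 _) ≫ M.act.addLeft m m' r ≫ M.act.mapLeft (𝟙 _) r
        simp [Biadd.mapLeft_id]
      lin_add_right m r r' := by
        change 𝟙 _ ≫ M.act.addRight m r r' ≫ 𝟙 _ = (𝟙 _ ⊗ₘ 𝟙 _) ≫ M.act.addRight m r r'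
        simp
      lin_assoc m r s := by
        change 𝟙 _ ≫ M.act.mapLeft (𝟙 _) s ≫ (M.assoc m r s).hom = (M.assoc m r s).hom ≫ 𝟙 _
        simp [Biadd.mapLeft_id]
      lin_unit m := Category.id_comp _ }
  comp := Hom.comp

instance homCategory (M N : TwoMod R) : Category.{u} (M ⟶ N) where
  Hom F G := Track F G
  id F :=
    { track := 𝟙 F.toHom
      lin m r := by
        change F.lin m r ≫ N.act.mapLeft (𝟙 _) r = 𝟙 _ ≫ F.lin m r
        simp [Biadd.mapLeft_id] }
  comp {F G H} s t :=
    { track := s.track ≫ t.track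
      lin m r := by
        change F.lin m r ≫ N.act.mapLeft (s.track.nat.app m ≫ t.track.nat.app m) r =
          (s.track.nat.app _ ≫ t.track.nat.app _) ≫ H.lin m r
        rw [Biadd.mapLeft_comp, reassoc_of% (s.lin m r), t.lin m r, Category.assoc] }

section

variable {M N K L : TwoMod R}

lemma hom_ext {F G : M ⟶ N} {s t : F ⟶ G} (h : s.track = t.track) : s = t := Track.ext h

/-- A track from an invertible track between underlying morphisms. -/
@[simps]
def isoMk {F G : M ⟶ N} (e : F.toHom ≅ G.toHom) (h : ∀ m r,
    F.lin m r ≫ N.act.mapLeft (e.hom.nat.app m) r = e.hom.nat.app (M.act.op m r) ≫ G.lin m r) :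
    F ≅ G where
  hom := { track := e.hom, lin := h }
  inv :=
    { track := e.inv
      lin := fun m r => by
        have h₁ (x : M.toSCGr) : e.hom.nat.app x ≫ e.inv.nat.app x = 𝟙 _ :=
          congr(($(e.hom_inv_id)).nat.app x)
        have h₂ (x : M.toSCGr) : e.inv.nat.app x ≫ e.hom.nat.app x = 𝟙 _ :=
          congr(($(e.inv_hom_id)).nat.app x)
        have h' := congr(e.inv.nat.app (M.act.op m r) ≫ $(h m r) ≫
          N.act.mapLeft (e.inv.nat.app m) r)
        rw [Category.assoc, ← Biadd.mapLeft_comp, h₁, Biadd.mapLeft_id, Category.comp_id,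
          Category.assoc, reassoc_of% h₂] at h'
        exact h'.symm }
  hom_inv_id := hom_ext e.hom_inv_id
  inv_hom_id := hom_ext e.inv_hom_id

instance : IsGroupoid (M ⟶ N) where
  all_isIso {F G} s := (isoMk (F := F) (G := G) (asIso s.track) s.lin).isIso_hom

end

instance : Bicategory.{u, u} (TwoMod R) where
  homCategory := homCategory
  whiskerLeft {_ _ K} F G H s :=
    { track := Bicategory.whiskerLeft F.toHom s.track
      lin := fun m r => by
        have h := congr(G.toHom.functor.map (F.lin m r) ≫ $(s.lin (F.toHom.functor.obj m) r))
        rw [reassoc_of% (s.track.nat.naturality (F.lin m r))] at h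
        exact (Category.assoc _ _ _).trans h }
  whiskerRight {_ _ K F G} s H :=
    { track := Bicategory.whiskerRight s.track H.toHom
      lin := fun m r => by
        have h := congr(H.toHom.functor.map $(s.lin m r) ≫ H.lin _ r)
        rw [Functor.map_comp, Functor.map_comp, Category.assoc, Category.assoc,
          H.lin_nat_left] at h
        exact (Category.assoc _ _ _).trans h }
  associator {_ _ _ L} F G H :=
    isoMk (F := Hom.comp (Hom.comp F G) H) (G := Hom.comp F (Hom.comp G H))
      (Bicategory.associator F.toHom G.toHom H.toHom) (fun m r => by
        change (H.toHom.functor.map (G.toHom.functor.map (F.lin m r) ≫ G.lin _ r) ≫ H.lin _ r) ≫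
          L.act.mapLeft (𝟙 _) r = 𝟙 _ ≫ H.toHom.functor.map (G.toHom.functor.map (F.lin m r)) ≫
            H.toHom.functor.map (G.lin _ r) ≫ H.lin _ r
        simp [Biadd.mapLeft_id])
  leftUnitor {M N} F := isoMk (F := Hom.comp (𝟙 M) F) (G := F)
    (Bicategory.leftUnitor F.toHom) (fun m r => by
      change (F.toHom.functor.map (𝟙 _) ≫ F.lin m r) ≫ N.act.mapLeft (𝟙 _) r = 𝟙 _ ≫ F.lin m r
      simp [Biadd.mapLeft_id])
  rightUnitor {_ N} F := isoMk (F := Hom.comp F (𝟙 N)) (G := F)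
    (Bicategory.rightUnitor F.toHom) (fun m r => by
      change (F.lin m r ≫ 𝟙 _) ≫ N.act.mapLeft (𝟙 _) r = 𝟙 _ ≫ F.lin m r
      simp [Biadd.mapLeft_id])
  whiskerLeft_id _ _ := hom_ext (Bicategory.whiskerLeft_id (B := SCGr) _ _)
  whiskerLeft_comp _ _ _ _ _ _ := hom_ext (Bicategory.whiskerLeft_comp (B := SCGr) _ _ _)
  id_whiskerLeft _ := hom_ext (Bicategory.id_whiskerLeft (B := SCGr) _)
  comp_whiskerLeft _ _ _ _ _ := hom_ext (Bicategory.comp_whiskerLeft (B := SCGr) _ _ _)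
  id_whiskerRight _ _ := hom_ext (Bicategory.id_whiskerRight (B := SCGr) _ _)
  comp_whiskerRight _ _ _ := hom_ext (Bicategory.comp_whiskerRight (B := SCGr) _ _ _)
  whiskerRight_id _ := hom_ext (Bicategory.whiskerRight_id (B := SCGr) _)
  whiskerRight_comp _ _ _ := hom_ext (Bicategory.whiskerRight_comp (B := SCGr) _ _ _)
  whisker_assoc _ _ _ _ _ := hom_ext (Bicategory.whisker_assoc (B := SCGr) _ _ _)
  whisker_exchange _ _ := hom_ext (Bicategory.whisker_exchange (B := SCGr) _ _)
  pentagon _ _ _ _ := hom_ext (Bicategory.pentagon (B := SCGr) _ _ _ _)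
  triangle _ _ := hom_ext (Bicategory.triangle (B := SCGr) _ _)

end TwoMod

section

variable {𝒞 𝒟 : Type*} [Category 𝒞] [MonoidalCategory 𝒞] [Category 𝒟] [MonoidalCategory 𝒟]

open Functor.LaxMonoidal Functor.OplaxMonoidal

/-- Between groupoids, compatibility with addition implies compatibility with zero. -/
lemma unit_of_tensor [IsGroupoid 𝒟] {F G : 𝒞 ⥤ 𝒟} [F.Monoidal] [G.Monoidal] (t : F ⟶ G)
    (h : μ F (𝟙_ 𝒞) (𝟙_ 𝒞) ≫ t.app (𝟙_ 𝒞 ⊗ 𝟙_ 𝒞) =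
      (t.app (𝟙_ 𝒞) ⊗ₘ t.app (𝟙_ 𝒞)) ≫ μ G (𝟙_ 𝒞) (𝟙_ 𝒞)) :
    ε F ≫ t.app (𝟙_ 𝒞) = ε G := by
  set a : 𝟙_ 𝒟 ⟶ 𝟙_ 𝒟 := ε F ≫ t.app (𝟙_ 𝒞) ≫ η G with ha
  have h₁ : (a ⊗ₘ a) ≫ (λ_ (𝟙_ 𝒟)).hom = (λ_ (𝟙_ 𝒟)).hom ≫ a := by
    have e := μ_unit F
    have e₁ : (ε F ⊗ₘ ε F) ≫ μ F (𝟙_ 𝒞) (𝟙_ 𝒞) ≫ F.map (λ_ (𝟙_ 𝒞)).hom =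
        (λ_ (𝟙_ 𝒟)).hom ≫ ε F := by
      rw [← cancel_mono (η F), Category.assoc, Category.assoc, μ_unit,
        tensorHom_comp_tensorHom_assoc]
      simp
    have h₂ := congr((ε F ⊗ₘ ε F) ≫ $h ≫ G.map (λ_ (𝟙_ 𝒞)).hom ≫ η G)
    simp only [Category.assoc, μ_unit] at h₂
    rw [← t.naturality_assoc, reassoc_of% e₁, tensorHom_comp_tensorHom_assoc,
      tensorHom_comp_tensorHom_assoc] at h₂
    simpa [ha] using h₂.symm
  have h₃ : a ▷ 𝟙_ 𝒟 = 𝟙 _ := by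
    rw [← leftUnitor_naturality, cancel_mono, MonoidalCategory.tensorHom_def] at h₁
    rw [← cancel_mono (𝟙_ 𝒟 ◁ a), h₁, Category.id_comp]
  have h₄ : a = 𝟙 _ := by
    have := rightUnitor_naturality a
    rwa [h₃, Category.id_comp, Eq.comm, ← Category.comp_id (ρ_ (𝟙_ 𝒟)).hom, Category.assoc,
      Category.id_comp, cancel_epi] at this
  rw [← cancel_mono (η G), Category.assoc, ← ha, h₄]; simp

end

/-- A track from a natural family of morphisms which is compatible with addition. -/
def SCGr.mkTrackOfTensor {A B : SCGr.{u}} {F G : A ⟶ B}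
    (t : ∀ x, F.functor.obj x ⟶ G.functor.obj x)
    (nat : ∀ {x y : A} (f : x ⟶ y), F.functor.map f ≫ t y = t x ≫ G.functor.map f)
    (tensor : ∀ x y, Functor.LaxMonoidal.μ F.functor x y ≫ t (x ⊗ y) =
      (t x ⊗ₘ t y) ≫ Functor.LaxMonoidal.μ G.functor x y) : F ⟶ G :=
  let s : F.functor ⟶ G.functor := { app := t, naturality := fun _ _ f => nat f }
  SCGr.mkTrack t nat (unit_of_tensor s (tensor _ _)) tensor

namespace Biadd

open Functor.LaxMonoidal

variable {M R N : SCGr.{u}} (β : Biadd M R N)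

/-- The constraint `0 ≅ 0 · r`. -/
def zeroLeft (r : R) : 𝟙_ N ⟶ β.op (𝟙_ M) r := ε (β.at' r).functor

lemma zeroLeft_mapRight {r s : R} (f : r ⟶ s) :
    β.zeroLeft r ≫ β.mapRight (𝟙_ M) f = β.zeroLeft s :=
  (β.atMap f).isMonoidal.unit

lemma zeroLeft_addLeft (r : R) :
    (β.zeroLeft r ⊗ₘ β.zeroLeft r) ≫ β.addLeft (𝟙_ M) (𝟙_ M) r ≫
      β.mapLeft (λ_ (𝟙_ M)).hom r = (λ_ (𝟙_ N)).hom ≫ β.zeroLeft r := by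
  have h := congr((𝟙_ N) ◁ β.zeroLeft r ≫
    $(Functor.LaxMonoidal.left_unitality (β.at' r).functor (𝟙_ M)))
  rw [MonoidalCategory.tensorHom_def', Category.assoc]
  exact h.symm.trans (leftUnitor_naturality _)

lemma zeroLeft_addRight (r s : R) :
    (β.zeroLeft r ⊗ₘ β.zeroLeft s) ≫ β.addRight (𝟙_ M) r s =
      (λ_ (𝟙_ N)).hom ≫ β.zeroLeft (r ⊗ s) := by
  have h : ((λ_ (𝟙_ N)).inv ≫ (β.zeroLeft r ⊗ₘ β.zeroLeft s)) ≫ β.addRight (𝟙_ M) r s =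
    β.zeroLeft (r ⊗ s) := (β.atAdd r s).isMonoidal.unit
  rw [← h]; simp

end Biadd

namespace TwoMod

open Functor.LaxMonoidal

variable {R : TwoRing.{u}}

/-- The associativity constraint as a track. -/
def assocTrack (N : TwoMod R) (r s : R.toSCGr) :
    N.act.at' r ≫ N.act.at' s ⟶ N.act.at' (R.mul.op r s) :=
  SCGr.mkTrackOfTensor (fun m => (N.assoc m r s).hom) (fun f => N.assoc_nat_left f r s)
    (fun x y => (Category.assoc _ _ _).trans (N.assoc_add_left x y r s))

/-- The unit constraint as a track. -/
def unitTrack (N : TwoMod R) : N.act.at' R.one ⟶ 𝟙 N.toSCGr :=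
  SCGr.mkTrackOfTensor (fun m => (N.unit m).hom) (fun f => N.unit_nat f)
    (fun x y => (N.unit_add x y).trans (Category.comp_id _).symm)

lemma zeroLeft_assoc (N : TwoMod R) (r s : R.toSCGr) :
    N.act.zeroLeft s ≫ N.act.mapLeft (N.act.zeroLeft r) s ≫ (N.assoc (𝟙_ _) r s).hom =
      N.act.zeroLeft (R.mul.op r s) := by
  have h : (N.act.zeroLeft s ≫ N.act.mapLeft (N.act.zeroLeft r) s) ≫ (N.assoc (𝟙_ _) r s).hom =
      N.act.zeroLeft (R.mul.op r s) := (N.assocTrack r s).isMonoidal.unit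
  rwa [Category.assoc] at h

lemma zeroLeft_unit (N : TwoMod R) :
    N.act.zeroLeft R.one ≫ (N.unit (𝟙_ _)).hom = 𝟙 _ :=
  N.unitTrack.isMonoidal.unit

end TwoMod

namespace TwoMod

open Functor.LaxMonoidal

variable {R : TwoRing.{u}} {M N : TwoMod R}

/-- The pointwise sum of two morphisms of right 2-modules. -/
def add (F G : M ⟶ N) : M ⟶ N where
  toHom := F.toHom ⊗ G.toHom
  lin m r := (F.lin m r ⊗ₘ G.lin m r) ≫
    N.act.addLeft (F.toHom.functor.obj m) (G.toHom.functor.obj m) r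
  lin_nat_left {m m'} f r := by
    change (F.toHom.functor.map _ ⊗ₘ G.toHom.functor.map _) ≫ (F.lin m' r ⊗ₘ G.lin m' r) ≫
        N.act.addLeft (F.toHom.functor.obj m') (G.toHom.functor.obj m') r =
      ((F.lin m r ⊗ₘ G.lin m r) ≫
        N.act.addLeft (F.toHom.functor.obj m) (G.toHom.functor.obj m) r) ≫
          N.act.mapLeft (F.toHom.functor.map f ⊗ₘ G.toHom.functor.map f) r
    rw [Category.assoc, ← Biadd.addLeft_nat, tensorHom_comp_tensorHom_assoc,
      tensorHom_comp_tensorHom_assoc, F.lin_nat_left, G.lin_nat_left]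
  lin_nat_right m {r r'} f := by
    change (F.toHom.functor.map _ ⊗ₘ G.toHom.functor.map _) ≫ (F.lin m r' ⊗ₘ G.lin m r') ≫
        N.act.addLeft (F.toHom.functor.obj m) (G.toHom.functor.obj m) r' =
      ((F.lin m r ⊗ₘ G.lin m r) ≫
        N.act.addLeft (F.toHom.functor.obj m) (G.toHom.functor.obj m) r) ≫
          N.act.mapRight (F.toHom.functor.obj m ⊗ G.toHom.functor.obj m) f
    rw [Category.assoc, Biadd.addLeft_mapRight, tensorHom_comp_tensorHom_assoc,
      tensorHom_comp_tensorHom_assoc, F.lin_nat_right, G.lin_nat_right]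
  lin_add_left m m' r := by
    change (tensorμ _ _ _ _ ≫ (μ F.toHom.functor _ _ ⊗ₘ μ G.toHom.functor _ _)) ≫
        (F.toHom.functor.map _ ⊗ₘ G.toHom.functor.map _) ≫
          (F.lin (m ⊗ m') r ⊗ₘ G.lin (m ⊗ m') r) ≫ _ =
      ((F.lin m r ⊗ₘ G.lin m r) ≫ _ ⊗ₘ (F.lin m' r ⊗ₘ G.lin m' r) ≫ _) ≫
        N.act.addLeft (F.toHom.functor.obj m ⊗ G.toHom.functor.obj m)
          (F.toHom.functor.obj m' ⊗ G.toHom.functor.obj m') r ≫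
          N.act.mapLeft (tensorμ _ _ _ _ ≫ (μ F.toHom.functor _ _ ⊗ₘ μ G.toHom.functor _ _)) r
    rw [Category.assoc, tensorHom_comp_tensorHom_assoc, tensorHom_comp_tensorHom_assoc,
      Category.assoc, F.lin_add_left, Category.assoc, G.lin_add_left,
      ← tensorHom_comp_tensorHom_assoc, ← tensorHom_comp_tensorHom_assoc, Biadd.addLeft_nat,
      ← tensorμ_natural_assoc, ← tensorHom_comp_tensorHom, Biadd.mapLeft_comp, Category.assoc,
      reassoc_of% (N.act.addLeft_addLeft)]
  lin_add_right m r r' := by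
    change (tensorμ _ _ _ _ ≫ (μ F.toHom.functor _ _ ⊗ₘ μ G.toHom.functor _ _)) ≫
        (F.toHom.functor.map _ ⊗ₘ G.toHom.functor.map _) ≫
          (F.lin m (r ⊗ r') ⊗ₘ G.lin m (r ⊗ r')) ≫ _ =
      ((F.lin m r ⊗ₘ G.lin m r) ≫ _ ⊗ₘ (F.lin m r' ⊗ₘ G.lin m r') ≫ _) ≫
        N.act.addRight (F.toHom.functor.obj m ⊗ G.toHom.functor.obj m) r r'
    rw [Category.assoc, tensorHom_comp_tensorHom_assoc, tensorHom_comp_tensorHom_assoc,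
      Category.assoc, F.lin_add_right, Category.assoc, G.lin_add_right,
      ← tensorHom_comp_tensorHom_assoc, ← tensorμ_natural_assoc, ← tensorHom_comp_tensorHom,
      Category.assoc, ← Biadd.addLeft_addRight, ← Category.assoc (tensorμ _ _ _ _),
      ← Category.assoc (tensorμ _ _ _ _), tensorμ_tensorμ, Category.id_comp]
  lin_assoc m r s := by
    change ((F.lin _ s ⊗ₘ G.lin _ s) ≫ _) ≫ N.act.mapLeft ((F.lin m r ⊗ₘ G.lin m r) ≫ _) s ≫
        (N.assoc (F.toHom.functor.obj m ⊗ G.toHom.functor.obj m) r s).hom =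
      (F.toHom.functor.map _ ⊗ₘ G.toHom.functor.map _) ≫ (F.lin m _ ⊗ₘ G.lin m _) ≫ _
    rw [Category.assoc, Biadd.mapLeft_comp, Category.assoc, ← reassoc_of% (N.act.addLeft_nat),
      N.assoc_add_left, tensorHom_comp_tensorHom_assoc, tensorHom_comp_tensorHom_assoc,
      tensorHom_comp_tensorHom_assoc, Category.assoc, Category.assoc, F.lin_assoc, G.lin_assoc]
  lin_unit m := by
    change ((F.lin _ _ ⊗ₘ G.lin _ _) ≫ _) ≫
        (N.unit (F.toHom.functor.obj m ⊗ G.toHom.functor.obj m)).hom =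
      (F.toHom.functor.map _ ⊗ₘ G.toHom.functor.map _)
    rw [Category.assoc, N.unit_add, tensorHom_comp_tensorHom, F.lin_unit, G.lin_unit]

/-- The zero morphism of right 2-modules. -/
def zero (M N : TwoMod R) : M ⟶ N where
  toHom := 𝟙_ (M.toSCGr ⟶ N.toSCGr)
  lin _ r := N.act.zeroLeft r
  lin_nat_left {m m'} f r := by
    change 𝟙 _ ≫ N.act.zeroLeft r = N.act.zeroLeft r ≫ N.act.mapLeft (𝟙 _) r
    simp [Biadd.mapLeft_id]
  lin_nat_right m {r r'} f := (Category.id_comp _).trans (N.act.zeroLeft_mapRight f).symm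
  lin_add_left m m' r := by
    change (λ_ (𝟙_ N.toSCGr)).hom ≫ 𝟙 _ ≫ N.act.zeroLeft r = _
    rw [Category.id_comp]
    exact (N.act.zeroLeft_addLeft r).symm
  lin_add_right m r r' := by
    change (λ_ (𝟙_ N.toSCGr)).hom ≫ 𝟙 _ ≫ N.act.zeroLeft (r ⊗ r') = _
    rw [Category.id_comp]
    exact (N.act.zeroLeft_addRight r r').symm
  lin_assoc m r s := (N.zeroLeft_assoc r s).trans (Category.id_comp _).symm
  lin_unit m := N.zeroLeft_unit

end TwoMod

namespace Biadd

open Functor.LaxMonoidal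

variable {M R N : SCGr.{u}} (β : Biadd M R N)

lemma addLeft_assoc (m n k : M) (r : R) :
    (β.addLeft m n r ▷ β.op k r) ≫ β.addLeft (m ⊗ n) k r ≫ β.mapLeft (α_ m n k).hom r =
      (α_ _ _ _).hom ≫ (β.op m r ◁ β.addLeft n k r) ≫ β.addLeft m (n ⊗ k) r :=
  associativity (β.at' r).functor m n k

lemma zeroLeft_addLeft_left (m : M) (r : R) :
    (β.zeroLeft r ▷ β.op m r) ≫ β.addLeft (𝟙_ M) m r ≫ β.mapLeft (λ_ m).hom r = (λ_ _).hom :=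
  (left_unitality (β.at' r).functor m).symm

lemma zeroLeft_addLeft_right (m : M) (r : R) :
    (β.op m r ◁ β.zeroLeft r) ≫ β.addLeft m (𝟙_ M) r ≫ β.mapLeft (ρ_ m).hom r = (ρ_ _).hom :=
  (right_unitality (β.at' r).functor m).symm

lemma addLeft_braiding (m n : M) (r : R) :
    β.addLeft m n r ≫ β.mapLeft (β_ m n).hom r = (β_ _ _).hom ≫ β.addLeft n m r :=
  Functor.LaxBraided.braided m n

end Biadd

namespace TwoMod

open Functor.LaxMonoidal

variable {R : TwoRing.{u}} {M N K : TwoMod R}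

instance homMonoidalStruct (M N : TwoMod R) : MonoidalCategoryStruct (M ⟶ N) :=
  let tensorHom {F F' G G' : M ⟶ N} (s : F ⟶ F') (t : G ⟶ G') : add F G ⟶ add F' G' :=
    { track := s.track ⊗ₘ t.track
      lin := fun m r => by
        change ((F.lin m r ⊗ₘ G.lin m r) ≫
            N.act.addLeft (F.toHom.functor.obj m) (G.toHom.functor.obj m) r) ≫
              N.act.mapLeft (s.track.nat.app m ⊗ₘ t.track.nat.app m) r =
          (s.track.nat.app _ ⊗ₘ t.track.nat.app _) ≫ (F'.lin m r ⊗ₘ G'.lin m r) ≫ _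
        rw [Category.assoc, ← Biadd.addLeft_nat, tensorHom_comp_tensorHom_assoc,
          tensorHom_comp_tensorHom_assoc, s.lin, t.lin] }
  { tensorObj := add
    tensorUnit := zero M N
    tensorHom := tensorHom
    whiskerLeft := fun F _ _ t => tensorHom (𝟙 F) t
    whiskerRight := fun s G => tensorHom s (𝟙 G)
    associator := fun F G H => isoMk (F := add (add F G) H) (G := add F (add G H))
      (α_ F.toHom G.toHom H.toHom) (fun m r => by
        change (((F.lin m r ⊗ₘ G.lin m r) ≫
            N.act.addLeft (F.toHom.functor.obj m) (G.toHom.functor.obj m) r ⊗ₘ H.lin m r) ≫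
              N.act.addLeft (F.toHom.functor.obj m ⊗ G.toHom.functor.obj m)
                (H.toHom.functor.obj m) r) ≫ N.act.mapLeft (α_ _ _ _).hom r =
          (α_ _ _ _).hom ≫ (F.lin m r ⊗ₘ (G.lin m r ⊗ₘ H.lin m r) ≫
            N.act.addLeft (G.toHom.functor.obj m) (H.toHom.functor.obj m) r) ≫
              N.act.addLeft (F.toHom.functor.obj m)
                (G.toHom.functor.obj m ⊗ H.toHom.functor.obj m) r
        have e₁ : ((F.lin m r ⊗ₘ G.lin m r) ≫
            N.act.addLeft (F.toHom.functor.obj m) (G.toHom.functor.obj m) r ⊗ₘ H.lin m r) =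
          ((F.lin m r ⊗ₘ G.lin m r) ⊗ₘ H.lin m r) ≫ (N.act.addLeft _ _ r ▷ _) := by
          rw [← tensorHom_id, tensorHom_comp_tensorHom, Category.comp_id]
        have e₂ : (F.lin m r ⊗ₘ (G.lin m r ⊗ₘ H.lin m r) ≫
            N.act.addLeft (G.toHom.functor.obj m) (H.toHom.functor.obj m) r) =
          (F.lin m r ⊗ₘ (G.lin m r ⊗ₘ H.lin m r)) ≫ (_ ◁ N.act.addLeft _ _ r) := by
          rw [← id_tensorHom, tensorHom_comp_tensorHom, Category.comp_id]
        rw [e₁, e₂, Category.assoc, Category.assoc, Category.assoc, Biadd.addLeft_assoc,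
          ← associator_naturality_assoc])
    leftUnitor := fun F => isoMk (F := add (zero M N) F) (G := F) (λ_ F.toHom) (fun m r => by
      change ((N.act.zeroLeft r ⊗ₘ F.lin m r) ≫
          N.act.addLeft (𝟙_ N.toSCGr) (F.toHom.functor.obj m) r) ≫ N.act.mapLeft (λ_ _).hom r =
        (λ_ _).hom ≫ F.lin m r
      rw [MonoidalCategory.tensorHom_def', Category.assoc, Category.assoc,
        Biadd.zeroLeft_addLeft_left, leftUnitor_naturality])
    rightUnitor := fun F => isoMk (F := add F (zero M N)) (G := F) (ρ_ F.toHom) (fun m r => by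
      change ((F.lin m r ⊗ₘ N.act.zeroLeft r) ≫
          N.act.addLeft (F.toHom.functor.obj m) (𝟙_ N.toSCGr) r) ≫ N.act.mapLeft (ρ_ _).hom r =
        (ρ_ _).hom ≫ F.lin m r
      rw [MonoidalCategory.tensorHom_def, Category.assoc, Category.assoc,
        Biadd.zeroLeft_addLeft_right, rightUnitor_naturality]) }

/-- The pointwise monoidal structure on the groupoid of morphisms `M ⟶ N`. -/
instance homMonoidal (M N : TwoMod R) : MonoidalCategory (M ⟶ N) :=
  MonoidalCategory.ofTensorHom
    (id_tensorHom_id := fun F G => hom_ext (id_tensorHom_id F.toHom G.toHom))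
    (id_tensorHom := fun _ _ _ _ => rfl)
    (tensorHom_id := fun _ _ => rfl)
    (tensorHom_comp_tensorHom := fun f₁ f₂ g₁ g₂ => hom_ext
      (tensorHom_comp_tensorHom f₁.track f₂.track g₁.track g₂.track))
    (associator_naturality := fun f₁ f₂ f₃ => hom_ext
      (associator_naturality f₁.track f₂.track f₃.track))
    (leftUnitor_naturality := fun s => hom_ext (leftUnitor_naturality s.track))
    (rightUnitor_naturality := fun s => hom_ext (rightUnitor_naturality s.track))
    (pentagon := fun F G H K => hom_ext
      (MonoidalCategory.pentagon F.toHom G.toHom H.toHom K.toHom))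
    (triangle := fun F G => hom_ext (MonoidalCategory.triangle F.toHom G.toHom))

instance homBraided (M N : TwoMod R) : BraidedCategory (M ⟶ N) where
  braiding F G := isoMk (F := add F G) (G := add G F) (β_ F.toHom G.toHom) (fun m r => by
    change ((F.lin m r ⊗ₘ G.lin m r) ≫
        N.act.addLeft (F.toHom.functor.obj m) (G.toHom.functor.obj m) r) ≫
          N.act.mapLeft (β_ _ _).hom r = (β_ _ _).hom ≫ (G.lin m r ⊗ₘ F.lin m r) ≫ _
    rw [Category.assoc, Biadd.addLeft_braiding, BraidedCategory.braiding_naturality_assoc])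
  braiding_naturality_right F _ _ t := hom_ext
    (BraidedCategory.braiding_naturality_right F.toHom t.track)
  braiding_naturality_left t H := hom_ext
    (BraidedCategory.braiding_naturality_left t.track H.toHom)
  hexagon_forward F G H := hom_ext (BraidedCategory.hexagon_forward F.toHom G.toHom H.toHom)
  hexagon_reverse F G H := hom_ext (BraidedCategory.hexagon_reverse F.toHom G.toHom H.toHom)

instance homSymmetric (M N : TwoMod R) : SymmetricCategory (M ⟶ N) where
  symmetry F G := hom_ext (SymmetricCategory.symmetry F.toHom G.toHom)

end TwoMod

namespace SCGr

open Functor.LaxMonoidal Functor.OplaxMonoidal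

variable {A B C : SCGr.{u}}

lemma mapPairing_add (F G : A ⟶ B) {x y : A} (p : x ⊗ y ⟶ 𝟙_ A) :
    mapPairing (F ⊗ G).functor p =
      addPairing (mapPairing F.functor p) (mapPairing G.functor p) := by
  change (tensorμ _ _ _ _ ≫ (μ F.functor _ _ ⊗ₘ μ G.functor _ _)) ≫
    (F.functor.map p ⊗ₘ G.functor.map p) ≫ (η F.functor ⊗ₘ η G.functor) ≫ (λ_ (𝟙_ B)).hom = _
  simp only [addPairing, mapPairing, ← tensorHom_comp_tensorHom, Category.assoc]

lemma mapPairing_comp (F : A ⟶ B) (G : B ⟶ C) {x y : A} (p : x ⊗ y ⟶ 𝟙_ A) :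
    mapPairing (F ≫ G).functor p = mapPairing G.functor (mapPairing F.functor p) := by
  change (μ G.functor _ _ ≫ G.functor.map (μ F.functor _ _)) ≫
    G.functor.map (F.functor.map p) ≫ G.functor.map (η F.functor) ≫ η G.functor = _
  simp only [mapPairing, Functor.map_comp, Category.assoc]

lemma mapPairing_id {x y : A} (p : x ⊗ y ⟶ 𝟙_ A) :
    mapPairing (𝟙 A : A ⟶ A).functor p = p := by
  change 𝟙 _ ≫ p ≫ 𝟙 _ = _
  simp

end SCGr

namespace TwoMod

open Functor.LaxMonoidal

variable {R : TwoRing.{u}} {M N K : TwoMod R}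

/-- The opposite, as an endomorphism of a right 2-module. -/
def neg (M : TwoMod R) : M ⟶ M where
  toHom := SCGr.neg M.toSCGr
  lin m r := SCGr.negComm (M.act.at' r) m
  lin_nat_left f r := (SCGr.negCommIso (M.act.at' r)).hom.nat.naturality f
  lin_nat_right m {r r'} f := by
    have h₁ := (SCGr.neg_compat_map (M.act.mapRight m f)).comp
      (SCGr.negComm_compat (M.act.at' r') m)
    have h₂ := (SCGr.negComm_compat (M.act.at' r) m).comp
      (compat_nat (M.act.atMap f).nat (negPairing m))
    exact h₁.unique h₂ ((Category.comp_id _).trans (Category.id_comp _).symm)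
  lin_add_left m m' r :=
    (Category.assoc _ _ _).symm.trans
      ((SCGr.negCommIso (M.act.at' r)).hom.isMonoidal.tensor m m')
  lin_add_right m r r' := by
    have h₁ := ((SCGr.neg_compat_μ (M.act.op m r) (M.act.op m r')).comp
      (SCGr.neg_compat_map (M.act.addRight m r r'))).comp
        (SCGr.negComm_compat (M.act.at' (r ⊗ r')) m)
    have h₂ := compat_nat (M.act.atAdd r r').nat (negPairing m)
    rw [SCGr.mapPairing_add] at h₂
    have h₃ := ((SCGr.negComm_compat (M.act.at' r) m).add
      (SCGr.negComm_compat (M.act.at' r') m)).comp h₂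
    refine (Category.assoc _ _ _).symm.trans (h₁.unique h₃ ?_)
    change (𝟙 _ ≫ M.act.addRight m r r') ≫ 𝟙 (M.act.op m (r ⊗ r')) =
      (𝟙 (M.act.op m r) ⊗ₘ 𝟙 (M.act.op m r')) ≫ M.act.addRight m r r'
    simp
  lin_assoc m r s := by
    have h₂ := compat_nat (M.assocTrack r s).nat (negPairing m)
    rw [SCGr.mapPairing_comp] at h₂
    have h₁ := ((SCGr.negComm_compat (M.act.at' s) (M.act.op m r)).comp
      ((SCGr.negComm_compat (M.act.at' r) m).map (M.act.at' s).functor)).comp h₂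
    have h₃ := (SCGr.neg_compat_map (M.assoc m r s).hom).comp
      (SCGr.negComm_compat (M.act.at' (R.mul.op r s)) m)
    refine (Category.assoc _ _ _).symm.trans (h₁.unique h₃ ?_)
    change (𝟙 _ ≫ M.act.mapLeft (𝟙 (M.act.op m r)) s) ≫ (M.assoc m r s).hom =
      (M.assoc m r s).hom ≫ 𝟙 (M.act.op m (R.mul.op r s))
    simp [Biadd.mapLeft_id]
  lin_unit m := by
    have h₂ := compat_nat M.unitTrack.nat (negPairing m)
    rw [SCGr.mapPairing_id] at h₂
    have h₁ := (SCGr.negComm_compat (M.act.at' R.one) m).comp h₂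
    exact h₁.unique (SCGr.neg_compat_map (M.unit m).hom) (Category.id_comp _)

/-- The canonical track `F + (-F) ≅ 0`. -/
def addNegIso (F : M ⟶ N) : F ⊗ (F ≫ neg N) ≅ 𝟙_ (M ⟶ N) :=
  isoMk (SCGr.addNegIso F.toHom) (fun m r => by
    have h := (SCGr.neg_compat_map (F.lin m r)).comp
      (SCGr.negComm_compat (N.act.at' r) (F.toHom.functor.obj m))
    have e : F.lin m r ≫ 𝟙 ((N.act.at' r).functor.obj (F.toHom.functor.obj m)) = F.lin m r :=
      Category.comp_id _
    rw [e] at h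
    have h' := congr($h ≫ ε (N.act.at' r).functor)
    simp only [mapPairing, Category.assoc, Functor.Monoidal.η_ε, Category.comp_id] at h'
    exact (Category.assoc _ _ _).trans h')

instance (F : M ⟶ N) : (tensorLeft F).IsEquivalence :=
  isEquivalence_tensorLeft_of_iso (addNegIso F)

end TwoMod

section

variable {𝒞 𝒟 : Type*} [Category 𝒞] [MonoidalCategory 𝒞] [Category 𝒟]
  [MonoidalCategory 𝒟]

open Functor.LaxMonoidal

lemma postcomp_unit (G : 𝒞 ⥤ 𝒟) [G.Monoidal] {X Y : 𝒞} (f : 𝟙_ 𝒞 ⟶ X) (g : 𝟙_ 𝒞 ⟶ Y) :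
    ((λ_ (𝟙_ 𝒟)).inv ≫ (ε G ≫ G.map f ⊗ₘ ε G ≫ G.map g)) ≫ μ G X Y =
      ε G ≫ G.map ((λ_ (𝟙_ 𝒞)).inv ≫ (f ⊗ₘ g)) := by
  have h : (λ_ (𝟙_ 𝒟)).inv ≫ (ε G ⊗ₘ ε G) ≫ μ G _ _ = ε G ≫ G.map (λ_ (𝟙_ 𝒞)).inv := by
    simp [MonoidalCategory.tensorHom_def']
  rw [← tensorHom_comp_tensorHom, Category.assoc, Category.assoc, μ_natural, reassoc_of% h,
    G.map_comp]

lemma postcomp_tensor [SymmetricCategory 𝒞] [SymmetricCategory 𝒟] (G : 𝒞 ⥤ 𝒟) [G.Braided] {X₁ X₂ Y₁ Y₂ Z₁ Z₂ : 𝒞} (f : X₁ ⊗ X₂ ⟶ Z₁)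
    (g : Y₁ ⊗ Y₂ ⟶ Z₂) :
    (tensorμ (G.obj X₁) (G.obj Y₁) (G.obj X₂) (G.obj Y₂) ≫
        (μ G X₁ X₂ ≫ G.map f ⊗ₘ μ G Y₁ Y₂ ≫ G.map g)) ≫ μ G Z₁ Z₂ =
      (μ G X₁ Y₁ ⊗ₘ μ G X₂ Y₂) ≫ μ G (X₁ ⊗ Y₁) (X₂ ⊗ Y₂) ≫
        G.map (tensorμ X₁ Y₁ X₂ Y₂ ≫ (f ⊗ₘ g)) := by
  rw [← tensorHom_comp_tensorHom, Category.assoc, Category.assoc, μ_natural, G.map_comp,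
    reassoc_of% (tensorμ_comp_μ_tensorHom_μ_comp_μ G)]

end

namespace SCGr

open Functor.LaxMonoidal Functor.Monoidal

variable {A B C : SCGr.{u}}

/-- Postcomposition with a morphism preserves pointwise sums. -/
@[reducible]
def postcompBraided (A : SCGr.{u}) (G : B ⟶ C) : (Bicategory.postcomp A G).Braided :=
  let m (F F' : A ⟶ B) : (F ≫ G) ⊗ (F' ≫ G) ≅ (F ⊗ F') ≫ G :=
    mkIso (fun x => μIso G.functor (F.functor.obj x) (F'.functor.obj x))
      (fun f => μ_natural G.functor _ _)
      (postcomp_unit G.functor (ε F.functor) (ε F'.functor))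
      (fun x y => postcomp_tensor G.functor (μ F.functor x y) (μ F'.functor x y))
  let e : 𝟙_ (A ⟶ C) ≅ 𝟙_ (A ⟶ B) ≫ G :=
    mkIso (fun x => εIso G.functor)
      (fun f => (Category.id_comp _).trans
        ((Category.comp_id _).symm.trans congr(_ ≫ $((G.functor.map_id _).symm))))
      ((Category.id_comp _).trans
        ((Category.comp_id _).symm.trans congr(_ ≫ $((G.functor.map_id _).symm))))
      (fun x y => by
        change (λ_ (𝟙_ C)).hom ≫ ε G.functor =
          (ε G.functor ⊗ₘ ε G.functor) ≫ μ G.functor _ _ ≫ G.functor.map (λ_ (𝟙_ B)).hom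
        simp [MonoidalCategory.tensorHom_def'])
  { Functor.CoreMonoidal.toMonoidal
      { εIso := e
        μIso := m
        μIso_hom_natural_left := fun {F F'} s H => track_ext fun x => by
          refine Eq.trans ?_ ((μ_natural_left G.functor (s.nat.app x) (H.functor.obj x)).trans ?_)
          · exact congr($(whiskerRight_nat_app (Bicategory.whiskerRight s G) (H ≫ G) x) ≫ _)
          · exact congr(_ ≫ G.functor.map $((whiskerRight_nat_app s H x).symm))
        μIso_hom_natural_right := fun {F F'} H s => track_ext fun x => by
          refine Eq.trans ?_ ((μ_natural_right G.functor (H.functor.obj x) (s.nat.app x)).trans ?_)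
          · exact congr($(whiskerLeft_nat_app (H ≫ G) (Bicategory.whiskerRight s G) x) ≫ _)
          · exact congr(_ ≫ G.functor.map $((whiskerLeft_nat_app H s x).symm))
        associativity := fun F F' F'' => track_ext fun x => by
          refine Eq.trans ?_ ((associativity G.functor (F.functor.obj x) (F'.functor.obj x)
            (F''.functor.obj x)).trans ?_)
          · exact congr($(whiskerRight_nat_app (m F F').hom (F'' ≫ G) x) ≫ _)
          · exact congr(_ ≫ $((whiskerLeft_nat_app (F ≫ G) (m F' F'').hom x).symm) ≫ _)
        left_unitality := fun F => track_ext fun x => by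
          refine (left_unitality G.functor (F.functor.obj x)).trans ?_
          exact congr($((whiskerRight_nat_app e.hom (F ≫ G) x).symm) ≫ _)
        right_unitality := fun F => track_ext fun x => by
          refine (right_unitality G.functor (F.functor.obj x)).trans ?_
          exact congr($((whiskerLeft_nat_app (F ≫ G) e.hom x).symm) ≫ _) } with
    braided := fun F F' => track_ext fun x => by
      change (m F F').hom.nat.app x ≫ G.functor.map ((β_ F F').hom.nat.app x) =
        (β_ (F ≫ G) (F' ≫ G)).hom.nat.app x ≫ (m F' F).hom.nat.app x
      exact Functor.LaxBraided.braided (F := G.functor) (F.functor.obj x) (F'.functor.obj x) }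

/-- Precomposition with a morphism preserves pointwise sums. -/
@[reducible]
def precompBraided (C : SCGr.{u}) (H : A ⟶ B) : (Bicategory.precomp C H).Braided :=
  let m (F F' : B ⟶ C) : (H ≫ F) ⊗ (H ≫ F') ≅ H ≫ (F ⊗ F') :=
    mkIso (fun x => Iso.refl _)
      (fun f => (Category.comp_id _).trans (Category.id_comp _).symm)
      (by
        change ((λ_ (𝟙_ C)).inv ≫ (ε F.functor ≫ F.functor.map (ε H.functor) ⊗ₘ
          ε F'.functor ≫ F'.functor.map (ε H.functor))) ≫ 𝟙 _ =
          ((λ_ (𝟙_ C)).inv ≫ (ε F.functor ⊗ₘ ε F'.functor)) ≫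
            (F.functor.map (ε H.functor) ⊗ₘ F'.functor.map (ε H.functor))
        rw [Category.comp_id, ← tensorHom_comp_tensorHom, Category.assoc])
      (fun x y => by
        change (tensorμ _ _ _ _ ≫ (μ F.functor _ _ ≫ F.functor.map (μ H.functor x y) ⊗ₘ
          μ F'.functor _ _ ≫ F'.functor.map (μ H.functor x y))) ≫ 𝟙 _ =
          (𝟙 _ ⊗ₘ 𝟙 _) ≫ (tensorμ _ _ _ _ ≫ (μ F.functor _ _ ⊗ₘ μ F'.functor _ _)) ≫
            (F.functor.map (μ H.functor x y) ⊗ₘ F'.functor.map (μ H.functor x y))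
        rw [Category.comp_id, ← tensorHom_comp_tensorHom, Category.assoc, id_tensorHom_id,
          Category.id_comp])
  let e : 𝟙_ (A ⟶ C) ≅ H ≫ 𝟙_ (B ⟶ C) :=
    mkIso (fun x => Iso.refl _)
      (fun f => (Category.comp_id _).trans (Category.id_comp _).symm)
      (by
        change 𝟙 (𝟙_ C) ≫ 𝟙 (𝟙_ C) = 𝟙 (𝟙_ C) ≫ 𝟙 (𝟙_ C)
        rfl)
      (fun x y => by
        change (λ_ (𝟙_ C)).hom ≫ 𝟙 (𝟙_ C) =
          (𝟙 (𝟙_ C) ⊗ₘ 𝟙 (𝟙_ C)) ≫ (λ_ (𝟙_ C)).hom ≫ 𝟙 (𝟙_ C)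
        simp)
  { Functor.CoreMonoidal.toMonoidal
      { εIso := e
        μIso := m
        μIso_hom_natural_left := fun s F => track_ext fun x =>
          (Category.comp_id _).trans (Category.id_comp _).symm
        μIso_hom_natural_right := fun F s => track_ext fun x =>
          (Category.comp_id _).trans (Category.id_comp _).symm
        associativity := fun F F' F'' => track_ext fun x => by
          change (𝟙 _ ⊗ₘ 𝟙 _) ≫ 𝟙 _ ≫ (α_ _ _ _).hom = (α_ _ _ _).hom ≫ (𝟙 _ ⊗ₘ 𝟙 _) ≫ 𝟙 _
          simp
        left_unitality := fun F => track_ext fun x => by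
          change (λ_ _).hom = (𝟙 _ ⊗ₘ 𝟙 _) ≫ 𝟙 _ ≫ (λ_ _).hom
          simp
        right_unitality := fun F => track_ext fun x => by
          change (ρ_ _).hom = (𝟙 _ ⊗ₘ 𝟙 _) ≫ 𝟙 _ ≫ (ρ_ _).hom
          simp } with
    braided := fun F F' => track_ext fun x =>
      (Category.id_comp _).trans (Category.comp_id _).symm }

end SCGr

namespace TwoMod

open Functor.LaxMonoidal

variable {R : TwoRing.{u}} {M N K : TwoMod R}

/-- The linearity constraint of a morphism of right 2-modules as a track. -/
def linTrack (F : M ⟶ N) (r : R.toSCGr) : M.act.at' r ≫ F.toHom ⟶ F.toHom ≫ N.act.at' r :=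
  SCGr.mkTrackOfTensor (fun m => F.lin m r) (fun f => F.lin_nat_left f r)
    (fun x y => (Category.assoc _ _ _).trans (F.lin_add_left x y r))

lemma lin_zero (F : M ⟶ N) (r : R.toSCGr) :
    ε F.toHom.functor ≫ F.toHom.functor.map (M.act.zeroLeft r) ≫ F.lin (𝟙_ M.toSCGr) r =
      N.act.zeroLeft r ≫ N.act.mapLeft (ε F.toHom.functor) r :=
  (Category.assoc _ _ _).symm.trans (linTrack F r).isMonoidal.unit

/-- Postcomposition with a morphism preserves pointwise sums. -/
@[reducible]
def postcompBraided (M : TwoMod R) (G : N ⟶ K) : (Bicategory.postcomp M G).Braided :=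
  letI P := SCGr.postcompBraided M.toSCGr G.toHom
  let m (F F' : M ⟶ N) : (F ≫ G) ⊗ (F' ≫ G) ≅ (F ⊗ F') ≫ G :=
    isoMk (Functor.Monoidal.μIso (Bicategory.postcomp M.toSCGr G.toHom) F.toHom F'.toHom)
      (fun x r => by
        change ((G.toHom.functor.map (F.lin x r) ≫ G.lin (F.toHom.functor.obj x) r ⊗ₘ
            G.toHom.functor.map (F'.lin x r) ≫ G.lin (F'.toHom.functor.obj x) r) ≫
              K.act.addLeft _ _ r) ≫ K.act.mapLeft (μ G.toHom.functor _ _) r =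
          μ G.toHom.functor _ _ ≫ G.toHom.functor.map ((F.lin x r ⊗ₘ F'.lin x r) ≫
            N.act.addLeft _ _ r) ≫ G.lin (F.toHom.functor.obj x ⊗ F'.toHom.functor.obj x) r
        rw [← tensorHom_comp_tensorHom, Category.assoc, Category.assoc, ← G.lin_add_left,
          μ_natural_assoc, Functor.map_comp, Category.assoc])
  let e : 𝟙_ (M ⟶ K) ≅ 𝟙_ (M ⟶ N) ≫ G :=
    isoMk (Functor.Monoidal.εIso (Bicategory.postcomp M.toSCGr G.toHom))
      (fun x r => (lin_zero G r).symm)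
  { Functor.CoreMonoidal.toMonoidal (F := Bicategory.postcomp M G)
      { εIso := e
        μIso := m
        μIso_hom_natural_left := fun {F F'} s F'' => hom_ext
          (P.μ_natural_left (X := F.toHom) (Y := F'.toHom) (Track.track s) F''.toHom)
        μIso_hom_natural_right := fun {F F'} F'' s => hom_ext
          (P.μ_natural_right (X := F.toHom) (Y := F'.toHom) F''.toHom (Track.track s))
        associativity := fun F F' F'' => hom_ext (P.associativity F.toHom F'.toHom F''.toHom)
        left_unitality := fun F => hom_ext (P.left_unitality F.toHom)
        right_unitality := fun F => hom_ext (P.right_unitality F.toHom) } with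
    braided := fun F F' => hom_ext (P.toLaxBraided.braided F.toHom F'.toHom) }

/-- Precomposition with a morphism preserves pointwise sums. -/
@[reducible]
def precompBraided (K : TwoMod R) (H : M ⟶ N) : (Bicategory.precomp K H).Braided :=
  letI P := SCGr.precompBraided K.toSCGr H.toHom
  let m (F F' : N ⟶ K) : (H ≫ F) ⊗ (H ≫ F') ≅ H ≫ (F ⊗ F') :=
    isoMk (Functor.Monoidal.μIso (Bicategory.precomp K.toSCGr H.toHom) F.toHom F'.toHom)
      (fun x r => by
        change ((F.toHom.functor.map (H.lin x r) ≫ F.lin (H.toHom.functor.obj x) r ⊗ₘ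
            F'.toHom.functor.map (H.lin x r) ≫ F'.lin (H.toHom.functor.obj x) r) ≫
              K.act.addLeft _ _ r) ≫ K.act.mapLeft (𝟙 _) r =
          𝟙 _ ≫ (F.toHom.functor.map (H.lin x r) ⊗ₘ F'.toHom.functor.map (H.lin x r)) ≫
            (F.lin (H.toHom.functor.obj x) r ⊗ₘ F'.lin (H.toHom.functor.obj x) r) ≫
              K.act.addLeft _ _ r
        rw [← tensorHom_comp_tensorHom, Category.assoc, Category.assoc, Biadd.mapLeft_id,
          Category.id_comp, Category.comp_id])
  let e : 𝟙_ (M ⟶ K) ≅ H ≫ 𝟙_ (N ⟶ K) :=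
    isoMk (Functor.Monoidal.εIso (Bicategory.precomp K.toSCGr H.toHom))
      (fun x r => by
        change K.act.zeroLeft r ≫ K.act.mapLeft (𝟙 _) r = 𝟙 _ ≫ 𝟙 _ ≫ K.act.zeroLeft r
        rw [Biadd.mapLeft_id, Category.comp_id, Category.id_comp, Category.id_comp])
  { Functor.CoreMonoidal.toMonoidal (F := Bicategory.precomp K H)
      { εIso := e
        μIso := m
        μIso_hom_natural_left := fun {F F'} s F'' => hom_ext
          (P.μ_natural_left (X := F.toHom) (Y := F'.toHom) (Track.track s) F''.toHom)
        μIso_hom_natural_right := fun {F F'} F'' s => hom_ext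
          (P.μ_natural_right (X := F.toHom) (Y := F'.toHom) F''.toHom (Track.track s))
        associativity := fun F F' F'' => hom_ext (P.associativity F.toHom F'.toHom F''.toHom)
        left_unitality := fun F => hom_ext (P.left_unitality F.toHom)
        right_unitality := fun F => hom_ext (P.right_unitality F.toHom) } with
    braided := fun F F' => hom_ext (P.toLaxBraided.braided F.toHom F'.toHom) }

end TwoMod

/-- The structure shared by the 2-categories considered here: the groupoids of morphisms are
symmetric categorical groups, and precomposition and postcomposition with a morphism are symmetric
monoidal functors between them. -/
class HomSCGr (C : Type (u + 1)) [Bicategory.{u, u} C] where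
  isGroupoid (A B : C) : IsGroupoid (A ⟶ B)
  monoidal (A B : C) : MonoidalCategory (A ⟶ B)
  symmetric (A B : C) : SymmetricCategory (A ⟶ B)
  isEquivalence_tensorLeft (A B : C) (f : A ⟶ B) : (tensorLeft f).IsEquivalence
  postcompBraided (X : C) {A B : C} (f : A ⟶ B) : (Bicategory.postcomp X f).Braided
  precompBraided (X : C) {A B : C} (f : A ⟶ B) : (Bicategory.precomp X f).Braided

/-- The 2-category of symmetric categorical groups, with pointwise addition of morphisms. -/
instance : HomSCGr SCGr.{u} where
  isGroupoid _ _ := inferInstance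
  monoidal := SCGr.homMonoidal
  symmetric := SCGr.homSymmetric
  isEquivalence_tensorLeft _ _ _ := inferInstance
  postcompBraided X _ _ f := SCGr.postcompBraided X f
  precompBraided X _ _ f := SCGr.precompBraided X f

/-- The 2-category of right 2-modules over a 2-ring, with pointwise addition of morphisms. -/
instance (R : TwoRing.{u}) : HomSCGr (TwoMod R) where
  isGroupoid _ _ := inferInstance
  monoidal := TwoMod.homMonoidal
  symmetric := TwoMod.homSymmetric
  isEquivalence_tensorLeft _ _ _ := inferInstance
  postcompBraided X _ _ f := TwoMod.postcompBraided X f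
  precompBraided X _ _ f := TwoMod.precompBraided X f

attribute [instance] HomSCGr.isGroupoid

attribute [reducible, instance] HomSCGr.monoidal HomSCGr.symmetric
  HomSCGr.postcompBraided HomSCGr.precompBraided

section

variable {C : Type (u + 1)} [Bicategory.{u, u} C]

/-- A morphism `f : A ⟶ B` is cofaithful if precomposition with `f`, from the groupoid of morphisms
`B ⟶ X` to the groupoid of morphisms `A ⟶ X`, is faithful for every object `X`. -/
def Cofaithful {A B : C} (f : A ⟶ B) : Prop :=
  ∀ X : C, (Bicategory.precomp X f).Faithful

/-- An object `P` is projective if postcomposition with any cofaithful morphism `A ⟶ B` induces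
a surjection from the set of connected components of the groupoid of morphisms `P ⟶ A` to that of
the groupoid of morphisms `P ⟶ B`. -/
def IsProjective (P : C) : Prop :=
  ∀ {A B : C} (f : A ⟶ B), Cofaithful f →
    Function.Surjective (Bicategory.postcomp P f).mapConnectedComponents

variable (C) in
/-- Every object receives a cofaithful morphism from a projective object. -/
def HasEnoughProjectives : Prop :=
  ∀ A : C, ∃ (P : C) (f : P ⟶ A), IsProjective P ∧ Cofaithful f

/-- A family of morphisms `A i ⟶ Q` is a coproduct if, for every object `X`, restriction along the
family is an equivalence from the groupoid of morphisms `Q ⟶ X` to the product of the groupoids of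
morphisms `A i ⟶ X`. -/
def IsCoproduct {I : Type u} {A : I → C} {Q : C} (ι : ∀ i, A i ⟶ Q) : Prop :=
  ∀ X : C, (Functor.pi' fun i => Bicategory.precomp X (ι i)).IsEquivalence

/-- The object `Q` is a coproduct of copies of `G`. -/
def IsCoproductOfCopies (G Q : C) : Prop :=
  ∃ (I : Type u) (ι : I → (G ⟶ Q)), IsCoproduct ι

variable [HomSCGr C]

/-- The symmetric categorical group of morphisms from `A` to `B`. -/
def homObj (A B : C) : SCGr.{u} where
  carrier := A ⟶ B
  isEquivalence_tensorLeft := HomSCGr.isEquivalence_tensorLeft A B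

/-- The morphism of symmetric categorical groups given by postcomposition with `f`. -/
def homMap (X : C) {A B : C} (f : A ⟶ B) : homObj X A ⟶ homObj X B :=
  SCGr.Hom.mk (A := homObj X A) (B := homObj X B) (Bicategory.postcomp X f)
    (braided := HomSCGr.postcompBraided X f)

/-- An object `S` is small if the 2-functor of morphisms out of `S`, with values in symmetric
categorical groups, preserves coproducts. -/
def IsSmall (S : C) : Prop :=
  ∀ {I : Type u} {A : I → C} {Q : C} (ι : ∀ i, A i ⟶ Q),
    IsCoproduct ι → IsCoproduct fun i => homMap S (ι i)

/-- The canonical track `0 ≫ f ⟶ 0`. -/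
def zeroComp (X : C) {A B : C} (f : A ⟶ B) : 𝟙_ (X ⟶ A) ≫ f ⟶ 𝟙_ (X ⟶ B) :=
  Functor.OplaxMonoidal.η (Bicategory.postcomp X f)

/-- The canonical track `f ≫ 0 ⟶ 0`. -/
def compZero (X : C) {A B : C} (f : A ⟶ B) : f ≫ 𝟙_ (B ⟶ X) ⟶ 𝟙_ (A ⟶ X) :=
  Functor.OplaxMonoidal.η (Bicategory.precomp X f)

section

variable {A B D : C} {f : A ⟶ B} {g : B ⟶ D}

open Bicategory in
/-- Given `f : A ⟶ B`, `g : B ⟶ D` and `α : f ≫ g ⟶ 0`, a track `η : g ≫ h ⟶ 0` is compatible with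
`α` if the two resulting tracks `f ≫ g ≫ h ⟶ 0` coincide. -/
def IsNullCompatible (α : f ≫ g ⟶ 𝟙_ (A ⟶ D)) {X : C} {h : D ⟶ X}
    (η : g ≫ h ⟶ 𝟙_ (B ⟶ X)) : Prop :=
  whiskerRight α h ≫ zeroComp A h = (associator f g h).hom ≫ whiskerLeft f η ≫ compZero X f

open Bicategory in
/-- The track `g ≫ q ≫ k ⟶ 0` induced by `ζ : g ≫ q ⟶ 0`. -/
def nullComp {Q X : C} {q : D ⟶ Q} (ζ : g ≫ q ⟶ 𝟙_ (B ⟶ Q)) (k : Q ⟶ X) :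
    g ≫ q ≫ k ⟶ 𝟙_ (B ⟶ X) :=
  (associator g q k).inv ≫ whiskerRight ζ k ≫ zeroComp B k

open Bicategory in
/-- The pair `(q, ζ)` is the relative cokernel of the diagram formed by `f : A ⟶ B`, `g : B ⟶ D` and
`α : f ≫ g ⟶ 0`: it is the universal pair consisting of a morphism `h : D ⟶ X` and a track
`g ≫ h ⟶ 0` compatible with `α`. That is, for every object `X`, composition with `(q, ζ)` is fully
faithful and essentially surjective from the groupoid of morphisms `Q ⟶ X` to the groupoid of such
pairs. -/
structure IsRelativeCokernel (α : f ≫ g ⟶ 𝟙_ (A ⟶ D)) {Q : C} (q : D ⟶ Q)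
    (ζ : g ≫ q ⟶ 𝟙_ (B ⟶ Q)) : Prop where
  compatible : IsNullCompatible α ζ
  exists_fac : ∀ {X : C} (h : D ⟶ X) (η : g ≫ h ⟶ 𝟙_ (B ⟶ X)), IsNullCompatible α η →
    ∃ (k : Q ⟶ X) (t : q ≫ k ⟶ h), nullComp ζ k = whiskerLeft g t ≫ η
  existsUnique_track : ∀ {X : C} (k k' : Q ⟶ X) (t : q ≫ k ⟶ q ≫ k'),
    nullComp ζ k = whiskerLeft g t ≫ nullComp ζ k' → ∃! s : k ⟶ k', whiskerLeft q s = t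

end

/-- An object `G` is a generator if every object is the relative cokernel of a diagram of
coproducts of copies of `G`. -/
def IsGenerator (G : C) : Prop :=
  ∀ S : C, ∃ (A B D : C) (f : A ⟶ B) (g : B ⟶ D) (α : f ≫ g ⟶ 𝟙_ (A ⟶ D))
    (q : D ⟶ S) (ζ : g ≫ q ⟶ 𝟙_ (B ⟶ S)),
    IsCoproductOfCopies G A ∧ IsCoproductOfCopies G B ∧ IsCoproductOfCopies G D ∧
      IsRelativeCokernel α q ζ

end

/-- The objects of the symmetric categorical group `Φ`: the integers. -/
@[ext]
structure PhiObj : Type u where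
  deg : ℤ

/-- Morphisms of `Φ`: there are none between different integers, and the automorphisms of an integer
`n` form a cyclic group of order two, written `ZMod 2`. -/
@[ext]
structure PhiHom (n m : PhiObj.{u}) : Type u where
  deg_eq : n.deg = m.deg
  sgn : ZMod 2

namespace PhiObj

instance : Category.{u} PhiObj.{u} where
  Hom := PhiHom
  id _ := ⟨rfl, 0⟩
  comp f g := ⟨f.deg_eq.trans g.deg_eq, f.sgn + g.sgn⟩
  id_comp _ := PhiHom.ext (zero_add _)
  comp_id _ := PhiHom.ext (add_zero _)
  assoc _ _ _ := PhiHom.ext (add_assoc _ _ _)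

variable {n m k l : PhiObj.{u}}

lemma hom_ext {f g : n ⟶ m} (h : f.sgn = g.sgn) : f = g := PhiHom.ext h

@[simp] lemma id_sgn : PhiHom.sgn (𝟙 n) = 0 := rfl
@[simp] lemma comp_sgn (f : n ⟶ m) (g : m ⟶ k) : (f ≫ g).sgn = f.sgn + g.sgn := rfl

/-- Every element of `ZMod 2` gives an isomorphism between equal integers. -/
@[simps]
def isoMk (h : n.deg = m.deg) (a : ZMod 2) : n ≅ m where
  hom := ⟨h, a⟩
  inv := ⟨h.symm, -a⟩
  hom_inv_id := hom_ext (add_neg_cancel a)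
  inv_hom_id := hom_ext (neg_add_cancel a)

instance : IsGroupoid PhiObj.{u} where
  all_isIso f := (isoMk f.deg_eq f.sgn).isIso_hom

instance : MonoidalCategoryStruct PhiObj.{u} where
  tensorObj n m := ⟨n.deg + m.deg⟩
  tensorUnit := ⟨0⟩
  tensorHom f g := ⟨congrArg₂ (· + ·) f.deg_eq g.deg_eq, f.sgn + g.sgn⟩
  whiskerLeft n _ _ g := ⟨congrArg (n.deg + ·) g.deg_eq, g.sgn⟩
  whiskerRight f m := ⟨congrArg (· + m.deg) f.deg_eq, f.sgn⟩
  associator n m k := isoMk (add_assoc n.deg m.deg k.deg) 0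
  leftUnitor n := isoMk (zero_add n.deg) 0
  rightUnitor n := isoMk (add_zero n.deg) 0

@[simp] lemma tensorHom_sgn (f : n ⟶ m) (g : k ⟶ l) : (f ⊗ₘ g).sgn = f.sgn + g.sgn := rfl
@[simp] lemma whiskerLeft_sgn (g : k ⟶ l) : (n ◁ g).sgn = g.sgn := rfl
@[simp] lemma whiskerRight_sgn (f : n ⟶ m) : (f ▷ k).sgn = f.sgn := rfl
@[simp] lemma associator_sgn : (α_ n m k).hom.sgn = 0 := rfl
@[simp] lemma associator_inv_sgn : (α_ n m k).inv.sgn = 0 := neg_zero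
@[simp] lemma leftUnitor_sgn : (λ_ n).hom.sgn = 0 := rfl
@[simp] lemma rightUnitor_sgn : (ρ_ n).hom.sgn = 0 := rfl

instance : MonoidalCategory PhiObj.{u} :=
  MonoidalCategory.ofTensorHom
    (id_tensorHom_id := fun _ _ => hom_ext (by simp))
    (id_tensorHom := fun _ _ _ _ => hom_ext (by simp))
    (tensorHom_id := fun _ _ => hom_ext (by simp))
    (tensorHom_comp_tensorHom := fun _ _ _ _ => hom_ext (by simp only [tensorHom_sgn, comp_sgn]; ring))
    (associator_naturality := fun _ _ _ => hom_ext (by simp [add_assoc]))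
    (leftUnitor_naturality := fun _ => hom_ext (by simp))
    (rightUnitor_naturality := fun _ => hom_ext (by simp))
    (pentagon := fun _ _ _ _ => hom_ext (by simp))
    (triangle := fun _ _ => hom_ext (by simp))

/-- The braiding `n + m ⟶ m + n` is the `n * m`-th multiple of the nontrivial automorphism. -/
instance : BraidedCategory PhiObj.{u} where
  braiding n m := isoMk (add_comm n.deg m.deg) (n.deg * m.deg : ℤ)
  braiding_naturality_right _ _ _ f := hom_ext (by simp [add_comm, f.deg_eq])
  braiding_naturality_left f _ := hom_ext (by simp [add_comm, f.deg_eq])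
  hexagon_forward n m k := hom_ext (by
    change 0 + (((n.deg * (m.deg + k.deg) : ℤ) : ZMod 2) + 0) =
      ((n.deg * m.deg : ℤ) : ZMod 2) + (0 + ((n.deg * k.deg : ℤ) : ZMod 2))
    push_cast; ring)
  hexagon_reverse n m k := hom_ext (by
    change -0 + ((((n.deg + m.deg) * k.deg : ℤ) : ZMod 2) + -0) =
      ((m.deg * k.deg : ℤ) : ZMod 2) + (-0 + ((n.deg * k.deg : ℤ) : ZMod 2))
    push_cast; ring)

instance : SymmetricCategory PhiObj.{u} where
  symmetry n m := hom_ext (by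
    change ((n.deg * m.deg : ℤ) : ZMod 2) + ((m.deg * n.deg : ℤ) : ZMod 2) = 0
    rw [mul_comm]
    exact CharTwo.add_self_eq_zero _)

end PhiObj

/-- The symmetric categorical group `Φ`. -/
def Phi : SCGr.{u} where
  carrier := PhiObj.{u}
  isEquivalence_tensorLeft n := isEquivalence_tensorLeft_of_iso
    (PhiObj.isoMk (n := n ⊗ ⟨-n.deg⟩) (m := 𝟙_ _) (add_neg_cancel n.deg) 0)

end

/-! Everything rests on one notion: an object is free on a family of points when morphisms out of
it, together with their tracks, are the same as families of points of the target (`IsFree`). In both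
2-categories a morphism is cofaithful exactly when it is surjective on isomorphism classes of
objects (`cofaithful_iff`). One direction is naturality of tracks. For the other, the cokernel on
isomorphism classes becomes the automorphism group of a one-object test object, where the projection
and zero give two tracks that the morphism cannot separate. Points lift along such morphisms up to
isomorphism, so free objects are projective, and the free object on all points of A maps
cofaithfully to A.

Free objects on sets are built syntactically: formal expressions as objects, formal arrows as
arrows, two formal arrows being identified when all their evaluations agree. The regular 2-module is
free on 1. That Φ is free on 1 is a coherence statement. The multiples of an object x form a
two-sided sequence generated by adding x. Their additivity constraint is symmetric up to the nm-th
power of the sign of x, which is the symmetry of x + x regarded as an automorphism of 0. This yields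
a morphism from Φ for every x. For the free object on one generator it is an equivalence, because
the sign of the generator is nontrivial.

For generation, S is resolved by three free objects: D on the objects of S, B on the arrows q(d) →
0, and A on the arrows g(b) → 0 that q makes trivial. `IsExact` records the outcome, and descent
shows that it suffices. A pair (h, η) prescribes the extension of h to arrows q(d) → 0, then by
translation to all arrows between values of q, and so a morphism on S. For 2-modules the underlying
morphism is built first and its linearity constraint descends afterwards.

For smallness, evaluation at the generator identifies morphisms out of Φ with the identity
2-functor, and morphisms out of R with the forgetful 2-functor. The latter preserves coproducts
because coinduction, X ↦ Hom(R, X), plays the role of a right adjoint.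

A projective P is a retract of a free object, so its group of isomorphism classes embeds in a free
abelian group and is itself free. A basis J gives v : free J → P that is bijective on isomorphism
classes. Being cofaithful, v has a section w. The other composite is isomorphic to the identity on
generators, hence as a morphism. Automorphism groups never have to be compared. -/

noncomputable section

/-! ### Symmetric monoidal functors from additivity constraints alone -/

namespace SCGr

open Functor.LaxMonoidal Functor.OplaxMonoidal

/-- A morphism of symmetric categorical groups from a functor with additivity constraints. The
constraint for the neutral object is determined by the others. -/
def mkHom {A B : SCGr.{u}} (F : A ⥤ B) (m : ∀ x y, F.obj x ⊗ F.obj y ⟶ F.obj (x ⊗ y))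
    (nat : ∀ {x x' y y' : A} (f : x ⟶ x') (g : y ⟶ y'),
      (F.map f ⊗ₘ F.map g) ≫ m x' y' = m x y ≫ F.map (f ⊗ₘ g))
    (assoc : ∀ x y z, m x y ▷ F.obj z ≫ m (x ⊗ y) z ≫ F.map (α_ x y z).hom =
      (α_ _ _ _).hom ≫ F.obj x ◁ m y z ≫ m x (y ⊗ z))
    (braid : ∀ x y, m x y ≫ F.map (β_ x y).hom = (β_ _ _).hom ≫ m y x) : A ⟶ B :=
  -- The only arrow that makes right unitality true at the object zero. It exists because adding
  -- F(0) is fully faithful.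
  let e : 𝟙_ B ⟶ F.obj (𝟙_ A) := (tensorLeft (F.obj (𝟙_ A))).preimage
    ((ρ_ _).hom ≫ inv (m (𝟙_ A) (𝟙_ A) ≫ F.map (ρ_ (𝟙_ A)).hom))
  have he : F.obj (𝟙_ A) ◁ e = (ρ_ _).hom ≫ inv (m (𝟙_ A) (𝟙_ A) ≫ F.map (ρ_ (𝟙_ A)).hom) :=
    (tensorLeft (F.obj (𝟙_ A))).map_preimage _
  -- Right unitality spreads from 0 to x: associativity at (x, 0, 0) expresses the constraint at x,
  -- tensored with F(0), through the constraint at 0. Inserting `e` in the last factor then leaves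
  -- the law at x.
  have right (x : A) : F.obj x ◁ e ≫ m x (𝟙_ A) ≫ F.map (ρ_ x).hom = (ρ_ _).hom := by
    have h := congr($(assoc x (𝟙_ A) (𝟙_ A)) ≫ F.map (x ◁ (ρ_ (𝟙_ A)).hom))
    simp only [Category.assoc, ← F.map_comp] at h
    have h₁ : (α_ x (𝟙_ A) (𝟙_ A)).hom ≫ x ◁ (ρ_ (𝟙_ A)).hom = (ρ_ x).hom ▷ 𝟙_ A := by monoidal
    have n₁ := nat (ρ_ x).hom (𝟙 (𝟙_ A))
    have n₂ := nat (𝟙 x) (ρ_ (𝟙_ A)).hom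
    simp only [F.map_id, tensorHom_id, id_tensorHom] at n₁ n₂
    rw [h₁, ← n₁, ← n₂] at h
    simp only [← Category.assoc, cancel_mono] at h
    have h' : F.obj (𝟙_ A) ◁ e ≫ m (𝟙_ A) (𝟙_ A) ≫ F.map (ρ_ (𝟙_ A)).hom = (ρ_ _).hom := by
      rw [he, Category.assoc, IsIso.inv_hom_id, Category.comp_id]
    set r := m x (𝟙_ A) ≫ F.map (ρ_ x).hom with hr
    set r' := m (𝟙_ A) (𝟙_ A) ≫ F.map (ρ_ (𝟙_ A)).hom
    have h₂ : r ▷ F.obj (𝟙_ A) = (α_ _ _ _).hom ≫ F.obj x ◁ r' := by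
      simpa [r, r'] using h
    have h₃ := congr((F.obj x ⊗ F.obj (𝟙_ A)) ◁ e ≫ $h₂)
    rw [whisker_exchange, tensor_whiskerLeft, Category.assoc, Category.assoc,
      Iso.inv_hom_id_assoc, ← MonoidalCategory.whiskerLeft_comp, h', ← rightUnitor_tensor_hom] at h₃
    rw [← cancel_epi (r ▷ 𝟙_ B), reassoc_of% h₃, rightUnitor_naturality]
  -- Left unitality is right unitality conjugated by the symmetry.
  have left (x : A) : e ▷ F.obj x ≫ m (𝟙_ A) x ≫ F.map (λ_ x).hom = (λ_ _).hom := by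
    rw [← cancel_epi (β_ (F.obj x) (𝟙_ B)).hom, braiding_leftUnitor, ← right x,
      ← BraidedCategory.braiding_naturality_right_assoc, ← reassoc_of% (braid x (𝟙_ A)),
      ← F.map_comp, braiding_leftUnitor]
  { functor := F
    braided :=
      { Functor.CoreMonoidal.toMonoidal (F := F)
          { εIso := asIso e
            μIso := fun x y => asIso (m x y)
            μIso_hom_natural_left := fun f z => by simpa using nat f (𝟙 z)
            μIso_hom_natural_right := fun z f => by simpa using nat (𝟙 z) f
            associativity := assoc
            left_unitality := fun x => (left x).symm
            right_unitality := fun x => (right x).symm } with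
        braided := braid } }

section

variable {A B : SCGr.{u}} (F : A ⥤ B) (m : ∀ x y, F.obj x ⊗ F.obj y ⟶ F.obj (x ⊗ y))
  (nat : ∀ {x x' y y' : A} (f : x ⟶ x') (g : y ⟶ y'),
    (F.map f ⊗ₘ F.map g) ≫ m x' y' = m x y ≫ F.map (f ⊗ₘ g))
  (assoc : ∀ x y z, m x y ▷ F.obj z ≫ m (x ⊗ y) z ≫ F.map (α_ x y z).hom =
    (α_ _ _ _).hom ≫ F.obj x ◁ m y z ≫ m x (y ⊗ z))
  (braid : ∀ x y, m x y ≫ F.map (β_ x y).hom = (β_ _ _).hom ≫ m y x)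

end

/-! ### Isomorphism classes and cofaithful morphisms of symmetric categorical groups -/

/-- The isomorphism classes of objects of a symmetric categorical group. -/
def Pi0 (A : SCGr.{u}) : Type u := Quotient (isIsomorphicSetoid A)

namespace Pi0

/-- The class of an object. -/
def mk {A : SCGr.{u}} (x : A) : Pi0 A := Quotient.mk _ x

variable {A B C : SCGr.{u}}

lemma mk_eq_iff {x y : A} : mk x = mk y ↔ Nonempty (x ⟶ y) :=
  Quotient.eq.trans ⟨fun ⟨e⟩ => ⟨e.hom⟩, fun ⟨f⟩ => ⟨asIso f⟩⟩

lemma mk_eq {x y : A} (f : x ⟶ y) : mk x = mk y := mk_eq_iff.2 ⟨f⟩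

lemma exists_rep (a : Pi0 A) : ∃ x : A, mk x = a := Quotient.exists_rep a

instance : Zero (Pi0 A) := ⟨mk (𝟙_ A)⟩

instance : Add (Pi0 A) :=
  ⟨Quotient.map₂ (fun x y => x ⊗ y) fun _ _ ⟨e⟩ _ _ ⟨e'⟩ => ⟨tensorIso e e'⟩⟩

instance : Neg (Pi0 A) :=
  ⟨Quotient.map (fun x => (neg A).functor.obj x) fun _ _ ⟨e⟩ => ⟨(neg A).functor.mapIso e⟩⟩

instance : AddCommGroup (Pi0 A) where
  add_assoc := by
    rintro ⟨x⟩ ⟨y⟩ ⟨z⟩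
    exact mk_eq (α_ x y z).hom
  zero_add := by
    rintro ⟨x⟩
    exact mk_eq (λ_ x).hom
  add_zero := by
    rintro ⟨x⟩
    exact mk_eq (ρ_ x).hom
  add_comm := by
    rintro ⟨x⟩ ⟨y⟩
    exact mk_eq (β_ x y).hom
  neg_add_cancel := by
    rintro ⟨x⟩
    exact mk_eq ((β_ (negObj x) x).hom ≫ negPairing x)
  nsmul := nsmulRec
  zsmul := zsmulRec

/-- The homomorphism induced by a morphism on isomorphism classes. -/
def map (F : A ⟶ B) : Pi0 A →+ Pi0 B :=
  AddMonoidHom.mk' (Quotient.map F.functor.obj fun _ _ ⟨e⟩ => ⟨F.functor.mapIso e⟩) (by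
    rintro ⟨x⟩ ⟨y⟩
    exact (mk_eq (μ F.functor x y)).symm)

lemma map_eq {F G : A ⟶ B} (t : F ⟶ G) : map F = map G := by
  ext a
  obtain ⟨x, rfl⟩ := exists_rep a
  exact mk_eq (t.nat.app x)

end Pi0

/-- The unique object of the symmetric categorical group with one object and given automorphism
group. -/
inductive SuspObj (K : Type u) : Type u
  | pt

namespace SuspObj

variable {K : Type u} [AddCommGroup K]

instance : Category.{u} (SuspObj K) where
  Hom _ _ := K
  id _ := 0
  comp f g := (f + g : K)
  id_comp f := zero_add (f : K)
  comp_id f := add_zero (f : K)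
  assoc f g h := add_assoc (f : K) g h

/-- The isomorphism given by an element of the group. -/
def iso (x y : SuspObj K) (k : K) : x ≅ y where
  hom := k
  inv := (-k : K)
  hom_inv_id := add_neg_cancel k
  inv_hom_id := neg_add_cancel k

instance : IsGroupoid (SuspObj K) where
  all_isIso f := (iso _ _ f).isIso_hom

instance : MonoidalCategoryStruct (SuspObj K) where
  tensorObj _ _ := pt
  tensorUnit := pt
  tensorHom f g := (f + g : K)
  whiskerLeft _ _ _ g := g
  whiskerRight f _ := f
  associator _ _ _ := iso _ _ 0
  leftUnitor _ := iso _ _ 0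
  rightUnitor _ := iso _ _ 0

instance : MonoidalCategory (SuspObj K) :=
  MonoidalCategory.ofTensorHom
    (id_tensorHom_id := fun _ _ => add_zero (0 : K))
    (id_tensorHom := fun _ _ _ f => zero_add (f : K))
    (tensorHom_id := fun f _ => add_zero (f : K))
    (tensorHom_comp_tensorHom := fun f g h k => add_add_add_comm (f : K) g h k)
    (associator_naturality := fun f g h => by
      change ((f + g : K) + h) + 0 = 0 + ((f : K) + (g + h))
      abel)
    (leftUnitor_naturality := fun f => by
      change (0 + f : K) + 0 = 0 + f
      abel)
    (rightUnitor_naturality := fun f => by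
      change (f + 0 : K) + 0 = 0 + f
      abel)
    (pentagon := fun _ _ _ _ => by
      change (0 + 0 : K) + (0 + (0 + 0)) = 0 + 0
      abel)
    (triangle := fun _ _ => by
      change (0 : K) + (0 + 0) = 0 + 0
      abel)

instance : BraidedCategory (SuspObj K) where
  braiding _ _ := iso _ _ 0
  braiding_naturality_right _ _ _ f := by
    change (f : K) + 0 = 0 + f
    abel
  braiding_naturality_left f _ := by
    change (f : K) + 0 = 0 + f
    abel
  hexagon_forward _ _ _ := by
    change (0 : K) + (0 + 0) = 0 + (0 + 0)
    rfl
  hexagon_reverse _ _ _ := by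
    change (-0 : K) + (0 + -0) = 0 + (-0 + 0)
    abel

instance : SymmetricCategory (SuspObj K) where
  symmetry _ _ := add_zero (0 : K)

end SuspObj

/-- The symmetric categorical group with one object whose automorphism group is `K`. -/
def susp (K : Type u) [AddCommGroup K] : SCGr.{u} where
  carrier := SuspObj K
  isEquivalence_tensorLeft _ := isEquivalence_tensorLeft_of_iso (y := .pt) (Iso.refl _)

/-- An additive invariant of objects with values in `K` gives an automorphism of the zero morphism
to `susp K`. -/
def suspTrack {B : SCGr.{u}} {K : Type u} [AddCommGroup K] (c : Pi0 B →+ K) :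
    𝟙_ (B ⟶ susp K) ⟶ 𝟙_ (B ⟶ susp K) :=
  mkTrackOfTensor (fun x => c (Pi0.mk x))
    (fun {x y} f => by
      change (0 : K) + c (Pi0.mk y) = c (Pi0.mk x) + 0
      rw [Pi0.mk_eq f, add_comm])
    (fun x y => by
      change (0 : K) + c (Pi0.mk x + Pi0.mk y) = c (Pi0.mk x) + c (Pi0.mk y) + 0
      rw [map_add, add_comm])

/-- A morphism is essentially surjective when every object of the target is isomorphic to a
value. -/
lemma surjective_of_quotient {A B : SCGr.{u}} (f : A ⟶ B)
    (h : QuotientAddGroup.mk' (Pi0.map f).range = 0) : Function.Surjective (Pi0.map f) := by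
  rw [← AddMonoidHom.range_eq_top]
  rw [← QuotientAddGroup.ker_mk' (Pi0.map f).range, h]
  ext; simp

/-- The test object is `susp` of the cokernel of `Pi0.map f`. The projection and the zero
homomorphism give two automorphisms of the zero morphism from B; they agree on values of f, so
faithfulness makes them equal and the cokernel vanishes. -/
lemma surjective_of_cofaithful {A B : SCGr.{u}} {f : A ⟶ B} (hf : Cofaithful f) :
    Function.Surjective (Pi0.map f) := by
  refine surjective_of_quotient f ?_
  have := hf (susp (Pi0 B ⧸ (Pi0.map f).range))
  have h : suspTrack (QuotientAddGroup.mk' (Pi0.map f).range) =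
      suspTrack (0 : Pi0 B →+ Pi0 B ⧸ (Pi0.map f).range) := by
    apply (Bicategory.precomp (susp (Pi0 B ⧸ (Pi0.map f).range)) f).map_injective
    refine track_ext fun x => ?_
    exact (QuotientAddGroup.eq_zero_iff _).2 ⟨Pi0.mk x, rfl⟩
  ext b
  obtain ⟨x, rfl⟩ := Pi0.exists_rep b
  exact congr(($h).nat.app x)

/-- Precomposition with an essentially surjective morphism is faithful. -/
lemma track_ext_of_surjective {A B X : SCGr.{u}} {f : A ⟶ B}
    (hf : Function.Surjective (Pi0.map f)) {k k' : B ⟶ X} {s t : k ⟶ k'}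
    (h : ∀ a, s.nat.app (f.functor.obj a) = t.nat.app (f.functor.obj a)) : s = t := by
  refine track_ext fun b => ?_
  obtain ⟨a, ha⟩ := hf (Pi0.mk b)
  obtain ⟨a, rfl⟩ := Pi0.exists_rep a
  obtain ⟨e⟩ := Pi0.mk_eq_iff.1 ha
  rw [← cancel_epi (k.functor.map e), s.nat.naturality, t.nat.naturality, h]

/-- The converse direction is naturality alone: the components of a track are determined by those at
one representative of each isomorphism class. -/
lemma cofaithful_iff {A B : SCGr.{u}} {f : A ⟶ B} :
    Cofaithful f ↔ Function.Surjective (Pi0.map f) :=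
  ⟨surjective_of_cofaithful, fun hf _ => ⟨fun h => track_ext_of_surjective hf fun a =>
    congr(($h).nat.app a)⟩⟩

end SCGr


/-! ### Biadditive functors from components; cofaithful morphisms of 2-modules -/

/-- The data of a biadditive functor `M × R → N`. The constraints for the neutral objects are
determined by the others. -/
structure BiaddCore (M R N : SCGr.{u}) where
  op : M → R → N
  mapLeft {m n : M} (f : m ⟶ n) (r : R) : op m r ⟶ op n r
  mapRight (m : M) {r s : R} (g : r ⟶ s) : op m r ⟶ op m s
  addLeft (m n : M) (r : R) : op m r ⊗ op n r ⟶ op (m ⊗ n) r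
  addRight (m : M) (r s : R) : op m r ⊗ op m s ⟶ op m (r ⊗ s)
  mapLeft_id (m : M) (r : R) : mapLeft (𝟙 m) r = 𝟙 _
  mapLeft_comp {m n k : M} (f : m ⟶ n) (g : n ⟶ k) (r : R) :
    mapLeft (f ≫ g) r = mapLeft f r ≫ mapLeft g r
  mapRight_id (m : M) (r : R) : mapRight m (𝟙 r) = 𝟙 _
  mapRight_comp (m : M) {r s t : R} (f : r ⟶ s) (g : s ⟶ t) :
    mapRight m (f ≫ g) = mapRight m f ≫ mapRight m g
  mapLeft_mapRight {m n : M} (f : m ⟶ n) {r s : R} (g : r ⟶ s) :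
    mapLeft f r ≫ mapRight n g = mapRight m g ≫ mapLeft f s
  addLeft_nat {m m' n n' : M} (f : m ⟶ m') (g : n ⟶ n') (r : R) :
    (mapLeft f r ⊗ₘ mapLeft g r) ≫ addLeft m' n' r = addLeft m n r ≫ mapLeft (f ⊗ₘ g) r
  addLeft_assoc (m n k : M) (r : R) :
    (addLeft m n r ▷ op k r) ≫ addLeft (m ⊗ n) k r ≫ mapLeft (α_ m n k).hom r =
      (α_ _ _ _).hom ≫ (op m r ◁ addLeft n k r) ≫ addLeft m (n ⊗ k) r
  addLeft_braiding (m n : M) (r : R) :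
    addLeft m n r ≫ mapLeft (β_ m n).hom r = (β_ _ _).hom ≫ addLeft n m r
  addLeft_mapRight (m n : M) {r s : R} (g : r ⟶ s) :
    addLeft m n r ≫ mapRight (m ⊗ n) g = (mapRight m g ⊗ₘ mapRight n g) ≫ addLeft m n s
  addRight_nat_left {m n : M} (f : m ⟶ n) (r s : R) :
    (mapLeft f r ⊗ₘ mapLeft f s) ≫ addRight n r s = addRight m r s ≫ mapLeft f (r ⊗ s)
  addRight_nat (m : M) {r r' s s' : R} (f : r ⟶ r') (g : s ⟶ s') :
    (mapRight m f ⊗ₘ mapRight m g) ≫ addRight m r' s' = addRight m r s ≫ mapRight m (f ⊗ₘ g)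
  addRight_assoc (m : M) (r s t : R) :
    (addRight m r s ▷ op m t) ≫ addRight m (r ⊗ s) t ≫ mapRight m (α_ r s t).hom =
      (α_ _ _ _).hom ≫ (op m r ◁ addRight m s t) ≫ addRight m r (s ⊗ t)
  addRight_braiding (m : M) (r s : R) :
    addRight m r s ≫ mapRight m (β_ r s).hom = (β_ _ _).hom ≫ addRight m s r
  addLeft_addRight (m n : M) (r s : R) :
    (tensorμ _ _ _ _ ≫ (addLeft m n r ⊗ₘ addLeft m n s)) ≫ addRight (m ⊗ n) r s =
      (addRight m r s ⊗ₘ addRight n r s) ≫ addLeft m n (r ⊗ s)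

namespace BiaddCore

variable {M R N : SCGr.{u}} (b : BiaddCore M R N)

/-- The morphism `m ↦ m · r`. -/
def at' (r : R) : M ⟶ N :=
  SCGr.mkHom
    { obj := fun m => b.op m r
      map := fun f => b.mapLeft f r
      map_id := fun m => b.mapLeft_id m r
      map_comp := fun f g => b.mapLeft_comp f g r }
    (fun m n => b.addLeft m n r) (fun f g => b.addLeft_nat f g r)
    (fun m n k => b.addLeft_assoc m n k r) (fun m n => b.addLeft_braiding m n r)

/-- The biadditive functor with the given data. -/
def toBiadd : Biadd M R N :=
  SCGr.mkHom (B := SCGr.hom M N)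
    { obj := b.at'
      map := fun {r s} g => SCGr.mkTrackOfTensor (F := b.at' r) (G := b.at' s)
        (fun m => b.mapRight m g)
        (fun f => b.mapLeft_mapRight f g) (fun m n => b.addLeft_mapRight m n g)
      map_id := fun r => SCGr.track_ext fun m => b.mapRight_id m r
      map_comp := fun f g => SCGr.track_ext fun m => b.mapRight_comp m f g }
    (fun r s => SCGr.mkTrackOfTensor (F := b.at' r ⊗ b.at' s) (G := b.at' (r ⊗ s))
      (fun m => b.addRight m r s)
      (fun f => b.addRight_nat_left f r s) (fun m n => b.addLeft_addRight m n r s))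
    (fun f g => SCGr.track_ext fun m => b.addRight_nat m f g)
    (fun r s t => SCGr.track_ext fun m => by
      refine Eq.trans ?_ ((b.addRight_assoc m r s t).trans ?_)
      · exact congr($(tensorHom_id (C := N) (b.addRight m r s) (b.op m t)) ≫ _)
      · exact congr(_ ≫ $((id_tensorHom (C := N) (b.op m r) (b.addRight m s t)).symm) ≫ _))
    (fun r s => SCGr.track_ext fun m => b.addRight_braiding m r s)

end BiaddCore

namespace TwoMod

variable {R : TwoRing.{u}}

/-- The biadditive functor on `susp K` given by a biadditive map. -/
def suspCore {K : Type u} [AddCommGroup K] (ρ : SCGr.Pi0 R.toSCGr →+ (K →+ K)) :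
    BiaddCore (SCGr.susp K) R.toSCGr (SCGr.susp K) where
  op _ _ := .pt
  mapLeft f r := ρ (.mk r) (show K from f)
  mapRight _ _ _ _ := (0 : K)
  addLeft _ _ _ := (0 : K)
  addRight _ _ _ := (0 : K)
  mapLeft_id _ r := (ρ (.mk r)).map_zero
  mapLeft_comp f g r := (ρ (.mk r)).map_add (show K from f) (show K from g)
  mapRight_id _ _ := rfl
  mapRight_comp _ _ _ _ _ _ := (add_zero (0 : K)).symm
  mapLeft_mapRight f r s g := by
    change ρ (.mk r) (show K from f) + 0 = 0 + ρ (.mk s) (show K from f)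
    rw [SCGr.Pi0.mk_eq g, add_comm]
  addLeft_nat f g r := by
    change ρ (.mk r) (show K from f) + ρ (.mk r) (show K from g) + 0 =
      0 + ρ (.mk r) ((show K from f) + (show K from g))
    rw [map_add, add_comm]
  addLeft_assoc _ _ _ r := by
    change (0 : K) + (0 + ρ (.mk r) (0 : K)) = 0 + (0 + 0)
    rw [map_zero]
  addLeft_braiding _ _ r := by
    change (0 : K) + ρ (.mk r) (0 : K) = 0 + 0
    rw [map_zero]
  addLeft_mapRight _ _ _ _ _ := by
    change (0 : K) + 0 = 0 + 0 + 0
    abel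
  addRight_nat_left f r s := by
    change ρ (.mk r) (show K from f) + ρ (.mk s) (show K from f) + 0 =
      0 + ρ (.mk r + .mk s) (show K from f)
    rw [map_add, add_comm]; rfl
  addRight_nat _ _ _ _ _ _ _ := by
    change (0 : K) + 0 + 0 = 0 + 0
    abel
  addRight_assoc _ _ _ _ := rfl
  addRight_braiding _ _ _ := rfl
  addLeft_addRight _ _ _ _ := by
    change ((0 + (-0 + (0 + (0 + -0))) : K) + (0 + 0)) + 0 = (0 + 0) + 0
    abel

/-- The right 2-module with one object given by a right action of the isomorphism classes of a
2-ring on an abelian group. -/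
def susp {K : Type u} [AddCommGroup K] (ρ : SCGr.Pi0 R.toSCGr →+ (K →+ K))
    (hone : ρ (.mk R.one) = .id K)
    (hmul : ∀ r s, ρ (.mk (R.mul.op r s)) = (ρ (.mk s)).comp (ρ (.mk r))) : TwoMod R where
  toSCGr := SCGr.susp K
  act := (suspCore ρ).toBiadd
  assoc _ _ _ := SCGr.SuspObj.iso _ _ 0
  unit _ := SCGr.SuspObj.iso _ _ 0
  assoc_nat_left f r s := by
    change ρ (.mk s) (ρ (.mk r) (show K from f)) + 0 = 0 + ρ (.mk (R.mul.op r s)) (show K from f)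
    rw [hmul, add_comm]; rfl
  assoc_nat_mid _ _ _ _ s := by
    change ρ (.mk s) (0 : K) + 0 = 0 + 0
    rw [map_zero]
  assoc_nat_right _ _ _ _ _ := rfl
  unit_nat f := by
    change ρ (.mk R.one) (show K from f) + 0 = 0 + (show K from f)
    rw [hone, add_comm]; rfl
  assoc_add_left _ _ _ s := by
    change (0 : K) + (ρ (.mk s) (0 : K) + 0) = (0 + 0) + 0
    rw [map_zero]; abel
  assoc_add_mid _ _ _ s := by
    change (0 : K) + (ρ (.mk s) (0 : K) + 0) = (0 + 0) + (0 + 0)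
    rw [map_zero]; abel
  assoc_add_right _ _ _ _ := by
    change (0 : K) + 0 = (0 + 0) + (0 + 0)
    abel
  unit_add _ _ := rfl
  pentagon _ _ _ t := by
    change ρ (.mk t) (0 : K) + (0 + 0) = 0 + 0
    rw [map_zero]; abel
  triangle _ r := by
    change (0 : K) + 0 = ρ (.mk r) (0 : K)
    rw [map_zero]; abel

/-- The action of the isomorphism classes of objects of a 2-ring on those of a 2-module. -/
def pi0Act (M : TwoMod R) : SCGr.Pi0 R.toSCGr →+ (SCGr.Pi0 M.toSCGr →+ SCGr.Pi0 M.toSCGr) :=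
  AddMonoidHom.mk' (Quotient.lift (fun r => SCGr.Pi0.map (M.act.at' r))
      fun _ _ ⟨e⟩ => SCGr.Pi0.map_eq (M.act.atMap e.hom)) (by
    rintro ⟨r⟩ ⟨s⟩
    ext a
    obtain ⟨x, rfl⟩ := SCGr.Pi0.exists_rep a
    exact (SCGr.Pi0.mk_eq (M.act.addRight x r s)).symm)

lemma pi0Act_map {M N : TwoMod R} (F : M ⟶ N) (r : SCGr.Pi0 R.toSCGr) (m : SCGr.Pi0 M.toSCGr) :
    pi0Act N r (SCGr.Pi0.map F.toHom m) = SCGr.Pi0.map F.toHom (pi0Act M r m) := by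
  obtain ⟨r, rfl⟩ := SCGr.Pi0.exists_rep r
  obtain ⟨m, rfl⟩ := SCGr.Pi0.exists_rep m
  exact (SCGr.Pi0.mk_eq (F.lin m r)).symm

/-- The action on the cokernel of a morphism on isomorphism classes. -/
def cokerAct {M N : TwoMod R} (F : M ⟶ N) :
    SCGr.Pi0 R.toSCGr →+ (SCGr.Pi0 N.toSCGr ⧸ (SCGr.Pi0.map F.toHom).range →+
      SCGr.Pi0 N.toSCGr ⧸ (SCGr.Pi0.map F.toHom).range) :=
  AddMonoidHom.mk' (fun r => QuotientAddGroup.map _ _ (pi0Act N r) (by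
      rintro _ ⟨m, rfl⟩
      exact ⟨pi0Act M r m, (pi0Act_map F r m).symm⟩)) (by
    intro r s
    ext n
    exact congr(QuotientAddGroup.mk' _ ($((pi0Act N).map_add r s) n)))

/-- The argument is the one for symmetric categorical groups, but the test object must be a
2-module. The map on isomorphism classes commutes with the action of the classes of R, so its
cokernel inherits an action and `susp` applies. Both the projection and zero are equivariant, which
is the linearity of the two tracks. -/
lemma surjective_of_cofaithful {M N : TwoMod R} {F : M ⟶ N} (hF : Cofaithful F) :
    Function.Surjective (SCGr.Pi0.map F.toHom) := by
  refine SCGr.surjective_of_quotient F.toHom ?_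
  let X : TwoMod R := susp (cokerAct F)
    (by
      ext n
      obtain ⟨x, rfl⟩ := SCGr.Pi0.exists_rep n
      exact congr(QuotientAddGroup.mk' _ $(SCGr.Pi0.mk_eq (N.unit x).hom)))
    (fun r s => by
      ext n
      obtain ⟨x, rfl⟩ := SCGr.Pi0.exists_rep n
      exact congr(QuotientAddGroup.mk' _ $(SCGr.Pi0.mk_eq (N.assoc x r s).inv)))
  let t (c : SCGr.Pi0 N.toSCGr →+ SCGr.Pi0 N.toSCGr ⧸ (SCGr.Pi0.map F.toHom).range)
      (hc : ∀ r n, cokerAct F r (c n) = c (pi0Act N r n)) : zero N X ⟶ zero N X :=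
    { track := SCGr.suspTrack c
      lin := fun m r => by
        refine (add_comm (G := SCGr.Pi0 N.toSCGr ⧸ (SCGr.Pi0.map F.toHom).range) _ _).trans ?_
        exact congr($(hc (.mk r) (.mk m)) + _) }
  have h : t (QuotientAddGroup.mk' (SCGr.Pi0.map F.toHom).range) (fun _ _ => rfl) =
      t 0 (fun _ _ => map_zero _) := by
    have := hF X
    apply (Bicategory.precomp X F).map_injective
    refine hom_ext (SCGr.track_ext fun x => ?_)
    exact (QuotientAddGroup.eq_zero_iff _).2 ⟨SCGr.Pi0.mk x, rfl⟩
  ext b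
  obtain ⟨x, rfl⟩ := SCGr.Pi0.exists_rep b
  exact congr(($h).track.nat.app x)

lemma cofaithful_iff {M N : TwoMod R} {F : M ⟶ N} :
    Cofaithful F ↔ Function.Surjective (SCGr.Pi0.map F.toHom) :=
  ⟨surjective_of_cofaithful, fun hF _ => ⟨fun h => hom_ext
    (SCGr.track_ext_of_surjective hF fun a => congr(($h).track.nat.app a))⟩⟩

end TwoMod

/-! ### Descent along essentially surjective morphisms -/

namespace SCGr

open Functor.LaxMonoidal Functor.OplaxMonoidal

section Descent

variable {D S X : SCGr.{u}}

/-- A morphism `h` descends along an essentially surjective morphism `q` as soon as it can be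
extended to all morphisms between values of `q`, compatibly with composition and addition. -/
theorem exists_descent (q : D ⟶ S) (h : D ⟶ X) (hq : Function.Surjective (Pi0.map q))
    (H : ∀ {d d' : D}, (q.functor.obj d ⟶ q.functor.obj d') →
      (h.functor.obj d ⟶ h.functor.obj d'))
    (H_map : ∀ {d d' : D} (v : d ⟶ d'), H (q.functor.map v) = h.functor.map v)
    (H_comp : ∀ {d d' d'' : D} (u : q.functor.obj d ⟶ q.functor.obj d')
      (u' : q.functor.obj d' ⟶ q.functor.obj d''), H (u ≫ u') = H u ≫ H u')
    (H_tensor : ∀ {c c' d d' : D} (u : q.functor.obj c ⟶ q.functor.obj d)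
      (u' : q.functor.obj c' ⟶ q.functor.obj d'),
      (H u ⊗ₘ H u') ≫ μ h.functor d d' =
        μ h.functor c c' ≫ H (δ q.functor c c' ≫ (u ⊗ₘ u') ≫ μ q.functor d d')) :
    ∃ (k : S ⟶ X) (t : q ≫ k ⟶ h), ∀ {d d' : D} (u : q.functor.obj d ⟶ q.functor.obj d'),
      k.functor.map u ≫ t.nat.app d' = t.nat.app d ≫ H u := by
  -- Each s receives a chosen preimage σ s with an isomorphism q(σ s) ≅ s. The descended morphism is
  -- s ↦ h(σ s), and `H` supplies its values on arrows and its constraints after conjugation with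
  -- the chosen isomorphisms.
  have hσ (s : S) : ∃ d, Nonempty (q.functor.obj d ≅ s) := by
    obtain ⟨a, ha⟩ := hq (Pi0.mk s)
    obtain ⟨a, rfl⟩ := Pi0.exists_rep a
    obtain ⟨e⟩ := Pi0.mk_eq_iff.1 ha
    exact ⟨a, ⟨asIso e⟩⟩
  choose σ e using hσ
  replace e := fun s => (e s).some
  have H_id (d : D) : H (𝟙 (q.functor.obj d)) = 𝟙 _ := by
    rw [← q.functor.map_id, H_map, h.functor.map_id]
  have H_right {c c' d : D} (u : q.functor.obj c ⟶ q.functor.obj d) :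
      H u ▷ h.functor.obj c' ≫ μ h.functor d c' =
        μ h.functor c c' ≫ H (δ q.functor c c' ≫ u ▷ q.functor.obj c' ≫ μ q.functor d c') := by
    rw [← tensorHom_id, ← H_id, H_tensor, tensorHom_id]
  have H_left {c c' d : D} (u : q.functor.obj c ⟶ q.functor.obj d) :
      h.functor.obj c' ◁ H u ≫ μ h.functor c' d =
        μ h.functor c' c ≫ H (δ q.functor c' c ≫ q.functor.obj c' ◁ u ≫ μ q.functor c' d) := by
    rw [← id_tensorHom, ← H_id, H_tensor, id_tensorHom]
  let k : S ⟶ X := mkHom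
    { obj := fun s => h.functor.obj (σ s)
      map := fun {s s'} w => H ((e s).hom ≫ w ≫ (e s').inv)
      map_id := fun s => by simp [H_id]
      map_comp := fun f g => by simp [← H_comp] }
    (fun s s' => μ h.functor (σ s) (σ s') ≫
      H (δ q.functor (σ s) (σ s') ≫ ((e s).hom ⊗ₘ (e s').hom) ≫ (e (s ⊗ s')).inv))
    (fun {x x' y y'} f g => by
      have h₁ := congr($(H_tensor ((e x).hom ≫ f ≫ (e x').inv) ((e y).hom ≫ g ≫ (e y').inv)) ≫
        H (δ q.functor (σ x') (σ y') ≫ ((e x').hom ⊗ₘ (e y').hom) ≫ (e (x' ⊗ y')).inv))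
      rw [Category.assoc, Category.assoc, ← H_comp] at h₁
      refine h₁.trans (Eq.trans ?_ (Category.assoc _ _ _).symm)
      dsimp only
      rw [← H_comp]
      congr 2
      simp)
    -- Both sides of the associativity law are brought to the form of constraints of h followed by
    -- `H` of a single arrow, using `H_right` for `h₁` and `H_left` for `h₂`. The two single arrows
    -- agree by coassociativity of the constraints of q.
    (fun s s' s'' => by
      have h₁ := congr(μ h.functor (σ s) (σ s') ▷ _ ≫
        $(H_right (c' := σ s'') (δ q.functor (σ s) (σ s') ≫ ((e s).hom ⊗ₘ (e s').hom) ≫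
          (e (s ⊗ s')).inv)) ≫
        H (δ q.functor (σ (s ⊗ s')) (σ s'') ≫ ((e (s ⊗ s')).hom ⊗ₘ (e s'').hom) ≫
          (e ((s ⊗ s') ⊗ s'')).inv) ≫
        H ((e ((s ⊗ s') ⊗ s'')).hom ≫ (α_ s s' s'').hom ≫ (e (s ⊗ s' ⊗ s'')).inv))
      have h₂ := congr((α_ _ _ _).hom ≫ _ ◁ μ h.functor (σ s') (σ s'') ≫
        $(H_left (c' := σ s) (δ q.functor (σ s') (σ s'') ≫ ((e s').hom ⊗ₘ (e s'').hom) ≫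
          (e (s' ⊗ s'')).inv)) ≫
        H (δ q.functor (σ s) (σ (s' ⊗ s'')) ≫ ((e s).hom ⊗ₘ (e (s' ⊗ s'')).hom) ≫
          (e (s ⊗ s' ⊗ s'')).inv))
      simp only [Category.assoc, ← H_comp] at h₁ h₂
      rw [← Functor.LaxMonoidal.associativity_assoc, ← H_map, ← H_comp] at h₂
      refine Eq.trans ?_ (h₁.trans (Eq.trans ?_ (h₂.symm.trans ?_)))
      · simp only [comp_whiskerRight, Category.assoc, ← H_comp]
      · congr 3
        have h₃ := Functor.OplaxMonoidal.associativity q.functor (σ s) (σ s') (σ s'')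
        simp only [MonoidalCategory.tensorHom_def, comp_whiskerRight,
          MonoidalCategory.whiskerLeft_comp,
          Category.assoc, Functor.Monoidal.μ_δ_assoc, ← reassoc_of% h₃]
        simp [whisker_exchange_assoc]
        rw [associator_naturality_left_assoc, associator_naturality_left_assoc,
          Iso.inv_hom_id_assoc, reassoc_of% h₃, whisker_exchange_assoc, whisker_exchange_assoc,
          whisker_exchange_assoc, whisker_exchange_assoc]
      · simp only [MonoidalCategory.whiskerLeft_comp, Category.assoc])
    (fun s s' => by
      dsimp only
      rw [Category.assoc, ← H_comp, ← Functor.LaxBraided.braided_assoc, ← H_map, ← H_comp]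
      congr 2
      simp)
  have hk {s s' : S} (w : s ⟶ s') : k.functor.map w = H ((e s).hom ≫ w ≫ (e s').inv) := rfl
  have hkμ (s s' : S) : μ k.functor s s' = μ h.functor (σ s) (σ s') ≫
      H (δ q.functor (σ s) (σ s') ≫ ((e s).hom ⊗ₘ (e s').hom) ≫ (e (s ⊗ s')).inv) := rfl
  have ht {d d' : D} (u : q.functor.obj d ⟶ q.functor.obj d') :
      H ((e (q.functor.obj d)).hom ≫ u ≫ (e (q.functor.obj d')).inv) ≫
        H (e (q.functor.obj d')).hom = H (e (q.functor.obj d)).hom ≫ H u := by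
    rw [← H_comp, ← H_comp]
    congr 1
    simp
  -- The preimage chosen for q(d) need not be d. The track compares the two by `H` of the chosen
  -- isomorphism, which is an arrow between values of q.
  let t : q ≫ k ⟶ h := mkTrackOfTensor (fun d => H (e (q.functor.obj d)).hom)
    (fun {d d'} v => (ht (q.functor.map v)).trans congr(_ ≫ $(H_map v)))
    (fun d d' => by
      refine Eq.trans ?_ (H_tensor _ _).symm
      have h₁ : (μ h.functor _ _ ≫ H (δ q.functor _ _ ≫ ((e (q.functor.obj d)).hom ⊗ₘ
          (e (q.functor.obj d')).hom) ≫ (e (q.functor.obj d ⊗ q.functor.obj d')).inv)) ≫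
        H ((e _).hom ≫ μ q.functor d d' ≫ (e _).inv) ≫ H (e (q.functor.obj (d ⊗ d'))).hom =
          μ h.functor (σ (q.functor.obj d)) (σ (q.functor.obj d')) ≫ H (
      δ q.functor (σ (q.functor.obj d)) (σ (q.functor.obj d')) ≫
        ((e (q.functor.obj d)).hom ⊗ₘ (e (q.functor.obj d')).hom) ≫ μ q.functor d d') := by
        rw [Category.assoc, ← H_comp, ← H_comp]
        congr 2
        simp
      exact (Category.assoc _ _ _).trans h₁)
  exact ⟨k, t, fun u => ht u⟩

/-- A track between precompositions with an essentially surjective morphism descends if it is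
natural with respect to all morphisms between values. -/
theorem exists_track_descent {q : D ⟶ S} (hq : Function.Surjective (Pi0.map q)) {k k' : S ⟶ X}
    (t : q ≫ k ⟶ q ≫ k') (ht : ∀ {d d' : D} (u : q.functor.obj d ⟶ q.functor.obj d'),
      k.functor.map u ≫ t.nat.app d' = t.nat.app d ≫ k'.functor.map u) :
    ∃ s : k ⟶ k', Bicategory.whiskerLeft q s = t := by
  have hσ (s : S) : ∃ d, Nonempty (q.functor.obj d ≅ s) := by
    obtain ⟨a, ha⟩ := hq (Pi0.mk s)
    obtain ⟨a, rfl⟩ := Pi0.exists_rep a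
    obtain ⟨e⟩ := Pi0.mk_eq_iff.1 ha
    exact ⟨a, ⟨asIso e⟩⟩
  choose σ e using hσ
  replace e := fun s => (e s).some
  let τ (d : D) : k.functor.obj (q.functor.obj d) ⟶ k'.functor.obj (q.functor.obj d) := t.nat.app d
  replace ht {d d' : D} (u : q.functor.obj d ⟶ q.functor.obj d') :
    k.functor.map u ≫ τ d' = τ d ≫ k'.functor.map u := ht u
  let s (x : S) : k.functor.obj x ⟶ k'.functor.obj x :=
    k.functor.map (e x).inv ≫ τ (σ x) ≫ k'.functor.map (e x).hom
  -- The component `s x` does not depend on the chosen preimage: any arrow from a value of q to x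
  -- computes it. Naturality and additivity both follow from this.
  have key {d : D} {x : S} (w : q.functor.obj d ⟶ x) :
      k.functor.map w ≫ s x = τ d ≫ k'.functor.map w := by
    have h := ht (w ≫ (e x).inv)
    simp only [s, ← Functor.map_comp_assoc, reassoc_of% h]
    simp
  have nat {x y : S} (f : x ⟶ y) : k.functor.map f ≫ s y = s x ≫ k'.functor.map f := by
    rw [← cancel_epi (k.functor.map (e x).hom), ← k.functor.map_comp_assoc, key,
      reassoc_of% (key (e x).hom), k'.functor.map_comp]
  refine ⟨mkTrackOfTensor s nat (fun x y => ?_), track_ext fun d => ?_⟩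
  · have h₁ := t.isMonoidal.tensor (σ x) (σ y)
    replace h₁ : (μ k.functor _ _ ≫ k.functor.map (μ q.functor (σ x) (σ y))) ≫ τ (σ x ⊗ σ y) =
      (τ (σ x) ⊗ₘ τ (σ y)) ≫ μ k'.functor _ _ ≫ k'.functor.map (μ q.functor (σ x) (σ y)) := h₁
    have h₂ := key (δ q.functor (σ x) (σ y) ≫ ((e x).hom ⊗ₘ (e y).hom))
    have h₃ := congr($h₁ ≫ k'.functor.map (δ q.functor (σ x) (σ y) ≫ ((e x).hom ⊗ₘ (e y).hom)))
    simp only [Category.assoc] at h₃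
    rw [← h₂, ← k.functor.map_comp_assoc, ← k'.functor.map_comp, Functor.Monoidal.μ_δ_assoc,
      ← μ_natural, ← μ_natural_assoc,
      tensorHom_comp_tensorHom_assoc, ← key, ← key, ← tensorHom_comp_tensorHom_assoc] at h₃
    exact (cancel_epi _).1 h₃
  · have h := key (𝟙 (q.functor.obj d))
    rw [k.functor.map_id, k'.functor.map_id, Category.id_comp, Category.comp_id] at h
    exact h

end Descent

section Equivalence

variable {A B X : SCGr.{u}}

/-- Precomposition with a morphism whose underlying functor is an equivalence is an equivalence. -/
lemma precomp_isEquivalence (E : A ⟶ B) [E.functor.IsEquivalence] :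
    (Bicategory.precomp X E).IsEquivalence := by
  have hE : Function.Surjective (Pi0.map E) := by
    intro b
    obtain ⟨b, rfl⟩ := Pi0.exists_rep b
    exact ⟨Pi0.mk (E.functor.objPreimage b), Pi0.mk_eq (E.functor.objObjPreimageIso b).hom⟩
  exact
    { faithful := cofaithful_iff.2 hE X
      full := ⟨fun {k k'} t => exists_track_descent hE t fun {d d'} u => by
        obtain ⟨v, rfl⟩ := E.functor.map_surjective u
        exact t.nat.naturality v⟩
      essSurj := ⟨fun h => by
        -- Full faithfulness of `E` supplies the extension to all arrows between values: take
        -- preimages in A and apply h.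
        obtain ⟨k, t, -⟩ := exists_descent E h hE (fun u => h.functor.map (E.functor.preimage u))
          (fun v => by simp) (fun u u' => by simp) (fun {c c' d d'} u u' => by
            obtain ⟨v, rfl⟩ := E.functor.map_surjective u
            obtain ⟨v', rfl⟩ := E.functor.map_surjective u'
            rw [Functor.OplaxMonoidal.δ_natural_assoc, Functor.Monoidal.δ_μ, Category.comp_id]
            simp)
        exact ⟨k, ⟨(asIso t : E ≫ k ≅ h)⟩⟩⟩ }

/-- Coproducts can be transported along equivalences. -/
lemma isCoproduct_of_equivalence {I : Type u} {A A' : I → SCGr.{u}} {Q Q' : SCGr.{u}}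
    {ι : ∀ i, A i ⟶ Q} {ι' : ∀ i, A' i ⟶ Q'} (E : ∀ i, A' i ⟶ A i) (F : Q' ⟶ Q)
    [∀ i, (E i).functor.IsEquivalence] [F.functor.IsEquivalence]
    (e : ∀ i, ι' i ≫ F ≅ E i ≫ ι i) (h : IsCoproduct ι) : IsCoproduct ι' := by
  intro X
  have := h X
  have := precomp_isEquivalence (X := X) F
  have (i : I) := precomp_isEquivalence (X := X) (E i)
  let Φ : Bicategory.precomp X F ⋙ (Functor.pi' fun i => Bicategory.precomp X (ι' i)) ≅
      (Functor.pi' fun i => Bicategory.precomp X (ι i)) ⋙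
        Functor.pi fun i => Bicategory.precomp X (E i) :=
    NatIso.ofComponents
      (fun k => Pi.isoMk fun i => (Bicategory.associator _ _ _).symm ≪≫
        Bicategory.whiskerRightIso (e i) k ≪≫ Bicategory.associator _ _ _)
      (fun {k k'} s => by
        ext i
        refine track_ext fun x => ?_
        change s.nat.app _ ≫ 𝟙 _ ≫ k'.functor.map ((e i).hom.nat.app x) ≫ 𝟙 _ =
          (𝟙 _ ≫ k.functor.map ((e i).hom.nat.app x) ≫ 𝟙 _) ≫ s.nat.app _
        rw [Category.id_comp, Category.comp_id, Category.id_comp, Category.comp_id]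
        exact (s.nat.naturality _).symm)
  have h₁ : (Bicategory.precomp X F ⋙
      (Functor.pi' fun i => Bicategory.precomp X (ι' i))).IsEquivalence :=
    Functor.isEquivalence_of_iso Φ.symm
  exact Functor.isEquivalence_of_comp_left (Bicategory.precomp X F) _

end Equivalence

end SCGr

/-! ### Translation of arrows between values of a functor -/

section ConjRight

variable {𝒞 𝒟 : Type*} [Category 𝒞] [MonoidalCategory 𝒞] [Category 𝒟] [MonoidalCategory 𝒟]

open Functor.LaxMonoidal Functor.OplaxMonoidal

/-- Addition of a value of a monoidal functor on the right to a morphism between values. -/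
def conjRight (F : 𝒞 ⥤ 𝒟) [F.Monoidal] {d d' : 𝒞} (u : F.obj d ⟶ F.obj d') (c : 𝒞) :
    F.obj (d ⊗ c) ⟶ F.obj (d' ⊗ c) :=
  δ F d c ≫ u ▷ F.obj c ≫ μ F d' c

variable (F : 𝒞 ⥤ 𝒟) [F.Monoidal]

lemma conjRight_comp {d d' d'' : 𝒞} (u : F.obj d ⟶ F.obj d') (u' : F.obj d' ⟶ F.obj d'') (c : 𝒞) :
    conjRight F (u ≫ u') c = conjRight F u c ≫ conjRight F u' c := by
  simp [conjRight]

lemma conjRight_map {d d' : 𝒞} (v : d ⟶ d') (c : 𝒞) :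
    conjRight F (F.map v) c = F.map (v ▷ c) := by
  simp [conjRight]

lemma conjRight_conjRight {d d' : 𝒞} (u : F.obj d ⟶ F.obj d') (c c' : 𝒞) :
    conjRight F (conjRight F u c) c' =
      F.map (α_ d c c').hom ≫ conjRight F u (c ⊗ c') ≫ F.map (α_ d' c c').inv := by
  have h₁ := Functor.OplaxMonoidal.associativity F d c c'
  have h₂ := Functor.LaxMonoidal.associativity_inv F d' c c'
  simp only [conjRight, comp_whiskerRight, Category.assoc]
  have h₃ : F.map (α_ d c c').hom ≫ δ F d (c ⊗ c') =
      δ F (d ⊗ c) c' ≫ δ F d c ▷ F.obj c' ≫ (α_ _ _ _).hom ≫ F.obj d ◁ μ F c c' := by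
    rw [reassoc_of% h₁, ← MonoidalCategory.whiskerLeft_comp, Functor.Monoidal.δ_μ,
      MonoidalCategory.whiskerLeft_id, Category.comp_id]
  rw [reassoc_of% h₃, whisker_exchange_assoc, h₂, ← associator_naturality_left_assoc,
    Iso.hom_inv_id_assoc]

/-- An arrow into 0 translated by c ends at 0 + c, which the unitor identifies with c. Thus
translating and then mapping to 0 is a sum of two arrows into 0; additivity on arrows into 0
therefore controls translations. -/
lemma conjRight_unit {d c : 𝒞} (x : F.obj d ⟶ 𝟙_ 𝒟) (z : F.obj (𝟙_ 𝒞 ⊗ c) ⟶ 𝟙_ 𝒟) :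
    conjRight F (x ≫ ε F) c ≫ z =
      δ F d c ≫ (x ⊗ₘ F.map (λ_ c).inv ≫ z) ≫ (λ_ (𝟙_ 𝒟)).hom := by
  have h : ε F ▷ F.obj c ≫ μ F (𝟙_ 𝒞) c = (λ_ _).hom ≫ F.map (λ_ c).inv := by
    rw [Functor.LaxMonoidal.left_unitality]
    simp
  simp only [conjRight, comp_whiskerRight, Category.assoc, MonoidalCategory.tensorHom_def,
    leftUnitor_naturality, reassoc_of% h]

/-- Translating by c and then by d', where c + d' maps to 0, gives back u up to arrows coming from
the source category. So translation can be undone. -/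
lemma conjRight_cancel {d d' c : 𝒞} (g : c ⊗ d' ⟶ 𝟙_ 𝒞) (u : F.obj d ⟶ F.obj d') :
    conjRight F (conjRight F u c) d' ≫ F.map ((α_ d' c d').hom ≫ d' ◁ g ≫ (ρ_ d').hom) =
      F.map ((α_ d c d').hom ≫ d ◁ g ≫ (ρ_ d).hom) ≫ u := by
  rw [conjRight_conjRight]
  have h (d : 𝒞) : F.map (d ◁ g ≫ (ρ_ d).hom) =
      δ F d (c ⊗ d') ≫ F.obj d ◁ (F.map g ≫ η F) ≫ (ρ_ _).hom := by
    rw [F.map_comp, ← cancel_epi (μ F d (c ⊗ d')), ← μ_natural_right_assoc]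
    simp
  simp only [F.map_comp, Category.assoc]
  rw [← F.map_comp_assoc (α_ d' c d').inv, Iso.inv_hom_id, F.map_id, Category.id_comp,
    ← F.map_comp, ← F.map_comp_assoc (d ◁ g), h, h, conjRight]
  simp only [Category.assoc, Functor.Monoidal.μ_δ_assoc]
  rw [← whisker_exchange_assoc, rightUnitor_naturality]

/-- Left translation is right translation conjugated by symmetries from the source, so closure
properties need only be required on the right. -/
lemma conjRight_braiding [SymmetricCategory 𝒞] [SymmetricCategory 𝒟] (F : 𝒞 ⥤ 𝒟) [F.Braided]
    {d d' : 𝒞} (u : F.obj d ⟶ F.obj d') (c : 𝒞) :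
    δ F c d ≫ F.obj c ◁ u ≫ μ F c d' =
      F.map (β_ c d).hom ≫ conjRight F u c ≫ F.map (β_ d' c).hom := by
  have h : F.map (β_ c d).hom ≫ δ F d c = δ F c d ≫ (β_ _ _).hom := by
    rw [← cancel_epi (μ F c d), reassoc_of% (Functor.LaxBraided.braided (F := F) c d)]
    simp
  rw [conjRight]
  simp only [Category.assoc, reassoc_of% h]
  rw [← BraidedCategory.braiding_naturality_right_assoc, Functor.LaxBraided.braided,
    SymmetricCategory.symmetry_assoc]

end ConjRight

namespace SCGr

open Functor.LaxMonoidal Functor.OplaxMonoidal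

/-- A class of morphisms between values of `q` which is closed under the operations of a
categorical group and contains the values of `q`. -/
structure ArrowSystem {D S : SCGr.{u}} (q : D ⟶ S) where
  mem {d d' : D} (u : q.functor.obj d ⟶ q.functor.obj d') : Prop
  map {d d' : D} (v : d ⟶ d') : mem (q.functor.map v)
  comp {d d' d'' : D} {u : q.functor.obj d ⟶ q.functor.obj d'}
    {u' : q.functor.obj d' ⟶ q.functor.obj d''} : mem u → mem u' → mem (u ≫ u')
  right {d d' : D} {u : q.functor.obj d ⟶ q.functor.obj d'} (c : D) :
    mem u → mem (conjRight q.functor u c)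

/-- An inclusion of classes can be checked on morphisms to the neutral object. -/
lemma ArrowSystem.le_of_unit {D S : SCGr.{u}} {q : D ⟶ S} (P Q : ArrowSystem q)
    (h : ∀ {d : D} (u : q.functor.obj d ⟶ q.functor.obj (𝟙_ D)), P.mem u → Q.mem u)
    {d d' : D} (u : q.functor.obj d ⟶ q.functor.obj d') (hu : P.mem u) : Q.mem u := by
  -- Translation by −d' followed by the pairing moves the target to 0, where `h` applies; the
  -- pairing is then removed again.
  have h₁ : Q.mem (conjRight q.functor u (negObj d')) := by
    have := Q.comp (h _ (P.comp (P.right (negObj d') hu) (P.map (negPairing d'))))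
      (Q.map (inv (negPairing d')))
    rwa [Category.assoc, ← q.functor.map_comp, IsIso.hom_inv_id, q.functor.map_id,
      Category.comp_id] at this
  let g : negObj d' ⊗ d' ⟶ 𝟙_ D := (β_ _ _).hom ≫ negPairing d'
  -- Translate back by d' and cancel −d' + d'.
  have h₂ := Q.comp (Q.comp (Q.map (inv ((α_ d (negObj d') d').hom ≫ d ◁ g ≫ (ρ_ d).hom)))
    (Q.right d' h₁)) (Q.map ((α_ d' (negObj d') d').hom ≫ d' ◁ g ≫ (ρ_ d').hom))
  rwa [Category.assoc, conjRight_cancel, ← Category.assoc, ← q.functor.map_comp,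
    IsIso.inv_hom_id, q.functor.map_id, Category.id_comp] at h₂

end SCGr

/-! ### An elementwise criterion for relative cokernels -/

namespace SCGr

open Functor.LaxMonoidal Functor.OplaxMonoidal

section RelativeCokernel

variable {A B D S X : SCGr.{u}}

/-- The components of a trivialization of a composition. -/
def nullApp {g : B ⟶ D} {q : D ⟶ S} (ζ : g ≫ q ⟶ 𝟙_ (B ⟶ S)) (b : B) :
    q.functor.obj (g.functor.obj b) ⟶ 𝟙_ S := ζ.nat.app b

section

variable {g : B ⟶ D} {q : D ⟶ S} (ζ : g ≫ q ⟶ 𝟙_ (B ⟶ S))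

lemma nullApp_nat {b b' : B} (v : b ⟶ b') :
    q.functor.map (g.functor.map v) ≫ nullApp ζ b' = nullApp ζ b :=
  (ζ.nat.naturality v).trans (Category.comp_id _)

lemma nullApp_tensor (b c : B) : μ q.functor _ _ ≫ q.functor.map (μ g.functor b c) ≫
    nullApp ζ (b ⊗ c) = (nullApp ζ b ⊗ₘ nullApp ζ c) ≫ (λ_ (𝟙_ S)).hom :=
  (Category.assoc _ _ _).symm.trans (ζ.isMonoidal.tensor b c)

lemma nullApp_unit : ε q.functor ≫ q.functor.map (ε g.functor) ≫ nullApp ζ (𝟙_ B) = 𝟙 _ :=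
  (Category.assoc _ _ _).symm.trans ζ.isMonoidal.unit

end

/-- The components of a track between precompositions. -/
def trackApp {q : D ⟶ S} {k k' : S ⟶ X} (t : q ≫ k ⟶ q ≫ k') (d : D) :
    k.functor.obj (q.functor.obj d) ⟶ k'.functor.obj (q.functor.obj d) := t.nat.app d

section

variable {q : D ⟶ S} {k k' : S ⟶ X} (t : q ≫ k ⟶ q ≫ k')

lemma trackApp_nat {d d' : D} (v : d ⟶ d') :
    k.functor.map (q.functor.map v) ≫ trackApp t d' =
      trackApp t d ≫ k'.functor.map (q.functor.map v) :=
  t.nat.naturality v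

lemma trackApp_tensor (c d : D) : μ k.functor _ _ ≫ k.functor.map (μ q.functor c d) ≫
    trackApp t (c ⊗ d) = (trackApp t c ⊗ₘ trackApp t d) ≫ μ k'.functor _ _ ≫
      k'.functor.map (μ q.functor c d) :=
  (Category.assoc _ _ _).symm.trans (t.isMonoidal.tensor c d)

lemma trackApp_unit : ε k.functor ≫ k.functor.map (ε q.functor) ≫ trackApp t (𝟙_ D) =
    ε k'.functor ≫ k'.functor.map (ε q.functor) :=
  (Category.assoc _ _ _).symm.trans t.isMonoidal.unit

end

lemma isNullCompatible_iff {f : A ⟶ B} {g : B ⟶ D} (α : f ≫ g ⟶ 𝟙_ (A ⟶ D)) {h : D ⟶ X}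
    (θ : g ≫ h ⟶ 𝟙_ (B ⟶ X)) : IsNullCompatible α θ ↔
      ∀ a, h.functor.map (nullApp α a) ≫ η h.functor = nullApp θ (f.functor.obj a) := by
  have h₁ (a : A) : (Bicategory.whiskerRight α h ≫ zeroComp A h).nat.app a =
    h.functor.map (nullApp α a) ≫ η h.functor := rfl
  have h₂ (a : A) : ((Bicategory.associator f g h).hom ≫ Bicategory.whiskerLeft f θ ≫
      compZero X f).nat.app a = nullApp θ (f.functor.obj a) :=
    (Category.id_comp _).trans (Category.comp_id _)
  constructor
  · intro h a
    rw [← h₁, h, h₂]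
  · intro h
    refine track_ext fun a => ?_
    rw [h₁, h₂, h]

lemma nullComp_app {g : B ⟶ D} {q : D ⟶ S} (ζ : g ≫ q ⟶ 𝟙_ (B ⟶ S)) (k : S ⟶ X) (b : B) :
    (nullComp ζ k).nat.app b = k.functor.map (nullApp ζ b) ≫ η k.functor :=
  Category.id_comp _

/-- The morphisms between values of `g` compatible with a trivialization of `g ≫ q`. -/
def nullSystem {g : B ⟶ D} {q : D ⟶ S} (ζ : g ≫ q ⟶ 𝟙_ (B ⟶ S)) : ArrowSystem g where
  mem {b b'} w := q.functor.map w ≫ nullApp ζ b' = nullApp ζ b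
  map v := nullApp_nat ζ v
  comp h h' := by rw [Functor.map_comp, Category.assoc, h', h]
  right {b b' w} c h := by
    rw [← cancel_epi (q.functor.map (μ g.functor b c)), ← cancel_epi (μ q.functor _ _),
      nullApp_tensor, conjRight]
    simp only [Functor.map_comp, Category.assoc]
    rw [← q.functor.map_comp_assoc (μ g.functor b c), Functor.Monoidal.μ_δ, q.functor.map_id,
      Category.id_comp, ← μ_natural_left_assoc, nullApp_tensor, ← tensorHom_id,
      tensorHom_comp_tensorHom_assoc, h, Category.id_comp]

/-- The morphisms between values of `q` compatible with a track. -/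
def trackSystem {q : D ⟶ S} {k k' : S ⟶ X} (t : q ≫ k ⟶ q ≫ k') : ArrowSystem q where
  mem {d d'} u := k.functor.map u ≫ trackApp t d' = trackApp t d ≫ k'.functor.map u
  map v := trackApp_nat t v
  comp {d d' d'' u u'} h h' := by
    rw [k.functor.map_comp, k'.functor.map_comp, Category.assoc, h', reassoc_of% h]
  right {d d' u} c h := by
    rw [← cancel_epi (k.functor.map (μ q.functor d c)), ← cancel_epi (μ k.functor _ _),
      reassoc_of% (trackApp_tensor t d c), conjRight]
    simp only [Functor.map_comp, Category.assoc]
    rw [← k.functor.map_comp_assoc (μ q.functor d c), Functor.Monoidal.μ_δ, k.functor.map_id,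
      Category.id_comp, ← μ_natural_left_assoc, trackApp_tensor,
      ← k'.functor.map_comp_assoc (μ q.functor d c), Functor.Monoidal.μ_δ, k'.functor.map_id,
      Category.id_comp, ← tensorHom_id,
      tensorHom_comp_tensorHom_assoc, h, Category.id_comp, ← μ_natural_left_assoc, ← tensorHom_id,
      tensorHom_comp_tensorHom_assoc, Category.comp_id]

/-- All morphisms between values of `q`. -/
def topSystem (q : D ⟶ S) : ArrowSystem q where
  mem _ := True
  map _ := trivial
  comp _ _ := trivial
  right _ _ := trivial

/-- The elementwise conditions under which `(q, ζ)` is the relative cokernel of `(f, g, α)`. -/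
structure IsExact {f : A ⟶ B} {g : B ⟶ D} (α : f ≫ g ⟶ 𝟙_ (A ⟶ D)) {q : D ⟶ S}
    (ζ : g ≫ q ⟶ 𝟙_ (B ⟶ S)) : Prop where
  surjective : Function.Surjective (Pi0.map q)
  exists_lift {d : D} (u : q.functor.obj d ⟶ 𝟙_ S) :
    ∃ (b : B) (v : g.functor.obj b ⟶ d), q.functor.map v ≫ u = nullApp ζ b
  exists_lift' {b : B} (v : g.functor.obj b ⟶ 𝟙_ D) :
    q.functor.map v ≫ η q.functor = nullApp ζ b →
      ∃ (a : A) (w : f.functor.obj a ⟶ b), g.functor.map w ≫ v = nullApp α a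

section

variable {f : A ⟶ B} {g : B ⟶ D} {α : f ≫ g ⟶ 𝟙_ (A ⟶ D)} {q : D ⟶ S}
  {ζ : g ≫ q ⟶ 𝟙_ (B ⟶ S)}

/-- By `exists_track_descent` the question is naturality of `t` along arrows between values of q
that need not come from D. Such good arrows form an `ArrowSystem`, so the target may be taken to be
q(0). There exactness lifts the arrow to some b in B, and naturality becomes the hypothesis on
`nullComp`. -/
lemma IsExact.exists_track (H : IsExact α ζ) {k k' : S ⟶ X} (t : q ≫ k ⟶ q ≫ k')
    (ht : nullComp ζ k = Bicategory.whiskerLeft g t ≫ nullComp ζ k') :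
    ∃ s : k ⟶ k', Bicategory.whiskerLeft q s = t := by
  refine exists_track_descent H.surjective t fun {d d'} u =>
    (topSystem q).le_of_unit (trackSystem t) (fun {d} u _ => ?_) u trivial
  change k.functor.map u ≫ trackApp t (𝟙_ D) = trackApp t d ≫ k'.functor.map u
  obtain ⟨b, v, hv⟩ := H.exists_lift (u ≫ η q.functor)
  have h₁ : k.functor.map (nullApp ζ b) ≫ η k.functor =
      trackApp t (g.functor.obj b) ≫ k'.functor.map (nullApp ζ b) ≫ η k'.functor := by
    rw [← nullComp_app, ht]
    exact congr(_ ≫ $(nullComp_app ζ k' b))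
  have h₂ : trackApp t (𝟙_ D) ≫ k'.functor.map (η q.functor) ≫ η k'.functor =
      k.functor.map (η q.functor) ≫ η k.functor := by
    rw [← cancel_epi (k.functor.map (ε q.functor)), ← cancel_epi (ε k.functor),
      reassoc_of% (trackApp_unit t)]
    simp [← Functor.map_comp_assoc]
  rw [← hv] at h₁
  simp only [Functor.map_comp, Category.assoc] at h₁
  rw [← reassoc_of% (trackApp_nat t v), cancel_epi, ← h₂] at h₁
  simpa only [← Category.assoc, cancel_mono] using h₁

/-- This is the purpose of A and α: an arrow of D between values of g which ζ does not see is not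
seen by θ either. After reduction to the target g(0), exactness lifts the arrow to A, where
compatibility with α evaluates both sides. -/
lemma IsExact.map_comp_nullApp (H : IsExact α ζ) {h : D ⟶ X} (θ : g ≫ h ⟶ 𝟙_ (B ⟶ X))
    (hθ : IsNullCompatible α θ)
    {b b' : B} (w : g.functor.obj b ⟶ g.functor.obj b')
    (hw : q.functor.map w ≫ nullApp ζ b' = nullApp ζ b) :
    h.functor.map w ≫ nullApp θ b' = nullApp θ b := by
  refine (nullSystem ζ).le_of_unit (nullSystem θ) (fun {b} w hw => ?_) w hw
  change q.functor.map w ≫ nullApp ζ (𝟙_ B) = nullApp ζ b at hw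
  change h.functor.map w ≫ nullApp θ (𝟙_ B) = nullApp θ b
  have hu {Y : SCGr.{u}} {j : D ⟶ Y} (ξ : g ≫ j ⟶ 𝟙_ (B ⟶ Y)) :
      j.functor.map (η g.functor) ≫ η j.functor = nullApp ξ (𝟙_ B) := by
    rw [← cancel_epi (j.functor.map (ε g.functor)), ← cancel_epi (ε j.functor), nullApp_unit]
    simp [← Functor.map_comp_assoc]
  obtain ⟨a, x, hx⟩ := H.exists_lift' (w ≫ η g.functor) (by
    rw [q.functor.map_comp, Category.assoc, hu ζ, hw])
  have h₁ := (isNullCompatible_iff α θ).1 hθ a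
  rw [← hx, ← nullApp_nat θ x] at h₁
  simp only [Functor.map_comp, Category.assoc, cancel_epi] at h₁
  rw [← h₁, hu]

/-- By `exists_descent` it is enough to extend h to all arrows between values of q. On an arrow into
0 the value `H₀` is forced by θ through any lift to B. A general arrow is governed by its effect,
after every translation, on arrows into 0 (`Good`). This determines its image uniquely, so the laws
of composition and addition follow from closure properties of `Good`. -/
theorem IsExact.exists_fac (H : IsExact α ζ) {h : D ⟶ X} (θ : g ≫ h ⟶ 𝟙_ (B ⟶ X))
    (hθ : IsNullCompatible α θ) :
    ∃ (k : S ⟶ X) (t : q ≫ k ⟶ h), nullComp ζ k = Bicategory.whiskerLeft g t ≫ θ := by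
  have ex {d : D} (u : q.functor.obj d ⟶ 𝟙_ S) : ∃ m : h.functor.obj d ⟶ 𝟙_ X,
      ∀ (b : B) (v : g.functor.obj b ⟶ d), q.functor.map v ≫ u = nullApp ζ b →
        h.functor.map v ≫ m = nullApp θ b := by
    obtain ⟨b, v, hv⟩ := H.exists_lift u
    -- Two lifts of u differ by v' ≫ inv v, which is invisible to ζ and hence to θ.
    refine ⟨inv (h.functor.map v) ≫ nullApp θ b, fun b' v' hv' => ?_⟩
    have h₁ := H.map_comp_nullApp θ hθ (v' ≫ inv v) (by
      rw [← hv, q.functor.map_comp, Category.assoc, ← q.functor.map_comp_assoc (inv v)]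
      simpa using hv')
    simpa using h₁
  choose H₀ hH₀ using @ex
  have nat {d d' : D} (v : d ⟶ d') (u : q.functor.obj d' ⟶ 𝟙_ S) :
      H₀ (q.functor.map v ≫ u) = h.functor.map v ≫ H₀ u := by
    obtain ⟨b, x, hx⟩ := H.exists_lift (q.functor.map v ≫ u)
    rw [← cancel_epi (h.functor.map x), hH₀ _ b x hx, ← h.functor.map_comp_assoc,
      hH₀ u b (x ≫ v) (by rw [q.functor.map_comp, Category.assoc, hx])]
  have tensor {d d' : D} (u : q.functor.obj d ⟶ 𝟙_ S) (u' : q.functor.obj d' ⟶ 𝟙_ S) :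
      H₀ (δ q.functor d d' ≫ (u ⊗ₘ u') ≫ (λ_ (𝟙_ S)).hom) =
        δ h.functor d d' ≫ (H₀ u ⊗ₘ H₀ u') ≫ (λ_ (𝟙_ X)).hom := by
    obtain ⟨b, x, hx⟩ := H.exists_lift u
    obtain ⟨b', x', hx'⟩ := H.exists_lift u'
    -- The sum of two lifts is a lift of the sum. The same computation serves (q, ζ), where it
    -- identifies the lift, and (h, θ), where it evaluates it.
    have key {Y : SCGr.{u}} {j : D ⟶ Y} (ξ : g ≫ j ⟶ 𝟙_ (B ⟶ Y)) (y : j.functor.obj d ⟶ 𝟙_ Y)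
        (y' : j.functor.obj d' ⟶ 𝟙_ Y) (hy : j.functor.map x ≫ y = nullApp ξ b)
        (hy' : j.functor.map x' ≫ y' = nullApp ξ b') :
        j.functor.map (δ g.functor b b' ≫ (x ⊗ₘ x')) ≫ δ j.functor d d' ≫ (y ⊗ₘ y') ≫
          (λ_ (𝟙_ Y)).hom = nullApp ξ (b ⊗ b') := by
      rw [← cancel_epi (j.functor.map (μ g.functor b b')), ← cancel_epi (μ j.functor _ _),
        nullApp_tensor, ← j.functor.map_comp_assoc, Functor.Monoidal.μ_δ_assoc,
        ← μ_natural_assoc, Functor.Monoidal.μ_δ_assoc, tensorHom_comp_tensorHom_assoc, hy, hy']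
    have h₁ := hH₀ _ _ _ (key ζ u u' hx hx')
    rw [← key θ (H₀ u) (H₀ u') (hH₀ _ _ _ hx) (hH₀ _ _ _ hx')] at h₁
    simpa only [cancel_epi] using h₁
  -- Quantifying over all translations c is what makes the relation stable under addition.
  let Good {d d' : D} (u : q.functor.obj d ⟶ q.functor.obj d')
      (m : h.functor.obj d ⟶ h.functor.obj d') : Prop :=
    ∀ (c : D) (z : q.functor.obj (d' ⊗ c) ⟶ 𝟙_ S),
      H₀ (conjRight q.functor u c ≫ z) = conjRight h.functor m c ≫ H₀ z
  have good_map {d d' : D} (v : d ⟶ d') : Good (q.functor.map v) (h.functor.map v) := by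
    intro c z
    rw [conjRight_map, conjRight_map, nat]
  have good_comp {d d' d'' : D} {u : q.functor.obj d ⟶ q.functor.obj d'}
      {u' : q.functor.obj d' ⟶ q.functor.obj d''} {m : h.functor.obj d ⟶ h.functor.obj d'}
      {m' : h.functor.obj d' ⟶ h.functor.obj d''} (h₁ : Good u m) (h₂ : Good u' m') :
      Good (u ≫ u') (m ≫ m') := by
    intro c z
    rw [conjRight_comp, conjRight_comp, Category.assoc, h₁, h₂, Category.assoc]
  have good_right {d d' : D} {u : q.functor.obj d ⟶ q.functor.obj d'}
      {m : h.functor.obj d ⟶ h.functor.obj d'} (h₁ : Good u m) (c : D) :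
      Good (conjRight q.functor u c) (conjRight h.functor m c) := by
    intro c' z
    rw [conjRight_conjRight, conjRight_conjRight]
    simp only [Category.assoc]
    rw [nat, h₁, nat]
  have good_left {d d' : D} {u : q.functor.obj d ⟶ q.functor.obj d'}
      {m : h.functor.obj d ⟶ h.functor.obj d'} (h₁ : Good u m) (c : D) :
      Good (δ q.functor c d ≫ q.functor.obj c ◁ u ≫ μ q.functor c d')
        (δ h.functor c d ≫ h.functor.obj c ◁ m ≫ μ h.functor c d') := by
    rw [conjRight_braiding, conjRight_braiding]
    exact good_comp (good_map _) (good_comp (good_right h₁ c) (good_map _))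
  have good_tensor {c c' d d' : D} {u : q.functor.obj c ⟶ q.functor.obj d}
      {u' : q.functor.obj c' ⟶ q.functor.obj d'} {m : h.functor.obj c ⟶ h.functor.obj d}
      {m' : h.functor.obj c' ⟶ h.functor.obj d'} (h₁ : Good u m) (h₂ : Good u' m') :
      Good (δ q.functor c c' ≫ (u ⊗ₘ u') ≫ μ q.functor d d')
        (δ h.functor c c' ≫ (m ⊗ₘ m') ≫ μ h.functor d d') := by
    have h₃ := good_comp (good_right h₁ c') (good_left h₂ d)
    simpa [conjRight, MonoidalCategory.tensorHom_def] using h₃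
  -- Test with c = −d' and z the pairing into 0. Since z and `H₀ z` are invertible, the translate of
  -- m is determined, and adding an object is faithful.
  have good_unique {d d' : D} {u : q.functor.obj d ⟶ q.functor.obj d'}
      {m m' : h.functor.obj d ⟶ h.functor.obj d'} (h₁ : Good u m) (h₂ : Good u m') : m = m' := by
    have h₃ := (h₁ (negObj d') (q.functor.map (negPairing d') ≫ η q.functor)).symm.trans
      (h₂ (negObj d') (q.functor.map (negPairing d') ≫ η q.functor))
    simp only [cancel_mono, conjRight, cancel_epi] at h₃
    apply (tensorLeft (h.functor.obj (negObj d'))).map_injective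
    change _ ◁ m = _ ◁ m'
    rw [← cancel_mono (β_ _ _).hom, BraidedCategory.braiding_naturality_right,
      BraidedCategory.braiding_naturality_right, h₃]
  have good_exists {d d' : D} (u : q.functor.obj d ⟶ q.functor.obj d') : ∃ m, Good u m := by
    let T : ArrowSystem q :=
      { mem := fun u => ∃ m, Good u m
        map := fun v => ⟨_, good_map v⟩
        comp := fun ⟨_, h₁⟩ ⟨_, h₂⟩ => ⟨_, good_comp h₁ h₂⟩
        right := fun c ⟨_, h₁⟩ => ⟨_, good_right h₁ c⟩ }
    -- Only arrows into q(0) remain. There the image is `H₀` followed by the unit constraint of h,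
    -- and goodness is the additivity of `H₀`.
    refine (topSystem q).le_of_unit T (fun {d} u _ => ⟨H₀ (u ≫ η q.functor) ≫ ε h.functor, ?_⟩) u
      trivial
    intro c z
    have h₁ := conjRight_unit q.functor (u ≫ η q.functor) z
    rw [Category.assoc, Functor.Monoidal.η_ε, Category.comp_id] at h₁
    rw [h₁, tensor, conjRight_unit, nat]
  choose K hK using @good_exists
  obtain ⟨k, t, ht⟩ := exists_descent q h H.surjective K
    (fun v => good_unique (hK _) (good_map v))
    (fun u u' => good_unique (hK _) (good_comp (hK u) (hK u')))
    (fun {c c' d d'} u u' => by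
      rw [← cancel_epi (δ h.functor c c'), Functor.Monoidal.δ_μ_assoc]
      exact good_unique (good_tensor (hK u) (hK u')) (hK _))
  refine ⟨k, t, track_ext fun b => (nullComp_app ζ k b).trans ?_⟩
  have h₁ : K (nullApp ζ b ≫ ε q.functor) = nullApp θ b ≫ ε h.functor := by
    refine good_unique (hK _) fun c z => ?_
    rw [conjRight_unit, conjRight_unit, tensor, nat]
    congr 3
    -- The identity of g(b) is itself a lift of `nullApp ζ b`, so `H₀` sends this arrow to `nullApp
    -- θ b`.
    have := hH₀ (nullApp ζ b) b (𝟙 _) (by simp)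
    simpa using this
  have h₂ : ε k.functor ≫ k.functor.map (ε q.functor) ≫ t.nat.app (𝟙_ D) = ε h.functor :=
    (Category.assoc _ _ _).symm.trans t.isMonoidal.unit
  have h₃ := ht (nullApp ζ b ≫ ε q.functor)
  rw [h₁, k.functor.map_comp, Category.assoc] at h₃
  have h₄ : k.functor.map (nullApp ζ b) ≫ η k.functor ≫ ε h.functor =
      t.nat.app (g.functor.obj b) ≫ nullApp θ b ≫ ε h.functor := by
    rw [← h₃, ← h₂, Functor.Monoidal.η_ε_assoc]
  have h₅ : k.functor.map (nullApp ζ b) ≫ η k.functor =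
      t.nat.app (g.functor.obj b) ≫ nullApp θ b := by
    rw [← cancel_mono (ε h.functor), Category.assoc, h₄, Category.assoc]
  exact h₅

/-- The elementwise criterion for relative cokernels of symmetric categorical groups. -/
theorem IsExact.isRelativeCokernel (H : IsExact α ζ) (hζ : IsNullCompatible α ζ) :
    IsRelativeCokernel α q ζ where
  compatible := hζ
  exists_fac _ θ hθ := H.exists_fac θ hθ
  existsUnique_track k k' t ht := by
    obtain ⟨s, hs⟩ := H.exists_track t ht
    exact ⟨s, hs, fun s' hs' => (cofaithful_iff.2 H.surjective _).map_injective (hs'.trans hs.symm)⟩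

end

end RelativeCokernel

end SCGr

/-! ### Formal consequences of freeness -/

/-- A 2-category whose objects have underlying categories, on which morphisms act. -/
class HasPoints (C : Type (u + 1)) [Bicategory.{u, u} C] where
  pts : C → SCGr.{u}
  map {A B : C} (f : A ⟶ B) : pts A ⟶ pts B
  ev {A : C} (a : pts A) (X : C) : (A ⟶ X) ⥤ pts X
  precompIso {A B : C} (f : A ⟶ B) (a : pts A) (X : C) :
    Bicategory.precomp X f ⋙ ev a X ≅ ev ((map f).functor.obj a) X
  postcompIso {A X Y : C} (a : pts A) (f : X ⟶ Y) :
    Bicategory.postcomp A f ⋙ ev a Y ≅ ev a X ⋙ (map f).functor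
  cofaithful_iff {A B : C} {f : A ⟶ B} :
    Cofaithful f ↔ Function.Surjective (SCGr.Pi0.map (map f))
  evIso {A X : C} (f : A ⟶ X) (a : pts A) : (ev a X).obj f ≅ (map f).functor.obj a
  evMapIso {A X : C} {a b : pts A} (e : a ≅ b) : ev a X ≅ ev b X

section Free

variable {C : Type (u + 1)} [Bicategory.{u, u} C] [HasPoints C]

open HasPoints

/-- A family of points of `Q` is a basis if evaluation at the family is an equivalence. -/
def IsFree {I : Type u} {Q : C} (x : I → pts Q) : Prop :=
  ∀ X : C, (Functor.pi' fun i => ev (x i) X).IsEquivalence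

section

variable {I : Type u} {Q : C} {x : I → pts Q} (hx : IsFree x) {X : C}

lemma IsFree.exists_hom (hx : IsFree x) (y : I → pts X) :
    ∃ f : Q ⟶ X, ∀ i, Nonempty ((map f).functor.obj (x i) ≅ y i) := by
  have := hx X
  let F : (Q ⟶ X) ⥤ (I → pts X) := Functor.pi' fun i => ev (x i) X
  exact ⟨F.objPreimage y, fun i => ⟨(evIso _ _).symm ≪≫ Pi.isoApp (F.objObjPreimageIso y) i⟩⟩

lemma IsFree.exists_track (hx : IsFree x) {f g : Q ⟶ X}
    (w : ∀ i, (ev (x i) X).obj f ⟶ (ev (x i) X).obj g) :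
    ∃ t : f ⟶ g, ∀ i, (ev (x i) X).map t = w i := by
  have := hx X
  let F : (Q ⟶ X) ⥤ (I → pts X) := Functor.pi' fun i => ev (x i) X
  obtain ⟨t, ht⟩ := F.map_surjective (X := f) (Y := g) w
  exact ⟨t, fun i => congrFun ht i⟩

lemma IsFree.track_ext (hx : IsFree x) {f g : Q ⟶ X} {s t : f ⟶ g}
    (h : ∀ i, (ev (x i) X).map s = (ev (x i) X).map t) : s = t := by
  have := hx X
  let F : (Q ⟶ X) ⥤ (I → pts X) := Functor.pi' fun i => ev (x i) X
  exact F.map_injective (funext h)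

/-- A cofaithful morphism is surjective on isomorphism classes, so the points prescribed by g lift
up to isomorphism. Freeness turns the lifted points into a morphism and the isomorphisms into a
single track. -/
lemma IsFree.isProjective (hx : IsFree x) : IsProjective Q := by
  intro A B f hf c
  obtain ⟨g, rfl⟩ := Quotient.exists_rep c
  have hs := cofaithful_iff.1 hf
  have h (i : I) : ∃ a : pts A, Nonempty ((map f).functor.obj a ≅ (ev (x i) B).obj g) := by
    obtain ⟨a, ha⟩ := hs (SCGr.Pi0.mk ((ev (x i) B).obj g))
    obtain ⟨a, rfl⟩ := SCGr.Pi0.exists_rep a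
    obtain ⟨e⟩ := SCGr.Pi0.mk_eq_iff.1 ha
    exact ⟨a, ⟨asIso e⟩⟩
  choose a e using h
  obtain ⟨k, hk⟩ := hx.exists_hom a
  obtain ⟨t, -⟩ := hx.exists_track (f := k ≫ f) (g := g) fun i =>
    (postcompIso (x i) f).hom.app k ≫
      (map f).functor.map ((evIso k (x i)).hom ≫ (hk i).some.hom) ≫ (e i).some.hom
  refine ⟨Quotient.mk _ k, ?_⟩
  exact Quotient.sound (Relation.ReflTransGen.single (Or.inl ⟨t⟩))

lemma IsFree.isEquivalence_ev {G : C} {e : pts G} (hG : IsFree fun _ : PUnit.{u + 1} => e) (X : C) :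
    (ev e X).IsEquivalence :=
  { faithful := ⟨fun h => hG.track_ext fun _ => h⟩
    full := ⟨fun w => by
      obtain ⟨t, ht⟩ := hG.exists_track fun _ => w
      exact ⟨t, ht PUnit.unit⟩⟩
    essSurj := ⟨fun y => by
      obtain ⟨f, hf⟩ := hG.exists_hom fun _ => y
      exact ⟨f, ⟨evIso _ _ ≪≫ (hf PUnit.unit).some⟩⟩⟩ }

/-- If `G` is free on one generator, every free object is a coproduct of copies of `G`. -/
lemma IsFree.isCoproductOfCopies (hx : IsFree x) {G : C} {e : pts G}
    (hG : IsFree fun _ : PUnit.{u + 1} => e) : IsCoproductOfCopies G Q := by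
  have h (i : I) : ∃ f : G ⟶ Q, Nonempty ((map f).functor.obj e ≅ x i) := by
    obtain ⟨f, hf⟩ := hG.exists_hom fun _ => x i
    exact ⟨f, hf PUnit.unit⟩
  choose ι hι using h
  have hev (X : C) := hG.isEquivalence_ev X
  refine ⟨I, ι, fun X => ?_⟩
  have := hx X
  -- Restriction along `ι` followed by evaluation at `e` is evaluation at the basis. Two of these
  -- three functors are equivalences, so the restriction is one.
  let Φ : (Functor.pi' fun i => Bicategory.precomp X (ι i)) ⋙ (Functor.pi fun _ : I => ev e X) ≅
      Functor.pi' fun i => ev (x i) X :=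
    NatIso.pi' (F := (Functor.pi' fun i => Bicategory.precomp X (ι i)) ⋙
        (Functor.pi fun _ : I => ev e X)) fun i =>
      precompIso (ι i) e X ≪≫ evMapIso (hι i).some
  have h₁ : ((Functor.pi' fun i => Bicategory.precomp X (ι i)) ⋙
      (Functor.pi fun _ : I => ev e X)).IsEquivalence := Functor.isEquivalence_of_iso Φ.symm
  exact Functor.isEquivalence_of_comp_right _ (Functor.pi fun _ : I => ev e X)

end

/-- The free object on all points of A hits every isomorphism class of A. -/
lemma hasEnoughProjectives_of_free
    (h : ∀ I : Type u, ∃ (Q : C) (x : I → pts Q), IsFree x) : HasEnoughProjectives C := by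
  intro A
  obtain ⟨Q, x, hx⟩ := h (pts A)
  obtain ⟨f, hf⟩ := hx.exists_hom (X := A) id
  refine ⟨Q, f, hx.isProjective, cofaithful_iff.2 fun a => ?_⟩
  obtain ⟨a, rfl⟩ := SCGr.Pi0.exists_rep a
  exact ⟨SCGr.Pi0.mk (x a), SCGr.Pi0.mk_eq (hf a).some.hom⟩

end Free

/-! ### Free resolutions of symmetric categorical groups -/

namespace SCGr

open Functor.LaxMonoidal Functor.OplaxMonoidal

instance : HasPoints SCGr.{u} where
  pts A := A
  map f := f
  ev a X :=
    { obj := fun F => F.functor.obj a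
      map := fun s => s.nat.app a }
  precompIso f a X := Iso.refl _
  postcompIso a f := Iso.refl _
  cofaithful_iff := cofaithful_iff
  evIso f a := Iso.refl _
  evMapIso e := NatIso.ofComponents (fun F => F.functor.mapIso e)
    (fun s => (s.nat.naturality e.hom).symm)

/-- A tautological resolution: D has a generator for every object of S, B one for every arrow q(d) →
0, and A one for every arrow g(b) → 0 whose image under q is the component of ζ. Each condition in
`IsExact` is then witnessed by a generator. -/
theorem isGenerator_of_free {G : SCGr.{u}} {e : G}
    (hG : IsFree (C := SCGr) fun _ : PUnit.{u + 1} => e)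
    (hfree : ∀ I : Type u, ∃ (Q : SCGr.{u}) (x : I → Q), IsFree (C := SCGr) x) :
    IsGenerator G := by
  intro S
  obtain ⟨D, x, hx⟩ := hfree S
  obtain ⟨q, hq⟩ := hx.exists_hom (X := S) id
  obtain ⟨B, y, hy⟩ := hfree (Σ d : D, (q.functor.obj d ⟶ 𝟙_ S))
  obtain ⟨g, hg⟩ := hy.exists_hom (X := D) Sigma.fst
  replace hg := fun j => (hg j).some
  obtain ⟨ζ, hζ⟩ := hy.exists_track (f := g ≫ q) (g := 𝟙_ (B ⟶ S)) fun j =>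
    q.functor.map (hg j).hom ≫ j.2
  replace hζ : ∀ j, nullApp ζ (y j) = q.functor.map (hg j).hom ≫ j.2 := hζ
  obtain ⟨A, z, hz⟩ := hfree
    (Σ b : B, { v : g.functor.obj b ⟶ 𝟙_ D // q.functor.map v ≫ η q.functor = nullApp ζ b })
  obtain ⟨f, hf⟩ := hz.exists_hom (X := B) Sigma.fst
  replace hf := fun j => (hf j).some
  obtain ⟨α, hα⟩ := hz.exists_track (f := f ≫ g) (g := 𝟙_ (A ⟶ D)) fun j =>
    g.functor.map (hf j).hom ≫ j.2.1
  replace hα : ∀ j, nullApp α (z j) = g.functor.map (hf j).hom ≫ j.2.1 := hα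
  refine ⟨A, B, D, f, g, α, q, ζ, hz.isCoproductOfCopies hG, hy.isCoproductOfCopies hG,
    hx.isCoproductOfCopies hG, ?_⟩
  refine IsExact.isRelativeCokernel ⟨?_, ?_, ?_⟩ ?_
  · intro s
    obtain ⟨s, rfl⟩ := Pi0.exists_rep s
    exact ⟨Pi0.mk (x s), Pi0.mk_eq (hq s).some.hom⟩
  · intro d u
    exact ⟨y ⟨d, u⟩, (hg ⟨d, u⟩).hom, (hζ ⟨d, u⟩).symm⟩
  · intro b v hv
    exact ⟨z ⟨b, v, hv⟩, (hf ⟨b, v, hv⟩).hom, (hα ⟨b, v, hv⟩).symm⟩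
  -- Compatibility of α and ζ is an equality of tracks out of the free object A. On a generator it
  -- is the condition built into the index set of A.
  · refine hz.track_ext fun j => ?_
    have h : q.functor.map (nullApp α (z j)) ≫ η q.functor = nullApp ζ (f.functor.obj (z j)) := by
      rw [hα, q.functor.map_comp, Category.assoc, j.2.2]
      exact nullApp_nat ζ (hf j).hom
    exact h.trans ((Category.id_comp _).trans (Category.comp_id _)).symm

end SCGr

/-! ### The syntactic free symmetric categorical group -/

section

variable {𝒞 𝒟 : Type*} [Category 𝒞] [MonoidalCategory 𝒞] [Category 𝒟] [MonoidalCategory 𝒟]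
  {F G : 𝒞 ⥤ 𝒟} [F.Monoidal] [G.Monoidal]

open Functor.LaxMonoidal Functor.OplaxMonoidal

/-- The sum of morphisms between values of monoidal functors. -/
def addComp {a b : 𝒞} (f : F.obj a ⟶ G.obj a) (g : F.obj b ⟶ G.obj b) :
    F.obj (a ⊗ b) ⟶ G.obj (a ⊗ b) :=
  δ F a b ≫ (f ⊗ₘ g) ≫ μ G a b

lemma μ_addComp {a b : 𝒞} (f : F.obj a ⟶ G.obj a) (g : F.obj b ⟶ G.obj b) :
    μ F a b ≫ addComp f g = (f ⊗ₘ g) ≫ μ G a b := by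
  simp [addComp]

/-- Together with the lemmas on associativity, units, pairing and symmetry that follow, this
provides the inductive steps showing that components defined by recursion on formal expressions are
natural. -/
lemma addComp_nat {a b c d : 𝒞} {u : a ⟶ b} {v : c ⟶ d} {f : F.obj a ⟶ G.obj a}
    {f' : F.obj b ⟶ G.obj b} {g : F.obj c ⟶ G.obj c} {g' : F.obj d ⟶ G.obj d}
    (hf : F.map u ≫ f' = f ≫ G.map u) (hg : F.map v ≫ g' = g ≫ G.map v) :
    F.map (u ⊗ₘ v) ≫ addComp f' g' = addComp f g ≫ G.map (u ⊗ₘ v) := by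
  rw [addComp, addComp, Category.assoc, Category.assoc, ← μ_natural, ← δ_natural_assoc,
    tensorHom_comp_tensorHom_assoc, tensorHom_comp_tensorHom_assoc, hf, hg]

lemma addComp_assoc {a b c : 𝒞} (f : F.obj a ⟶ G.obj a) (g : F.obj b ⟶ G.obj b)
    (h : F.obj c ⟶ G.obj c) :
    F.map (α_ a b c).hom ≫ addComp f (addComp g h) =
      addComp (addComp f g) h ≫ G.map (α_ a b c).hom := by
  have e₁ : (addComp f g ⊗ₘ h) =
      δ F a b ▷ _ ≫ ((f ⊗ₘ g) ⊗ₘ h) ≫ μ G a b ▷ _ := by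
    rw [← tensorHom_id, ← tensorHom_id, tensorHom_comp_tensorHom, tensorHom_comp_tensorHom,
      Category.id_comp, Category.comp_id, addComp]
  have e₂ : (f ⊗ₘ addComp g h) =
      _ ◁ δ F b c ≫ (f ⊗ₘ (g ⊗ₘ h)) ≫ _ ◁ μ G b c := by
    rw [← id_tensorHom, ← id_tensorHom, tensorHom_comp_tensorHom, tensorHom_comp_tensorHom,
      Category.id_comp, Category.comp_id, addComp]
  rw [addComp, addComp.eq_def (addComp f g), e₁, e₂]
  simp only [Category.assoc]
  rw [Functor.LaxMonoidal.associativity, associator_naturality_assoc,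
    ← Functor.OplaxMonoidal.associativity_assoc]

lemma addComp_left {a : 𝒞} (f : F.obj a ⟶ G.obj a) :
    F.map (λ_ a).hom ≫ f = addComp (η F ≫ ε G) f ≫ G.map (λ_ a).hom := by
  have e : (η F ≫ ε G ⊗ₘ f) = η F ▷ _ ≫ (𝟙_ 𝒟 ◁ f) ≫ ε G ▷ _ := by
    rw [← tensorHom_id, ← id_tensorHom, ← tensorHom_id, tensorHom_comp_tensorHom,
      tensorHom_comp_tensorHom, Category.id_comp, Category.id_comp, Category.comp_id]
  rw [addComp, e]
  simp only [Category.assoc]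
  rw [← Functor.LaxMonoidal.left_unitality, leftUnitor_naturality,
    ← Functor.OplaxMonoidal.left_unitality_hom_assoc]

lemma addComp_right {a : 𝒞} (f : F.obj a ⟶ G.obj a) :
    F.map (ρ_ a).hom ≫ f = addComp f (η F ≫ ε G) ≫ G.map (ρ_ a).hom := by
  have e : (f ⊗ₘ η F ≫ ε G) = _ ◁ η F ≫ (f ▷ 𝟙_ 𝒟) ≫ _ ◁ ε G := by
    rw [← tensorHom_id, ← id_tensorHom, ← id_tensorHom, tensorHom_comp_tensorHom,
      tensorHom_comp_tensorHom, Category.id_comp, Category.id_comp, Category.comp_id]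
  rw [addComp, e]
  simp only [Category.assoc]
  rw [← Functor.LaxMonoidal.right_unitality, rightUnitor_naturality,
    ← Functor.OplaxMonoidal.right_unitality_hom_assoc]

/-- The component at an opposite is defined by `dualMap`, whose defining property `Compat` is
naturality along the pairing with the constraints moved to the other side. -/
lemma pair_nat {a b : 𝒞} (p : a ⊗ b ⟶ 𝟙_ 𝒞) {f : F.obj a ⟶ G.obj a} {g : F.obj b ⟶ G.obj b}
    (h : Compat (mapPairing F p) (mapPairing G p) f g) :
    F.map p ≫ η F ≫ ε G = addComp f g ≫ G.map p := by
  rw [Compat, mapPairing, mapPairing] at h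
  have := congr(δ F a b ≫ $h ≫ ε G)
  simp only [Category.assoc, Functor.Monoidal.η_ε, Functor.Monoidal.δ_μ_assoc,
    Category.comp_id] at this
  rw [addComp, Category.assoc, Category.assoc, this]

end

section

variable {𝒞 𝒟 : Type*} [Category 𝒞] [MonoidalCategory 𝒞] [SymmetricCategory 𝒞] [Category 𝒟]
  [MonoidalCategory 𝒟] [SymmetricCategory 𝒟] {F G : 𝒞 ⥤ 𝒟} [F.Braided] [G.Braided]

open Functor.LaxMonoidal Functor.OplaxMonoidal

lemma addComp_braiding {a b : 𝒞} (f : F.obj a ⟶ G.obj a) (g : F.obj b ⟶ G.obj b) :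
    F.map (β_ a b).hom ≫ addComp g f = addComp f g ≫ G.map (β_ a b).hom := by
  have h : F.map (β_ a b).hom ≫ δ F b a = δ F a b ≫ (β_ _ _).hom := by
    rw [← cancel_epi (μ F a b), Functor.LaxBraided.braided_assoc]
    simp
  rw [addComp, addComp, reassoc_of% h, ← BraidedCategory.braiding_naturality_assoc,
    Category.assoc, Category.assoc, Functor.LaxBraided.braided]

end

namespace SCGr

open Functor.LaxMonoidal Functor.OplaxMonoidal

/-- Formal sums and opposites of the elements of `I`. -/
inductive FreeObj (I : Type u) : Type u
  | of : I → FreeObj I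
  | zero : FreeObj I
  | add : FreeObj I → FreeObj I → FreeObj I
  | neg : FreeObj I → FreeObj I

/-- Formal morphisms between formal sums. -/
inductive FreeHom {I : Type u} : FreeObj I → FreeObj I → Type u
  | id (a) : FreeHom a a
  | comp {a b c} (f : FreeHom a b) (g : FreeHom b c) : FreeHom a c
  | inv {a b} (f : FreeHom a b) : FreeHom b a
  | tensor {a b c d} (f : FreeHom a b) (g : FreeHom c d) : FreeHom (.add a c) (.add b d)
  | assoc (a b c) : FreeHom (.add (.add a b) c) (.add a (.add b c))
  | left (a) : FreeHom (.add .zero a) a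
  | right (a) : FreeHom (.add a .zero) a
  | braid (a b) : FreeHom (.add a b) (.add b a)
  | pair (a) : FreeHom (.add a (.neg a)) .zero

section

variable {I : Type u} {X : SCGr.{u}} (v : I → X)

/-- The value of a formal sum. -/
def FreeObj.eval : FreeObj I → X
  | .of i => v i
  | .zero => 𝟙_ X
  | .add a b => a.eval ⊗ b.eval
  | .neg a => negObj a.eval

/-- The value of a formal morphism. -/
def FreeHom.eval : {a b : FreeObj I} → FreeHom a b → (a.eval v ⟶ b.eval v)
  | _, _, .id a => 𝟙 _
  | _, _, .comp f g => f.eval ≫ g.eval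
  | _, _, .inv f => CategoryTheory.inv f.eval
  | _, _, .tensor f g => f.eval ⊗ₘ g.eval
  | _, _, .assoc a b c => (α_ _ _ _).hom
  | _, _, .left a => (λ_ _).hom
  | _, _, .right a => (ρ_ _).hom
  | _, _, .braid a b => (β_ _ _).hom
  | _, _, .pair a => negPairing _

end

/-- Formal morphisms are identified when they have equal values in all symmetric categorical
groups. -/
def FreeHom.setoid {I : Type u} (a b : FreeObj I) : Setoid (FreeHom a b) where
  r f g := ∀ (X : SCGr.{u}) (v : I → X), f.eval v = g.eval v
  iseqv := ⟨fun _ _ _ => rfl, fun h X v => (h X v).symm, fun h h' X v => (h X v).trans (h' X v)⟩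

section

variable {I : Type u}

/-- No list of relations is needed: each law holds here because it holds after every evaluation, and
evaluation descends to classes by definition. The identification quantifies over all symmetric
categorical groups but is a proposition, so the arrows stay in the same universe. -/
instance : Category.{u} (FreeObj I) where
  Hom a b := Quotient (FreeHom.setoid a b)
  id a := Quotient.mk (FreeHom.setoid _ _) (.id a)
  comp := Quotient.map₂ .comp fun _ _ h _ _ h' X v => congr($(h X v) ≫ $(h' X v))
  id_comp := by
    rintro a b ⟨f⟩
    exact Quotient.sound fun X v => Category.id_comp _
  comp_id := by
    rintro a b ⟨f⟩
    exact Quotient.sound fun X v => Category.comp_id _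
  assoc := by
    rintro a b c d ⟨f⟩ ⟨g⟩ ⟨h⟩
    exact Quotient.sound fun X v => Category.assoc _ _ _

/-- The morphism represented by a formal morphism. -/
def FreeHom.mk {a b : FreeObj I} (f : FreeHom a b) : a ⟶ b := Quotient.mk (FreeHom.setoid _ _) f

lemma FreeHom.sound {a b : FreeObj I} {f g : FreeHom a b}
    (h : ∀ (X : SCGr.{u}) (v : I → X), f.eval v = g.eval v) : f.mk = g.mk := Quotient.sound h

lemma FreeHom.exists_rep {a b : FreeObj I} (f : a ⟶ b) : ∃ g : FreeHom a b, g.mk = f :=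
  Quotient.exists_rep f

/-- The isomorphism represented by a formal morphism. -/
def FreeHom.iso {a b : FreeObj I} (f : FreeHom a b) : a ≅ b where
  hom := f.mk
  inv := f.inv.mk
  hom_inv_id := FreeHom.sound (f := .comp f f.inv) (g := .id _) fun _ _ => IsIso.hom_inv_id _
  inv_hom_id := FreeHom.sound (f := .comp f.inv f) (g := .id _) fun _ _ => IsIso.inv_hom_id _

instance : IsGroupoid (FreeObj I) where
  all_isIso f := by
    obtain ⟨f, rfl⟩ := FreeHom.exists_rep f
    exact f.iso.isIso_hom

instance : MonoidalCategoryStruct (FreeObj I) where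
  tensorObj := .add
  tensorUnit := .zero
  tensorHom := Quotient.map₂ .tensor fun _ _ h _ _ h' X v => congr($(h X v) ⊗ₘ $(h' X v))
  whiskerLeft a _ _ := Quotient.map (.tensor (.id a)) fun _ _ h X v => congr(𝟙 _ ⊗ₘ $(h X v))
  whiskerRight {b c} f a := Quotient.map (sa := FreeHom.setoid b c)
    (sb := FreeHom.setoid (.add b a) (.add c a)) (fun f => .tensor f (.id a))
    (fun _ _ h X v => congr($(h X v) ⊗ₘ 𝟙 _)) f
  associator a b c := (FreeHom.assoc a b c).iso
  leftUnitor a := (FreeHom.left a).iso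
  rightUnitor a := (FreeHom.right a).iso

instance : MonoidalCategory (FreeObj I) :=
  MonoidalCategory.ofTensorHom
    (id_tensorHom_id := fun a b => FreeHom.sound fun X v => id_tensorHom_id _ _)
    (id_tensorHom := fun a b b' f => by
      obtain ⟨f, rfl⟩ := FreeHom.exists_rep f
      rfl)
    (tensorHom_id := fun f a => by
      obtain ⟨f, rfl⟩ := FreeHom.exists_rep f
      rfl)
    (tensorHom_comp_tensorHom := by
      rintro a b c a' b' c' ⟨f⟩ ⟨g⟩ ⟨h⟩ ⟨k⟩
      exact FreeHom.sound fun X v => tensorHom_comp_tensorHom _ _ _ _)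
    (associator_naturality := by
      rintro a b c a' b' c' ⟨f⟩ ⟨g⟩ ⟨h⟩
      exact FreeHom.sound fun X v => associator_naturality _ _ _)
    (leftUnitor_naturality := by
      rintro a b ⟨f⟩
      exact FreeHom.sound fun X v =>
        congr($(id_tensorHom _ _) ≫ (λ_ _).hom).trans (leftUnitor_naturality (f.eval v)))
    (rightUnitor_naturality := by
      rintro a b ⟨f⟩
      exact FreeHom.sound fun X v =>
        congr($(tensorHom_id _ _) ≫ (ρ_ _).hom).trans (rightUnitor_naturality (f.eval v)))
    (pentagon := fun a b c d => FreeHom.sound fun X v => by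
      have h := MonoidalCategory.pentagon (a.eval v) (b.eval v) (c.eval v) (d.eval v)
      rw [← tensorHom_id, ← id_tensorHom] at h
      exact h)
    (triangle := fun a b => FreeHom.sound fun X v => by
      have h := MonoidalCategory.triangle (a.eval v) (b.eval v)
      rw [← tensorHom_id, ← id_tensorHom] at h
      exact h)

instance : BraidedCategory (FreeObj I) where
  braiding a b := (FreeHom.braid a b).iso
  braiding_naturality_right a := by
    rintro b c ⟨f⟩
    exact FreeHom.sound fun X v => by
      have h := BraidedCategory.braiding_naturality_right (a.eval v) (f.eval v)
      rw [← tensorHom_id, ← id_tensorHom] at h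
      exact h
  braiding_naturality_left := by
    rintro a b ⟨f⟩ c
    exact FreeHom.sound fun X v => by
      have h := BraidedCategory.braiding_naturality_left (f.eval v) (c.eval v)
      rw [← tensorHom_id, ← id_tensorHom] at h
      exact h
  hexagon_forward a b c := FreeHom.sound fun X v => by
    have h := BraidedCategory.hexagon_forward (a.eval v) (b.eval v) (c.eval v)
    rw [← tensorHom_id, ← id_tensorHom] at h
    exact h
  hexagon_reverse a b c := FreeHom.sound fun X v => by
    have h := BraidedCategory.hexagon_reverse (a.eval v) (b.eval v) (c.eval v)
    rw [← tensorHom_id, ← id_tensorHom] at h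
    simp only [← IsIso.Iso.inv_hom] at h
    exact h

instance : SymmetricCategory (FreeObj I) where
  symmetry _ _ := FreeHom.sound fun _ _ => SymmetricCategory.symmetry _ _

end

/-- The free symmetric categorical group on a set. -/
def free (I : Type u) : SCGr.{u} where
  carrier := FreeObj I
  isEquivalence_tensorLeft a := isEquivalence_tensorLeft_of_iso (FreeHom.pair a).iso

section

variable {I : Type u} {X : SCGr.{u}}

/-- The morphism from the free symmetric categorical group extending a given family. -/
def free.lift (v : I → X) : free I ⟶ X :=
  mkHom (A := free I)
    { obj := FreeObj.eval v
      map := Quotient.lift (FreeHom.eval v) fun _ _ h => h X v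
      map_id := fun _ => rfl
      map_comp := by
        rintro a b c ⟨f⟩ ⟨g⟩
        rfl }
    (fun a b => 𝟙 (a.eval v ⊗ b.eval v))
    (by
      rintro a b c d ⟨f⟩ ⟨g⟩
      exact (Category.comp_id _).trans (Category.id_comp _).symm)
    (fun a b c => by
      change 𝟙 (a.eval v ⊗ b.eval v) ▷ c.eval v ≫ 𝟙 ((a.eval v ⊗ b.eval v) ⊗ c.eval v) ≫
        (α_ _ _ _).hom = (α_ _ _ _).hom ≫ a.eval v ◁ 𝟙 (b.eval v ⊗ c.eval v) ≫ 𝟙 _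
      simp)
    (fun a b => (Category.id_comp _).trans (Category.comp_id _).symm)

/-- The components of a track extending a given family. -/
def free.trackApp {F G : free I ⟶ X}
    (w : ∀ i, F.functor.obj (.of i) ⟶ G.functor.obj (.of i)) :
    ∀ a : FreeObj I, F.functor.obj a ⟶ G.functor.obj a
  | .of i => w i
  | .zero => η F.functor ≫ ε G.functor
  | .add a b => addComp (trackApp w a) (trackApp w b)
  | .neg a => dualMap (mapPairing F.functor (FreeHom.pair a).mk)
      (mapPairing G.functor (FreeHom.pair a).mk) (trackApp w a)

variable {F G : free I ⟶ X} (w : ∀ i, F.functor.obj (.of i) ⟶ G.functor.obj (.of i))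

/-- Induction runs over formal arrows rather than their classes. The components depend only on
objects, so naturality along one representative is naturality along its class. -/
lemma free.trackApp_nat {a b : FreeObj I} (f : FreeHom a b) :
    F.functor.map f.mk ≫ trackApp w b = trackApp w a ≫ G.functor.map f.mk := by
  induction f with
  | id a =>
    exact congr($(F.functor.map_id a) ≫ _).trans ((Category.id_comp _).trans
      ((Category.comp_id _).symm.trans congr(_ ≫ $((G.functor.map_id a).symm))))
  | comp f g hf hg =>
    exact congr($(F.functor.map_comp f.mk g.mk) ≫ _).trans ((Category.assoc _ _ _).trans
      (congr(_ ≫ $hg).trans ((Category.assoc _ _ _).symm.trans (congr($hf ≫ _).trans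
        ((Category.assoc _ _ _).trans congr(_ ≫ $((G.functor.map_comp f.mk g.mk).symm)))))))
  | inv f hf =>
    have h (H : free I ⟶ X) :
        H.functor.map (FreeHom.inv f).mk = CategoryTheory.inv (H.functor.map f.mk) :=
      IsIso.eq_inv_of_hom_inv_id ((H.functor.map_comp _ _).symm.trans
        (congr(H.functor.map $(f.iso.hom_inv_id)).trans (H.functor.map_id _)))
    rw [h F, h G, IsIso.inv_comp_eq, ← Category.assoc, IsIso.eq_comp_inv, hf]
  | tensor f g hf hg => exact addComp_nat hf hg
  | assoc a b c => exact addComp_assoc _ _ _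
  | left a => exact addComp_left _
  | right a => exact addComp_right _
  | braid a b => exact addComp_braiding _ _
  | pair a =>
    exact pair_nat (𝒞 := free I) (F := F.functor) (G := G.functor) (FreeHom.pair a).mk
      (dualMap_compat _ _ _)

/-- The track extending a given family. -/
def free.track : F ⟶ G :=
  mkTrackOfTensor (free.trackApp w)
    (fun {a b} f => by
      obtain ⟨f, rfl⟩ := FreeHom.exists_rep f
      exact trackApp_nat w f)
    (fun a b => μ_addComp _ _)

/-- The axioms of a track determine its components at zero and at sums. At an opposite the component
is determined because it is compatible with the pairing and such arrows are unique
(`Compat.unique`). -/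
lemma free.track_ext {s t : F ⟶ G}
    (h : ∀ i, s.nat.app (FreeObj.of i) = t.nat.app (FreeObj.of i)) : s = t := by
  refine SCGr.track_ext fun a => ?_
  induction a with
  | of i => exact h i
  | zero =>
    exact (cancel_epi (ε F.functor)).1 (s.isMonoidal.unit.trans t.isMonoidal.unit.symm)
  | add a b ha hb =>
    exact (cancel_epi (μ F.functor a b)).1 ((s.isMonoidal.tensor a b).trans
      (congr(($ha ⊗ₘ $hb) ≫ μ G.functor a b).trans (t.isMonoidal.tensor a b).symm))
  | neg a ha =>
    exact (compat_nat s.nat (FreeHom.pair a).mk).unique (compat_nat t.nat (FreeHom.pair a).mk) ha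

end

theorem isFree_of (I : Type u) : IsFree (C := SCGr.{u}) (Q := free I) FreeObj.of := fun _ =>
  { faithful := ⟨fun h => free.track_ext fun i => congrFun h i⟩
    full := ⟨fun w => ⟨free.track w, rfl⟩⟩
    essSurj := ⟨fun v => ⟨free.lift v, ⟨Iso.refl _⟩⟩⟩ }

end SCGr

/-! ### Signs, multiples of an object, and morphisms out of Φ -/

section

variable {𝒞 : Type*} [Category 𝒞] [MonoidalCategory 𝒞]

/-- The action of endomorphisms of the unit on an object. -/
def unitAct (φ : 𝟙_ 𝒞 ⟶ 𝟙_ 𝒞) (c : 𝒞) : c ⟶ c := (λ_ c).inv ≫ φ ▷ c ≫ (λ_ c).hom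

lemma unitAct_nat (φ : 𝟙_ 𝒞 ⟶ 𝟙_ 𝒞) {c d : 𝒞} (f : c ⟶ d) :
    unitAct φ c ≫ f = f ≫ unitAct φ d := by
  simp only [unitAct, Category.assoc]
  rw [← leftUnitor_naturality, ← whisker_exchange_assoc, leftUnitor_inv_naturality_assoc]

lemma unitAct_id (c : 𝒞) : unitAct (𝟙 (𝟙_ 𝒞)) c = 𝟙 c := by simp [unitAct]

lemma unitAct_comp (φ ψ : 𝟙_ 𝒞 ⟶ 𝟙_ 𝒞) (c : 𝒞) :
    unitAct (φ ≫ ψ) c = unitAct φ c ≫ unitAct ψ c := by simp [unitAct]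

lemma unitAct_whiskerRight (φ : 𝟙_ 𝒞 ⟶ 𝟙_ 𝒞) (c d : 𝒞) :
    unitAct φ c ▷ d = unitAct φ (c ⊗ d) := by
  simp [unitAct]

lemma whiskerLeft_unitAct [SymmetricCategory 𝒞] (φ : 𝟙_ 𝒞 ⟶ 𝟙_ 𝒞) (c d : 𝒞) :
    c ◁ unitAct φ d = unitAct φ (c ⊗ d) := by
  rw [← cancel_mono (β_ c d).hom, BraidedCategory.braiding_naturality_right,
    unitAct_whiskerRight, unitAct_nat]

end

namespace SCGr

variable {X : SCGr.{u}}

/-- Adding c is an equivalence, hence bijective on arrows. This surjectivity, with the injectivity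
below, identifies the endomorphisms of every object with those of the unit, so a sign can be moved
between objects. -/
lemma exists_unitAct {c : X} (f : c ⟶ c) : ∃ φ, unitAct φ c = f := by
  have h : (tensorRight c).IsEquivalence :=
    Functor.isEquivalence_of_iso
      (NatIso.ofComponents (fun d => β_ c d) fun f => by simp : tensorLeft c ≅ tensorRight c)
  obtain ⟨φ, hφ⟩ := (tensorRight c).map_surjective ((λ_ c).hom ≫ f ≫ (λ_ c).inv)
  refine ⟨φ, ?_⟩
  change φ ▷ c = _ at hφ
  simp [unitAct, hφ]

lemma unitAct_injective (c : X) {φ ψ : 𝟙_ X ⟶ 𝟙_ X} (h : unitAct φ c = unitAct ψ c) : φ = ψ := by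
  have e : (tensorRight c).IsEquivalence :=
    Functor.isEquivalence_of_iso
      (NatIso.ofComponents (fun d => β_ c d) fun f => by simp : tensorLeft c ≅ tensorRight c)
  refine (tensorRight c).map_injective ?_
  exact (cancel_mono (λ_ c).hom).1 ((cancel_epi (λ_ c).inv).1 h)

/-- The automorphism of the unit acting on `x ⊗ x` as the symmetry. -/
def symSign (x : X) : 𝟙_ X ⟶ 𝟙_ X := (exists_unitAct (β_ x x).hom).choose

lemma unitAct_symSign (x : X) : unitAct (symSign x) (x ⊗ x) = (β_ x x).hom :=
  (exists_unitAct (β_ x x).hom).choose_spec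

/-- The powers of the sign of `x`. -/
def sgnPow (x : X) (a : ZMod 2) : 𝟙_ X ⟶ 𝟙_ X := if a = 0 then 𝟙 _ else symSign x

lemma sgnPow_zero (x : X) : sgnPow x 0 = 𝟙 _ := if_pos rfl

lemma sgnPow_one (x : X) : sgnPow x 1 = symSign x := if_neg (by decide)

/-- The symmetry of x + x squares to the identity, so exponents matter only modulo two. -/
lemma sgnPow_add (x : X) (a b : ZMod 2) : sgnPow x (a + b) = sgnPow x a ≫ sgnPow x b := by
  have h : symSign x ≫ symSign x = 𝟙 _ := by
    apply unitAct_injective (x ⊗ x)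
    rw [unitAct_comp, unitAct_symSign, unitAct_id]
    exact SymmetricCategory.symmetry _ _
  have h' : (1 + 1 : ZMod 2) = 0 := by decide
  have hc : ∀ c : ZMod 2, c = 0 ∨ c = 1 := by decide
  obtain rfl | rfl := hc a
  · rw [zero_add, sgnPow_zero, Category.id_comp]
  obtain rfl | rfl := hc b
  · rw [add_zero, sgnPow_zero, Category.comp_id]
  · rw [h', sgnPow_zero, sgnPow_one, h]

/-- The action of signs. -/
abbrev sgnAct (x : X) (a : ZMod 2) (c : X) : c ⟶ c := unitAct (sgnPow x a) c

/-- A sequence of objects with isomorphisms from the sum of `x` and each object to the next. -/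
structure Tower (x : X) where
  obj : ℤ → X
  step (n : ℤ) : x ⊗ obj n ⟶ obj (n + 1)

namespace Tower

variable {x : X}

/-- Maps of towers. -/
def IsMap (A B : Tower x) (f : ∀ n, A.obj n ⟶ B.obj n) : Prop :=
  ∀ n, A.step n ≫ f (n + 1) = x ◁ f n ≫ B.step n

lemma IsMap.comp {A B C : Tower x} {f : ∀ n, A.obj n ⟶ B.obj n} {g : ∀ n, B.obj n ⟶ C.obj n}
    (hf : IsMap A B f) (hg : IsMap B C g) : IsMap A C fun n => f n ≫ g n := fun n => by
  rw [← Category.assoc, hf, Category.assoc, hg, MonoidalCategory.whiskerLeft_comp, Category.assoc]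

/-- Forwards the steps are invertible, and backwards adding x is faithful, so integer induction
works in both directions. The coherence laws for multiples below are proved by showing that both
sides are tower maps in n and comparing them at n = 0. -/
lemma IsMap.ext {A B : Tower x} {f g : ∀ n, A.obj n ⟶ B.obj n} (hf : IsMap A B f)
    (hg : IsMap A B g) (h : f 0 = g 0) (n : ℤ) : f n = g n := by
  have hs (n : ℤ) (h : f n = g n) : f (n + 1) = g (n + 1) := by
    rw [← cancel_epi (A.step n), hf, hg, h]
  have hp (n : ℤ) (h : f (n + 1) = g (n + 1)) : f n = g n := by
    have e := hf n
    rw [h, hg, cancel_mono] at e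
    exact (tensorLeft x).map_injective e.symm
  induction n with
  | zero => exact h
  | succ n ih => exact hs _ ih
  | pred n ih =>
    refine hp _ ?_
    rw [sub_add_cancel]
    exact ih

/-- The nonnegative part of the map of towers with a given value at zero. -/
def extendNat (A B : Tower x) (f : A.obj 0 ⟶ B.obj 0) : ∀ n : ℕ, A.obj (.ofNat n) ⟶ B.obj (.ofNat n)
  | 0 => f
  | n + 1 => inv (A.step (.ofNat n)) ≫ x ◁ extendNat A B f n ≫ B.step (.ofNat n)

/-- The negative part of the map of towers with a given value at zero. -/
def extendNeg (A B : Tower x) (f : A.obj 0 ⟶ B.obj 0) :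
    ∀ n : ℕ, A.obj (.negSucc n) ⟶ B.obj (.negSucc n)
  | 0 => (tensorLeft x).preimage (A.step (.negSucc 0) ≫ f ≫ inv (B.step (.negSucc 0)))
  | n + 1 => (tensorLeft x).preimage
      (A.step (.negSucc (n + 1)) ≫ extendNeg A B f n ≫ inv (B.step (.negSucc (n + 1))))

/-- The map of towers with a given value at zero. -/
def extend (A B : Tower x) (f : A.obj 0 ⟶ B.obj 0) : ∀ n, A.obj n ⟶ B.obj n
  | .ofNat n => extendNat A B f n
  | .negSucc n => extendNeg A B f n

lemma isMap_extend (A B : Tower x) (f : A.obj 0 ⟶ B.obj 0) : IsMap A B (extend A B f) := by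
  have aux {p q r s : X} (a : x ⊗ p ⟶ q) (b : x ⊗ r ⟶ s) (g : q ⟶ s) :
      a ≫ g = x ◁ (tensorLeft x).preimage (X := p) (Y := r) (a ≫ g ≫ inv b) ≫ b := by
    have h : x ◁ (tensorLeft x).preimage (X := p) (Y := r) (a ≫ g ≫ inv b) = a ≫ g ≫ inv b :=
      (tensorLeft x).map_preimage _
    rw [h, Category.assoc, Category.assoc, IsIso.inv_hom_id, Category.comp_id]
  -- The successor of `.negSucc 0` is 0 and that of `.negSucc (n + 1)` is `.negSucc n`. The two
  -- negative cases therefore correspond to the two clauses of `extendNeg`, each solved by a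
  -- preimage under adding x.
  rintro (n | _ | n)
  · exact IsIso.hom_inv_id_assoc (A.step (.ofNat n)) _
  · exact aux _ _ _
  · exact aux _ _ _

/-- The morphism between equal terms of a tower. -/
def cast (A : Tower x) {n m : ℤ} (h : n = m) : A.obj n ⟶ A.obj m := eqToHom (congrArg A.obj h)

lemma cast_rfl (A : Tower x) (n : ℤ) : A.cast (rfl : n = n) = 𝟙 _ := rfl

lemma cast_cast (A : Tower x) {n m k : ℤ} (h : n = m) (h' : m = k) :
    A.cast h ≫ A.cast h' = A.cast (h.trans h') := eqToHom_trans _ _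

lemma cast_nat {A B : Tower x} (f : ∀ n, A.obj n ⟶ B.obj n) {n m : ℤ} (h : n = m) :
    A.cast h ≫ f m = f n ≫ B.cast h := by
  subst h
  rw [cast_rfl, cast_rfl, Category.id_comp, Category.comp_id]

lemma step_cast (A : Tower x) {n m k : ℤ} (h : n = m) (hn : n + 1 = k) (hm : m + 1 = k) :
    A.step n ≫ A.cast hn = x ◁ A.cast h ≫ A.step m ≫ A.cast hm := by
  subst h
  rw [cast_rfl, MonoidalCategory.whiskerLeft_id, Category.id_comp]

/-- The sum of a tower and an object. -/
def sum (A : Tower x) (c : X) : Tower x where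
  obj n := A.obj n ⊗ c
  step n := (α_ _ _ _).inv ≫ A.step n ▷ c

/-- The tower with shifted index. -/
def shift (A : Tower x) (k : ℤ) : Tower x where
  obj n := A.obj (n + k)
  step n := A.step (n + k) ≫ A.cast (by ring)

lemma IsMap.whiskerRight {A B : Tower x} {f : ∀ n, A.obj n ⟶ B.obj n} (hf : IsMap A B f) (c : X) :
    IsMap (A.sum c) (B.sum c) fun n => f n ▷ c := fun n => by
  have h := congr((α_ _ _ _).inv ≫ $(hf n) ▷ c)
  simp only [comp_whiskerRight] at h
  refine (Category.assoc _ _ _).trans (h.trans ?_)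
  simp [sum]

lemma isMap_whiskerLeft (A : Tower x) {c d : X} (f : c ⟶ d) :
    IsMap (A.sum c) (A.sum d) fun n => A.obj n ◁ f := fun n => by
  change ((α_ _ _ _).inv ≫ A.step n ▷ c) ≫ A.obj (n + 1) ◁ f =
    x ◁ A.obj n ◁ f ≫ (α_ _ _ _).inv ≫ A.step n ▷ d
  rw [Category.assoc, ← whisker_exchange]
  simp

lemma IsMap.shift {A B : Tower x} {f : ∀ n, A.obj n ⟶ B.obj n} (hf : IsMap A B f) (k : ℤ) :
    IsMap (A.shift k) (B.shift k) fun n => f (n + k) := fun n => by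
  change (A.step (n + k) ≫ A.cast _) ≫ f (n + 1 + k) = x ◁ f (n + k) ≫ B.step (n + k) ≫ B.cast _
  rw [Category.assoc, cast_nat f, reassoc_of% (hf (n + k))]

lemma isMap_sum_shift (A : Tower x) (c : X) (k : ℤ) :
    IsMap ((A.shift k).sum c) ((A.sum c).shift k) fun _ => 𝟙 _ := fun n => by
  have h (n m : ℤ) (e : n = m) : A.cast e ▷ c = (A.sum c).cast e := by
    subst e
    simp [cast_rfl, sum]
  simp [sum, shift, h]

lemma isMap_shift_shift (A : Tower x) (k l : ℤ) :
    IsMap ((A.shift k).shift l) (A.shift (l + k)) fun n => A.cast (by ring) := fun n => by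
  have h (n m : ℤ) (e : n = m) : (A.shift k).cast e = A.cast (congrArg (· + k) e) := by
    subst e
    rfl
  have e {p q r : ℤ} (h₁ : n + l + k + 1 = p) (h₂ : p = q) (h₃ : q = r) (h₄ : n + (l + k) + 1 = r)
      (h₅ : n + l + k = n + (l + k)) :
      ((A.step (n + l + k) ≫ A.cast h₁) ≫ A.cast h₂) ≫ A.cast h₃ =
        x ◁ A.cast h₅ ≫ A.step (n + (l + k)) ≫ A.cast h₄ := by
    rw [Category.assoc, Category.assoc, cast_cast, cast_cast, step_cast]
  change ((A.step (n + l + k) ≫ A.cast _) ≫ (A.shift k).cast _) ≫ A.cast _ = _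
  rw [h]
  exact e _ _ _ _ _

lemma isMap_assoc (A : Tower x) (c d : X) :
    IsMap ((A.sum c).sum d) (A.sum (c ⊗ d)) fun n => (α_ (A.obj n) c d).hom := fun n => by
  simp [sum]

/-- A family failing to be a tower map by the same k signs at every step is corrected by nk signs at
level n. The exponents match because k + (n + 1)k and nk agree modulo two. -/
lemma isMap_sgnAct {A B : Tower x} {f : ∀ n, A.obj n ⟶ B.obj n} {k : ℤ}
    (hf : ∀ n, A.step n ≫ f (n + 1) = (x ◁ f n ≫ B.step n) ≫ sgnAct x k _) :
    IsMap A B fun n => f n ≫ sgnAct x (n * k : ℤ) _ := fun n => by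
  have h : (k : ZMod 2) + ((n + 1) * k : ℤ) = (n * k : ℤ) := by
    have h₂ : (2 : ZMod 2) = 0 := by decide
    push_cast
    linear_combination (k : ZMod 2) * h₂
  rw [MonoidalCategory.whiskerLeft_comp, whiskerLeft_unitAct, Category.assoc, unitAct_nat,
    reassoc_of% (hf n), ← unitAct_comp, ← sgnPow_add, h]

variable (x)

/-- The nonnegative multiples of `x`. -/
def mulNat : ℕ → X
  | 0 => 𝟙_ X
  | n + 1 => x ⊗ mulNat n

/-- The negative multiples of `x`. -/
def mulNeg : ℕ → X
  | 0 => (tensorLeft x).objPreimage (𝟙_ X)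
  | n + 1 => (tensorLeft x).objPreimage (mulNeg n)

/-- The tower of multiples of `x`. -/
def mul : Tower x where
  obj
    | .ofNat n => mulNat x n
    | .negSucc n => mulNeg x n
  step
    | .ofNat n => 𝟙 (x ⊗ mulNat x n)
    | .negSucc 0 => ((tensorLeft x).objObjPreimageIso (𝟙_ X)).hom
    | .negSucc (n + 1) => ((tensorLeft x).objObjPreimageIso (mulNeg x n)).hom

/-- The additivity constraint of multiples of `x`. -/
def mulAdd (m : ℤ) : ∀ n, (mul x).obj n ⊗ (mul x).obj m ⟶ (mul x).obj (n + m) :=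
  extend ((mul x).sum ((mul x).obj m)) ((mul x).shift m)
    ((λ_ ((mul x).obj m)).hom ≫ (mul x).cast (zero_add m).symm)

lemma isMap_mulAdd (m : ℤ) :
    IsMap ((mul x).sum ((mul x).obj m)) ((mul x).shift m) (mulAdd x m) := isMap_extend _ _ _

lemma mulAdd_step (n m : ℤ) : (mul x).step n ▷ (mul x).obj m ≫ mulAdd x m (n + 1) =
    (α_ _ _ _).hom ≫ x ◁ mulAdd x m n ≫ (mul x).step (n + m) ≫ (mul x).cast (by ring) := by
  rw [← cancel_epi (α_ _ _ _).inv, Iso.inv_hom_id_assoc]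
  exact (Category.assoc _ _ _).symm.trans (isMap_mulAdd x m n)

lemma mulAdd_cast_left {n n' : ℤ} (h : n = n') (m : ℤ) :
    (mul x).cast h ▷ (mul x).obj m ≫ mulAdd x m n' =
      mulAdd x m n ≫ (mul x).cast (congrArg (· + m) h) := by
  subst h
  simp [cast_rfl]

lemma mulAdd_cast_right (n : ℤ) {m m' : ℤ} (h : m = m') :
    (mul x).obj n ◁ (mul x).cast h ≫ mulAdd x m' n =
      mulAdd x m n ≫ (mul x).cast (congrArg (n + ·) h) := by
  subst h
  simp [cast_rfl]

/-- With m and k fixed, both sides are composites of tower maps in n. At n = 0 the law only involves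
unitors. -/
lemma mulAdd_assoc (n m k : ℤ) : mulAdd x m n ▷ (mul x).obj k ≫ mulAdd x k (n + m) ≫
      (mul x).cast (add_assoc n m k) =
    (α_ _ _ _).hom ≫ (mul x).obj n ◁ mulAdd x k m ≫ mulAdd x (m + k) n := by
  have h₁ := (((isMap_mulAdd x m).whiskerRight ((mul x).obj k)).comp
    (isMap_sum_shift (mul x) ((mul x).obj k) m)).comp
    (((isMap_mulAdd x k).shift m).comp (isMap_shift_shift (mul x) k m))
  have h₂ := (isMap_assoc (mul x) ((mul x).obj m) ((mul x).obj k)).comp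
    ((isMap_whiskerLeft (mul x) (mulAdd x k m)).comp (isMap_mulAdd x (m + k)))
  have aux {a b c d e : X} (i : a ⟶ b) (u : b ⊗ c ⟶ e) (v : a ⊗ c ⟶ d) (w : d ⟶ e)
      (h : i ▷ c ≫ u = v ≫ w) :
      ((λ_ a).hom ≫ i) ▷ c ≫ u = (α_ (𝟙_ X) a c).hom ≫ 𝟙_ X ◁ v ≫ (λ_ d).hom ≫ w := by
    rw [comp_whiskerRight, Category.assoc, h, leftUnitor_naturality_assoc,
      leftUnitor_tensor_hom_assoc, Iso.hom_inv_id_assoc]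
  have h := h₁.ext h₂ ?_ n
  · exact (congr($((Category.comp_id _).symm) ≫ _)).trans h
  · change (mulAdd x m 0 ▷ _ ≫ 𝟙 _) ≫ mulAdd x k (0 + m) ≫ (mul x).cast _ =
      (α_ (𝟙_ X) _ _).hom ≫ 𝟙_ X ◁ mulAdd x k m ≫ mulAdd x (m + k) 0
    rw [Category.comp_id]
    refine aux _ _ _ _ ?_
    rw [reassoc_of% (mulAdd_cast_left x (zero_add m).symm k), cast_cast]

/-- The constraint is defined by recursion on its left index, so its value at zero on the left is
built in. On the right it has to be found by comparing tower maps. -/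
lemma mulAdd_zero_right (n : ℤ) : mulAdd x 0 n =
    (ρ_ ((mul x).obj n)).hom ≫ (mul x).cast (add_zero n).symm := by
  have h : IsMap ((mul x).sum ((mul x).obj 0)) ((mul x).shift 0)
      fun n => (ρ_ ((mul x).obj n)).hom ≫ (mul x).cast (add_zero n).symm := fun n => by
    change ((α_ _ _ _).inv ≫ (mul x).step n ▷ 𝟙_ X) ≫ (ρ_ ((mul x).obj (n + 1))).hom ≫
      (mul x).cast _ = x ◁ ((ρ_ ((mul x).obj n)).hom ≫ (mul x).cast _) ≫
        (mul x).step (n + 0) ≫ (mul x).cast _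
    rw [Category.assoc, rightUnitor_naturality_assoc, MonoidalCategory.whiskerLeft_comp,
      Category.assoc, ← step_cast (mul x) (add_zero n).symm (add_zero _).symm,
        rightUnitor_tensor_hom_assoc]
    simp
  refine (isMap_mulAdd x 0).ext h ?_ n
  exact congr($(unitors_equal (C := X)) ≫ _)

/-- A summand x splits off the left index without a sign (`mulAdd_step`). Splitting it off the right
index moves it past n copies of x, and each crossing contributes one sign. -/
lemma mulAdd_step_right (n m : ℤ) : (mul x).obj n ◁ (mul x).step m ≫ mulAdd x (m + 1) n =
    ((α_ _ _ _).inv ≫ (β_ _ x).hom ▷ (mul x).obj m ≫ (α_ _ _ _).hom ≫ x ◁ mulAdd x m n ≫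
      (mul x).step (n + m) ≫ (mul x).cast (add_assoc n m 1)) ≫ sgnAct x n _ := by
  have h₁ := (isMap_whiskerLeft (mul x) ((mul x).step m)).comp (isMap_mulAdd x (m + 1))
  have h₂ := isMap_sgnAct (A := (mul x).sum (x ⊗ (mul x).obj m)) (B := (mul x).shift (m + 1))
    (f := fun n => (α_ _ _ _).inv ≫ (β_ _ x).hom ▷ (mul x).obj m ≫ (α_ _ _ _).hom ≫
      x ◁ mulAdd x m n ≫ (mul x).step (n + m) ≫ (mul x).cast (add_assoc n m 1)) (k := 1) ?_
  · have h := h₁.ext h₂ ?_ n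
    · rw [mul_one] at h
      exact h
    · have aux {b b' c d e : X} (s : x ⊗ b ⟶ c) (w : c ⟶ e) (i : b ⟶ b') (s' : x ⊗ b' ⟶ d)
          (j : d ⟶ e) (h : s ≫ w = x ◁ i ≫ s' ≫ j) : 𝟙_ X ◁ s ≫ (λ_ c).hom ≫ w =
            ((α_ _ _ _).inv ≫ (β_ _ x).hom ▷ b ≫ (α_ _ _ _).hom ≫ x ◁ ((λ_ b).hom ≫ i) ≫
              s' ≫ j) ≫ sgnAct x (0 * 1 : ℤ) _ := by
        rw [zero_mul, Int.cast_zero, sgnAct, sgnPow_zero, unitAct_id, Category.comp_id,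
          leftUnitor_naturality_assoc, h]
        simp
      refine aux _ _ _ _ _ ?_
      exact step_cast _ _ _ _
  · intro n
    have aux {a a' b c d e f g : X} (s : x ⊗ a ⟶ a') (u : a' ⊗ b ⟶ c) (v : x ⊗ c ⟶ d)
        (u' : a ⊗ b ⟶ e) (v' : x ⊗ e ⟶ f) (w : f ⟶ c) (w' : f ⟶ g) (v'' : x ⊗ g ⟶ d)
        (h : s ▷ b ≫ u = (α_ _ _ _).hom ≫ x ◁ u' ≫ v' ≫ w) (h' : x ◁ w ≫ v = x ◁ w' ≫ v'') :
        ((α_ _ _ _).inv ≫ s ▷ (x ⊗ b)) ≫ (α_ _ _ _).inv ≫ (β_ _ x).hom ▷ b ≫ (α_ _ _ _).hom ≫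
          x ◁ u ≫ v = (x ◁ ((α_ _ _ _).inv ≫ (β_ _ x).hom ▷ b ≫ (α_ _ _ _).hom ≫ x ◁ u' ≫ v' ≫ w') ≫
            v'') ≫ sgnAct x (1 : ℤ) d := by
      -- The hexagon replaces the crossing of x with x + a by the crossing of x with a and that of x
      -- with x. The latter is one sign acting on the whole object, so the uncorrected family fails
      -- by exactly one sign per step.
      have e₁ : sgnAct x (1 : ℤ) (x ⊗ x ⊗ a ⊗ b) =
          (α_ _ _ _).inv ≫ (β_ x x).hom ▷ (a ⊗ b) ≫ (α_ _ _ _).hom := by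
        rw [Int.cast_one, sgnAct, sgnPow_one, ← unitAct_symSign, unitAct_whiskerRight, unitAct_nat,
          Iso.inv_hom_id_assoc]
      have e₂ : (α_ x a (x ⊗ b)).inv ≫ (α_ (x ⊗ a) x b).inv ≫ (β_ (x ⊗ a) x).hom ▷ b ≫
          (α_ x (x ⊗ a) b).hom ≫ x ◁ (α_ x a b).hom =
          x ◁ ((α_ a x b).inv ≫ (β_ a x).hom ▷ b ≫ (α_ x a b).hom) ≫
            sgnAct x (1 : ℤ) (x ⊗ x ⊗ a ⊗ b) := by
        rw [e₁, BraidedCategory.braiding_tensor_left_hom]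
        monoidal
      have e₃ : s ▷ (x ⊗ b) ≫ (α_ _ _ _).inv ≫ (β_ _ x).hom ▷ b ≫ (α_ _ _ _).hom ≫ x ◁ u =
          (α_ (x ⊗ a) x b).inv ≫ (β_ (x ⊗ a) x).hom ▷ b ≫
          (α_ x (x ⊗ a) b).hom ≫ x ◁ (s ▷ b ≫ u) := by
        rw [associator_inv_naturality_left_assoc, ← comp_whiskerRight_assoc,
          BraidedCategory.braiding_naturality_left]
        simp
      rw [Category.assoc, reassoc_of% e₃, h, MonoidalCategory.whiskerLeft_comp,
        MonoidalCategory.whiskerLeft_comp, MonoidalCategory.whiskerLeft_comp]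
      simp only [Category.assoc]
      rw [reassoc_of% e₂, h', unitAct_nat]
      simp only [MonoidalCategory.whiskerLeft_comp, Category.assoc]
    refine aux _ _ _ _ _ _ _ _ (mulAdd_step x n m) ?_
    exact (step_cast (mul x) _ (show n + m + 1 + 1 = n + 1 + (m + 1) by ring) _).symm.trans
      (step_cast _ _ _ _)

/-- The additivity constraint of multiples is symmetric up to a sign. -/
lemma braiding_mulAdd (n m : ℤ) : mulAdd x m n =
    ((β_ _ _).hom ≫ mulAdd x n m ≫ (mul x).cast (add_comm m n)) ≫ sgnAct x (n * m : ℤ) _ := by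
  -- With m fixed, passing from n to n + 1 moves one x past m copies of x. By `mulAdd_step_right`
  -- this costs m signs per step, hence nm signs altogether.
  have h := isMap_sgnAct (A := (mul x).sum ((mul x).obj m)) (B := (mul x).shift m)
    (f := fun n => (β_ _ _).hom ≫ mulAdd x n m ≫ (mul x).cast (add_comm m n)) (k := m) ?_
  · refine (isMap_mulAdd x m).ext h ?_ n
    have aux {b c d : X} (i : b ⟶ c) (j : c ⟶ d) :
        (λ_ b).hom ≫ i ≫ j = ((β_ _ _).hom ≫ ((ρ_ b).hom ≫ i) ≫ j) ≫ sgnAct x (0 * m : ℤ) _ := by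
      rw [zero_mul, Int.cast_zero, sgnAct, sgnPow_zero, unitAct_id, Category.comp_id]
      simp
    refine Eq.trans ?_ ((aux ((mul x).cast (add_zero m).symm) ((mul x).cast (by ring))).trans ?_)
    · rw [cast_cast]
      rfl
    · rw [mulAdd_zero_right]
      rfl
  · intro n
    have aux {a a' b c d e f : X} (s : x ⊗ a ⟶ a') (u : b ⊗ a' ⟶ c) (v : c ⟶ d)
        (u' : b ⊗ a ⟶ e) (v' : x ⊗ e ⟶ c) (w : e ⟶ f) (v'' : x ⊗ f ⟶ d)
        (h : b ◁ s ≫ u = ((α_ _ _ _).inv ≫ (β_ _ x).hom ▷ a ≫ (α_ _ _ _).hom ≫ x ◁ u' ≫ v') ≫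
          sgnAct x m c) (h' : v' ≫ v = x ◁ w ≫ v'') :
        ((α_ _ _ _).inv ≫ s ▷ b) ≫ (β_ _ _).hom ≫ u ≫ v =
          (x ◁ ((β_ _ _).hom ≫ u' ≫ w) ≫ v'') ≫ sgnAct x m d := by
      have e₁ : (α_ _ _ _).inv ≫ (β_ (x ⊗ a) b).hom ≫ (α_ _ _ _).inv ≫ (β_ _ x).hom ▷ a ≫
          (α_ _ _ _).hom = x ◁ (β_ a b).hom := by
        rw [BraidedCategory.braiding_tensor_left_hom]
        simp [← comp_whiskerRight_assoc]
      rw [Category.assoc, BraidedCategory.braiding_naturality_left_assoc, reassoc_of% h,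
        unitAct_nat, reassoc_of% h', reassoc_of% e₁]
      simp
    refine aux ((mul x).step n) _ _ _ ((mul x).step (m + n) ≫ (mul x).cast (add_assoc m n 1)) _ _
      (mulAdd_step_right x m n) ?_
    refine (Category.assoc _ _ _).trans ((congr(_ ≫ $(cast_cast _ _ _))).trans ?_)
    exact step_cast _ _ _ _

end Tower

/-- The morphism from `Φ` determined by an object. -/
def phiLift (x : X) : Phi ⟶ X :=
  mkHom (A := Phi)
    { obj := fun n => (Tower.mul x).obj n.deg
      map := fun f => (Tower.mul x).cast f.deg_eq ≫ sgnAct x f.sgn _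
      map_id := fun n => by
        change (Tower.mul x).cast rfl ≫ sgnAct x 0 _ = 𝟙 _
        rw [Tower.cast_rfl, sgnAct, sgnPow_zero, unitAct_id, Category.comp_id]
      map_comp := fun {n m k} f g => by
        have h : (Tower.mul x).cast (f.deg_eq.trans g.deg_eq) ≫
            unitAct (sgnPow x (f.sgn + g.sgn)) _ =
          ((Tower.mul x).cast f.deg_eq ≫ unitAct (sgnPow x f.sgn) _) ≫ (Tower.mul x).cast g.deg_eq ≫
            unitAct (sgnPow x g.sgn) _ := by
          rw [sgnPow_add, unitAct_comp, Category.assoc, reassoc_of% (unitAct_nat (sgnPow x f.sgn)),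
            ← Tower.cast_cast, Category.assoc]
        exact h }
    (fun n m => Tower.mulAdd x m.deg n.deg)
    (fun {n n' m m'} f g => by
      have h : ((Tower.mul x).cast f.deg_eq ≫ unitAct (sgnPow x f.sgn) _ ⊗ₘ
          (Tower.mul x).cast g.deg_eq ≫ unitAct (sgnPow x g.sgn) _) ≫ Tower.mulAdd x m'.deg n'.deg =
          Tower.mulAdd x m.deg n.deg ≫
            (Tower.mul x).cast (congrArg₂ (· + ·) f.deg_eq g.deg_eq) ≫
              unitAct (sgnPow x (f.sgn + g.sgn)) _ := by
        rw [add_comm f.sgn, sgnPow_add, unitAct_comp, ← tensorHom_comp_tensorHom,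
          MonoidalCategory.tensorHom_def,
          MonoidalCategory.tensorHom_def, unitAct_whiskerRight, whiskerLeft_unitAct]
        simp only [Category.assoc]
        rw [unitAct_nat, Category.assoc, reassoc_of% (unitAct_nat (sgnPow x g.sgn)),
          reassoc_of% (Tower.mulAdd_cast_right x n'.deg g.deg_eq),
          reassoc_of% (Tower.mulAdd_cast_left x f.deg_eq m.deg),
          reassoc_of% (Tower.cast_cast (Tower.mul x))]
      exact h)
    (fun n m k => by
      refine Eq.trans ?_ (Tower.mulAdd_assoc x n.deg m.deg k.deg)
      have h : (Tower.mul x).cast (add_assoc n.deg m.deg k.deg) ≫ sgnAct x 0 _ =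
        (Tower.mul x).cast (add_assoc n.deg m.deg k.deg) := by
        rw [sgnAct, sgnPow_zero, unitAct_id, Category.comp_id]
      exact congr(_ ≫ _ ≫ $h))
    -- The nm signs in the symmetry of Φ cancel the nm signs of `braiding_mulAdd`, since a + a = 0
    -- in `ZMod 2`.
    (fun n m => by
      have h : Tower.mulAdd x m.deg n.deg ≫ (Tower.mul x).cast (add_comm n.deg m.deg) ≫
          sgnAct x (n.deg * m.deg : ℤ) _ = (β_ _ _).hom ≫ Tower.mulAdd x n.deg m.deg := by
        have e (a : ZMod 2) : a + a = 0 := CharTwo.add_self_eq_zero a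
        rw [Tower.braiding_mulAdd, Category.assoc, reassoc_of% (unitAct_nat (sgnPow x _)),
          ← unitAct_comp, ← sgnPow_add, e, sgnPow_zero, unitAct_id, Category.comp_id]
        simp only [Category.assoc]
        rw [Tower.cast_cast, Tower.cast_rfl, Category.comp_id]
      exact h)

end SCGr

/-! ### Φ is free on the object 1 -/

/-- Bases are transported along equivalences. -/
lemma IsFree.of_precomp_isEquivalence {C : Type (u + 1)} [Bicategory.{u, u} C] [HasPoints C]
    {I : Type u} {Q Q' : C} {x : I → HasPoints.pts Q} (hx : IsFree x) {y : I → HasPoints.pts Q'}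
    (E : Q' ⟶ Q) (hE : ∀ X, (Bicategory.precomp X E).IsEquivalence)
    (e : ∀ i, (HasPoints.map E).functor.obj (y i) ≅ x i) : IsFree y := by
  intro X
  have := hx X
  have := hE X
  let Φ : Bicategory.precomp X E ⋙ (Functor.pi' fun i => HasPoints.ev (y i) X) ≅
      Functor.pi' fun i => HasPoints.ev (x i) X :=
    NatIso.pi' (F := Bicategory.precomp X E ⋙ (Functor.pi' fun i => HasPoints.ev (y i) X))
      fun i => HasPoints.precompIso E (y i) X ≪≫ HasPoints.evMapIso (e i)
  have h : (Bicategory.precomp X E ⋙ (Functor.pi' fun i => HasPoints.ev (y i) X)).IsEquivalence :=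
    Functor.isEquivalence_of_iso Φ.symm
  exact Functor.isEquivalence_of_comp_left (Bicategory.precomp X E) _

namespace SCGr

/-- The generator of the free symmetric categorical group on one element. -/
abbrev gen : free PUnit.{u + 1} := FreeObj.of PUnit.unit

/-- The degree of a formal sum. -/
def degHom : free PUnit.{u + 1} ⟶ Phi.{u} := free.lift fun _ => (⟨1⟩ : PhiObj)

/-- Φ detects the sign of the generator: `degHom` sends its symmetry to the symmetry of 1 with
itself, whose sign 1 · 1 is not 0. -/
lemma symSign_gen_ne : symSign gen.{u} ≠ 𝟙 _ := by
  intro h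
  have h₁ := unitAct_symSign gen.{u}
  rw [h, unitAct_id] at h₁
  have h₂ : degHom.{u}.functor.map (𝟙 (gen ⊗ gen)) = degHom.{u}.functor.map (β_ gen gen).hom :=
    congr(degHom.functor.map $h₁)
  have h₃ : (0 : ZMod 2) = ((1 * 1 : ℤ) : ZMod 2) := congrArg PhiHom.sgn h₂
  revert h₃
  decide

lemma degHom_essSurj (n : Phi.{u}) : ∃ a, Nonempty (degHom.functor.obj a ≅ n) := by
  obtain ⟨n⟩ := n
  have h : ∃ a, (degHom.functor.obj a).deg = n := by
    have hneg : (degHom.functor.obj (FreeObj.neg gen)).deg = -1 := by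
      have h : (1 : ℤ) + (degHom.functor.obj (FreeObj.neg gen)).deg = 0 :=
        (negPairing (𝒞 := Phi.{u}) (⟨1⟩ : PhiObj)).deg_eq
      omega
    induction n with
    | zero => exact ⟨FreeObj.zero, rfl⟩
    | succ n ih =>
      obtain ⟨a, ha⟩ := ih
      exact ⟨FreeObj.add a gen, congr($ha + 1)⟩
    | pred n ih =>
      obtain ⟨a, ha⟩ := ih
      exact ⟨FreeObj.add a (.neg gen), congr($ha + $hneg)⟩
  obtain ⟨a, ha⟩ := h
  exact ⟨a, ⟨PhiObj.isoMk ha 0⟩⟩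

/-- By freeness, `degHom` followed by `phiLift gen` is isomorphic to the identity, because this
holds on the generator. This gives essential surjectivity and, since `degHom` reaches every integer,
fullness. Faithfulness is the nontriviality of the sign, as two parallel arrows of Φ differ at most
by a sign. -/
lemma phiLift_isEquivalence : (phiLift gen.{u}).functor.IsEquivalence := by
  let s : degHom ≫ phiLift gen.{u} ⟶ 𝟙 (free PUnit.{u + 1}) := free.track fun _ => (ρ_ gen).hom
  let t : (degHom ≫ phiLift gen.{u}).functor ≅ 𝟭 _ :=
    @asIso _ _ _ _ s.nat (NatIso.isIso_of_isIso_app _)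
  exact
    { faithful := ⟨fun {n m f g} h => by
        have h₁ := unitAct_injective _ ((cancel_epi ((Tower.mul gen).cast f.deg_eq)).1 h)
        have hc : ∀ c : ZMod 2, c = 0 ∨ c = 1 := by decide
        refine PhiObj.hom_ext ?_
        obtain hf | hf := hc f.sgn <;> obtain hg | hg := hc g.sgn <;>
          simp only [hf, hg, sgnPow_zero, sgnPow_one] at h₁ ⊢
        · exact absurd h₁.symm symSign_gen_ne
        · exact absurd h₁ symSign_gen_ne⟩
      full := ⟨fun {n m} u => by
        obtain ⟨a, ⟨e⟩⟩ := degHom_essSurj n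
        obtain ⟨b, ⟨e'⟩⟩ := degHom_essSurj m
        have hF : (degHom ≫ phiLift gen.{u}).functor.Full := Functor.Full.of_iso t.symm
        obtain ⟨v, hv⟩ := (degHom ≫ phiLift gen.{u}).functor.map_surjective
          ((phiLift gen).functor.map e.hom ≫ u ≫ (phiLift gen).functor.map e'.inv)
        refine ⟨e.inv ≫ degHom.functor.map v ≫ e'.hom, ?_⟩
        have hv' : (phiLift gen).functor.map (degHom.functor.map v) = _ := hv
        rw [Functor.map_comp, Functor.map_comp, hv']
        simp [← Functor.map_comp, ← Functor.map_comp_assoc]⟩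
      essSurj := ⟨fun a => ⟨degHom.functor.obj a, ⟨t.app a⟩⟩⟩ }

/-- The object 1 corresponds to the multiple `gen ⊗ 𝟙_`, which the right unitor identifies with the
generator. -/
lemma isFree_phi : IsFree (C := SCGr.{u}) (Q := Phi) fun _ : PUnit.{u + 1} => (⟨1⟩ : PhiObj) := by
  have := phiLift_isEquivalence.{u}
  exact (isFree_of PUnit).of_precomp_isEquivalence (phiLift gen)
    (fun _ => precomp_isEquivalence _) fun _ => ρ_ gen

lemma isProjective_phi : IsProjective Phi.{u} := isFree_phi.isProjective

lemma isGenerator_phi : IsGenerator Phi.{u} :=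
  isGenerator_of_free isFree_phi fun I => ⟨free I, FreeObj.of, isFree_of I⟩

lemma hasEnoughProjectives : HasEnoughProjectives SCGr.{u} :=
  hasEnoughProjectives_of_free fun I => ⟨free I, FreeObj.of, isFree_of I⟩

end SCGr

/-! ### Smallness of Φ -/

namespace SCGr

/-- Evaluation at an object, as a morphism of symmetric categorical groups. -/
def evHom {A : SCGr.{u}} (a : A) (X : SCGr.{u}) : homObj A X ⟶ X :=
  mkHom (A := homObj A X) (HasPoints.ev (C := SCGr) a X)
    (fun F G => 𝟙 (F.functor.obj a ⊗ G.functor.obj a))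
    (fun f g => (Category.comp_id _).trans (Category.id_comp _).symm)
    (fun F G H => by
      change 𝟙 (F.functor.obj a ⊗ G.functor.obj a) ▷ H.functor.obj a ≫ 𝟙 _ ≫ (α_ _ _ _).hom =
        (α_ _ _ _).hom ≫ F.functor.obj a ◁ 𝟙 (G.functor.obj a ⊗ H.functor.obj a) ≫ 𝟙 _
      simp)
    (fun F G => (Category.id_comp _).trans (Category.comp_id _).symm)

/-- Evaluation at the basis element identifies the 2-functor of morphisms out of G with the
identity, compatibly with pointwise addition. A coproduct is therefore carried to an equivalent
coproduct. -/
lemma isSmall_of_isFree {G : SCGr.{u}} {e : G}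
    (hG : IsFree (C := SCGr) fun _ : PUnit.{u + 1} => e) :
    IsSmall G := by
  intro I A Q ι h
  have hev (X : SCGr.{u}) : (evHom e X).functor.IsEquivalence := hG.isEquivalence_ev X
  have (i : I) := hev (A i)
  have := hev Q
  refine isCoproduct_of_equivalence (A' := fun i => homObj G (A i)) (fun i => evHom e (A i))
    (evHom e Q) (fun i => ?_) h
  exact asIso (mkTrackOfTensor (F := homMap G (ι i) ≫ evHom e Q) (G := evHom e (A i) ≫ ι i)
    (fun F => 𝟙 ((ι i).functor.obj (F.functor.obj e)))
    (fun s => (Category.comp_id _).trans (Category.id_comp _).symm)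
    (fun F F' => by
      have h {a b : A i} : (𝟙 _ ≫ Functor.LaxMonoidal.μ (ι i).functor a b) ≫ 𝟙 _ =
          (𝟙 _ ⊗ₘ 𝟙 _) ≫ Functor.LaxMonoidal.μ (ι i).functor a b ≫
            (ι i).functor.map (𝟙 (a ⊗ b)) := by simp
      exact h))

lemma isSmall_phi : IsSmall Phi.{u} := isSmall_of_isFree isFree_phi

end SCGr

/-! ### Projective symmetric categorical groups are free -/

/-- Subgroups of free abelian groups are free. -/
theorem exists_basis_submodule {I : Type u} (N : Submodule ℤ (I →₀ ℤ)) :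
    ∃ J : Type u, Nonempty (Module.Basis J ℤ N) := by
  classical
  obtain ⟨lo, wf⟩ := exists_wellFoundedLT I
  -- With I well-ordered, `L i` is the ideal of coefficients at i of elements of N supported in
  -- indices at most i. An element `b i` is chosen whose coefficient at i generates this ideal.
  let L (i : I) : Submodule ℤ ℤ :=
    Submodule.map (Finsupp.lapply i) (N ⊓ Finsupp.supported ℤ ℤ (Set.Iic i))
  have hL (i : I) : ∃ v ∈ N, v ∈ Finsupp.supported ℤ ℤ (Set.Iic i) ∧
      ∀ w ∈ N, w ∈ Finsupp.supported ℤ ℤ (Set.Iic i) → v i ∣ w i := by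
    obtain ⟨a, ha⟩ := (IsPrincipalIdealRing.principal (L i)).principal
    have hv : a ∈ L i := ha ▸ Submodule.mem_span_singleton_self a
    obtain ⟨v, ⟨hv, hv'⟩, rfl⟩ := hv
    refine ⟨v, hv, hv', fun w hw hw' => ?_⟩
    have h : w i ∈ L i := ⟨w, ⟨hw, hw'⟩, rfl⟩
    rw [ha, Submodule.mem_span_singleton] at h
    obtain ⟨c, hc⟩ := h
    exact ⟨c, by rw [← hc, mul_comm]; rfl⟩
  choose b hbN hbs hb using hL
  -- Only indices with a nonzero ideal contribute. The chosen elements then have distinct leading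
  -- indices, which gives independence by looking at the largest one.
  let J := { i : I // b i i ≠ 0 }
  let e : J → N := fun j => ⟨b j, hbN j⟩
  have hlin : LinearIndependent ℤ e := by
    rw [linearIndependent_iff]
    intro c hc
    by_contra hne
    have hs : c.support.Nonempty := Finsupp.support_nonempty_iff.2 hne
    obtain ⟨i, hi, hmax⟩ := c.support.exists_max_image (fun j : J => (j : I)) hs
    have h : ∑ j ∈ c.support, c j * b j i = 0 := by
      have := congrArg (fun v : N => (v : I →₀ ℤ) i) hc
      simpa [Finsupp.linearCombination_apply, Finsupp.sum, e, Finsupp.finsetSum_apply] using this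
    rw [Finset.sum_eq_single i] at h
    · rcases mul_eq_zero.1 h with h | h
      · exact Finsupp.mem_support_iff.1 hi h
      · exact i.2 h
    · intro j hj hji
      have h0 : b j i = 0 := by
        by_contra h0
        have h1 := (Finsupp.mem_supported ℤ (b j)).1 (hbs j) (Finsupp.mem_support_iff.2 h0)
        exact hji (Subtype.ext (le_antisymm (hmax j hj) h1))
      rw [h0, mul_zero]
    · exact fun h => absurd hi h
  -- Transfinite induction on a bound i for the support: subtracting a multiple of `b i` kills the
  -- coefficient at i, and what remains is zero or supported below a smaller index.
  have hspan : ∀ i : I, ∀ v : N, (v : I →₀ ℤ) ∈ Finsupp.supported ℤ ℤ (Set.Iic i) →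
      v ∈ Submodule.span ℤ (Set.range e) := by
    intro i
    induction i using wf.wf.induction with
    | _ i ih =>
    intro v hv
    obtain ⟨c, hc⟩ := hb i v v.2 hv
    have key : ∀ w : N, (w : I →₀ ℤ) ∈ Finsupp.supported ℤ ℤ (Set.Iic i) →
        (w : I →₀ ℤ) i = 0 → w ∈ Submodule.span ℤ (Set.range e) := by
      intro w hw hwi
      by_cases h0 : w = 0
      · rw [h0]; exact Submodule.zero_mem _
      have hs : (w : I →₀ ℤ).support.Nonempty :=
        Finsupp.support_nonempty_iff.2 fun h => h0 (Subtype.ext h)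
      obtain ⟨j, hj, hmax⟩ := (w : I →₀ ℤ).support.exists_max_image id hs
      have hji : j ≤ i := (Finsupp.mem_supported ℤ _).1 hw hj
      refine ih j (lt_of_le_of_ne hji ?_) w ((Finsupp.mem_supported ℤ _).2 fun k hk => hmax k hk)
      rintro rfl
      exact Finsupp.mem_support_iff.1 hj hwi
    by_cases h0 : b i i = 0
    · exact key v hv (by rw [hc, h0, zero_mul])
    · let j : J := ⟨i, h0⟩
      have h := key (v - c • e j) ((Finsupp.supported ℤ ℤ (Set.Iic i)).sub_mem hv
        ((Finsupp.supported ℤ ℤ (Set.Iic i)).smul_mem c (hbs i))) (by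
          change (v : I →₀ ℤ) i - c * b i i = 0
          rw [hc, mul_comm, sub_self])
      have h' := Submodule.add_mem _ h
        (Submodule.smul_mem _ c (Submodule.subset_span (Set.mem_range_self j)))
      rwa [sub_add_cancel] at h'
  refine ⟨J, ⟨Module.Basis.mk hlin fun v _ => ?_⟩⟩
  by_cases h0 : v = 0
  · rw [h0]; exact Submodule.zero_mem _
  have hs : (v : I →₀ ℤ).support.Nonempty :=
    Finsupp.support_nonempty_iff.2 fun h => h0 (Subtype.ext h)
  obtain ⟨j, hj, hmax⟩ := (v : I →₀ ℤ).support.exists_max_image id hs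
  exact hspan j v ((Finsupp.mem_supported ℤ _).2 fun k hk => hmax k hk)

namespace SCGr

variable {I : Type u}

/-- The coefficients of a formal sum. -/
def FreeObj.coeff : FreeObj I → (I →₀ ℤ)
  | .of i => Finsupp.single i 1
  | .zero => 0
  | .add a b => a.coeff + b.coeff
  | .neg a => - a.coeff

lemma FreeHom.coeff_eq {a b : FreeObj I} (f : FreeHom a b) : a.coeff = b.coeff := by
  induction f with
  | id a => rfl
  | comp f g hf hg => exact hf.trans hg
  | inv f hf => exact hf.symm
  | tensor f g hf hg => exact congr($hf + $hg)
  | assoc a b c => exact add_assoc _ _ _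
  | left a => exact zero_add _
  | right a => exact add_zero _
  | braid a b => exact add_comm _ _
  | pair a => exact add_neg_cancel _

/-- The connected components of a free symmetric categorical group form a free abelian group. -/
def freePi0 (I : Type u) : Pi0 (free I) →+ (I →₀ ℤ) where
  toFun := Quotient.lift FreeObj.coeff fun _ _ ⟨f⟩ => by
    obtain ⟨f, hf⟩ := FreeHom.exists_rep f.hom
    exact f.coeff_eq
  map_zero' := rfl
  map_add' := by
    rintro ⟨a⟩ ⟨b⟩
    rfl

lemma freePi0_of (i : I) : freePi0 I (Pi0.mk (A := free I) (.of i)) = Finsupp.single i 1 := rfl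

/-- The classes of the generators generate the group: formal sums are handled by additivity and
formal opposites by the pairing. -/
lemma mk_eq_coeff {A : Type*} [AddCommGroup A] (f g : Pi0 (free I) →+ A)
    (h : ∀ i, f (Pi0.mk (A := free I) (.of i)) = g (Pi0.mk (A := free I) (.of i))) : f = g := by
  ext a
  obtain ⟨a, rfl⟩ := Pi0.exists_rep a
  induction a with
  | of i => exact h i
  | zero => exact f.map_zero.trans g.map_zero.symm
  | add a b ha hb => exact (f.map_add _ _).trans (congr($ha + $hb).trans (g.map_add _ _).symm)
  | neg a ha =>
    have hn : Pi0.mk (A := free I) (.neg a) = - Pi0.mk (A := free I) a :=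
      eq_neg_of_add_eq_zero_right (Pi0.mk_eq (A := free I) (FreeHom.pair a).mk)
    rw [hn, map_neg, map_neg, ha]

/-- Sending a basis vector to the class of its generator gives a left inverse, which is checked on
generators. -/
lemma freePi0_injective : Function.Injective (freePi0 I) := by
  let T : (I →₀ ℤ) →+ Pi0 (free I) := Finsupp.liftAddHom fun i =>
    (smulAddHom ℤ (Pi0 (free I))).flip (Pi0.mk (A := free I) (.of i))
  have h : T.comp (freePi0 I) = AddMonoidHom.id _ := mk_eq_coeff _ _ fun i => by
    change T (freePi0 I _) = _
    rw [freePi0_of]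
    simp [T]
  exact Function.LeftInverse.injective (g := T) fun a => DFunLike.congr_fun h a

/-- Projectivity lifts the connected component of the identity. In a groupoid a zigzag of tracks
composes to a single isomorphism. -/
lemma exists_section {P B : SCGr.{u}} (hP : IsProjective P) {f : B ⟶ P} (hf : Cofaithful f) :
    ∃ s : P ⟶ B, Nonempty (s ≫ f ≅ 𝟙 P) := by
  obtain ⟨s, hs⟩ := hP f hf (Quotient.mk _ (𝟙 P))
  obtain ⟨s, rfl⟩ := Quotient.exists_rep s
  have h : Zigzag (s ≫ f) (𝟙 P) := Quotient.exact hs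
  refine ⟨s, ?_⟩
  generalize 𝟙 P = k at h
  induction h with
  | refl => exact ⟨Iso.refl _⟩
  | tail _ h ih =>
    obtain ⟨e⟩ := ih
    obtain ⟨⟨t⟩⟩ | ⟨⟨t⟩⟩ := h
    · exact ⟨e ≪≫ asIso t⟩
    · exact ⟨e ≪≫ (asIso t).symm⟩

/-- P is a retract of the free object on its own objects, so `Pi0 P` embeds in a free abelian group
and has a basis J. Representatives of the basis define `v` from the free object on J, bijective on
isomorphism classes. Projectivity of P gives `w` with w ≫ v isomorphic to the identity, and freeness
of the source of `v` gives the other composite. -/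
theorem exists_equivalence_free {P : SCGr.{u}} (hP : IsProjective P) :
    ∃ J : Type u, Nonempty (Bicategory.Equivalence P (free J)) := by
  obtain ⟨f, hf⟩ := (isFree_of P).exists_hom (X := P) id
  have hf' : Cofaithful f := cofaithful_iff.2 fun a => by
    obtain ⟨a, rfl⟩ := Pi0.exists_rep a
    exact ⟨Pi0.mk (A := free P) (.of a), Pi0.mk_eq (hf a).some.hom⟩
  obtain ⟨s, ⟨e⟩⟩ := exists_section hP hf'
  have hs : Function.Injective (Pi0.map s) := by
    refine Function.LeftInverse.injective (g := Pi0.map f) fun a => ?_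
    obtain ⟨a, rfl⟩ := Pi0.exists_rep a
    exact Pi0.mk_eq (e.hom.nat.app a)
  let φ : Pi0 P →ₗ[ℤ] (P →₀ ℤ) := ((freePi0 P).comp (Pi0.map s)).toIntLinearMap
  have hφ : Function.Injective φ := freePi0_injective.comp hs
  obtain ⟨J, ⟨b⟩⟩ := exists_basis_submodule (LinearMap.range φ)
  let b' : Module.Basis J ℤ (Pi0 P) := b.map (LinearEquiv.ofInjective φ hφ).symm
  have hx (j : J) := Pi0.exists_rep (b' j)
  choose x hx using hx
  obtain ⟨v, hv⟩ := (isFree_of J).exists_hom (X := P) x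
  have hv₁ (j : J) : Pi0.map v (Pi0.mk (A := free J) (.of j)) = b' j :=
    (Pi0.mk_eq (hv j).some.hom).trans (hx j)
  have hrepr : (b'.repr.toLinearMap.toAddMonoidHom).comp (Pi0.map v) = freePi0 J :=
    mk_eq_coeff _ _ fun j => by
      change b'.repr (Pi0.map v _) = _
      rw [hv₁, freePi0_of, Module.Basis.repr_self]
  have hinj : Function.Injective (Pi0.map v) := by
    have h : Function.Injective (b'.repr ∘ Pi0.map v) := by
      have : (b'.repr ∘ Pi0.map v) = freePi0 J := funext fun a => DFunLike.congr_fun hrepr a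
      rw [this]
      exact freePi0_injective
    exact h.of_comp
  have hsurj : Function.Surjective (Pi0.map v) := by
    have h : (⊤ : Submodule ℤ (Pi0 P)) ≤ LinearMap.range (Pi0.map v).toIntLinearMap := by
      rw [← b'.span_eq, Submodule.span_le]
      rintro _ ⟨j, rfl⟩
      exact ⟨Pi0.mk (A := free J) (.of j), hv₁ j⟩
    exact fun a => h (Submodule.mem_top (x := a))
  obtain ⟨w, ⟨e'⟩⟩ := exists_section hP (cofaithful_iff.2 hsurj)
  -- Applying v to the image of a generator under v ≫ w gives an object isomorphic to its value
  -- under v. Injectivity on isomorphism classes removes v, and the isomorphisms on generators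
  -- extend to a track without any further condition.
  have ht (j : J) : Nonempty ((v ≫ w).functor.obj (.of j) ⟶ FreeObj.of j) :=
    Pi0.mk_eq_iff.1 (hinj (Pi0.mk_eq (e'.hom.nat.app (v.functor.obj (.of j)))))
  obtain ⟨t, -⟩ := (isFree_of J).exists_track (f := v ≫ w) (g := 𝟙 _) fun j => (ht j).some
  exact ⟨J, ⟨Bicategory.Equivalence.mkOfAdjointifyCounit e'.symm (asIso t)⟩⟩

theorem isCoproductOfCopies_of_isProjective (P : SCGr.{u}) (hP : IsProjective P) :
    ∃ Q : SCGr.{u}, IsCoproductOfCopies Phi Q ∧ Nonempty (Bicategory.Equivalence P Q) := by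
  obtain ⟨J, hJ⟩ := exists_equivalence_free hP
  exact ⟨free J, (isFree_of J).isCoproductOfCopies isFree_phi, hJ⟩

end SCGr

/-! ### Free 2-modules -/

namespace Biadd

open Functor.LaxMonoidal

variable {M R N : SCGr.{u}} (β : Biadd M R N)

instance : Functor.Braided (C := R) (D := M ⟶ N) β.functor := SCGr.Hom.braided β

lemma mapRight_id (m : M) (r : R) : β.mapRight m (𝟙 r) = 𝟙 _ :=
  congr(($(β.functor.map_id r)).nat.app m)

lemma mapRight_comp (m : M) {r s t : R} (f : r ⟶ s) (g : s ⟶ t) :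
    β.mapRight m (f ≫ g) = β.mapRight m f ≫ β.mapRight m g :=
  congr(($(β.functor.map_comp f g)).nat.app m)

lemma addRight_nat (m : M) {r r' s s' : R} (f : r ⟶ r') (g : s ⟶ s') :
    (β.mapRight m f ⊗ₘ β.mapRight m g) ≫ β.addRight m r' s' =
      β.addRight m r s ≫ β.mapRight m (f ⊗ₘ g) := by
  have h := congr(($(μ_natural β.functor f g)).nat.app m)
  exact h

lemma addRight_assoc (m : M) (r s t : R) :
    (β.addRight m r s ▷ β.op m t) ≫ β.addRight m (r ⊗ s) t ≫ β.mapRight m (α_ r s t).hom =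
      (α_ _ _ _).hom ≫ (β.op m r ◁ β.addRight m s t) ≫ β.addRight m r (s ⊗ t) := by
  have h := congr(($(associativity β.functor r s t)).nat.app m)
  refine Eq.trans ?_ (h.trans ?_)
  · exact congr($((SCGr.whiskerRight_nat_app (β.atAdd r s) (β.at' t) m).symm) ≫ _)
  · exact congr(_ ≫ $(SCGr.whiskerLeft_nat_app (β.at' r) (β.atAdd s t) m) ≫ _)

lemma addRight_braiding (m : M) (r s : R) :
    β.addRight m r s ≫ β.mapRight m (β_ r s).hom = (β_ _ _).hom ≫ β.addRight m s r := by
  have h := congr(($(Functor.LaxBraided.braided (F := β.functor) r s)).nat.app m)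
  exact h

end Biadd

namespace TwoMod

open Functor.LaxMonoidal Functor.OplaxMonoidal

/-- Formal linear combinations of the elements of `I`. -/
inductive FreeObj (R : TwoRing.{u}) (I : Type u) : Type u
  | of : I → FreeObj R I
  | zero : FreeObj R I
  | add : FreeObj R I → FreeObj R I → FreeObj R I
  | neg : FreeObj R I → FreeObj R I
  | act : FreeObj R I → R.toSCGr → FreeObj R I

/-- Formal morphisms between formal linear combinations. -/
inductive FreeHom {R : TwoRing.{u}} {I : Type u} : FreeObj R I → FreeObj R I → Type u
  | id (a) : FreeHom a a
  | comp {a b c} (f : FreeHom a b) (g : FreeHom b c) : FreeHom a c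
  | inv {a b} (f : FreeHom a b) : FreeHom b a
  | tensor {a b c d} (f : FreeHom a b) (g : FreeHom c d) : FreeHom (.add a c) (.add b d)
  | assoc (a b c) : FreeHom (.add (.add a b) c) (.add a (.add b c))
  | left (a) : FreeHom (.add .zero a) a
  | right (a) : FreeHom (.add a .zero) a
  | braid (a b) : FreeHom (.add a b) (.add b a)
  | pair (a) : FreeHom (.add a (.neg a)) .zero
  | mapLeft {a b} (f : FreeHom a b) (r) : FreeHom (.act a r) (.act b r)
  | mapRight (a) {r s : R.toSCGr} (g : r ⟶ s) : FreeHom (.act a r) (.act a s)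
  | addLeft (a b r) : FreeHom (.add (.act a r) (.act b r)) (.act (.add a b) r)
  | addRight (a) (r s : R.toSCGr) : FreeHom (.add (.act a r) (.act a s)) (.act a (r ⊗ s))
  | actAssoc (a r s) : FreeHom (.act (.act a r) s) (.act a (R.mul.op r s))
  | actUnit (a) : FreeHom (.act a R.one) a

section

variable {R : TwoRing.{u}} {I : Type u} {X : TwoMod R} (v : I → X.toSCGr)

/-- The value of a formal sum. -/
def FreeObj.eval : FreeObj R I → X.toSCGr
  | .of i => v i
  | .zero => 𝟙_ X.toSCGr
  | .add a b => a.eval ⊗ b.eval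
  | .neg a => negObj a.eval
  | .act a r => X.act.op a.eval r

/-- The value of a formal morphism. -/
def FreeHom.eval : {a b : FreeObj R I} → FreeHom a b → (a.eval v ⟶ b.eval v)
  | _, _, .id a => 𝟙 _
  | _, _, .comp f g => f.eval ≫ g.eval
  | _, _, .inv f => CategoryTheory.inv f.eval
  | _, _, .tensor f g => f.eval ⊗ₘ g.eval
  | _, _, .assoc a b c => (α_ _ _ _).hom
  | _, _, .left a => (λ_ _).hom
  | _, _, .right a => (ρ_ _).hom
  | _, _, .braid a b => (β_ _ _).hom
  | _, _, .pair a => negPairing _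
  | _, _, .mapLeft f r => X.act.mapLeft f.eval r
  | _, _, .mapRight a g => X.act.mapRight _ g
  | _, _, .addLeft a b r => X.act.addLeft _ _ r
  | _, _, .addRight a r s => X.act.addRight _ r s
  | _, _, .actAssoc a r s => (X.assoc _ r s).hom
  | _, _, .actUnit a => (X.unit _).hom

end

/-- Formal morphisms are identified when they have equal values in all 2-modules. -/
def FreeHom.setoid {R : TwoRing.{u}} {I : Type u} (a b : FreeObj R I) : Setoid (FreeHom a b) where
  r f g := ∀ (X : TwoMod R) (v : I → X.toSCGr), f.eval v = g.eval v
  iseqv := ⟨fun _ _ _ => rfl, fun h X v => (h X v).symm, fun h h' X v => (h X v).trans (h' X v)⟩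

section

variable {R : TwoRing.{u}} {I : Type u}

/-- As in the case of symmetric categorical groups, every law, including those of the action below,
is inherited from all evaluations in 2-modules. -/
instance : Category.{u} (FreeObj R I) where
  Hom a b := Quotient (FreeHom.setoid a b)
  id a := Quotient.mk (FreeHom.setoid _ _) (.id a)
  comp := Quotient.map₂ .comp fun _ _ h _ _ h' X v => congr($(h X v) ≫ $(h' X v))
  id_comp := by
    rintro a b ⟨f⟩
    exact Quotient.sound fun X v => Category.id_comp _
  comp_id := by
    rintro a b ⟨f⟩
    exact Quotient.sound fun X v => Category.comp_id _
  assoc := by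
    rintro a b c d ⟨f⟩ ⟨g⟩ ⟨h⟩
    exact Quotient.sound fun X v => Category.assoc _ _ _

/-- The morphism represented by a formal morphism. -/
def FreeHom.mk {a b : FreeObj R I} (f : FreeHom a b) : a ⟶ b := Quotient.mk (FreeHom.setoid _ _) f

lemma FreeHom.sound {a b : FreeObj R I} {f g : FreeHom a b}
    (h : ∀ (X : TwoMod R) (v : I → X.toSCGr), f.eval v = g.eval v) : f.mk = g.mk := Quotient.sound h

lemma FreeHom.exists_rep {a b : FreeObj R I} (f : a ⟶ b) : ∃ g : FreeHom a b, g.mk = f :=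
  Quotient.exists_rep f

/-- The isomorphism represented by a formal morphism. -/
def FreeHom.iso {a b : FreeObj R I} (f : FreeHom a b) : a ≅ b where
  hom := f.mk
  inv := f.inv.mk
  hom_inv_id := FreeHom.sound (f := .comp f f.inv) (g := .id _) fun _ _ => IsIso.hom_inv_id _
  inv_hom_id := FreeHom.sound (f := .comp f.inv f) (g := .id _) fun _ _ => IsIso.inv_hom_id _

instance : IsGroupoid (FreeObj R I) where
  all_isIso f := by
    obtain ⟨f, rfl⟩ := FreeHom.exists_rep f
    exact f.iso.isIso_hom

instance : MonoidalCategoryStruct (FreeObj R I) where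
  tensorObj := .add
  tensorUnit := .zero
  tensorHom := Quotient.map₂ .tensor fun _ _ h _ _ h' X v => congr($(h X v) ⊗ₘ $(h' X v))
  whiskerLeft a _ _ := Quotient.map (.tensor (.id a)) fun _ _ h X v => congr(𝟙 _ ⊗ₘ $(h X v))
  whiskerRight {b c} f a := Quotient.map (sa := FreeHom.setoid b c)
    (sb := FreeHom.setoid (.add b a) (.add c a)) (fun f => .tensor f (.id a))
    (fun _ _ h X v => congr($(h X v) ⊗ₘ 𝟙 _)) f
  associator a b c := (FreeHom.assoc a b c).iso
  leftUnitor a := (FreeHom.left a).iso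
  rightUnitor a := (FreeHom.right a).iso

instance : MonoidalCategory (FreeObj R I) :=
  MonoidalCategory.ofTensorHom
    (id_tensorHom_id := fun a b => FreeHom.sound fun X v => id_tensorHom_id _ _)
    (id_tensorHom := fun a b b' f => by
      obtain ⟨f, rfl⟩ := FreeHom.exists_rep f
      rfl)
    (tensorHom_id := fun f a => by
      obtain ⟨f, rfl⟩ := FreeHom.exists_rep f
      rfl)
    (tensorHom_comp_tensorHom := by
      rintro a b c a' b' c' ⟨f⟩ ⟨g⟩ ⟨h⟩ ⟨k⟩
      exact FreeHom.sound fun X v => tensorHom_comp_tensorHom _ _ _ _)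
    (associator_naturality := by
      rintro a b c a' b' c' ⟨f⟩ ⟨g⟩ ⟨h⟩
      exact FreeHom.sound fun X v => associator_naturality _ _ _)
    (leftUnitor_naturality := by
      rintro a b ⟨f⟩
      exact FreeHom.sound fun X v =>
        congr($(id_tensorHom _ _) ≫ (λ_ _).hom).trans (leftUnitor_naturality (f.eval v)))
    (rightUnitor_naturality := by
      rintro a b ⟨f⟩
      exact FreeHom.sound fun X v =>
        congr($(tensorHom_id _ _) ≫ (ρ_ _).hom).trans (rightUnitor_naturality (f.eval v)))
    (pentagon := fun a b c d => FreeHom.sound fun X v => by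
      have h := MonoidalCategory.pentagon (a.eval v) (b.eval v) (c.eval v) (d.eval v)
      rw [← tensorHom_id, ← id_tensorHom] at h
      exact h)
    (triangle := fun a b => FreeHom.sound fun X v => by
      have h := MonoidalCategory.triangle (a.eval v) (b.eval v)
      rw [← tensorHom_id, ← id_tensorHom] at h
      exact h)

instance : BraidedCategory (FreeObj R I) where
  braiding a b := (FreeHom.braid a b).iso
  braiding_naturality_right a := by
    rintro b c ⟨f⟩
    exact FreeHom.sound fun X v => by
      have h := BraidedCategory.braiding_naturality_right (a.eval v) (f.eval v)
      rw [← tensorHom_id, ← id_tensorHom] at h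
      exact h
  braiding_naturality_left := by
    rintro a b ⟨f⟩ c
    exact FreeHom.sound fun X v => by
      have h := BraidedCategory.braiding_naturality_left (f.eval v) (c.eval v)
      rw [← tensorHom_id, ← id_tensorHom] at h
      exact h
  hexagon_forward a b c := FreeHom.sound fun X v => by
    have h := BraidedCategory.hexagon_forward (a.eval v) (b.eval v) (c.eval v)
    rw [← tensorHom_id, ← id_tensorHom] at h
    exact h
  hexagon_reverse a b c := FreeHom.sound fun X v => by
    have h := BraidedCategory.hexagon_reverse (a.eval v) (b.eval v) (c.eval v)
    rw [← tensorHom_id, ← id_tensorHom] at h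
    simp only [← IsIso.Iso.inv_hom] at h
    exact h

instance : SymmetricCategory (FreeObj R I) where
  symmetry _ _ := FreeHom.sound fun _ _ => SymmetricCategory.symmetry _ _

end

/-- The symmetric categorical group underlying the free 2-module on a set. -/
def freeSCGr (R : TwoRing.{u}) (I : Type u) : SCGr.{u} where
  carrier := FreeObj R I
  isEquivalence_tensorLeft a := isEquivalence_tensorLeft_of_iso (FreeHom.pair a).iso

/-- The action of a 2-ring on the free 2-module. -/
def freeCore (R : TwoRing.{u}) (I : Type u) :
    BiaddCore (freeSCGr R I) R.toSCGr (freeSCGr R I) where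
  op := .act
  mapLeft {a b} f r := Quotient.map (sa := FreeHom.setoid a b)
    (sb := FreeHom.setoid (.act a r) (.act b r)) (fun f => .mapLeft f r)
    (fun _ _ h X v => congr(X.act.mapLeft $(h X v) r)) f
  mapRight a {_ _} g := (FreeHom.mapRight a g).mk
  addLeft a b r := (FreeHom.addLeft a b r).mk
  addRight a r s := (FreeHom.addRight a r s).mk
  mapLeft_id a r := FreeHom.sound fun X v => X.act.mapLeft_id _ r
  mapLeft_comp := by
    rintro a b c ⟨f⟩ ⟨g⟩ r
    exact FreeHom.sound fun X v => X.act.mapLeft_comp _ _ r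
  mapRight_id a r := FreeHom.sound fun X v => X.act.mapRight_id _ r
  mapRight_comp a {_ _ _} f g := FreeHom.sound fun X v => X.act.mapRight_comp _ f g
  mapLeft_mapRight := by
    rintro a b ⟨f⟩ r s g
    exact FreeHom.sound fun X v => X.act.mapLeft_mapRight _ g
  addLeft_nat := by
    rintro a a' b b' ⟨f⟩ ⟨g⟩ r
    exact FreeHom.sound fun X v => X.act.addLeft_nat _ _ r
  addLeft_assoc a b c r := FreeHom.sound fun X v => by
    have h := X.act.addLeft_assoc (a.eval v) (b.eval v) (c.eval v) r
    rw [← tensorHom_id, ← id_tensorHom] at h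
    exact h
  addLeft_braiding a b r := FreeHom.sound fun X v => X.act.addLeft_braiding _ _ r
  addLeft_mapRight a b {_ _} g := FreeHom.sound fun X v => X.act.addLeft_mapRight _ _ g
  addRight_nat_left := by
    rintro a b ⟨f⟩ r s
    exact FreeHom.sound fun X v => X.act.addRight_nat_left _ r s
  addRight_nat a {_ _ _ _} f g := FreeHom.sound fun X v => X.act.addRight_nat _ f g
  addRight_assoc a r s t := FreeHom.sound fun X v => by
    have h := X.act.addRight_assoc (a.eval v) r s t
    rw [← tensorHom_id, ← id_tensorHom] at h
    exact h
  addRight_braiding a r s := FreeHom.sound fun X v => X.act.addRight_braiding _ r s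
  addLeft_addRight a b r s := FreeHom.sound fun X v => by
    have h := X.act.addLeft_addRight (a.eval v) (b.eval v) r s
    simp only [tensorμ, ← tensorHom_id, ← id_tensorHom, ← IsIso.Iso.inv_hom] at h
    exact h

/-- The free 2-module on a set. -/
def free (R : TwoRing.{u}) (I : Type u) : TwoMod R where
  toSCGr := freeSCGr R I
  act := (freeCore R I).toBiadd
  assoc a r s := (FreeHom.actAssoc a r s).iso
  unit a := (FreeHom.actUnit a).iso
  assoc_nat_left := by
    rintro a b ⟨f⟩ r s
    exact FreeHom.sound fun X v => X.assoc_nat_left _ r s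
  assoc_nat_mid a {_ _} f s := FreeHom.sound fun X v => X.assoc_nat_mid _ f s
  assoc_nat_right a r {_ _} f := FreeHom.sound fun X v => X.assoc_nat_right _ r f
  unit_nat := by
    rintro a b ⟨f⟩
    exact FreeHom.sound fun X v => X.unit_nat _
  assoc_add_left a b r s := FreeHom.sound fun X v => X.assoc_add_left _ _ r s
  assoc_add_mid a r r' s := FreeHom.sound fun X v => X.assoc_add_mid _ r r' s
  assoc_add_right a r s s' := FreeHom.sound fun X v => X.assoc_add_right _ r s s'
  unit_add a b := FreeHom.sound fun X v => X.unit_add _ _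
  pentagon a r s t := FreeHom.sound fun X v => X.pentagon _ r s t
  triangle a r := FreeHom.sound fun X v => X.triangle _ r

section

variable {R : TwoRing.{u}} {I : Type u} {X : TwoMod R}

/-- The underlying morphism of the morphism from the free 2-module extending a given family. -/
def free.liftHom (v : I → X.toSCGr) : freeSCGr R I ⟶ X.toSCGr :=
  SCGr.mkHom (A := freeSCGr R I)
    { obj := FreeObj.eval v
      map := Quotient.lift (FreeHom.eval v) fun _ _ h => h X v
      map_id := fun _ => rfl
      map_comp := by
        rintro a b c ⟨f⟩ ⟨g⟩
        rfl }
    (fun a b => 𝟙 (a.eval v ⊗ b.eval v))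
    (by
      rintro a b c d ⟨f⟩ ⟨g⟩
      exact (Category.comp_id _).trans (Category.id_comp _).symm)
    (fun a b c => by
      change 𝟙 (a.eval v ⊗ b.eval v) ▷ c.eval v ≫ 𝟙 ((a.eval v ⊗ b.eval v) ⊗ c.eval v) ≫
        (α_ _ _ _).hom = (α_ _ _ _).hom ≫ a.eval v ◁ 𝟙 (b.eval v ⊗ c.eval v) ≫ 𝟙 _
      simp)
    (fun a b => (Category.id_comp _).trans (Category.comp_id _).symm)

/-- The morphism from the free 2-module extending a given family. -/
def free.lift (v : I → X.toSCGr) : free R I ⟶ X where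
  toHom := liftHom v
  lin a r := 𝟙 (X.act.op (a.eval v) r)
  lin_nat_left := by
    rintro a b ⟨f⟩ r
    exact (Category.comp_id _).trans (Category.id_comp _).symm
  lin_nat_right a {_ _} f := (Category.comp_id _).trans (Category.id_comp _).symm
  lin_add_left a b r := by
    change 𝟙 _ ≫ X.act.addLeft (a.eval v) (b.eval v) r ≫ 𝟙 _ =
      (𝟙 _ ⊗ₘ 𝟙 _) ≫ X.act.addLeft (a.eval v) (b.eval v) r ≫
        X.act.mapLeft (𝟙 (a.eval v ⊗ b.eval v)) r
    rw [Biadd.mapLeft_id, id_tensorHom_id, Category.id_comp]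
  lin_add_right a r s := by
    change 𝟙 _ ≫ X.act.addRight (a.eval v) r s ≫ 𝟙 _ =
      (𝟙 _ ⊗ₘ 𝟙 _) ≫ X.act.addRight (a.eval v) r s
    rw [id_tensorHom_id, Category.id_comp, Category.id_comp, Category.comp_id]
  lin_assoc a r s := by
    change 𝟙 _ ≫ X.act.mapLeft (𝟙 (X.act.op (a.eval v) r)) s ≫ (X.assoc (a.eval v) r s).hom =
      (X.assoc (a.eval v) r s).hom ≫ 𝟙 _
    rw [Biadd.mapLeft_id, Category.id_comp, Category.id_comp, Category.comp_id]
  lin_unit a := Category.id_comp _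

end

end TwoMod

namespace TwoMod

open Functor.LaxMonoidal Functor.OplaxMonoidal

section

variable {R : TwoRing.{u}} {M N : TwoMod R} {F G : M ⟶ N} {a b c : M.toSCGr}

/-- The action on morphisms between values of morphisms of 2-modules. -/
def actComp (f : F.toHom.functor.obj a ⟶ G.toHom.functor.obj a) (r : R.toSCGr) :
    F.toHom.functor.obj (M.act.op a r) ⟶ G.toHom.functor.obj (M.act.op a r) :=
  F.lin a r ≫ N.act.mapLeft f r ≫ inv (G.lin a r)

lemma actComp_lin (f : F.toHom.functor.obj a ⟶ G.toHom.functor.obj a) (r : R.toSCGr) :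
    actComp f r ≫ G.lin a r = F.lin a r ≫ N.act.mapLeft f r := by
  simp [actComp]

/-- This and the remaining lemmas of the section are the inductive steps of `free.trackApp_nat` for
the formal arrows that involve the action. Each reduces, after composing with the invertible
constraint of G, to the matching axiom for morphisms of 2-modules. -/
lemma actComp_nat_left {u : a ⟶ b} {f : F.toHom.functor.obj a ⟶ G.toHom.functor.obj a}
    {g : F.toHom.functor.obj b ⟶ G.toHom.functor.obj b}
    (h : F.toHom.functor.map u ≫ g = f ≫ G.toHom.functor.map u) (r : R.toSCGr) :
    F.toHom.functor.map (M.act.mapLeft u r) ≫ actComp g r =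
      actComp f r ≫ G.toHom.functor.map (M.act.mapLeft u r) := by
  rw [← cancel_mono (G.lin b r), Category.assoc, Category.assoc, actComp_lin, G.lin_nat_left,
    reassoc_of% (actComp_lin (F := F) (G := G) f r), reassoc_of% F.lin_nat_left,
    ← Biadd.mapLeft_comp, ← Biadd.mapLeft_comp, h]

lemma actComp_nat_right (f : F.toHom.functor.obj a ⟶ G.toHom.functor.obj a) {r s : R.toSCGr}
    (u : r ⟶ s) :
    F.toHom.functor.map (M.act.mapRight a u) ≫ actComp f s =
      actComp f r ≫ G.toHom.functor.map (M.act.mapRight a u) := by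
  rw [← cancel_mono (G.lin a s), Category.assoc, Category.assoc, actComp_lin, G.lin_nat_right,
    reassoc_of% (actComp_lin (F := F) (G := G) f r), reassoc_of% F.lin_nat_right,
    Biadd.mapLeft_mapRight]

lemma addLeft_actComp (f : F.toHom.functor.obj a ⟶ G.toHom.functor.obj a)
    (g : F.toHom.functor.obj b ⟶ G.toHom.functor.obj b) (r : R.toSCGr) :
    F.toHom.functor.map (M.act.addLeft a b r) ≫ actComp (a := a ⊗ b) (addComp f g) r =
      addComp (actComp f r) (actComp g r) ≫ G.toHom.functor.map (M.act.addLeft a b r) := by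
  have h : (actComp f r ⊗ₘ actComp g r) ≫ (G.lin a r ⊗ₘ G.lin b r) =
      (F.lin a r ⊗ₘ F.lin b r) ≫ (N.act.mapLeft f r ⊗ₘ N.act.mapLeft g r) := by
    rw [tensorHom_comp_tensorHom, tensorHom_comp_tensorHom, actComp_lin, actComp_lin]
  rw [← cancel_mono (G.lin (a ⊗ b) r), ← cancel_epi (μ F.toHom.functor _ _)]
  simp only [Category.assoc]
  rw [actComp_lin, reassoc_of% (μ_addComp (F := F.toHom.functor) (G := G.toHom.functor)),
    G.lin_add_left, reassoc_of% h, reassoc_of% F.lin_add_left, ← Biadd.mapLeft_comp, μ_addComp,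
    Biadd.mapLeft_comp, reassoc_of% (Biadd.addLeft_nat N.act f g r)]

lemma addRight_actComp (f : F.toHom.functor.obj a ⟶ G.toHom.functor.obj a) (r s : R.toSCGr) :
    F.toHom.functor.map (M.act.addRight a r s) ≫ actComp f (r ⊗ s) =
      addComp (actComp f r) (actComp f s) ≫ G.toHom.functor.map (M.act.addRight a r s) := by
  have h : (actComp f r ⊗ₘ actComp f s) ≫ (G.lin a r ⊗ₘ G.lin a s) =
      (F.lin a r ⊗ₘ F.lin a s) ≫ (N.act.mapLeft f r ⊗ₘ N.act.mapLeft f s) := by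
    rw [tensorHom_comp_tensorHom, tensorHom_comp_tensorHom, actComp_lin, actComp_lin]
  rw [← cancel_mono (G.lin a (r ⊗ s)), ← cancel_epi (μ F.toHom.functor _ _)]
  simp only [Category.assoc]
  rw [actComp_lin, reassoc_of% (μ_addComp (F := F.toHom.functor) (G := G.toHom.functor)),
    G.lin_add_right, reassoc_of% h, reassoc_of% F.lin_add_right, Biadd.addRight_nat_left]

lemma actComp_assoc (f : F.toHom.functor.obj a ⟶ G.toHom.functor.obj a) (r s : R.toSCGr) :
    F.toHom.functor.map (M.assoc a r s).hom ≫ actComp f (R.mul.op r s) =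
      actComp (actComp f r) s ≫ G.toHom.functor.map (M.assoc a r s).hom := by
  rw [← cancel_mono (G.lin a (R.mul.op r s)), Category.assoc, Category.assoc, actComp_lin,
    ← G.lin_assoc, reassoc_of% (actComp_lin (F := F) (G := G) (actComp f r) s),
    ← reassoc_of% (F.lin_assoc a r s), ← N.assoc_nat_left,
    ← reassoc_of% (Biadd.mapLeft_comp N.act (actComp f r)), actComp_lin, Biadd.mapLeft_comp,
    Category.assoc]

lemma actComp_unit (f : F.toHom.functor.obj a ⟶ G.toHom.functor.obj a) :
    F.toHom.functor.map (M.unit a).hom ≫ f =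
      actComp f R.one ≫ G.toHom.functor.map (M.unit a).hom := by
  rw [← G.lin_unit, reassoc_of% (actComp_lin (F := F) (G := G) f), N.unit_nat, ← F.lin_unit,
    Category.assoc]

end

end TwoMod

namespace TwoMod

open Functor.LaxMonoidal Functor.OplaxMonoidal

section

variable {R : TwoRing.{u}} {I : Type u} {X : TwoMod R}

/-- The components of a track extending a given family. -/
def free.trackApp {F G : free R I ⟶ X}
    (w : ∀ i, F.toHom.functor.obj (FreeObj.of i) ⟶ G.toHom.functor.obj (FreeObj.of i)) :
    ∀ a : FreeObj R I, F.toHom.functor.obj a ⟶ G.toHom.functor.obj a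
  | .of i => w i
  | .zero => η F.toHom.functor ≫ ε G.toHom.functor
  | .add a b => addComp (trackApp w a) (trackApp w b)
  | .neg a => dualMap (mapPairing F.toHom.functor (FreeHom.pair a).mk)
      (mapPairing G.toHom.functor (FreeHom.pair a).mk) (trackApp w a)
  | .act a r => actComp (M := free R I) (a := a) (trackApp w a) r

variable {F G : free R I ⟶ X}
  (w : ∀ i, F.toHom.functor.obj (FreeObj.of i) ⟶ G.toHom.functor.obj (FreeObj.of i))

lemma free.trackApp_nat {a b : FreeObj R I} (f : FreeHom a b) :
    F.toHom.functor.map f.mk ≫ trackApp w b = trackApp w a ≫ G.toHom.functor.map f.mk := by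
  induction f with
  | id a =>
    exact congr($(F.toHom.functor.map_id a) ≫ _).trans ((Category.id_comp _).trans
      ((Category.comp_id _).symm.trans congr(_ ≫ $((G.toHom.functor.map_id a).symm))))
  | comp f g hf hg =>
    exact congr($(F.toHom.functor.map_comp f.mk g.mk) ≫ _).trans ((Category.assoc _ _ _).trans
      (congr(_ ≫ $hg).trans ((Category.assoc _ _ _).symm.trans (congr($hf ≫ _).trans
        ((Category.assoc _ _ _).trans
          congr(_ ≫ $((G.toHom.functor.map_comp f.mk g.mk).symm)))))))
  | inv f hf =>
    have h (H : free R I ⟶ X) :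
        H.toHom.functor.map (FreeHom.inv f).mk = CategoryTheory.inv (H.toHom.functor.map f.mk) :=
      IsIso.eq_inv_of_hom_inv_id ((H.toHom.functor.map_comp _ _).symm.trans
        (congr(H.toHom.functor.map $(f.iso.hom_inv_id)).trans (H.toHom.functor.map_id _)))
    rw [h F, h G, IsIso.inv_comp_eq, ← Category.assoc, IsIso.eq_comp_inv, hf]
  | tensor f g hf hg =>
    exact addComp_nat (F := F.toHom.functor) (G := G.toHom.functor) hf hg
  | assoc a b c => exact addComp_assoc (F := F.toHom.functor) (G := G.toHom.functor) _ _ _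
  | left a => exact addComp_left (F := F.toHom.functor) (G := G.toHom.functor) _
  | right a => exact addComp_right (F := F.toHom.functor) (G := G.toHom.functor) _
  | braid a b => exact addComp_braiding (F := F.toHom.functor) (G := G.toHom.functor) _ _
  | pair a =>
    exact pair_nat (𝒞 := (free R I).toSCGr) (a := a) (b := .neg a) (F := F.toHom.functor)
      (G := G.toHom.functor) (FreeHom.pair a).mk (dualMap_compat _ _ _)
  | mapLeft f r hf => exact actComp_nat_left (M := free R I) hf r
  | mapRight a g => exact actComp_nat_right (M := free R I) _ g
  | addLeft a b r => exact addLeft_actComp (M := free R I) _ _ r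
  | addRight a r s => exact addRight_actComp (M := free R I) _ r s
  | actAssoc a r s => exact actComp_assoc (M := free R I) _ r s
  | actUnit a => exact actComp_unit (M := free R I) _

/-- The track extending a given family. -/
def free.track : F ⟶ G where
  track := SCGr.mkTrackOfTensor (free.trackApp w)
    (fun {a b} f => by
      obtain ⟨f, rfl⟩ := FreeHom.exists_rep f
      exact trackApp_nat w f)
    (fun a b => μ_addComp _ _)
  lin a r := (actComp_lin (M := free R I) (a := a) _ r).symm

/-- Linearity of a track, solved for its component at a multiple. It makes tracks out of free and
regular 2-modules unique. -/
lemma Track.app_act {M N : TwoMod R} {F G : M ⟶ N} (s : F ⟶ G) (a : M.toSCGr) (r : R.toSCGr) :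
    s.track.nat.app (M.act.op a r) = actComp (s.track.nat.app a) r := by
  rw [← cancel_mono (G.lin a r), actComp_lin]
  exact (s.lin a r).symm

lemma free.track_ext {s t : F ⟶ G}
    (h : ∀ i, s.track.nat.app (FreeObj.of i) = t.track.nat.app (FreeObj.of i)) : s = t := by
  refine hom_ext (SCGr.track_ext fun a => ?_)
  induction a with
  | of i => exact h i
  | zero =>
    exact (cancel_epi (ε F.toHom.functor)).1
      (s.track.isMonoidal.unit.trans t.track.isMonoidal.unit.symm)
  | add a b ha hb =>
    exact (cancel_epi (μ F.toHom.functor a b)).1 ((s.track.isMonoidal.tensor a b).trans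
      (congr(($ha ⊗ₘ $hb) ≫ μ G.toHom.functor a b).trans (t.track.isMonoidal.tensor a b).symm))
  | neg a ha =>
    exact (compat_nat s.track.nat (FreeHom.pair a).mk).unique
      (compat_nat t.track.nat (FreeHom.pair a).mk) ha
  | act a r ha =>
    exact (Track.app_act s a r).trans (congr(actComp (M := free R I) (a := a) $ha r).trans
      (Track.app_act t a r).symm)

end

instance (R : TwoRing.{u}) : HasPoints (TwoMod R) where
  pts M := M.toSCGr
  map f := f.toHom
  ev a X :=
    { obj := fun F => F.toHom.functor.obj a
      map := fun s => s.track.nat.app a }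
  precompIso f a X := Iso.refl _
  postcompIso a f := Iso.refl _
  cofaithful_iff := cofaithful_iff
  evIso f a := Iso.refl _
  evMapIso e := NatIso.ofComponents (fun F => F.toHom.functor.mapIso e)
    (fun s => (s.track.nat.naturality e.hom).symm)

theorem isFree_of (R : TwoRing.{u}) (I : Type u) :
    IsFree (C := TwoMod R) (Q := free R I) FreeObj.of := fun _ =>
  { faithful := ⟨fun h => free.track_ext fun i => congrFun h i⟩
    full := ⟨fun w => ⟨free.track w, rfl⟩⟩
    essSurj := ⟨fun v => ⟨free.lift v, ⟨Iso.refl _⟩⟩⟩ }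

theorem hasEnoughProjectives (R : TwoRing.{u}) : HasEnoughProjectives (TwoMod R) :=
  hasEnoughProjectives_of_free fun I => ⟨free R I, FreeObj.of, isFree_of R I⟩

end TwoMod

/-! ### The regular 2-module is free on its unit -/

lemma comp_inv_of_comp_hom {𝒞 : Type*} [Category 𝒞] [MonoidalCategory 𝒞] {x x' y y' z z' : 𝒞}
    {e₁ : x ≅ x'} {e₂ : y ≅ y'} {e : z ≅ z'} {p : x ⊗ y ⟶ z} {q : x' ⊗ y' ⟶ z'}
    (h : p ≫ e.hom = (e₁.hom ⊗ₘ e₂.hom) ≫ q) : q ≫ e.inv = (e₁.inv ⊗ₘ e₂.inv) ≫ p := by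
  rw [Iso.comp_inv_eq, Category.assoc, h, tensorHom_comp_tensorHom_assoc]
  simp

section

variable {𝒞 𝒟 : Type*} [Category 𝒞] [Category 𝒟] {F G : 𝒞 ⥤ 𝒟} {a b c : 𝒞} {u : a ⟶ b} {v : b ⟶ c}
  {p : F.obj a ⟶ G.obj a} {q q' : F.obj b ⟶ G.obj b} {r : F.obj c ⟶ G.obj c}

/-- Naturality squares are pasted, cancelled and compared one at a time in these three lemmas, since
the components concerned are not yet known to form a natural transformation. -/
lemma paste_nat (h : F.map u ≫ q = p ≫ G.map u) (k : F.map v ≫ r = q ≫ G.map v) {w : a ⟶ c}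
    (hw : u ≫ v = w) : F.map w ≫ r = p ≫ G.map w := by
  rw [← hw, F.map_comp, G.map_comp, Category.assoc, k, reassoc_of% h]

lemma cancel_nat [IsGroupoid 𝒞] (h : F.map u ≫ q = p ≫ G.map u) {w : a ⟶ c} (hw : u ≫ v = w)
    (k : F.map w ≫ r = p ≫ G.map w) : F.map v ≫ r = q ≫ G.map v := by
  rw [← cancel_epi (F.map u), ← F.map_comp_assoc, hw, k, reassoc_of% h, ← G.map_comp, hw]

lemma unique_nat [IsGroupoid 𝒞] (h : F.map u ≫ q = p ≫ G.map u) (h' : F.map u ≫ q' = p ≫ G.map u) :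
    q = q' := by
  rw [← cancel_epi (F.map u), h, h']

end

namespace TwoMod

open Functor.LaxMonoidal Functor.OplaxMonoidal

section

variable {R : TwoRing.{u}}

lemma mapRight_one_injective {x y : R.toSCGr} {f g : x ⟶ y}
    (h : R.mul.mapRight R.one f = R.mul.mapRight R.one g) : f = g := by
  rw [← cancel_epi (R.unitLeft x).hom, ← R.unitLeft_nat, ← R.unitLeft_nat, h]

lemma mapLeft_one_injective {M : TwoMod R} {x y : M.toSCGr} {f g : x ⟶ y}
    (h : M.act.mapLeft f R.one = M.act.mapLeft g R.one) : f = g := by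
  rw [← cancel_epi (M.unit x).hom, ← M.unit_nat, ← M.unit_nat, h]

/-- The left unit constraint of a 2-ring at a product. -/
lemma assoc_unitLeft (x y : R.toSCGr) :
    (R.assoc R.one x y).hom ≫ (R.unitLeft (R.mul.op x y)).hom =
      R.mul.mapLeft (R.unitLeft x).hom y := by
  apply mapRight_one_injective
  -- Kelly's argument: the pentagon with two units, the triangle and naturality give the law
  -- multiplied by 1 on the left, and that factor can be removed.
  have e := R.pentagon R.one R.one x y
  have h₁ := congr($e ≫ R.mul.mapRight R.one (R.unitLeft (R.mul.op x y)).hom)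
  simp only [Category.assoc, R.triangle] at h₁
  rw [← R.assoc_nat_left, ← R.triangle, Biadd.mapLeft_comp, Category.assoc, R.assoc_nat_mid,
    ← Biadd.mapRight_comp] at h₁
  have : IsIso (R.mul.mapLeft (R.assoc R.one R.one x).hom y) := IsGroupoid.all_isIso _
  exact (cancel_epi (R.assoc _ _ _).hom).1 ((cancel_epi _).1 h₁)

/-- The unit constraint of a 2-module at a product. -/
lemma assoc_unitRight {M : TwoMod R} (m : M.toSCGr) (r : R.toSCGr) :
    (M.assoc m r R.one).hom ≫ M.act.mapRight m (R.unitRight r).hom =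
      (M.unit (M.act.op m r)).hom := by
  apply mapLeft_one_injective
  -- The mirror image of Kelly's argument, with the extra factor 1 acting on the right.
  have e := M.pentagon m r R.one R.one
  have h₁ := congr($e ≫ M.act.mapRight m (R.mul.mapRight r (R.unitLeft R.one).hom))
  simp only [Category.assoc] at h₁
  rw [← M.assoc_nat_right, reassoc_of% (M.triangle (M.act.op m r) R.one),
    ← Biadd.mapRight_comp, R.triangle, ← M.assoc_nat_mid, ← Category.assoc, ← Biadd.mapLeft_comp] at h₁
  exact (cancel_mono (M.assoc _ _ _).hom).1 h₁

/-- Naturality of the left unit constraint along itself shows that multiplying it by 1 on the left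
gives the left constraint at 1 · 1. `assoc_unitLeft` and the triangle then make the two constraints
agree after acting by 1 on the right. -/
lemma unitLeft_one (R : TwoRing.{u}) : (R.unitLeft R.one).hom = (R.unitRight R.one).hom := by
  have h := R.unitLeft_nat (R.unitLeft R.one).hom
  rw [cancel_mono] at h
  refine mapLeft_one_injective (M := regular R) ?_
  exact (assoc_unitLeft R.one R.one).symm.trans
    (congr(_ ≫ $(h.symm)).trans (R.triangle R.one R.one))

variable {X : TwoMod R}

/-- The morphism `r ↦ m · r` from the regular 2-module. -/
def regular.lift (m : X.toSCGr) : regular R ⟶ X where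
  toHom := SCGr.mkHom (A := R.toSCGr)
    { obj := fun r => X.act.op m r
      map := fun f => X.act.mapRight m f
      map_id := fun r => X.act.mapRight_id m r
      map_comp := fun f g => X.act.mapRight_comp m f g }
    (fun r s => X.act.addRight m r s)
    (fun f g => X.act.addRight_nat m f g)
    (fun r s t => X.act.addRight_assoc m r s t)
    (fun r s => X.act.addRight_braiding m r s)
  lin r s := (X.assoc m r s).inv
  lin_nat_left {r r'} f s := by
    have h := X.assoc_nat_mid m f s
    rw [← Iso.inv_comp_eq, ← Category.assoc, ← Iso.eq_comp_inv] at h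
    exact h.symm
  lin_nat_right r {s s'} f := by
    have h := X.assoc_nat_right m r f
    rw [← Iso.inv_comp_eq, ← Category.assoc, ← Iso.eq_comp_inv] at h
    exact h.symm
  lin_add_left r r' s := by
    have h := comp_inv_of_comp_hom ((Category.assoc _ _ _).trans (X.assoc_add_mid m r r' s))
    exact (Category.assoc _ _ _).symm.trans h
  lin_add_right r s s' := by
    have h := comp_inv_of_comp_hom (X.assoc_add_right m r s s')
    exact (Category.assoc _ _ _).symm.trans h
  lin_assoc r s t := by
    have h := X.pentagon m r s t
    have e : X.act.mapLeft (X.assoc m r s).inv t ≫ X.act.mapLeft (X.assoc m r s).hom t = 𝟙 _ := by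
      rw [← Biadd.mapLeft_comp, Iso.inv_hom_id, Biadd.mapLeft_id]
    change (X.assoc m (R.mul.op r s) t).inv ≫ X.act.mapLeft (X.assoc m r s).inv t ≫
      (X.assoc (X.act.op m r) s t).hom =
        X.act.mapRight m (R.assoc r s t).hom ≫ (X.assoc m r (R.mul.op s t)).inv
    rw [Iso.eq_comp_inv, Category.assoc, Category.assoc, ← h, reassoc_of% e, Iso.inv_hom_id_assoc]
  lin_unit r := by
    have h := assoc_unitRight m r
    exact (X.assoc m r R.one).inv_comp_eq.2 h.symm

variable {F G : regular R ⟶ X}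

/-- The components of the track extending a morphism between values at one. -/
def regular.trackApp (w : F.toHom.functor.obj R.one ⟶ G.toHom.functor.obj R.one) (r : R.toSCGr) :
    F.toHom.functor.obj r ⟶ G.toHom.functor.obj r :=
  inv (F.toHom.functor.map (R.unitLeft r).hom) ≫ actComp (M := regular R) (a := R.one) w r ≫
    G.toHom.functor.map (R.unitLeft r).hom

lemma regular.map_unitLeft_trackApp
    (w : F.toHom.functor.obj R.one ⟶ G.toHom.functor.obj R.one) (r : R.toSCGr) :
    F.toHom.functor.map (R.unitLeft r).hom ≫ trackApp w r =
      actComp (M := regular R) (a := R.one) w r ≫ G.toHom.functor.map (R.unitLeft r).hom :=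
  IsIso.hom_inv_id_assoc _ _

/-- The component at r is that of w acted on by r, transported along 1 · r ≅ r. This law and the two
below are laws of `actComp` at the point 1, pasted with that isomorphism. -/
lemma regular.trackApp_nat (w : F.toHom.functor.obj R.one ⟶ G.toHom.functor.obj R.one)
    {r s : R.toSCGr} (f : r ⟶ s) :
    F.toHom.functor.map f ≫ trackApp w s = trackApp w r ≫ G.toHom.functor.map f :=
  cancel_nat (𝒞 := (regular R).toSCGr) (F := F.toHom.functor)
    (G := G.toHom.functor) (u := (R.unitLeft r).hom) (v := f)
    (map_unitLeft_trackApp w r) (R.unitLeft_nat f).symm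
    (paste_nat (actComp_nat_right (M := regular R) (a := R.one) w f)
      (map_unitLeft_trackApp w s) rfl)

lemma regular.trackApp_add (w : F.toHom.functor.obj R.one ⟶ G.toHom.functor.obj R.one)
    (r s : R.toSCGr) :
    trackApp w (r ⊗ s) =
      addComp (F := F.toHom.functor) (G := G.toHom.functor) (trackApp w r) (trackApp w s) :=
  unique_nat (𝒞 := (regular R).toSCGr) (F := F.toHom.functor) (G := G.toHom.functor)
    (u := (R.unitLeft r).hom ⊗ₘ (R.unitLeft s).hom)
    (paste_nat (addRight_actComp (M := regular R) (a := R.one) w r s)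
      (map_unitLeft_trackApp w (r ⊗ s)) (R.unitLeft_add r s))
    (addComp_nat (map_unitLeft_trackApp w r) (map_unitLeft_trackApp w s))

lemma regular.trackApp_act (w : F.toHom.functor.obj R.one ⟶ G.toHom.functor.obj R.one)
    (r s : R.toSCGr) :
    trackApp w (R.mul.op r s) = actComp (M := regular R) (a := r) (trackApp w r) s :=
  unique_nat (𝒞 := (regular R).toSCGr) (F := F.toHom.functor) (G := G.toHom.functor)
    (u := R.mul.mapLeft (R.unitLeft r).hom s)
    (paste_nat (actComp_assoc (M := regular R) (a := R.one) w r s)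
      (map_unitLeft_trackApp w (R.mul.op r s)) (assoc_unitLeft r s))
    (actComp_nat_left (M := regular R) (map_unitLeft_trackApp w r) s)

/-- The track extending a morphism between values at one. -/
def regular.track (w : F.toHom.functor.obj R.one ⟶ G.toHom.functor.obj R.one) : F ⟶ G where
  track := SCGr.mkTrackOfTensor (regular.trackApp w) (regular.trackApp_nat w) fun r s =>
    congr(_ ≫ $(regular.trackApp_add w r s)).trans (μ_addComp _ _)
  lin r s := by
    have h := actComp_lin (M := regular R) (F := F) (G := G) (regular.trackApp w r) s
    exact h.symm.trans congr($((regular.trackApp_act w r s).symm) ≫ _)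

/-- Two constraints 1 · 1 ≅ 1 meet here: the left one in the definition of the component and the
right one in `actComp_unit`. They coincide by `unitLeft_one`. -/
lemma regular.track_app_one (w : F.toHom.functor.obj R.one ⟶ G.toHom.functor.obj R.one) :
    (regular.track w).track.nat.app R.one = w :=
  unique_nat (𝒞 := (regular R).toSCGr) (F := F.toHom.functor)
    (G := G.toHom.functor) (u := (R.unitLeft R.one).hom)
    (map_unitLeft_trackApp w R.one)
    (unitLeft_one R ▸ actComp_unit (M := regular R) (a := R.one) w)

lemma regular.track_ext {s t : F ⟶ G} (h : s.track.nat.app R.one = t.track.nat.app R.one) :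
    s = t := by
  refine hom_ext (SCGr.track_ext fun r => ?_)
  rw [← cancel_epi (F.toHom.functor.map (R.unitLeft r).hom)]
  have e := (Track.app_act s R.one r).trans (congr(actComp (M := regular R) (a := R.one) $h r).trans
    (Track.app_act t R.one r).symm)
  exact (s.track.nat.naturality _).trans (congr($e ≫ _).trans (t.track.nat.naturality _).symm)

end

/-- Essential surjectivity comes from r ↦ m · r, whose value at 1 is identified with m by the unit
constraint. -/
theorem isFree_regular (R : TwoRing.{u}) :
    IsFree (C := TwoMod R) (Q := regular R) fun _ : PUnit.{u + 1} => R.one := fun _ =>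
  { faithful := ⟨fun h => regular.track_ext (congrFun h PUnit.unit)⟩
    full := ⟨fun w => ⟨regular.track (w PUnit.unit), funext fun _ => regular.track_app_one _⟩⟩
    essSurj := ⟨fun v => ⟨regular.lift (v PUnit.unit),
      ⟨CategoryTheory.Pi.isoMk fun _ => TwoMod.unit _ _⟩⟩⟩ }

end TwoMod

/-! ### Relative cokernels of 2-modules from those of the underlying objects -/

lemma SCGr.natTrans_ext_of_surjective {D S X : SCGr.{u}} {q : D ⟶ S}
    (hq : Function.Surjective (SCGr.Pi0.map q)) {F G : S ⥤ X} (s t : F ⟶ G)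
    (h : ∀ d, s.app (q.functor.obj d) = t.app (q.functor.obj d)) (m : S) : s.app m = t.app m := by
  obtain ⟨d, hd⟩ := hq (SCGr.Pi0.mk m)
  obtain ⟨d, rfl⟩ := SCGr.Pi0.exists_rep d
  obtain ⟨e⟩ := SCGr.Pi0.mk_eq_iff.1 hd
  rw [← cancel_epi (F.map e), s.naturality, t.naturality, h]

namespace TwoMod

open Functor.LaxMonoidal Functor.OplaxMonoidal

variable {R : TwoRing.{u}}

section

variable {M N : TwoMod R} (h : M ⟶ N) {F : M.toSCGr ⟶ N.toSCGr} (t : F ⟶ h.toHom)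

/-- The linearity constraint transported along a track. -/
def transportLin (m : M.toSCGr) (r : R.toSCGr) :
    F.functor.obj (M.act.op m r) ⟶ N.act.op (F.functor.obj m) r :=
  t.nat.app (M.act.op m r) ≫ h.lin m r ≫ inv (N.act.mapLeft (t.nat.app m) r)

lemma transportLin_comp (m : M.toSCGr) (r : R.toSCGr) :
    transportLin h t m r ≫ N.act.mapLeft (t.nat.app m) r =
      t.nat.app (M.act.op m r) ≫ h.lin m r := by
  simp [transportLin]

/-- The transport of a morphism of 2-modules along a track. -/
def transport : M ⟶ N where
  toHom := F
  lin := transportLin h t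
  lin_nat_left {m m'} f r := by
    rw [← cancel_mono (N.act.mapLeft (t.nat.app m') r), Category.assoc, Category.assoc,
      transportLin_comp, ← Biadd.mapLeft_comp, t.nat.naturality, Biadd.mapLeft_comp,
      reassoc_of% (transportLin_comp h t), t.nat.naturality_assoc, h.lin_nat_left]
  lin_nat_right m {r r'} f := by
    rw [← cancel_mono (N.act.mapLeft (t.nat.app m) r'), Category.assoc, Category.assoc,
      transportLin_comp, ← Biadd.mapLeft_mapRight,
      reassoc_of% (transportLin_comp h t), t.nat.naturality_assoc, h.lin_nat_right]
  lin_add_left m m' r := by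
    rw [← cancel_mono (N.act.mapLeft (t.nat.app (m ⊗ m')) r)]
    simp only [Category.assoc]
    rw [transportLin_comp, ← Biadd.mapLeft_comp, t.isMonoidal.tensor, Biadd.mapLeft_comp,
      ← reassoc_of% (N.act.addLeft_nat), tensorHom_comp_tensorHom_assoc, transportLin_comp,
      transportLin_comp, t.nat.naturality_assoc, reassoc_of% (t.isMonoidal.tensor),
      h.lin_add_left, tensorHom_comp_tensorHom_assoc]
  lin_add_right m r r' := by
    rw [← cancel_mono (N.act.mapLeft (t.nat.app m) (r ⊗ r'))]
    simp only [Category.assoc]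
    rw [transportLin_comp, ← Biadd.addRight_nat_left, tensorHom_comp_tensorHom_assoc,
      transportLin_comp, transportLin_comp, t.nat.naturality_assoc,
      reassoc_of% (t.isMonoidal.tensor), h.lin_add_right, tensorHom_comp_tensorHom_assoc]
  lin_assoc m r s := by
    rw [← cancel_mono (N.act.mapLeft (t.nat.app m) (R.mul.op r s))]
    simp only [Category.assoc]
    rw [transportLin_comp, ← N.assoc_nat_left, ← reassoc_of% (N.act.mapLeft_comp),
      transportLin_comp, Biadd.mapLeft_comp, Category.assoc, reassoc_of% (transportLin_comp h t),
      t.nat.naturality_assoc, h.lin_assoc]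
  lin_unit m := by
    rw [← cancel_mono (t.nat.app m), Category.assoc, ← N.unit_nat, reassoc_of% (transportLin_comp h t),
      h.lin_unit, t.nat.naturality]

end

section

variable {D S X : TwoMod R} {q : D ⟶ S} (hq : Function.Surjective (SCGr.Pi0.map q.toHom))

section

variable (h : D ⟶ X) {k : S.toSCGr ⟶ X.toSCGr} (t : q.toHom ≫ k ⟶ h.toHom)
  {L : ∀ r : R.toSCGr, S.act.at' r ≫ k ⟶ k ≫ X.act.at' r}

/-- The components of a linearity constraint. -/
def linApp {r : R.toSCGr} (L : S.act.at' r ≫ k ⟶ k ≫ X.act.at' r) (m : S.toSCGr) :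
    k.functor.obj (S.act.op m r) ⟶ X.act.op (k.functor.obj m) r := L.nat.app m

/-- The linearity constraint on a composition transported along a track. -/
def compLin (d : D.toSCGr) (r : R.toSCGr) :
    k.functor.obj (q.toHom.functor.obj (D.act.op d r)) ⟶
      X.act.op (k.functor.obj (q.toHom.functor.obj d)) r := transportLin h t d r

/-- The morphism of 2-modules on `k` with the linearity constraint `L`, when `q ≫ k` underlies
a morphism of 2-modules. -/
def descend (hq : Function.Surjective (SCGr.Pi0.map q.toHom))
    (hL : ∀ d r, k.functor.map (q.lin d r) ≫ linApp (L r) (q.toHom.functor.obj d) =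
      compLin h t d r) : S ⟶ X where
  toHom := k
  lin m r := (L r).nat.app m
  lin_nat_left f r := (L r).nat.naturality f
  -- Naturality and additivity in m hold because each `L r` is a track. Each of the other laws is an
  -- equality of transformations natural in m, so it can be checked at values of q. There it is the
  -- law for the transported morphism `transport h t`, once the constraint of q is cancelled.
  lin_nat_right m {r r'} f := by
    refine SCGr.natTrans_ext_of_surjective hq
      (F := (S.act.at' r).functor ⋙ k.functor) (G := k.functor ⋙ (X.act.at' r').functor)
      (Functor.whiskerRight (S.act.atMap f).nat k.functor ≫ (L r').nat)
      ((L r).nat ≫ Functor.whiskerLeft k.functor (X.act.atMap f).nat) (fun d => ?_) m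
    have e : k.functor.map (S.act.mapRight (q.toHom.functor.obj d) f) ≫
        linApp (L r') (q.toHom.functor.obj d) =
        linApp (L r) (q.toHom.functor.obj d) ≫
          X.act.mapRight (k.functor.obj (q.toHom.functor.obj d)) f := by
      have e' := (transport h t).lin_nat_right d f
      change k.functor.map (q.toHom.functor.map _) ≫ compLin h t d r' =
        compLin h t d r ≫ X.act.mapRight (k.functor.obj (q.toHom.functor.obj d)) f at e'
      rw [← hL, ← hL, ← k.functor.map_comp_assoc, q.lin_nat_right, k.functor.map_comp] at e'
      simpa only [Category.assoc, cancel_epi] using e'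
    exact e
  lin_add_left m m' r := (Category.assoc _ _ _).symm.trans ((L r).isMonoidal.tensor m m')
  lin_add_right m r r' := by
    refine SCGr.natTrans_ext_of_surjective hq
      (F := ((S.act.at' r ≫ k) ⊗ (S.act.at' r' ≫ k)).functor)
      (G := (k ≫ X.act.at' (r ⊗ r')).functor)
      ((μ (Bicategory.postcomp S.toSCGr k) (S.act.at' r) (S.act.at' r')).nat ≫
        Functor.whiskerRight (S.act.atAdd r r').nat k.functor ≫ (L (r ⊗ r')).nat)
      ((L r ⊗ₘ L r').nat ≫ Functor.whiskerLeft k.functor (X.act.atAdd r r').nat)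
      (fun d => ?_) m
    have e : μ k.functor (S.act.op (q.toHom.functor.obj d) r)
        (S.act.op (q.toHom.functor.obj d) r') ≫
        k.functor.map (S.act.addRight (q.toHom.functor.obj d) r r') ≫
          linApp (L (r ⊗ r')) (q.toHom.functor.obj d) =
        (linApp (L r) (q.toHom.functor.obj d) ⊗ₘ linApp (L r') (q.toHom.functor.obj d)) ≫
          X.act.addRight (k.functor.obj (q.toHom.functor.obj d)) r r' := by
      have e' := (transport h t).lin_add_right d r r'
      change (μ k.functor _ _ ≫ k.functor.map (μ q.toHom.functor _ _)) ≫
        k.functor.map (q.toHom.functor.map _) ≫ compLin h t d (r ⊗ r') =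
        (compLin h t d r ⊗ₘ compLin h t d r') ≫
          X.act.addRight (k.functor.obj (q.toHom.functor.obj d)) r r' at e'
      rw [← hL, ← hL, ← hL, ← tensorHom_comp_tensorHom] at e'
      simp only [Category.assoc] at e'
      rw [← k.functor.map_comp_assoc (q.toHom.functor.map _),
        ← k.functor.map_comp_assoc (μ q.toHom.functor _ _), q.lin_add_right, k.functor.map_comp,
        Category.assoc, ← μ_natural_assoc] at e'
      simpa only [cancel_epi] using e'
    exact e
  lin_assoc m r s := by
    refine SCGr.natTrans_ext_of_surjective hq
      (F := (S.act.at' r).functor ⋙ (S.act.at' s).functor ⋙ k.functor)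
      (G := (k ≫ X.act.at' (R.mul.op r s)).functor)
      (Functor.whiskerLeft (S.act.at' r).functor (L s).nat ≫
        Functor.whiskerRight (L r).nat (X.act.at' s).functor ≫
          Functor.whiskerLeft k.functor (X.assocTrack r s).nat)
      (Functor.whiskerRight (S.assocTrack r s).nat k.functor ≫ (L (R.mul.op r s)).nat)
      (fun d => ?_) m
    have e : linApp (L s) (S.act.op (q.toHom.functor.obj d) r) ≫
        X.act.mapLeft (linApp (L r) (q.toHom.functor.obj d)) s ≫
          (X.assoc (k.functor.obj (q.toHom.functor.obj d)) r s).hom =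
        k.functor.map (S.assoc (q.toHom.functor.obj d) r s).hom ≫
          linApp (L (R.mul.op r s)) (q.toHom.functor.obj d) := by
      have e' := (transport h t).lin_assoc d r s
      change compLin h t (D.act.op d r) s ≫ X.act.mapLeft (compLin h t d r) s ≫
        (X.assoc (k.functor.obj (q.toHom.functor.obj d)) r s).hom =
        k.functor.map (q.toHom.functor.map _) ≫ compLin h t d (R.mul.op r s) at e'
      have n : k.functor.map (S.act.mapLeft (q.lin d r) s) ≫
          linApp (L s) (S.act.op (q.toHom.functor.obj d) r) =
          linApp (L s) (q.toHom.functor.obj (D.act.op d r)) ≫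
            X.act.mapLeft (k.functor.map (q.lin d r)) s := (L s).nat.naturality (q.lin d r)
      rw [← hL, ← hL, ← hL, Biadd.mapLeft_comp, Category.assoc, Category.assoc,
        ← reassoc_of% n, ← k.functor.map_comp_assoc (q.toHom.functor.map _), ← q.lin_assoc,
        k.functor.map_comp, k.functor.map_comp, Category.assoc, Category.assoc] at e'
      have : IsIso (S.act.mapLeft (q.lin d r) s) := IsGroupoid.all_isIso _
      simpa only [cancel_epi] using e'
    exact e
  lin_unit m := by
    refine SCGr.natTrans_ext_of_surjective hq
      (F := (S.act.at' R.one).functor ⋙ k.functor) (G := k.functor)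
      ((L R.one).nat ≫ Functor.whiskerLeft k.functor X.unitTrack.nat)
      (Functor.whiskerRight S.unitTrack.nat k.functor) (fun d => ?_) m
    have e : linApp (L R.one) (q.toHom.functor.obj d) ≫
        (X.unit (k.functor.obj (q.toHom.functor.obj d))).hom =
        k.functor.map (S.unit (q.toHom.functor.obj d)).hom := by
      have e' := (transport h t).lin_unit d
      change compLin h t d R.one ≫ (X.unit (k.functor.obj (q.toHom.functor.obj d))).hom =
        k.functor.map (q.toHom.functor.map _) at e'
      rw [← hL, ← q.lin_unit, k.functor.map_comp] at e'
      simpa only [Category.assoc, cancel_epi] using e'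
    exact e

/-- The given track, as a track of 2-modules. -/
def descendTrack (hq : Function.Surjective (SCGr.Pi0.map q.toHom))
    (hL : ∀ d r, k.functor.map (q.lin d r) ≫ linApp (L r) (q.toHom.functor.obj d) =
      compLin h t d r) : q ≫ descend h t hq hL ⟶ h where
  track := t
  lin d r := congr($(hL d r) ≫ _).trans (transportLin_comp h t d r)

end

/-- Both sides are natural in m, and at a value of q the equation is linearity of `t` after
cancelling the constraint of q. -/
lemma lin_of_surjective (hq : Function.Surjective (SCGr.Pi0.map q.toHom)) {k k' : S ⟶ X}
    (t : q ≫ k ⟶ q ≫ k') (s : k.toHom ⟶ k'.toHom)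
    (hs : ∀ d, s.nat.app (q.toHom.functor.obj d) = t.track.nat.app d) (m : S.toSCGr)
    (r : R.toSCGr) :
    k.lin m r ≫ X.act.mapLeft (s.nat.app m) r = s.nat.app (S.act.op m r) ≫ k'.lin m r := by
  refine SCGr.natTrans_ext_of_surjective hq
    (F := (S.act.at' r).functor ⋙ k.toHom.functor)
    (G := k'.toHom.functor ⋙ (X.act.at' r).functor)
    ((linTrack k r).nat ≫ Functor.whiskerRight s.nat (X.act.at' r).functor)
    (Functor.whiskerLeft (S.act.at' r).functor s.nat ≫ (linTrack k' r).nat) (fun d => ?_) m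
  have e : k.lin (q.toHom.functor.obj d) r ≫
      X.act.mapLeft (s.nat.app (q.toHom.functor.obj d)) r =
      s.nat.app (S.act.op (q.toHom.functor.obj d) r) ≫ k'.lin (q.toHom.functor.obj d) r := by
    have e' := t.lin d r
    rw [← hs, ← hs] at e'
    change (k.toHom.functor.map (q.lin d r) ≫ k.lin (q.toHom.functor.obj d) r) ≫
      X.act.mapLeft (s.nat.app (q.toHom.functor.obj d)) r =
      s.nat.app (q.toHom.functor.obj (D.act.op d r)) ≫
        k'.toHom.functor.map (q.lin d r) ≫ k'.lin (q.toHom.functor.obj d) r at e'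
    rw [← s.nat.naturality_assoc, Category.assoc] at e'
    simpa only [cancel_epi] using e'
  exact e

end

section

variable {A B D S X : TwoMod R} {f : A ⟶ B} {g : B ⟶ D} {α : f ≫ g ⟶ 𝟙_ (A ⟶ D)} {q : D ⟶ S}
  {ζ : g ≫ q ⟶ 𝟙_ (B ⟶ S)}

lemma isNullCompatible_track {h : D ⟶ X} {θ : g ≫ h ⟶ 𝟙_ (B ⟶ X)} :
    IsNullCompatible α θ ↔ IsNullCompatible (C := SCGr) (f := f.toHom) (g := g.toHom)
      (h := h.toHom) α.track θ.track :=
  ⟨fun H => congr(($H).track), fun H => hom_ext H⟩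

lemma null_lin {h : D ⟶ X} (θ : g ≫ h ⟶ 𝟙_ (B ⟶ X)) (b : B.toSCGr) (r : R.toSCGr) :
    h.toHom.functor.map (g.lin b r) ≫ h.lin (g.toHom.functor.obj b) r ≫
        X.act.mapLeft (SCGr.nullApp (g := g.toHom) (q := h.toHom) θ.track b) r =
      SCGr.nullApp (g := g.toHom) (q := h.toHom) θ.track (B.act.op b r) ≫ X.act.zeroLeft r :=
  (Category.assoc _ _ _).symm.trans (θ.lin b r)

/-- The constraint `0 · r ⟶ 0`. -/
def zeroAct (X : TwoMod R) (r : R.toSCGr) : X.act.op (𝟙_ X.toSCGr) r ⟶ 𝟙_ X.toSCGr :=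
  η (X.act.at' r).functor

lemma zeroLeft_zeroAct (X : TwoMod R) (r : R.toSCGr) : X.act.zeroLeft r ≫ zeroAct X r = 𝟙 _ :=
  Functor.Monoidal.ε_η _

/-- On values of q the constraint is forced by those of q and h, which gives the track `T`. It
descends by `IsExact.exists_track` in symmetric categorical groups, applied to the two ways of
combining k with the action of r. The required condition along g follows from linearity of ζ and θ.
-/
lemma exists_lin (H : SCGr.IsExact (f := f.toHom) (g := g.toHom) (q := q.toHom) α.track ζ.track)
    {h : D ⟶ X} (θ : g ≫ h ⟶ 𝟙_ (B ⟶ X)) {k : S.toSCGr ⟶ X.toSCGr} (t : q.toHom ≫ k ⟶ h.toHom)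
    (ht : nullComp (C := SCGr) (g := g.toHom) (q := q.toHom) ζ.track k =
      Bicategory.whiskerLeft g.toHom t ≫ θ.track) (r : R.toSCGr) :
    ∃ L : S.act.at' r ≫ k ⟶ k ≫ X.act.at' r, ∀ d,
      k.functor.map (q.lin d r) ≫ linApp L (q.toHom.functor.obj d) = compLin h t d r := by
  let Λ := Bicategory.whiskerRight (linTrack q r) k ≫
    (Bicategory.associator q.toHom (S.act.at' r) k).hom
  let T : q.toHom ≫ S.act.at' r ≫ k ⟶ q.toHom ≫ k ≫ X.act.at' r :=
    inv Λ ≫ (Bicategory.associator (D.act.at' r) q.toHom k).hom ≫ linTrack (transport h t) r ≫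
      (Bicategory.associator q.toHom k (X.act.at' r)).hom
  let T' (d : D.toSCGr) : k.functor.obj (S.act.op (q.toHom.functor.obj d) r) ⟶
    X.act.op (k.functor.obj (q.toHom.functor.obj d)) r := T.nat.app d
  have hT (d : D.toSCGr) : k.functor.map (q.lin d r) ≫ T' d = compLin h t d r := by
    have e : Λ ≫ T = (Bicategory.associator (D.act.at' r) q.toHom k).hom ≫
      linTrack (transport h t) r ≫ (Bicategory.associator q.toHom k (X.act.at' r)).hom :=
      IsIso.hom_inv_id_assoc _ _
    have e' : (k.functor.map (q.lin d r) ≫ 𝟙 _) ≫ T' d = 𝟙 _ ≫ compLin h t d r ≫ 𝟙 _ :=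
      congr(($e).nat.app d)
    simpa using e'
  obtain ⟨L, hL⟩ := H.exists_track (k := S.act.at' r ≫ k) (k' := k ≫ X.act.at' r) T (by
    refine SCGr.track_ext fun b => (SCGr.nullComp_app _ _ _).trans ?_
    refine Eq.trans ?_ congr(_ ≫ $((SCGr.nullComp_app _ _ _).symm))
    let z := SCGr.nullApp (g := g.toHom) (q := q.toHom) ζ.track
    let w := SCGr.nullApp (g := g.toHom) (q := h.toHom) θ.track
    let t' (d : D.toSCGr) : k.functor.obj (q.toHom.functor.obj d) ⟶ h.toHom.functor.obj d :=
      t.nat.app d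
    have hz : q.toHom.functor.map (g.lin b r) ≫ q.lin (g.toHom.functor.obj b) r ≫
      S.act.mapLeft (z b) r = z (B.act.op b r) ≫ S.act.zeroLeft r := null_lin ζ b r
    have hw : h.toHom.functor.map (g.lin b r) ≫ h.lin (g.toHom.functor.obj b) r ≫
      X.act.mapLeft (w b) r = w (B.act.op b r) ≫ X.act.zeroLeft r := null_lin θ b r
    have hC (b : B.toSCGr) : k.functor.map (z b) ≫ η k.functor = t' (g.toHom.functor.obj b) ≫ w b :=
      (SCGr.nullComp_app _ _ _).symm.trans congr(($ht).nat.app b)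
    have hD : compLin h t (g.toHom.functor.obj b) r ≫ X.act.mapLeft (t' (g.toHom.functor.obj b)) r =
        t' (D.act.op (g.toHom.functor.obj b) r) ≫ h.lin (g.toHom.functor.obj b) r :=
      transportLin_comp h t _ r
    have hE : k.functor.map (q.toHom.functor.map (g.lin b r)) ≫
        t' (D.act.op (g.toHom.functor.obj b) r) =
        t' (g.toHom.functor.obj (B.act.op b r)) ≫ h.toHom.functor.map (g.lin b r) :=
      t.nat.naturality (g.lin b r)
    -- After precomposition with the constraints of q and g, both sides reduce to the component of k
    -- applied to ζ at b · r: the left by `hz`, the right by `hD`, `hE`, `hw` and `hC`.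
    have e : k.functor.map (S.act.mapLeft (z b) r) ≫ k.functor.map (zeroAct S r) ≫
        η k.functor = T' (g.toHom.functor.obj b) ≫ X.act.mapLeft (k.functor.map (z b)) r ≫
          X.act.mapLeft (η k.functor) r ≫ zeroAct X r := by
      rw [← cancel_epi (k.functor.map (q.lin (g.toHom.functor.obj b) r)), reassoc_of% hT,
        ← cancel_epi (k.functor.map (q.toHom.functor.map (g.lin b r))),
        ← reassoc_of% (X.act.mapLeft_comp), hC, Biadd.mapLeft_comp, Category.assoc,
        reassoc_of% hD, reassoc_of% hE, reassoc_of% hw, zeroLeft_zeroAct,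
        ← k.functor.map_comp_assoc (S.act.mapLeft _ _), ← k.functor.map_comp_assoc,
        ← k.functor.map_comp_assoc]
      rw [Category.assoc, reassoc_of% hz, zeroLeft_zeroAct, Category.comp_id, hC, Category.comp_id]
    exact e)
  exact ⟨L, fun d => congr(_ ≫ ($hL).nat.app d).trans (hT d)⟩

/-- The elementwise criterion for relative cokernels of 2-modules. -/
theorem isRelativeCokernel_of_isExact
    (H : SCGr.IsExact (f := f.toHom) (g := g.toHom) (q := q.toHom) α.track ζ.track)
    (hζ : IsNullCompatible α ζ) : IsRelativeCokernel α q ζ where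
  compatible := hζ
  exists_fac {X} h θ hθ := by
    -- Factor the underlying morphism first, then find a linearity constraint for each r separately.
    -- Their mutual coherence is automatic by `descend`.
    obtain ⟨k, t, ht⟩ := H.exists_fac (h := h.toHom) θ.track (isNullCompatible_track.1 hθ)
    have hL := exists_lin H θ t ht
    choose L hL using hL
    exact ⟨descend h t H.surjective fun d r => hL r d, descendTrack h t _ _, hom_ext ht⟩
  existsUnique_track {X} k k' t ht := by
    obtain ⟨s, hs⟩ := H.exists_track (k := k.toHom) (k' := k'.toHom) t.track congr(($ht).track)
    refine ⟨{ track := s, lin := lin_of_surjective H.surjective t s fun d =>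
      congr(($hs).nat.app d) }, hom_ext hs, fun s' hs' => ?_⟩
    exact (cofaithful_iff.2 H.surjective _).map_injective (hs'.trans (hom_ext hs).symm)

end

/-- Exactness concerns only underlying objects and tracks, so the tautological three-stage
resolution works with free 2-modules. -/
theorem isGenerator_of_free {G : TwoMod R} {e : G.toSCGr}
    (hG : IsFree (C := TwoMod R) fun _ : PUnit.{u + 1} => e)
    (hfree : ∀ I : Type u, ∃ (Q : TwoMod R) (x : I → Q.toSCGr), IsFree (C := TwoMod R) x) :
    IsGenerator G := by
  intro S
  obtain ⟨D, x, hx⟩ := hfree S.toSCGr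
  obtain ⟨q, hq⟩ := hx.exists_hom (X := S) id
  replace hq (s : S.toSCGr) : q.toHom.functor.obj (x s) ≅ s := (hq s).some
  obtain ⟨B, y, hy⟩ := hfree (Σ d : D.toSCGr, (q.toHom.functor.obj d ⟶ 𝟙_ S.toSCGr))
  obtain ⟨g, hg⟩ := hy.exists_hom (X := D) Sigma.fst
  replace hg j : g.toHom.functor.obj (y j) ≅ j.1 := (hg j).some
  obtain ⟨ζ, hζ⟩ := hy.exists_track (f := g ≫ q) (g := 𝟙_ (B ⟶ S)) fun j =>
    q.toHom.functor.map (hg j).hom ≫ j.2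
  let ζ' := SCGr.nullApp (g := g.toHom) (q := q.toHom) ζ.track
  replace hζ : ∀ j, ζ' (y j) = q.toHom.functor.map (hg j).hom ≫ j.2 := hζ
  obtain ⟨A, z, hz⟩ := hfree
    (Σ b : B.toSCGr, { v : g.toHom.functor.obj b ⟶ 𝟙_ D.toSCGr //
      q.toHom.functor.map v ≫ η q.toHom.functor = ζ' b })
  obtain ⟨f, hf⟩ := hz.exists_hom (X := B) Sigma.fst
  replace hf j : f.toHom.functor.obj (z j) ≅ j.1 := (hf j).some
  obtain ⟨α, hα⟩ := hz.exists_track (f := f ≫ g) (g := 𝟙_ (A ⟶ D)) fun j =>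
    g.toHom.functor.map (hf j).hom ≫ j.2.1
  let α' := SCGr.nullApp (g := f.toHom) (q := g.toHom) α.track
  replace hα : ∀ j, α' (z j) = g.toHom.functor.map (hf j).hom ≫ j.2.1 := hα
  refine ⟨A, B, D, f, g, α, q, ζ, hz.isCoproductOfCopies hG, hy.isCoproductOfCopies hG,
    hx.isCoproductOfCopies hG, ?_⟩
  refine isRelativeCokernel_of_isExact ⟨?_, ?_, ?_⟩ ?_
  · intro s
    obtain ⟨s, rfl⟩ := SCGr.Pi0.exists_rep s
    exact ⟨SCGr.Pi0.mk (x s), SCGr.Pi0.mk_eq (hq s).hom⟩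
  · intro d u
    exact ⟨y ⟨d, u⟩, (hg ⟨d, u⟩).hom, (hζ ⟨d, u⟩).symm⟩
  · intro b v hv
    exact ⟨z ⟨b, v, hv⟩, (hf ⟨b, v, hv⟩).hom, (hα ⟨b, v, hv⟩).symm⟩
  · refine hz.track_ext fun j => ?_
    have h : q.toHom.functor.map (α' (z j)) ≫ η q.toHom.functor =
        ζ' (f.toHom.functor.obj (z j)) := by
      rw [hα, q.toHom.functor.map_comp, Category.assoc, j.2.2]
      exact SCGr.nullApp_nat (g := g.toHom) (q := q.toHom) ζ.track (hf j).hom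
    exact h.trans ((Category.id_comp _).trans (Category.comp_id _)).symm

theorem isGenerator_regular (R : TwoRing.{u}) : IsGenerator (regular R) :=
  isGenerator_of_free (isFree_regular R) fun I => ⟨free R I, FreeObj.of, isFree_of R I⟩

end TwoMod

/-! ### Coinduced 2-modules -/

namespace SCGr

open Functor.LaxMonoidal Functor.OplaxMonoidal

variable {A B : SCGr.{u}}

/-- A track with prescribed components. -/
def copyTrack {F G : A ⟶ B} (s : F ⟶ G) (t : ∀ x, F.functor.obj x ⟶ G.functor.obj x)
    (h : ∀ x, t x = s.nat.app x) : F ⟶ G :=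
  mkTrackOfTensor t (fun f => by rw [h, h]; exact s.nat.naturality f)
    (fun x y => by rw [h, h, h]; exact s.isMonoidal.tensor x y)

lemma tensorμ_nat_app (F G H K : A ⟶ B) (x : A) :
    (tensorμ F G H K).nat.app x =
      tensorμ (F.functor.obj x) (G.functor.obj x) (H.functor.obj x) (K.functor.obj x) := by
  simp [tensorμ]

end SCGr

namespace TwoMod

open Functor.LaxMonoidal Functor.OplaxMonoidal

variable {R : TwoRing.{u}} {M : TwoMod R}

/-- The morphism `r ↦ m · r` of symmetric categorical groups. -/
def orbit (m : M.toSCGr) : R.toSCGr ⟶ M.toSCGr := (regular.lift m).toHom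

/-- The functoriality of orbits. -/
def orbitMap {m n : M.toSCGr} (f : m ⟶ n) : orbit m ⟶ orbit n :=
  SCGr.mkTrackOfTensor (F := orbit m) (G := orbit n) (fun r => M.act.mapLeft f r)
    (fun g => (M.act.mapLeft_mapRight f g).symm)
    (fun r s => (M.act.addRight_nat_left f r s).symm)

/-- The additivity of orbits. -/
def orbitAdd (m n : M.toSCGr) : orbit m ⊗ orbit n ⟶ orbit (m ⊗ n) :=
  SCGr.mkTrackOfTensor (F := orbit m ⊗ orbit n) (G := orbit (m ⊗ n)) (fun r => M.act.addLeft m n r)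
    (fun g => (M.act.addLeft_mapRight m n g).symm)
    (fun r s => by
      have h := congr(tensorμ _ _ _ _ ≫ $(M.act.addLeft_addRight m n r s))
      rw [Category.assoc, ← Category.assoc (tensorμ _ _ _ _), tensorμ_tensorμ,
        Category.id_comp] at h
      exact (Category.assoc _ _ _).trans h.symm)

/-- The orbit of a multiple. -/
def orbitAct (m : M.toSCGr) (r : R.toSCGr) :
    orbit (M.act.op m r) ⟶ orbit (M := regular R) r ≫ orbit m :=
  SCGr.mkTrackOfTensor (F := orbit (M.act.op m r)) (G := orbit (M := regular R) r ≫ orbit m)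
    (fun s => (M.assoc m r s).hom) (fun f => M.assoc_nat_right m r f)
    (fun s s' => M.assoc_add_right m r s s')

/-- The orbit of the unit. -/
def orbitOne (R : TwoRing.{u}) : orbit (M := regular R) R.one ⟶ 𝟙 R.toSCGr :=
  SCGr.mkTrackOfTensor (F := orbit (M := regular R) R.one) (G := 𝟙 R.toSCGr)
    (fun s => (R.unitLeft s).hom) (fun f => R.unitLeft_nat f)
    (fun s s' => (R.unitLeft_add s s').trans (Category.comp_id _).symm)

/-- Morphisms of 2-modules preserve orbits. -/
def orbitLin {M N : TwoMod R} (F : M ⟶ N) (m : M.toSCGr) :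
    orbit m ≫ F.toHom ⟶ orbit (F.toHom.functor.obj m) :=
  SCGr.mkTrackOfTensor (F := orbit m ≫ F.toHom) (G := orbit (F.toHom.functor.obj m))
    (fun r => F.lin m r) (fun f => F.lin_nat_right m f)
    (fun r s => (Category.assoc _ _ _).trans (F.lin_add_right m r s))

section

variable {X : SCGr.{u}}

/-- The action on the symmetric categorical group of morphisms out of a 2-ring. -/
def coindCore (R : TwoRing.{u}) (X : SCGr.{u}) :
    BiaddCore (SCGr.hom R.toSCGr X) R.toSCGr (SCGr.hom R.toSCGr X) where
  op φ r := orbit (M := regular R) r ≫ φ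
  mapLeft f r := Bicategory.whiskerLeft (orbit (M := regular R) r) f
  mapRight φ _ _ g := Bicategory.whiskerRight (orbitMap (M := regular R) g) φ
  addLeft φ ψ r := μ (Bicategory.precomp X (orbit (M := regular R) r)) φ ψ
  addRight φ r s :=
    μ (Bicategory.postcomp R.toSCGr φ) (orbit (M := regular R) r) (orbit (M := regular R) s) ≫
      Bicategory.whiskerRight (orbitAdd (M := regular R) r s) φ
  mapLeft_id φ r := (Bicategory.precomp X (orbit (M := regular R) r)).map_id φ
  mapLeft_comp f g r := (Bicategory.precomp X (orbit (M := regular R) r)).map_comp f g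
  mapRight_id φ r := SCGr.track_ext fun t => by
    have e : φ.functor.map (R.mul.mapLeft (𝟙 r) t) = 𝟙 _ := by
      rw [Biadd.mapLeft_id, φ.functor.map_id]
    exact e
  mapRight_comp φ r s t f g := SCGr.track_ext fun x => by
    have e : φ.functor.map (R.mul.mapLeft (f ≫ g) x) =
        φ.functor.map (R.mul.mapLeft f x) ≫ φ.functor.map (R.mul.mapLeft g x) := by
      rw [Biadd.mapLeft_comp, φ.functor.map_comp]
    exact e
  mapLeft_mapRight f r s g := SCGr.track_ext fun t =>
    (f.nat.naturality (R.mul.mapLeft g t)).symm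
  addLeft_nat f g r := μ_natural (Bicategory.precomp X (orbit (M := regular R) r)) f g
  addLeft_assoc φ ψ χ r := associativity (Bicategory.precomp X (orbit (M := regular R) r)) φ ψ χ
  addLeft_braiding φ ψ r :=
    Functor.LaxBraided.braided (F := Bicategory.precomp X (orbit (M := regular R) r)) φ ψ
  addLeft_mapRight φ ψ r s g := SCGr.track_ext fun t =>
    (Category.id_comp _).trans (Category.comp_id _).symm
  addRight_nat_left {φ ψ} f r s := SCGr.track_ext fun t => by
    have e := f.nat.naturality (R.mul.addLeft r s t)
    have e' := f.isMonoidal.tensor (R.mul.op r t) (R.mul.op s t)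
    have e₁ : (f.nat.app (R.mul.op r t) ⊗ₘ f.nat.app (R.mul.op s t)) ≫ μ ψ.functor _ _ ≫
        ψ.functor.map (R.mul.addLeft r s t) =
        (μ φ.functor _ _ ≫ φ.functor.map (R.mul.addLeft r s t)) ≫
          f.nat.app (R.mul.op (r ⊗ s) t) := by
      rw [Category.assoc, e, reassoc_of% e']
    exact e₁
  addRight_nat φ {r r' s s'} f g := SCGr.track_ext fun t => by
    have e : (φ.functor.map (R.mul.mapLeft f t) ⊗ₘ φ.functor.map (R.mul.mapLeft g t)) ≫
        μ φ.functor _ _ ≫ φ.functor.map (R.mul.addLeft r' s' t) =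
        (μ φ.functor _ _ ≫ φ.functor.map (R.mul.addLeft r s t)) ≫
          φ.functor.map (R.mul.mapLeft (f ⊗ₘ g) t) := by
      rw [Category.assoc, ← φ.functor.map_comp, ← Biadd.addLeft_nat, φ.functor.map_comp,
        μ_natural_assoc]
    exact e
  addRight_assoc φ r s x := SCGr.track_ext fun t => by
    have e : (μ φ.functor (R.mul.op r t) (R.mul.op s t) ≫ φ.functor.map (R.mul.addLeft r s t)) ▷
          φ.functor.obj (R.mul.op x t) ≫
        (μ φ.functor _ _ ≫ φ.functor.map (R.mul.addLeft (r ⊗ s) x t)) ≫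
          φ.functor.map (R.mul.mapLeft (α_ r s x).hom t) = (α_ _ _ _).hom ≫
        φ.functor.obj (R.mul.op r t) ◁ (μ φ.functor (R.mul.op s t) (R.mul.op x t) ≫
          φ.functor.map (R.mul.addLeft s x t)) ≫
        μ φ.functor _ _ ≫ φ.functor.map (R.mul.addLeft r (s ⊗ x) t) := by
      have h := R.mul.addLeft_assoc r s x t
      simp only [comp_whiskerRight, MonoidalCategory.whiskerLeft_comp, Category.assoc]
      rw [μ_natural_left_assoc, μ_natural_right_assoc, ← φ.functor.map_comp, ← φ.functor.map_comp,
        h, φ.functor.map_comp, φ.functor.map_comp,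
        Functor.LaxMonoidal.associativity_assoc]
    refine Eq.trans ?_ (e.trans ?_)
    · exact congr($(tensorHom_id (C := X) (μ φ.functor (R.mul.op r t) (R.mul.op s t) ≫
        φ.functor.map (R.mul.addLeft r s t)) (φ.functor.obj (R.mul.op x t))) ≫ _)
    · exact congr(_ ≫ $((id_tensorHom (C := X) (φ.functor.obj (R.mul.op r t))
        (μ φ.functor (R.mul.op s t) (R.mul.op x t) ≫
          φ.functor.map (R.mul.addLeft s x t))).symm) ≫ _)
  addRight_braiding φ r s := SCGr.track_ext fun t => by
    have e : (μ φ.functor (R.mul.op r t) (R.mul.op s t) ≫ φ.functor.map (R.mul.addLeft r s t)) ≫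
        φ.functor.map (R.mul.mapLeft (β_ r s).hom t) = (β_ _ _).hom ≫
        μ φ.functor _ _ ≫ φ.functor.map (R.mul.addLeft s r t) := by
      rw [Category.assoc, ← φ.functor.map_comp, Biadd.addLeft_braiding, φ.functor.map_comp,
        Functor.LaxBraided.braided_assoc]
    exact e
  addLeft_addRight φ ψ r s := SCGr.track_ext fun t => by
    -- Addition in the first variable is pointwise and has identity components. The interchange of
    -- the four summands occurs twice and cancels.
    have e {a b c d x y x' y' : X} (f : a ⊗ b ⟶ x) (g : c ⊗ d ⟶ y) (f' : x ⟶ x') (g' : y ⟶ y') :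
        (tensorμ a b c d ≫ (𝟙 (a ⊗ c) ⊗ₘ 𝟙 (b ⊗ d))) ≫ (tensorμ a c b d ≫ (f ⊗ₘ g)) ≫
          (f' ⊗ₘ g') = (f ≫ f' ⊗ₘ g ≫ g') ≫ 𝟙 _ := by
      rw [id_tensorHom_id, Category.comp_id, Category.comp_id, Category.assoc,
        ← Category.assoc (tensorμ _ _ _ _), tensorμ_tensorμ, Category.id_comp,
        tensorHom_comp_tensorHom]
    refine Eq.trans ?_ (e (μ φ.functor (R.mul.op r t) (R.mul.op s t))
      (μ ψ.functor (R.mul.op r t) (R.mul.op s t)) (φ.functor.map (R.mul.addLeft r s t))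
      (ψ.functor.map (R.mul.addLeft r s t)))
    exact congr(($(SCGr.tensorμ_nat_app _ _ _ _ t) ≫ _) ≫ _)

end

end TwoMod

lemma map_inv_eq_of_map_hom {𝒞 𝒟 : Type*} [Category 𝒞] [Category 𝒟] (F : 𝒞 ⥤ 𝒟) {a b : 𝒞}
    (e : a ≅ b)
    {x : F.obj b ⟶ F.obj a} (h : F.map e.hom ≫ x = 𝟙 _) : F.map e.inv = x := by
  rw [← cancel_epi (F.map e.hom), h, ← F.map_comp, e.hom_inv_id, F.map_id]

lemma comp_inv_eq_of_hom {𝒞 : Type*} [Category 𝒞] {a b c d : 𝒞} {f : a ⟶ b} {g : c ⟶ d}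
    {e : a ≅ c} {e' : b ≅ d} (h : f ≫ e'.hom = e.hom ≫ g) : g ≫ e'.inv = e.inv ≫ f := by
  rw [Iso.comp_inv_eq, Category.assoc, h, Iso.inv_hom_id_assoc]

namespace TwoMod

open Functor.LaxMonoidal Functor.OplaxMonoidal

variable {R : TwoRing.{u}}

section

variable {X : SCGr.{u}}

/-- The associativity constraint of the coinduced 2-module. -/
def coindAssoc (φ : R.toSCGr ⟶ X) (r s : R.toSCGr) :
    orbit (M := regular R) s ≫ orbit (M := regular R) r ≫ φ ⟶
      orbit (M := regular R) (R.mul.op r s) ≫ φ :=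
  SCGr.copyTrack (G := orbit (M := regular R) (R.mul.op r s) ≫ φ)
    -- Acting by r and then s evaluates φ at r(st), acting by rs evaluates it at (rs)t. The
    -- constraint thus runs against the associativity of R, hence the inverse.
    (inv (Bicategory.whiskerRight (orbitAct (M := regular R) r s) φ ≫
      (Bicategory.associator _ _ _).hom))
    (fun t => φ.functor.map (R.assoc r s t).inv) (fun t => by
      have e := IsIso.hom_inv_id (Bicategory.whiskerRight (orbitAct (M := regular R) r s) φ ≫
        (Bicategory.associator _ _ _).hom)
      have e' : (φ.functor.map (R.assoc r s t).hom ≫ 𝟙 _) ≫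
        (inv (Bicategory.whiskerRight (orbitAct (M := regular R) r s) φ ≫
          (Bicategory.associator _ _ _).hom)).nat.app t = 𝟙 _ := congr(($e).nat.app t)
      rw [Category.comp_id] at e'
      exact map_inv_eq_of_map_hom _ _ e')

/-- The unit constraint of the coinduced 2-module. -/
def coindUnit (φ : R.toSCGr ⟶ X) : orbit (M := regular R) R.one ≫ φ ⟶ φ :=
  SCGr.copyTrack (F := orbit (M := regular R) R.one ≫ φ)
    (Bicategory.whiskerRight (orbitOne R) φ ≫ (Bicategory.leftUnitor φ).hom)
    (fun t => φ.functor.map (R.unitLeft t).hom) (fun _ => (Category.comp_id _).symm)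

/-- `coindAssoc` as an isomorphism. -/
def coindAssocIso (φ : R.toSCGr ⟶ X) (r s : R.toSCGr) :
    orbit (M := regular R) s ≫ orbit (M := regular R) r ≫ φ ≅
      orbit (M := regular R) (R.mul.op r s) ≫ φ := asIso (coindAssoc φ r s)

/-- `coindUnit` as an isomorphism. -/
def coindUnitIso (φ : R.toSCGr ⟶ X) : orbit (M := regular R) R.one ≫ φ ≅ φ := asIso (coindUnit φ)

end

/-- The coinduced 2-module of a symmetric categorical group. -/
def coind (R : TwoRing.{u}) (X : SCGr.{u}) : TwoMod R where
  toSCGr := SCGr.hom R.toSCGr X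
  act := (coindCore R X).toBiadd
  assoc φ r s := coindAssocIso φ r s
  unit φ := coindUnitIso φ
  -- The evaluation point t acts as an additional last variable: a law here in the second or third
  -- variable is the law of R in its first or second one, and laws in the first variable hold
  -- pointwise. The triangle becomes the derived law `assoc_unitLeft`.
  assoc_nat_left f r s := SCGr.track_ext fun t => (f.nat.naturality (R.assoc r s t).inv).symm
  assoc_nat_mid φ {r r'} f s := SCGr.track_ext fun t => by
    have e : φ.functor.map (R.mul.mapLeft f (R.mul.op s t)) ≫ φ.functor.map (R.assoc r' s t).inv =
        φ.functor.map (R.assoc r s t).inv ≫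
          φ.functor.map (R.mul.mapLeft (R.mul.mapLeft f s) t) := by
      rw [← φ.functor.map_comp, ← φ.functor.map_comp, comp_inv_eq_of_hom (R.assoc_nat_left f s t)]
    exact e
  assoc_nat_right φ r {s s'} f := SCGr.track_ext fun t => by
    have e : φ.functor.map (R.mul.mapRight r (R.mul.mapLeft f t)) ≫
        φ.functor.map (R.assoc r s' t).inv =
        φ.functor.map (R.assoc r s t).inv ≫
          φ.functor.map (R.mul.mapLeft (R.mul.mapRight r f) t) := by
      rw [← φ.functor.map_comp, ← φ.functor.map_comp, comp_inv_eq_of_hom (R.assoc_nat_mid r f t)]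
    exact e
  unit_nat f := SCGr.track_ext fun t => (f.nat.naturality (R.unitLeft t).hom).symm
  assoc_add_left φ ψ r s := SCGr.track_ext fun t => by
    have e {a b c d : X} (f : a ⟶ b) (g : c ⟶ d) :
        𝟙 (a ⊗ c) ≫ 𝟙 (a ⊗ c) ≫ (f ⊗ₘ g) = (f ⊗ₘ g) ≫ 𝟙 _ := by simp
    exact e (φ.functor.map (R.assoc r s t).inv) (ψ.functor.map (R.assoc r s t).inv)
  assoc_add_mid φ r r' s := SCGr.track_ext fun t => by
    have e : 𝟙 _ ≫ (μ φ.functor _ _ ≫ φ.functor.map (R.mul.addLeft r r' (R.mul.op s t))) ≫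
        φ.functor.map (R.assoc (r ⊗ r') s t).inv =
        (φ.functor.map (R.assoc r s t).inv ⊗ₘ φ.functor.map (R.assoc r' s t).inv) ≫
          (μ φ.functor _ _ ≫ φ.functor.map (R.mul.addLeft (R.mul.op r s) (R.mul.op r' s) t)) ≫
            φ.functor.map (R.mul.mapLeft (R.mul.addLeft r r' s) t) := by
      have h := comp_inv_of_comp_hom
        ((Category.assoc _ _ _).trans (R.assoc_add_left r r' s t))
      rw [Category.id_comp, Category.assoc, Category.assoc, ← φ.functor.map_comp,
        ← φ.functor.map_comp, h, φ.functor.map_comp, μ_natural_assoc]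
    exact e
  assoc_add_right φ r s s' := SCGr.track_ext fun t => by
    have e : ((μ φ.functor _ _ ≫ φ.functor.map (R.mul.addRight r (R.mul.op s t)
        (R.mul.op s' t))) ≫ φ.functor.map (R.mul.mapRight r (R.mul.addLeft s s' t))) ≫
        φ.functor.map (R.assoc r (s ⊗ s') t).inv =
        (φ.functor.map (R.assoc r s t).inv ⊗ₘ φ.functor.map (R.assoc r s' t).inv) ≫
          (μ φ.functor _ _ ≫ φ.functor.map (R.mul.addLeft (R.mul.op r s) (R.mul.op r s') t)) ≫
            φ.functor.map (R.mul.mapLeft (R.mul.addRight r s s') t) := by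
      have h := comp_inv_of_comp_hom
        ((Category.assoc _ _ _).trans (R.assoc_add_mid r s s' t))
      rw [Category.assoc] at h
      simp only [Category.assoc, ← φ.functor.map_comp]
      rw [h, φ.functor.map_comp, μ_natural_assoc]
    exact e
  unit_add φ ψ := SCGr.track_ext fun t => Category.id_comp _
  pentagon φ r s t := SCGr.track_ext fun x => by
    have e : φ.functor.map (R.assoc r s (R.mul.op t x)).inv ≫
        φ.functor.map (R.assoc (R.mul.op r s) t x).inv ≫
          φ.functor.map (R.mul.mapLeft (R.assoc r s t).hom x) =
        φ.functor.map (R.mul.mapRight r (R.assoc s t x).inv) ≫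
          φ.functor.map (R.assoc r (R.mul.op s t) x).inv := by
      have h := R.pentagon r s t x
      have h' : R.mul.mapRight r (R.assoc s t x).hom ≫ R.mul.mapRight r (R.assoc s t x).inv =
          𝟙 _ := by
        rw [← Biadd.mapRight_comp, Iso.hom_inv_id, Biadd.mapRight_id]
      simp only [← φ.functor.map_comp]
      congr 1
      rw [← cancel_epi ((R.assoc (R.mul.op r s) t x).hom ≫ (R.assoc r s (R.mul.op t x)).hom)]
      conv_rhs => rw [← h]
      simp only [Category.assoc, Iso.hom_inv_id_assoc]
      rw [reassoc_of% h', Iso.hom_inv_id, Category.comp_id]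
    exact e
  triangle φ r := SCGr.track_ext fun t => by
    have e : φ.functor.map (R.assoc R.one r t).inv ≫
        φ.functor.map (R.mul.mapLeft (R.unitLeft r).hom t) =
        φ.functor.map (R.unitLeft (R.mul.op r t)).hom := by
      rw [← φ.functor.map_comp, ← assoc_unitLeft, Iso.inv_hom_id_assoc]
    exact e

end TwoMod

/-! ### Morphisms to coinduced 2-modules -/

namespace TwoMod

open Functor.LaxMonoidal Functor.OplaxMonoidal

variable {R : TwoRing.{u}} {M N : TwoMod R} {X : SCGr.{u}}

/-- The morphism sending an element to its orbit. -/
def orbitHom (M : TwoMod R) : M.toSCGr ⟶ SCGr.hom R.toSCGr M.toSCGr :=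
  SCGr.mkHom (B := SCGr.hom R.toSCGr M.toSCGr)
    { obj := orbit
      map := orbitMap
      map_id := fun m => SCGr.track_ext fun r => M.act.mapLeft_id m r
      map_comp := fun f g => SCGr.track_ext fun r => M.act.mapLeft_comp f g r }
    orbitAdd
    (fun f g => SCGr.track_ext fun r => M.act.addLeft_nat f g r)
    (fun a b c => SCGr.track_ext fun r => by
      refine Eq.trans ?_ ((M.act.addLeft_assoc a b c r).trans ?_)
      · exact congr($(tensorHom_id (C := M.toSCGr) (M.act.addLeft a b r) (M.act.op c r)) ≫ _)
      · exact congr(_ ≫ $((id_tensorHom (C := M.toSCGr) (M.act.op a r)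
          (M.act.addLeft b c r)).symm) ≫ _))
    (fun a b => SCGr.track_ext fun r => M.act.addLeft_braiding a b r)

/-- Postcomposition as a morphism of symmetric categorical groups. -/
def postcompHom (A : SCGr.{u}) {B C : SCGr.{u}} (φ : B ⟶ C) : SCGr.hom A B ⟶ SCGr.hom A C :=
  SCGr.Hom.mk (A := SCGr.hom A B) (B := SCGr.hom A C) (Bicategory.postcomp A φ)
    (braided := SCGr.postcompBraided A φ)

/-- The linearity constraint of the morphism to the coinduced 2-module. -/
def toCoindLin (φ : M.toSCGr ⟶ X) (m : M.toSCGr) (r : R.toSCGr) :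
    orbit (M.act.op m r) ≫ φ ⟶ orbit (M := regular R) r ≫ orbit m ≫ φ :=
  SCGr.copyTrack (F := orbit (M.act.op m r) ≫ φ) (G := orbit (M := regular R) r ≫ orbit m ≫ φ)
    (Bicategory.whiskerRight (orbitAct m r) φ ≫ (Bicategory.associator _ _ _).hom)
    (fun s => φ.functor.map (M.assoc m r s).hom) (fun _ => (Category.comp_id _).symm)

/-- The morphism to the coinduced 2-module corresponding to a morphism of symmetric categorical
groups. -/
def toCoind (φ : M.toSCGr ⟶ X) : M ⟶ coind R X where
  toHom := orbitHom M ≫ postcompHom R.toSCGr φ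
  lin := toCoindLin φ
  lin_nat_left {m m'} f r := SCGr.track_ext fun s => by
    have e : φ.functor.map (M.act.mapLeft (M.act.mapLeft f r) s) ≫
        φ.functor.map (M.assoc m' r s).hom =
        φ.functor.map (M.assoc m r s).hom ≫ φ.functor.map (M.act.mapLeft f (R.mul.op r s)) := by
      rw [← φ.functor.map_comp, ← φ.functor.map_comp, M.assoc_nat_left]
    exact e
  lin_nat_right m {r r'} f := SCGr.track_ext fun s => by
    have e : φ.functor.map (M.act.mapLeft (M.act.mapRight m f) s) ≫
        φ.functor.map (M.assoc m r' s).hom =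
        φ.functor.map (M.assoc m r s).hom ≫
          φ.functor.map (M.act.mapRight m (R.mul.mapLeft f s)) := by
      rw [← φ.functor.map_comp, ← φ.functor.map_comp, M.assoc_nat_mid]
    exact e
  lin_add_left m m' r := SCGr.track_ext fun s => by
    have e : (μ φ.functor _ _ ≫ φ.functor.map (M.act.addLeft (M.act.op m r) (M.act.op m' r) s)) ≫
        φ.functor.map (M.act.mapLeft (M.act.addLeft m m' r) s) ≫
          φ.functor.map (M.assoc (m ⊗ m') r s).hom =
        (φ.functor.map (M.assoc m r s).hom ⊗ₘ φ.functor.map (M.assoc m' r s).hom) ≫ 𝟙 _ ≫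
          μ φ.functor _ _ ≫ φ.functor.map (M.act.addLeft m m' (R.mul.op r s)) := by
      rw [Category.id_comp, Category.assoc, μ_natural_assoc]
      simp only [← φ.functor.map_comp]
      rw [M.assoc_add_left]
    exact e
  lin_add_right m r r' := SCGr.track_ext fun s => by
    have e : (μ φ.functor _ _ ≫ φ.functor.map (M.act.addLeft (M.act.op m r) (M.act.op m r') s)) ≫
        φ.functor.map (M.act.mapLeft (M.act.addRight m r r') s) ≫
          φ.functor.map (M.assoc m (r ⊗ r') s).hom =
        (φ.functor.map (M.assoc m r s).hom ⊗ₘ φ.functor.map (M.assoc m r' s).hom) ≫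
          (μ φ.functor _ _ ≫
            φ.functor.map (M.act.addRight m (R.mul.op r s) (R.mul.op r' s))) ≫
              φ.functor.map (M.act.mapRight m (R.mul.addLeft r r' s)) := by
      rw [Category.assoc, Category.assoc, μ_natural_assoc]
      simp only [← φ.functor.map_comp]
      rw [M.assoc_add_mid]
    exact e
  lin_assoc m r s := SCGr.track_ext fun t => by
    have e : φ.functor.map (M.assoc (M.act.op m r) s t).hom ≫
        φ.functor.map (M.assoc m r (R.mul.op s t)).hom ≫
          φ.functor.map (M.act.mapRight m (R.assoc r s t).inv) =
        φ.functor.map (M.act.mapLeft (M.assoc m r s).hom t) ≫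
          φ.functor.map (M.assoc m (R.mul.op r s) t).hom := by
      have h' : M.act.mapRight m (R.assoc r s t).hom ≫ M.act.mapRight m (R.assoc r s t).inv =
          𝟙 _ := by
        rw [← Biadd.mapRight_comp, Iso.hom_inv_id, Biadd.mapRight_id]
      simp only [← φ.functor.map_comp]
      rw [← reassoc_of% (M.pentagon m r s t), h', Category.comp_id]
    exact e
  lin_unit m := SCGr.track_ext fun s => by
    have e : φ.functor.map (M.assoc m R.one s).hom ≫
        φ.functor.map (M.act.mapRight m (R.unitLeft s).hom) =
        φ.functor.map (M.act.mapLeft (M.unit m).hom s) := by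
      rw [← φ.functor.map_comp, M.triangle]
    exact e

/-- The functoriality of `toCoind`. -/
def toCoindMap {φ ψ : M.toSCGr ⟶ X} (w : φ ⟶ ψ) : toCoind φ ⟶ toCoind ψ where
  track := SCGr.mkTrackOfTensor (fun m => Bicategory.whiskerLeft (orbit m) w)
    (fun {m m'} f => SCGr.track_ext fun r => w.nat.naturality (M.act.mapLeft f r))
    (fun m m' => SCGr.track_ext fun r => by
      have e : (μ φ.functor _ _ ≫ φ.functor.map (M.act.addLeft m m' r)) ≫
          w.nat.app (M.act.op (m ⊗ m') r) =
          (w.nat.app (M.act.op m r) ⊗ₘ w.nat.app (M.act.op m' r)) ≫ μ ψ.functor _ _ ≫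
            ψ.functor.map (M.act.addLeft m m' r) := by
        have e' := w.isMonoidal.tensor (M.act.op m r) (M.act.op m' r)
        rw [Category.assoc, w.nat.naturality, reassoc_of% e']
      exact e)
  lin m r := SCGr.track_ext fun s => w.nat.naturality (M.assoc m r s).hom

/-- The naturality of `toCoind`. -/
def toCoindComp (f : N ⟶ M) (φ : M.toSCGr ⟶ X) : toCoind (f.toHom ≫ φ) ⟶ f ≫ toCoind φ where
  track := SCGr.mkTrackOfTensor (F := (toCoind (f.toHom ≫ φ)).toHom) (G := (f ≫ toCoind φ).toHom)
    (fun a => SCGr.copyTrack (F := orbit a ≫ f.toHom ≫ φ)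
      (G := orbit (f.toHom.functor.obj a) ≫ φ)
      ((Bicategory.associator _ _ _).inv ≫ Bicategory.whiskerRight (orbitLin f a) φ)
      (fun r => φ.functor.map (f.lin a r)) (fun _ => (Category.id_comp _).symm))
    (fun {a b} g => SCGr.track_ext fun r => by
      have e : φ.functor.map (f.toHom.functor.map (N.act.mapLeft g r)) ≫ φ.functor.map (f.lin b r) =
          φ.functor.map (f.lin a r) ≫
            φ.functor.map (M.act.mapLeft (f.toHom.functor.map g) r) := by
        rw [← φ.functor.map_comp, ← φ.functor.map_comp, f.lin_nat_left]
      exact e)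
    (fun a b => SCGr.track_ext fun r => by
      have e : ((μ φ.functor _ _ ≫ φ.functor.map (μ f.toHom.functor _ _)) ≫
          φ.functor.map (f.toHom.functor.map (N.act.addLeft a b r))) ≫
            φ.functor.map (f.lin (a ⊗ b) r) =
          (φ.functor.map (f.lin a r) ⊗ₘ φ.functor.map (f.lin b r)) ≫
            (μ φ.functor _ _ ≫ φ.functor.map (M.act.addLeft _ _ r)) ≫
              φ.functor.map (M.act.mapLeft (μ f.toHom.functor a b) r) := by
        have h := f.lin_add_left a b r
        simp only [Category.assoc, ← φ.functor.map_comp]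
        rw [h, φ.functor.map_comp, μ_natural_assoc]
      exact e)
  lin a r := SCGr.track_ext fun s => by
    have e : φ.functor.map (f.toHom.functor.map (N.assoc a r s).hom) ≫
        φ.functor.map (f.lin a (R.mul.op r s)) =
        φ.functor.map (f.lin (N.act.op a r) s) ≫ φ.functor.map (M.act.mapLeft (f.lin a r) s) ≫
          φ.functor.map (M.assoc (f.toHom.functor.obj a) r s).hom := by
      simp only [← φ.functor.map_comp]
      rw [f.lin_assoc]
    exact e

/-- Evaluation at the unit. -/
def coindEv (R : TwoRing.{u}) (X : SCGr.{u}) : (coind R X).toSCGr ⟶ X := SCGr.evHom R.one X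

/-- The counit of coinduction. -/
def coindCounit (φ : M.toSCGr ⟶ X) : (toCoind φ).toHom ≫ coindEv R X ⟶ φ :=
  SCGr.mkTrackOfTensor (F := (toCoind φ).toHom ≫ coindEv R X)
    (fun m => φ.functor.map (M.unit m).hom)
    (fun {m m'} f => by
      have e : φ.functor.map (M.act.mapLeft f R.one) ≫ φ.functor.map (M.unit m').hom =
          φ.functor.map (M.unit m).hom ≫ φ.functor.map f := by
        rw [← φ.functor.map_comp, M.unit_nat, φ.functor.map_comp]
      exact e)
    (fun m m' => by
      have e : (𝟙 _ ≫ μ φ.functor _ _ ≫ φ.functor.map (M.act.addLeft m m' R.one)) ≫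
          φ.functor.map (M.unit (m ⊗ m')).hom =
          (φ.functor.map (M.unit m).hom ⊗ₘ φ.functor.map (M.unit m').hom) ≫ μ φ.functor _ _ := by
        rw [Category.id_comp, Category.assoc, ← φ.functor.map_comp, M.unit_add, μ_natural]
      exact e)

/-! ### The forgetful 2-functor preserves coproducts; smallness of the regular 2-module -/

variable {I : Type u} {A : I → TwoMod R} {Q : TwoMod R} {ι : ∀ i, A i ⟶ Q}

/-- The tracks `toCoindMap s` and `toCoindMap t` agree along every `ι i`, so they are equal by the
coproduct property with target `coind R X`. Evaluating at 1 gives s and t at m · 1, and the unit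
constraint carries this to m. -/
lemma faithful_of_isCoproduct (h : IsCoproduct ι) {φ ψ : Q.toSCGr ⟶ X} {s t : φ ⟶ ψ}
    (hst : ∀ i a, s.nat.app ((ι i).toHom.functor.obj a) = t.nat.app ((ι i).toHom.functor.obj a)) :
    s = t := by
  have hf := (h (coind R X)).faithful
  have e : toCoindMap s = toCoindMap t := by
    refine hf.map_injective (funext fun i => hom_ext (SCGr.track_ext fun a =>
      SCGr.track_ext fun r => ?_))
    have e : s.nat.app (Q.act.op ((ι i).toHom.functor.obj a) r) =
        t.nat.app (Q.act.op ((ι i).toHom.functor.obj a) r) := by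
      rw [← cancel_epi (φ.functor.map ((ι i).lin a r)), s.nat.naturality, t.nat.naturality, hst]
    exact e
  refine SCGr.track_ext fun m => ?_
  have e' : s.nat.app (Q.act.op m R.one) = t.nat.app (Q.act.op m R.one) :=
    congr((($e).track.nat.app m).nat.app R.one)
  rw [← cancel_epi (φ.functor.map (Q.unit m).hom), s.nat.naturality, t.nat.naturality, e']

/-- Move the tracks `w i` to coinduced 2-modules, where the coproduct property glues them, and
return by evaluation at 1. Naturality of `toCoind` in its source makes the restrictions comparable.
-/
lemma full_of_isCoproduct (h : IsCoproduct ι) {φ ψ : Q.toSCGr ⟶ X}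
    (w : ∀ i, (ι i).toHom ≫ φ ⟶ (ι i).toHom ≫ ψ) :
    ∃ t : φ ⟶ ψ, ∀ i, Bicategory.whiskerLeft (ι i).toHom t = w i := by
  have hf := (h (coind R X)).full
  let g (i : I) : ι i ≫ toCoind φ ⟶ ι i ≫ toCoind ψ :=
    inv (toCoindComp (ι i) φ) ≫ toCoindMap (w i) ≫ toCoindComp (ι i) ψ
  obtain ⟨k, hk⟩ := hf.map_surjective (X := toCoind φ) (Y := toCoind ψ) g
  let k' (m : Q.toSCGr) : φ.functor.obj (Q.act.op m R.one) ⟶ ψ.functor.obj (Q.act.op m R.one) :=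
    (k.track.nat.app m).nat.app R.one
  have hk' (i : I) (a : (A i).toSCGr) : φ.functor.map ((ι i).lin a R.one) ≫
      k' ((ι i).toHom.functor.obj a) =
      (w i).nat.app ((A i).act.op a R.one) ≫ ψ.functor.map ((ι i).lin a R.one) := by
    have e : toCoindComp (ι i) φ ≫ Bicategory.whiskerLeft (ι i) k =
        toCoindMap (w i) ≫ toCoindComp (ι i) ψ := by
      have e₁ : Bicategory.whiskerLeft (ι i) k = g i := congrFun hk i
      rw [e₁]
      exact IsIso.hom_inv_id_assoc _ _
    exact congr((($e).track.nat.app a).nat.app R.one)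
  -- Evaluation at 1 only gives a track between m ↦ φ(m · 1) and m ↦ ψ(m · 1); the counit conjugates
  -- it to one from φ to ψ.
  let t : φ ⟶ ψ := inv (coindCounit φ) ≫ Bicategory.whiskerRight k.track (coindEv R X) ≫
    coindCounit ψ
  have ht (m : Q.toSCGr) : φ.functor.map (Q.unit m).hom ≫ t.nat.app m =
      k' m ≫ ψ.functor.map (Q.unit m).hom := by
    have e : coindCounit φ ≫ t = Bicategory.whiskerRight k.track (coindEv R X) ≫ coindCounit ψ :=
      IsIso.hom_inv_id_assoc _ _
    exact congr(($e).nat.app m)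
  refine ⟨t, fun i => SCGr.track_ext fun a => ?_⟩
  have hw : φ.functor.map ((ι i).toHom.functor.map ((A i).unit a).hom) ≫ (w i).nat.app a =
      (w i).nat.app ((A i).act.op a R.one) ≫
        ψ.functor.map ((ι i).toHom.functor.map ((A i).unit a).hom) :=
    (w i).nat.naturality ((A i).unit a).hom
  have e : t.nat.app ((ι i).toHom.functor.obj a) = (w i).nat.app a := by
    rw [← cancel_epi (φ.functor.map ((ι i).toHom.functor.map ((A i).unit a).hom))]
    refine Eq.trans ?_ hw.symm
    rw [← (ι i).lin_unit, φ.functor.map_comp, Category.assoc, ht, reassoc_of% hk',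
      ψ.functor.map_comp]
  exact e

/-- The forgetful 2-functor from 2-modules preserves coproducts. -/
theorem isCoproduct_toHom (h : IsCoproduct ι) : IsCoproduct (C := SCGr) fun i => (ι i).toHom :=
  fun X =>
  { faithful := ⟨fun hst => faithful_of_isCoproduct h fun i a =>
      congr(($(congrFun hst i)).nat.app a)⟩
    full := ⟨fun w => by
      obtain ⟨t, ht⟩ := full_of_isCoproduct h w
      exact ⟨t, funext ht⟩⟩
    -- Glue the adjoint morphisms `toCoind (φ i)` to a morphism into `coind R X` and evaluate it at
    -- 1; the counit identifies its restrictions with the given ones.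
    essSurj := ⟨fun φ => by
      have := (h (coind R X)).essSurj
      let P : (Q ⟶ coind R X) ⥤ (∀ i, A i ⟶ coind R X) :=
        Functor.pi' fun i => Bicategory.precomp (coind R X) (ι i)
      let F := P.objPreimage fun i => toCoind (φ i)
      let e : P.obj F ≅ fun i => toCoind (φ i) := P.objObjPreimageIso _
      refine ⟨F.toHom ≫ coindEv R X, ⟨CategoryTheory.Pi.isoMk fun i => ?_⟩⟩
      let e' : (ι i).toHom ≫ F.toHom ⟶ (toCoind (φ i)).toHom := (e.hom i).track
      exact asIso ((Bicategory.associator _ _ _).inv ≫ Bicategory.whiskerRight e' (coindEv R X) ≫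
        coindCounit (φ i))⟩ }

/-- Evaluation at an element, as a morphism of symmetric categorical groups. -/
def evHom (m : M.toSCGr) (N : TwoMod R) : homObj M N ⟶ N.toSCGr :=
  SCGr.mkHom (A := homObj M N) (HasPoints.ev (C := TwoMod R) m N)
    (fun F G => 𝟙 (F.toHom.functor.obj m ⊗ G.toHom.functor.obj m))
    (fun f g => (Category.comp_id _).trans (Category.id_comp _).symm)
    (fun F G H => by
      change 𝟙 (F.toHom.functor.obj m ⊗ G.toHom.functor.obj m) ▷ H.toHom.functor.obj m ≫ 𝟙 _ ≫
        (α_ _ _ _).hom = (α_ _ _ _).hom ≫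
          F.toHom.functor.obj m ◁ 𝟙 (G.toHom.functor.obj m ⊗ H.toHom.functor.obj m) ≫ 𝟙 _
      simp)
    (fun F G => (Category.id_comp _).trans (Category.comp_id _).symm)

/-- Evaluation at the basis element identifies the 2-functor of morphisms out of G with the
forgetful 2-functor, to which `isCoproduct_toHom` applies. -/
theorem isSmall_of_isFree {G : TwoMod R} {e : G.toSCGr}
    (hG : IsFree (C := TwoMod R) fun _ : PUnit.{u + 1} => e) : IsSmall G := by
  intro I A Q ι h
  have hev (N : TwoMod R) : (evHom e N).functor.IsEquivalence := hG.isEquivalence_ev N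
  have (i : I) := hev (A i)
  have := hev Q
  refine SCGr.isCoproduct_of_equivalence (A' := fun i => homObj G (A i)) (fun i => evHom e (A i))
    (evHom e Q) (fun i => ?_) (isCoproduct_toHom h)
  exact asIso (SCGr.mkTrackOfTensor (F := homMap G (ι i) ≫ evHom e Q)
    (G := evHom e (A i) ≫ (ι i).toHom)
    (fun F => 𝟙 ((ι i).toHom.functor.obj (F.toHom.functor.obj e)))
    (fun s => (Category.comp_id _).trans (Category.id_comp _).symm)
    (fun F F' => by
      have h {a b : (A i).toSCGr} : (𝟙 _ ≫ μ (ι i).toHom.functor a b) ≫ 𝟙 _ =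
          (𝟙 _ ⊗ₘ 𝟙 _) ≫ μ (ι i).toHom.functor a b ≫
            (ι i).toHom.functor.map (𝟙 (a ⊗ b)) := by simp
      exact h))

end TwoMod

end

theorem theorem7p1 :
    (IsSmall Phi.{u} ∧ IsProjective Phi.{u} ∧ IsGenerator Phi.{u}) ∧
    HasEnoughProjectives SCGr.{u} ∧
    (∀ P : SCGr.{u}, IsProjective P →
      ∃ Q : SCGr.{u}, IsCoproductOfCopies Phi Q ∧ Nonempty (Bicategory.Equivalence P Q)) ∧
    ∀ R : TwoRing.{u},
      (IsSmall (TwoMod.regular R) ∧ IsProjective (TwoMod.regular R) ∧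
        IsGenerator (TwoMod.regular R)) ∧
      HasEnoughProjectives (TwoMod R) := by
  refine ⟨⟨SCGr.isSmall_phi, SCGr.isProjective_phi, SCGr.isGenerator_phi⟩,
    SCGr.hasEnoughProjectives, SCGr.isCoproductOfCopies_of_isProjective, fun R => ?_⟩
  exact ⟨⟨TwoMod.isSmall_of_isFree (TwoMod.isFree_regular R), (TwoMod.isFree_regular R).isProjective,
    TwoMod.isGenerator_regular R⟩, TwoMod.hasEnoughProjectives R⟩
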